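/- **Setting.** Let $X$ be an infinite dimensional separable real Banach space with a zero mean Gaussian measure $\mu$, and let $\mathrm{Im}:X\to H=L_2([0,1])$ be an injective continuous linear map. Let $C_\nu$ be the covariance operator of $\nu=\mu\,\mathrm{Im}^{-1}$, i.e. $\langle C_\nu h_1,h_2\rangle=\int_H\langle h,h_1\rangle\langle h,h_2\rangle\,\nu(dh)$. Assume that there is an orthonormal system $\eta_1,\eta_2,\dots$ in $\mathrm{Im}(X)$ with $C_\nu\eta_j=\lambda_j\eta_j$, $\lambda_1\ge\lambda_2\ge\dots>0$, such that $C_\nu$ vanishes on the orthogonal complement of all $\eta_j$, and that $\lambda_j=\Theta(j^{-k})$ with $k>1$. Let $r\ge1$ be an integer and $K_0,\dots,K_r>0$. Let $F_r$ be the class of $f:X\to\mathbb R$ that are $r-1$ times Fréchet differentiable with $\sup_x\|f^{(i)}(x)\|\le K_i$ for $0\le i\le r-1$ (norms of $i$-linear forms on $X$) and $\|f^{(r-1)}(x)-f^{(r-1)}(y)\|\le K_r\|\mathrm{Im}(x-y)\|_H$ for all $x,y\in X$. Path integration is the approximation of $I(f)=\int_X f\,d\mu$ for $f\in F_r$. For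 $d\ge0$ let $X_d=\mathrm{span}\{\mathrm{Im}^{-1}\eta_1,\dots,\mathrm{Im}^{-1}\eta_d\}$ and $I_d(f)=\int_{\mathbb R^d}f(\mathrm{Im}^{-1}(t_1\eta_1+\dots+t_d\eta_d))\,\nu_d(dt)$, where $\nu_d$ is the zero mean Gaussian measure with covariance matrix $\mathrm{diag}(\lambda_1,\dots,\lambda_d)$. For $\varepsilon>0$ let $d(\varepsilon)$ be the least $d$ with $|I(f)-I_d(f)|\le\varepsilon/2$ for all $f\in F_r$. **Algorithms and costs.** For the error demand $\varepsilon$, all algorithms use function values $f(x)$ with $x\in X_{d}$, $d=d(\varepsilon)$; one function value costs $\mathbf c_d$, where $\mathbf c_d\ge a\,d$ for some $a>0$ and $\mathbf c_d$ is bounded by a polynomial in $d$ (for instance $\mathbf c_d=\mathbf c\,d$). * *Classical algorithms* are branching programs over the real numbers; function values cost $\mathbf c_d$, arithmetic operations and comparisons cost $1$. $\mathrm{comp}^{\rm wor}(\varepsilon)$ is the minimal worst case cost over $F_r$ of a deterministic algorithm with $|I(f)-A(f)|\le\varepsilon$ for all $f\in F_r$. $\mathrm{comp}^{\rm ran}(\varepsilon)$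 and $n^{\rm ran}(\varepsilon)$ are the minimal expected cost, and the minimal expected number of function values, for a worst $f\in F_r$, of a randomized algorithm with expected error at most $\varepsilon$ for all $f\in F_r$. * *Quantum algorithms* on $m$ qubits consist of quantum operations (one-qubit unitaries and controlled-not gates, cost $1$ each) and quantum queries $|i\rangle|y\rangle\mapsto|i\rangle|y\oplus\beta(f(\tau(i)))\rangle$ (cost $\mathbf c_d+m$ each), where $\tau$ maps indices to points of $X_d$ and $\beta$ codes real numbers by bits; they start in $|0\cdots0\rangle$ and end with a measurement whose result is decoded to a real number. The output must be within $\varepsilon$ of $I(f)$ with probability at least $3/4$ for all $f\in F_r$. Let $\mathrm{comp}^{\rm q}(\varepsilon)$ and $\mathrm{qq}(\varepsilon)$ be the minimal cost and the minimal number of quantum queries of such algorithms. **Corollary.** There are quantum algorithms $A_\varepsilon$, $\varepsilon>0$, that compute $\varepsilon$-approximations to path integrals over $F_r$ with probability at least $3/4$ and have the following properties. 1. Path integration on a quantum computer is tractable: $\mathrm{cost}(A_\varepsilon)\le C\varepsilon^{-s}$ for all $\varepsilon\in(0,\frac12)$, with some $C$ and $s$ independent of $\varepsilon$. 2. Path integration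 on a quantum computer can be solved roughly $\varepsilon^{-1}$ times faster than on a classical computer using randomization: for every $\delta>0$ and all sufficiently small $\varepsilon>0$, $$\varepsilon^{-(1-\delta)}\,\mathrm{cost}(A_\varepsilon)\le\mathrm{comp}^{\rm ran}(\varepsilon)\le\varepsilon^{-(1+\delta)}\,\mathrm{comp}^{\rm q}(\varepsilon).$$ It is exponentially (that is, by more than any polynomial in $\varepsilon^{-1}$) faster than with a worst case assurance: for every $s$ and all sufficiently small $\varepsilon>0$, $\mathrm{comp}^{\rm wor}(\varepsilon)\ge\varepsilon^{-s}\,\mathrm{cost}(A_\varepsilon)$. 3. The number of quantum queries is roughly the square root of the number of function values needed with randomization: for every $\delta>0$ and all sufficiently small $\varepsilon>0$, $$n^{\rm ran}(\varepsilon)^{1/2-\delta}\le\mathrm{qq}(\varepsilon)\le\mathrm{queries}(A_\varepsilon)\le n^{\rm ran}(\varepsilon)^{1/2+\delta}.$$ 4. The number of qubits is polynomial in $\varepsilon^{-1}$: $\mathrm{qubits}(A_\varepsilon)\le C\varepsilon^{-s}$ for all $\varepsilon\in(0,\frac12)$, with some $C$ and $s$ independent of $\varepsilon$. If $X=C([0,1])$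 with the Wiener measure and $\mathrm{Im}\,x=x$, then the degree is $2$ for $r=1$ and $1$ for $r\ge2$: $\mathrm{qubits}(A_\varepsilon)=\varepsilon^{-2+o(1)}$ for $r=1$ and $\mathrm{qubits}(A_\varepsilon)=\varepsilon^{-1+o(1)}$ for $r\ge2$, as $\varepsilon\to0$. -/

import Mathlib

open MeasureTheory ProbabilityTheory Filter Topology
open scoped ENNReal NNReal

noncomputable section

namespace PathIntegration

/-! ### The path integration problem -/

/-- The Hilbert space `L₂([0,1])`. -/
abbrev H : Type := Lp ℝ 2 (volume : Measure unitInterval)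

/-- A zero mean Gaussian measure `μ` on the separable Banach space `X`, an embedding
`Im : X → L₂([0,1])`, and the system of eigenpairs (with positive eigenvalues) of the covariance
operator `C` of the image measure `ν` of `μ` under `Im`, i.e. of the operator given by
`⟪C h₁, h₂⟫ = ∫ ⟪y, h₁⟫ ⟪y, h₂⟫ ν(dy) = ∫ ⟪Im x, h₁⟫ ⟪Im x, h₂⟫ μ(dx)`.
The eigenvectors are `η i = Im (e i)`; the sequences start at index `0`, so `lam j` is the
`(j+1)`-st eigenvalue. -/
structure Setting (X : Type*) [NormedAddCommGroup X] [NormedSpace ℝ X] [MeasurableSpace X] where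
  /-- the measure of path integration -/
  μ : Measure X
  gaussian : IsGaussian μ
  zero_mean : ∀ L : X →L[ℝ] ℝ, ∫ x, L x ∂μ = 0
  /-- the embedding of `X` into `L₂([0,1])` -/
  Im : X →L[ℝ] H
  Im_injective : Function.Injective Im
  /-- the preimages of the eigenvectors -/
  e : ℕ → X
  /-- the eigenvalues -/
  lam : ℕ → ℝ
  orthonormal : Orthonormal ℝ (fun i => Im (e i))
  lam_pos : ∀ i, 0 < lam i
  lam_antitone : Antitone lam
  /-- `C (η i) = lam i • η i`. -/
  eigen : ∀ (i : ℕ) (h : H),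
    ∫ x, inner ℝ (Im x) (Im (e i)) * inner ℝ (Im x) h ∂μ = lam i * inner ℝ (Im (e i)) h
  /-- The list of eigenvectors is complete: `C` vanishes on their orthogonal complement. -/
  complete : ∀ h : H, (∀ i, inner ℝ (Im (e i)) h = 0) →
    ∀ h' : H, ∫ x, inner ℝ (Im x) h * inner ℝ (Im x) h' ∂μ = 0

namespace Setting

variable {X : Type*} [NormedAddCommGroup X] [NormedSpace ℝ X] [MeasurableSpace X]

/-- `X = C([0,1])` with the sup norm, `Im x = x`, and `μ` is the Wiener measure: the zero mean
Gaussian measure with covariance function `min t u`. (`X` is identified with `C([0,1])` through a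
linear isometry `Φ`.) -/
def IsWiener (P : Setting X) : Prop :=
  ∃ Φ : X ≃ₗᵢ[ℝ] C(unitInterval, ℝ),
    (∀ x, P.Im x = ContinuousMap.toLp (E := ℝ) 2 (volume : Measure unitInterval) ℝ (Φ x)) ∧
    ∀ t u : unitInterval, ∫ x, Φ x t * Φ x u ∂P.μ = min (t : ℝ) (u : ℝ)

/-- The class `F_r`: the Fréchet derivatives of order `i ≤ r - 1` are bounded by `K i` (as
multilinear forms on `X`), and the derivative of order `r - 1` is Lipschitz with constant `K r`
with respect to the norm of `L₂([0,1])`. -/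
def F (P : Setting X) (K : ℕ → ℝ) (r : ℕ) : Set (X → ℝ) :=
  {f | ContDiff ℝ ((r - 1 : ℕ) : WithTop ℕ∞) f ∧
    (∀ i ≤ r - 1, ∀ x, ‖iteratedFDeriv ℝ i f x‖ ≤ K i) ∧
    ∀ x y, ‖iteratedFDeriv ℝ (r - 1) f x - iteratedFDeriv ℝ (r - 1) f y‖
      ≤ K r * ‖P.Im (x - y)‖}

/-- The path integral `I(f)`. -/
def I (P : Setting X) (f : X → ℝ) : ℝ := ∫ x, f x ∂P.μ

/-- The function of `d` variables `f_d(t) = f(Im⁻¹(t₁η₁ + ⋯ + t_dη_d))`: the restriction of `f` to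
`X_d = span {Im⁻¹ η₁, …, Im⁻¹ η_d}`. -/
def restrict (P : Setting X) (d : ℕ) (f : X → ℝ) (t : Fin d → ℝ) : ℝ :=
  f (∑ i, t i • P.e i)

/-- The `d`-dimensional Gaussian integral `I_d(f)`, with independent zero mean coordinates of
variances `λ₁, …, λ_d`. -/
def Id (P : Setting X) (d : ℕ) (f : X → ℝ) : ℝ :=
  ∫ t, P.restrict d f t ∂(Measure.pi fun i : Fin d => gaussianReal 0 (P.lam i).toNNReal)

/-- `d(ε, F_r)`: the least `d` with `|I(f) - I_d(f)| ≤ ε / 2` for all `f ∈ F_r`. -/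
def dim (P : Setting X) (K : ℕ → ℝ) (r : ℕ) (ε : ℝ) : ℕ :=
  sInf {d | ∀ f ∈ P.F K r, |P.I f - P.Id d f| ≤ ε / 2}

end Setting

/-! ### Classical algorithms: the real number model with function values -/

/-- The arithmetic operations. -/
inductive ArithOp
  | add | sub | mul | div

/-- Exact real arithmetic. -/
def ArithOp.eval : ArithOp → ℝ → ℝ → ℝ
  | .add, a, b => a + b
  | .sub, a, b => a - b
  | .mul, a, b => a * b
  | .div, a, b => a / b

/-- A (branching) program over the real numbers that may evaluate a function of `d` real variables.
The memory is a list of reals; every instruction except `output` and `branch` puts its result in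
front of it, and numbers `i`, `j` are addresses in the memory. -/
inductive RealProg (d : ℕ) : Type
  /-- stop and return the content of cell `i` -/
  | output (i : ℕ) : RealProg d
  /-- store a constant -/
  | const (a : ℝ) (next : RealProg d) : RealProg d
  /-- store the function value at the point whose coordinates are in the cells `t 0, …, t (d-1)` -/
  | value (t : Fin d → ℕ) (next : RealProg d) : RealProg d
  /-- store the result of an arithmetic operation on the cells `i` and `j` -/
  | arith (o : ArithOp) (i j : ℕ) (next : RealProg d) : RealProg d
  /-- compare the cells `i` and `j` -/
  | branch (i j : ℕ) (yes no : RealProg d) : RealProg d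

namespace RealProg

variable {d : ℕ}

/-- The value returned on the function `g`, started with memory `M`. -/
def run (g : (Fin d → ℝ) → ℝ) : RealProg d → List ℝ → ℝ
  | output i, M => M.getD i 0
  | const a p, M => p.run g (a :: M)
  | value t p, M => p.run g (g (fun i => M.getD (t i) 0) :: M)
  | arith o i j p, M => p.run g (o.eval (M.getD i 0) (M.getD j 0) :: M)
  | branch i j p q, M => open Classical in
      if M.getD i 0 ≤ M.getD j 0 then p.run g M else q.run g M

/-- The number of function values used on `g`. -/
def values (g : (Fin d → ℝ) → ℝ) : RealProg d → List ℝ → ℕ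
  | output _, _ => 0
  | const a p, M => p.values g (a :: M)
  | value t p, M => p.values g (g (fun i => M.getD (t i) 0) :: M) + 1
  | arith o i j p, M => p.values g (o.eval (M.getD i 0) (M.getD j 0) :: M)
  | branch i j p q, M => open Classical in
      if M.getD i 0 ≤ M.getD j 0 then p.values g M else q.values g M

/-- The number of arithmetic operations and comparisons performed on `g`. -/
def ops (g : (Fin d → ℝ) → ℝ) : RealProg d → List ℝ → ℕ
  | output _, _ => 0
  | const a p, M => p.ops g (a :: M)
  | value t p, M => p.ops g (g (fun i => M.getD (t i) 0) :: M)
  | arith o i j p, M => p.ops g (o.eval (M.getD i 0) (M.getD j 0) :: M) + 1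
  | branch i j p q, M => open Classical in
      (if M.getD i 0 ≤ M.getD j 0 then p.ops g M else q.ops g M) + 1

/-- The cost on `g`, started with empty memory, when one function value costs `c d`. -/
def cost (c : ℕ → ℝ) (p : RealProg d) (g : (Fin d → ℝ) → ℝ) : ℝ :=
  c d * p.values g [] + p.ops g []

end RealProg

/-- A randomized algorithm: a random program. -/
structure RandomProg (d : ℕ) where
  /-- the source of randomness -/
  Ω : Type
  mΩ : MeasurableSpace Ω
  /-- its probability law -/
  law : Measure Ω
  isProb : IsProbabilityMeasure law
  /-- the program that is run -/
  prog : Ω → RealProg d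

/-- Results and costs on `g` are random variables. -/
def RandomProg.MeasurableOn {d : ℕ} (A : RandomProg d) (g : (Fin d → ℝ) → ℝ) : Prop :=
  Measurable[A.mΩ] (fun ω => (A.prog ω).run g []) ∧
  Measurable[A.mΩ] (fun ω => (A.prog ω).values g []) ∧
  Measurable[A.mΩ] (fun ω => (A.prog ω).ops g [])

/-- The expectation of a nonnegative quantity over the randomness of `A`. -/
def RandomProg.expect {d : ℕ} (A : RandomProg d) (Y : A.Ω → ℝ) : ℝ≥0∞ :=
  @lintegral A.Ω A.mΩ A.law fun ω => ENNReal.ofReal (Y ω)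

/-! ### Quantum algorithms -/

/-- The labels of the computational basis of `m` qubits. -/
abbrev Bits (m : ℕ) : Type := Fin m → Bool

/-- Elementary quantum operations on `m` qubits: one-qubit unitaries and controlled-not gates. -/
inductive Gate (m : ℕ) : Type
  | single (j : Fin m) (u : Matrix.unitaryGroup Bool ℂ) : Gate m
  | cnot (ctrl target : Fin m) (ne : ctrl ≠ target) : Gate m

/-- The action of an elementary gate on a vector of amplitudes. -/
def Gate.act {m : ℕ} : Gate m → (Bits m → ℂ) → (Bits m → ℂ)
  | .single j u, ψ => fun b =>
      ∑ v : Bool, (u : Matrix Bool Bool ℂ) (b j) v * ψ (Function.update b j v)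
  | .cnot ctrl target _, ψ => fun b =>
      ψ (if b ctrl then Function.update b target (!(b target)) else b)

/-- One step of a quantum algorithm on `m` qubits. -/
inductive Step (m : ℕ) : Type
  | gate (g : Gate m) : Step m
  | query : Step m

/-- A quantum algorithm for functions of `d` real variables. It works in the Hilbert space of
dimension `2 ^ qubits`; a query uses some index qubits and some (other) value qubits and maps
`|i⟩|y⟩` to `|i⟩|y ⊕ code (g (point i))⟩`. At the end all qubits are measured, and the measured
bits are decoded to a real number. -/
structure QuantumAlg (d : ℕ) where
  qubits : ℕ
  nIndex : ℕ
  nValue : ℕ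
  /-- the qubits that hold the index -/
  index : Fin nIndex ↪ Fin qubits
  /-- the qubits that receive the function value -/
  value : Fin nValue ↪ Fin qubits
  disjoint : ∀ i j, index i ≠ value j
  /-- the sample point with a given index -/
  point : Bits nIndex → (Fin d → ℝ)
  /-- the coding of function values by bits -/
  code : ℝ → Bits nValue
  /-- the steps, in the order of execution -/
  steps : List (Step qubits)
  /-- the decoding of the result of the measurement -/
  decode : Bits qubits → ℝ

namespace QuantumAlg

variable {d : ℕ}

/-- Add the bits `v`, modulo 2, to the value qubits of `b`. -/
def xorValue (A : QuantumAlg d) (v : Bits A.nValue) (b : Bits A.qubits) : Bits A.qubits :=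
  fun q => xor (b q) (decide (∃ j, A.value j = q ∧ v j = true))

/-- The action of a quantum query about `g` on a vector of amplitudes. It permutes the basis
vectors by an involution. -/
def queryAct (A : QuantumAlg d) (g : (Fin d → ℝ) → ℝ) (ψ : Bits A.qubits → ℂ) :
    Bits A.qubits → ℂ :=
  fun b => ψ (A.xorValue (A.code (g (A.point fun i => b (A.index i)))) b)

/-- The action of one step. -/
def stepAct (A : QuantumAlg d) (g : (Fin d → ℝ) → ℝ) :
    Step A.qubits → (Bits A.qubits → ℂ) → (Bits A.qubits → ℂ)
  | .gate u, ψ => u.act ψ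
  | .query, ψ => A.queryAct g ψ

/-- The final state, on input `|0…0⟩`. -/
def final (A : QuantumAlg d) (g : (Fin d → ℝ) → ℝ) : Bits A.qubits → ℂ :=
  A.steps.foldl (fun ψ s => A.stepAct g s ψ) (Pi.single (fun _ => false) 1)

/-- The probability that the output lies in `S`. -/
def prob (A : QuantumAlg d) (g : (Fin d → ℝ) → ℝ) (S : Set ℝ) : ℝ :=
  open Classical in ∑ b, if A.decode b ∈ S then ‖A.final g b‖ ^ 2 else 0

/-- The number of quantum queries. -/
def queries (A : QuantumAlg d) : ℕ :=
  A.steps.countP fun s => match s with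
    | .query => true
    | .gate _ => false

/-- The number of quantum operations. -/
def ops (A : QuantumAlg d) : ℕ :=
  A.steps.countP fun s => match s with
    | .query => false
    | .gate _ => true

/-- The cost: a quantum query costs `c d + qubits`, a quantum operation costs one. -/
def cost (c : ℕ → ℝ) (A : QuantumAlg d) : ℝ :=
  (c d + A.qubits) * A.queries + A.ops

end QuantumAlg

/-! ### Complexities of path integration

In each setting an algorithm for the error demand `ε` uses function values at points of the
subspace `X_d` with `d = d(ε, F_r)`, at the cost `c d` each. -/

namespace Setting

variable {X : Type*} [NormedAddCommGroup X] [NormedSpace ℝ X] [MeasurableSpace X]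

/-- `A` computes an `ε`-approximation for all `f ∈ F_r`, deterministically. -/
def DetSolves (P : Setting X) (K : ℕ → ℝ) (r : ℕ) (ε : ℝ) {d : ℕ} (A : RealProg d) : Prop :=
  ∀ f ∈ P.F K r, |P.I f - A.run (P.restrict d f) []| ≤ ε

/-- The randomized error of `A` is at most `ε`: the expected error is at most `ε` for all
`f ∈ F_r`. -/
def RanSolves (P : Setting X) (K : ℕ → ℝ) (r : ℕ) (ε : ℝ) {d : ℕ} (A : RandomProg d) : Prop :=
  ∀ f ∈ P.F K r, A.MeasurableOn (P.restrict d f) ∧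
    A.expect (fun ω => |P.I f - (A.prog ω).run (P.restrict d f) []|) ≤ ENNReal.ofReal ε

/-- `A` computes an `ε`-approximation with probability at least `3/4` for all `f ∈ F_r`. -/
def QuantumSolves (P : Setting X) (K : ℕ → ℝ) (r : ℕ) (ε : ℝ) {d : ℕ} (A : QuantumAlg d) : Prop :=
  ∀ f ∈ P.F K r, 3 / 4 ≤ A.prob (P.restrict d f) {y | |P.I f - y| ≤ ε}

/-- The worst case complexity: the least worst case cost over `F_r`. -/
def compWor (P : Setting X) (K : ℕ → ℝ) (r : ℕ) (c : ℕ → ℝ) (ε : ℝ) : ℝ≥0∞ :=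
  sInf {C | ∃ A : RealProg (P.dim K r ε), P.DetSolves K r ε A ∧
    ∀ f ∈ P.F K r, ENNReal.ofReal (A.cost c (P.restrict _ f)) ≤ C}

/-- The randomized complexity: the least expected cost, for a worst `f ∈ F_r`. -/
def compRan (P : Setting X) (K : ℕ → ℝ) (r : ℕ) (c : ℕ → ℝ) (ε : ℝ) : ℝ≥0∞ :=
  sInf {C | ∃ A : RandomProg (P.dim K r ε), P.RanSolves K r ε A ∧
    ∀ f ∈ P.F K r, A.expect (fun ω => (A.prog ω).cost c (P.restrict _ f)) ≤ C}

/-- The least (expected, for a worst `f ∈ F_r`) number of function values used by a randomized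
algorithm with error at most `ε`. -/
def nRan (P : Setting X) (K : ℕ → ℝ) (r : ℕ) (ε : ℝ) : ℝ≥0∞ :=
  sInf {N | ∃ A : RandomProg (P.dim K r ε), P.RanSolves K r ε A ∧
    ∀ f ∈ P.F K r, A.expect (fun ω => ((A.prog ω).values (P.restrict _ f) [] : ℝ)) ≤ N}

/-- The least cost of a quantum algorithm. -/
def compQuantum (P : Setting X) (K : ℕ → ℝ) (r : ℕ) (c : ℕ → ℝ) (ε : ℝ) : ℝ≥0∞ :=
  sInf {C | ∃ A : QuantumAlg (P.dim K r ε), P.QuantumSolves K r ε A ∧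
    C = ENNReal.ofReal (A.cost c)}

/-- The least number of quantum queries of a quantum algorithm. -/
def qq (P : Setting X) (K : ℕ → ℝ) (r : ℕ) (ε : ℝ) : ℝ≥0∞ :=
  sInf {N | ∃ A : QuantumAlg (P.dim K r ε), P.QuantumSolves K r ε A ∧ N = (A.queries : ℝ≥0∞)}

end Setting

/-- `γ(1) = 1` and `γ(r) = 0` for `r ≥ 2`. -/
def gam (r : ℕ) : ℝ := if r = 1 then 1 else 0

end PathIntegration

end

/-! Up to factors ε^{±δ} the corollary says that, over X_d with d = d(ε), randomization needs ε^{-2}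
function values, a quantum computer needs ε^{-1} queries, and a deterministic algorithm needs more
values than any power of ε^{-1}. The step from counts to costs is short: the quantum algorithm has
at most about d ε^{-δ} qubits, d ≥ 1 for small ε, and c d ≥ a d. Hence a query costs at most c d
times ε^{-δ}, and gates are absorbed in the same way.

Dimension. With the projection `proj d` onto X_d, I(f) - I_d(f) is the mean of f(x) - f(`proj d` x)
(`Id_eq`). The measure is invariant under the reflection `refl d`, so the moments of x - `proj d` x
stay bounded, and the mean square of its image in H is the tail of the eigenvalue series, which is
polynomially small. Only the derivative of order r - 1 is Lipschitz with respect to Im. An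
interpolation argument (`norm_sub_le_of_fderiv`) passes this property down to f with worse
exponents, so d(ε) is polynomial in 1/ε.

Upper bounds. Monte Carlo with a multiple of ε^{-2} samples from the Gaussian measure on X_d gives
the randomized bound. For the quantum bound, I_d is replaced by an equal weight mean of 2^n function
values, where n is d times a logarithm (`exists_cubature`). The values are coded as angles Φ whose
cosines depend affinely on them. Two reflections, one about the uniform superposition and one built
from the phases ±Φ, have a product that acts on a plane with eigenvalues e^{±iϑ}, where cos ϑ is the
mean of cos Φ. Independent Hadamard tests of the powers 2·3^j of these eigenvalues determine ϑ to
accuracy 3^{-J} with about 3^J queries up to powers of J (`exists_mean_algorithm`).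

Lower bounds. In the first D eigen-coordinates there are M^D bumps with disjoint supports and equal
integrals c M^{-(r+D)}, and every combination with coefficients in [-1,1] lies in F_r
(`exists_bumps`). As X is infinite dimensional, D is arbitrary. A deterministic program cannot see
the coefficients that it does not touch, which forces M^D/2 values as soon as ε M^r is small; a
large D beats every power. For random signs a Fourier argument with a potential function shows that
error of the order of the standard deviation of the sum already needs a quarter of all values
(`RandomProg.le_values`). For quantum algorithms, acceptance probabilities after q queries are
combinations of functions of 2q bits and so are uncorrelated with the parity of more bits, while
exact counting determines the parity (`QuantumAlg.le_two_mul_queries`). As D grows, the exponents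
tend to 2 and 1.

Wiener measure. The number of qubits lies between d and about d ε^{-δ}, so d(ε) is needed up to
ε^{±δ}. The eigenfunctions are sines and λ_j = 1/((j+1/2)π)^2, which makes the tail of order 1/d.
For r = 1 the truncation error is of the order of the root of the tail. For r ≥ 2 the invariance
under `refl d` cancels the first order term. What remains is the mean squared sup norm of the
remainder, which chaining bounds by d^{-1+δ}. Functions A exp(-‖Q Im x‖^2), constant on X_d, show
that both rates are sharp. -/

set_option linter.unusedSectionVars false

noncomputable section

namespace PathIntegration

/-! ### Circuits -/

/-- Whether a step is a query. -/
def Step.isQuery {m : ℕ} : Step m → Bool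
  | .query => true
  | .gate _ => false

namespace QuantumAlg

variable {d : ℕ} (A : QuantumAlg d)

/-- The action of a list of steps. -/
def exec (g : (Fin d → ℝ) → ℝ) (l : List (Step A.qubits)) (ψ : Bits A.qubits → ℂ) :
    Bits A.qubits → ℂ :=
  l.foldl (fun ψ s => A.stepAct g s ψ) ψ

/-- The operator `T g` (on the states described by `emb`) is implemented with at most `q` queries and at most
`k` gates. -/
def Realizes {V : Type*} (emb : V → Bits A.qubits → ℂ)
    (T : ((Fin d → ℝ) → ℝ) → V → V) (q k : ℕ) : Prop :=
  ∃ l : List (Step A.qubits), l.countP Step.isQuery ≤ q ∧ l.countP (fun s => !s.isQuery) ≤ k ∧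
    ∀ g φ, A.exec g l (emb φ) = emb (T g φ)

variable {A}

theorem exec_append (g : (Fin d → ℝ) → ℝ) (l l' : List (Step A.qubits)) (ψ : Bits A.qubits → ℂ) :
    A.exec g (l ++ l') ψ = A.exec g l' (A.exec g l ψ) := by
  simp [exec, List.foldl_append]

namespace Realizes

variable {V : Type*} {emb : V → Bits A.qubits → ℂ} {T T' : ((Fin d → ℝ) → ℝ) → V → V}
  {q q' k k' : ℕ}

theorem mono (h : A.Realizes emb T q k) (hq : q ≤ q') (hk : k ≤ k') : A.Realizes emb T q' k' := by
  obtain ⟨l, h1, h2, h3⟩ := h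
  exact ⟨l, h1.trans hq, h2.trans hk, h3⟩

theorem congr (h : A.Realizes emb T q k) (hT : ∀ g φ, T g φ = T' g φ) :
    A.Realizes emb T' q k := by
  obtain ⟨l, h1, h2, h3⟩ := h
  exact ⟨l, h1, h2, fun g φ => by rw [h3, hT]⟩

theorem refl : A.Realizes emb (fun _ φ => φ) 0 0 := ⟨[], by simp, by simp, fun _ _ => rfl⟩

theorem comp (h : A.Realizes emb T q k) (h' : A.Realizes emb T' q' k') :
    A.Realizes emb (fun g φ => T' g (T g φ)) (q + q') (k + k') := by
  obtain ⟨l, h1, h2, h3⟩ := h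
  obtain ⟨l', h1', h2', h3'⟩ := h'
  refine ⟨l ++ l', ?_, ?_, fun g φ => ?_⟩
  · rw [List.countP_append]; omega
  · rw [List.countP_append]; omega
  · rw [exec_append, h3, h3']

theorem iterate (h : A.Realizes emb T q k) (N : ℕ) :
    A.Realizes emb (fun g => (T g)^[N]) (N * q) (N * k) := by
  induction N with
  | zero => exact (Realizes.refl.mono (by simp) (by simp)).congr fun _ _ => rfl
  | succ N ih =>
    refine ((h.comp ih).mono (by ring_nf; omega) (by ring_nf; omega)).congr fun g φ => ?_
    rw [Function.iterate_succ_apply]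

theorem foldl {β : Type*} {F : β → ((Fin d → ℝ) → ℝ) → V → V}
    (h : ∀ x, A.Realizes emb (F x) q k) (l : List β) :
    A.Realizes emb (fun g φ => l.foldl (fun φ x => F x g φ) φ) (l.length * q) (l.length * k) := by
  induction l with
  | nil => exact (Realizes.refl.mono (by simp) (by simp)).congr fun _ _ => rfl
  | cons x l ih =>
    refine (((h x).comp ih).mono ?_ ?_).congr fun g φ => ?_
    · simp only [List.length_cons]; ring_nf; omega
    · simp only [List.length_cons]; ring_nf; omega
    · simp

/-- Operators on all states act on the states described by `emb`. -/
theorem lift {T : ((Fin d → ℝ) → ℝ) → (Bits A.qubits → ℂ) → (Bits A.qubits → ℂ)}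
    (h : A.Realizes (fun ψ => ψ) T q k) (hT : ∀ g φ, T g (emb φ) = emb (T' g φ)) :
    A.Realizes emb T' q k := by
  obtain ⟨l, h1, h2, h3⟩ := h
  exact ⟨l, h1, h2, fun g φ => by rw [← hT]; exact h3 g (emb φ)⟩

end Realizes

/-- A state operator that permutes the basis and multiplies by phases. -/
def monomial {m : ℕ} (π : Bits m → Bits m) (χ : Bits m → ℂ) (ψ : Bits m → ℂ) : Bits m → ℂ :=
  fun b => χ b * ψ (π b)

theorem realizes_single (j : Fin A.qubits) (u : Matrix.unitaryGroup Bool ℂ) :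
    A.Realizes (fun ψ => ψ) (fun _ => (Gate.single j u).act) 0 1 :=
  ⟨[.gate (.single j u)], by simp [Step.isQuery], by simp [Step.isQuery], fun _ _ => rfl⟩

theorem realizes_query :
    A.Realizes (fun ψ => ψ) (fun g => A.queryAct g) 1 0 :=
  ⟨[.query], by simp [Step.isQuery], by simp [Step.isQuery], fun _ _ => rfl⟩

/-- The permutation of the basis by a controlled-not gate. -/
def cnotPerm {m : ℕ} (i j : Fin m) (b : Bits m) : Bits m :=
  Function.update b j (xor (b j) (b i))

theorem realizes_cnot {i j : Fin A.qubits} (h : i ≠ j) :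
    A.Realizes (fun ψ => ψ) (fun _ => monomial (cnotPerm i j) 1) 0 1 := by
  refine ⟨[.gate (.cnot i j h)], by simp [Step.isQuery], by simp [Step.isQuery], fun g ψ => ?_⟩
  funext b
  simp only [exec, List.foldl, stepAct, Gate.act, monomial, cnotPerm, Pi.one_apply, one_mul]
  congr 1
  cases hb : b i <;> simp

/-- The phase gate. -/
def phaseMatrix (θ : ℝ) : Matrix Bool Bool ℂ :=
  Matrix.diagonal fun b => if b then Complex.exp (θ * Complex.I) else 1

theorem phaseMatrix_mem (θ : ℝ) : phaseMatrix θ ∈ Matrix.unitaryGroup Bool ℂ := by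
  rw [Matrix.mem_unitaryGroup_iff, phaseMatrix, Matrix.star_eq_conjTranspose,
    Matrix.diagonal_conjTranspose, Matrix.diagonal_mul_diagonal, ← Matrix.diagonal_one]
  congr 1
  funext b
  cases b
  · simp
  · simp [← Complex.exp_conj, ← Complex.exp_add]

/-- The Hadamard matrix. -/
def hadMatrix : Matrix Bool Bool ℂ :=
  fun a b => ((√2)⁻¹ : ℝ) * if a && b then -1 else 1

theorem sqrt_two_inv_mul_self : (((√2)⁻¹ : ℝ) : ℂ) * ((√2)⁻¹ : ℝ) = 1 / 2 := by
  rw [← Complex.ofReal_mul, ← mul_inv, Real.mul_self_sqrt (by norm_num)]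
  norm_num

theorem hadMatrix_mul_self : hadMatrix * hadMatrix = 1 := by
  have h := sqrt_two_inv_mul_self
  ext a b
  rw [Matrix.mul_apply]
  cases a <;> cases b <;>
    simp only [Fintype.sum_bool, hadMatrix, Bool.and_self, Bool.and_false, Bool.false_and,
      if_true, Bool.false_eq_true, if_false, Matrix.one_apply, reduceCtorEq] <;>
    first | linear_combination 2 * h | linear_combination (0 : ℂ) * h

theorem hadMatrix_mem : hadMatrix ∈ Matrix.unitaryGroup Bool ℂ := by
  rw [Matrix.mem_unitaryGroup_iff]
  have : star hadMatrix = hadMatrix := by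
    ext a b
    rw [Matrix.star_apply]
    cases a <;> cases b <;> simp [hadMatrix]
  rw [this, hadMatrix_mul_self]

/-- The matrix of the not gate. -/
def notMatrix : Matrix Bool Bool ℂ := fun a b => if a = b then 0 else 1

theorem notMatrix_mem : notMatrix ∈ Matrix.unitaryGroup Bool ℂ := by
  rw [Matrix.mem_unitaryGroup_iff]
  ext a b
  rw [Matrix.mul_apply]
  cases a <;> cases b <;> simp [notMatrix, Matrix.star_apply]

/-- The phase factor `exp (i θ)` if `x` is true. -/
def phase (θ : ℝ) (x : Bool) : ℂ := if x then Complex.exp (θ * Complex.I) else 1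

theorem realizes_phase (j : Fin A.qubits) (θ : ℝ) :
    A.Realizes (fun ψ => ψ) (fun _ => monomial (fun b => b) (fun b => phase θ (b j))) 0 1 := by
  refine (realizes_single j ⟨_, phaseMatrix_mem θ⟩).congr fun _ ψ => ?_
  funext b
  simp only [Gate.act, monomial, phaseMatrix, Matrix.diagonal_apply, phase]
  rw [Finset.sum_eq_single (b j)]
  · simp
  · intro v _ hv
    simp [Ne.symm hv]
  · simp

theorem monomial_monomial {m : ℕ} (π π' : Bits m → Bits m) (χ χ' : Bits m → ℂ) (ψ : Bits m → ℂ) :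
    monomial π' χ' (monomial π χ ψ) = monomial (fun b => π (π' b)) (fun b => χ' b * χ (π' b)) ψ := by
  funext b
  simp [monomial, mul_assoc]

theorem cnotPerm_cnotPerm {m : ℕ} {i j : Fin m} (h : i ≠ j) (b : Bits m) :
    cnotPerm i j (cnotPerm i j b) = b := by
  funext x
  by_cases hx : x = j
  · subst hx; simp [cnotPerm, Function.update_of_ne h]
  · simp [cnotPerm, Function.update_of_ne hx]

theorem cnotPerm_apply_target {m : ℕ} (i j : Fin m) (b : Bits m) :
    cnotPerm i j b j = xor (b j) (b i) := by simp [cnotPerm]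

theorem cnotPerm_apply_of_ne {m : ℕ} {i j x : Fin m} (h : x ≠ j) (b : Bits m) :
    cnotPerm i j b x = b x := by simp [cnotPerm, Function.update_of_ne h]

/-- Conjugation of a diagonal operator by a permutation of the basis that is an involution. -/
theorem Realizes.conj {π : ((Fin d → ℝ) → ℝ) → Bits A.qubits → Bits A.qubits}
    {χ : ((Fin d → ℝ) → ℝ) → Bits A.qubits → ℂ} {q k q' k' : ℕ}
    (h : A.Realizes (fun ψ => ψ) (fun g => monomial (π g) 1) q k) (hπ : ∀ g b, π g (π g b) = b)
    (h' : A.Realizes (fun ψ => ψ) (fun g => monomial (fun b => b) (χ g)) q' k') :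
    A.Realizes (fun ψ => ψ) (fun g => monomial (fun b => b) (fun b => χ g (π g b)))
      (2 * q + q') (2 * k + k') := by
  refine (((h.comp h').comp h).mono (by omega) (by omega)).congr fun g ψ => ?_
  rw [monomial_monomial, monomial_monomial]
  simp [hπ]

theorem Realizes.diag_mul {χ χ' : ((Fin d → ℝ) → ℝ) → Bits A.qubits → ℂ} {q k q' k' : ℕ}
    (h : A.Realizes (fun ψ => ψ) (fun g => monomial (fun b => b) (χ g)) q k)
    (h' : A.Realizes (fun ψ => ψ) (fun g => monomial (fun b => b) (χ' g)) q' k') :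
    A.Realizes (fun ψ => ψ) (fun g => monomial (fun b => b) (fun b => χ g b * χ' g b))
      (q + q') (k + k') := by
  refine (h.comp h').congr fun g ψ => ?_
  rw [monomial_monomial]
  simp [mul_comm]

theorem realizes_phase_xor {i j : Fin A.qubits} (h : i ≠ j) (θ : ℝ) :
    A.Realizes (fun ψ => ψ) (fun _ => monomial (fun b => b) (fun b => phase θ (xor (b j) (b i))))
      0 3 := by
  refine ((Realizes.conj (realizes_cnot h) (fun _ => cnotPerm_cnotPerm h)
    (realizes_phase j θ)).mono (by omega) (by omega)).congr fun g ψ => ?_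
  simp [cnotPerm_apply_target]

theorem realizes_phase_xor_xor {i j l : Fin A.qubits} (hil : i ≠ l) (hjl : j ≠ l) (θ : ℝ) :
    A.Realizes (fun ψ => ψ)
      (fun _ => monomial (fun b => b) (fun b => phase θ (xor (xor (b l) (b i)) (b j)))) 0 5 := by
  refine ((Realizes.conj (realizes_cnot hil) (fun _ => cnotPerm_cnotPerm hil)
    (realizes_phase_xor hjl θ)).mono (by omega) (by omega)).congr fun g ψ => ?_
  simp [cnotPerm_apply_target, cnotPerm_apply_of_ne hjl]

/-- The sign `-1` if `x` is true. -/
def sgn (x : Bool) : ℂ := if x then -1 else 1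

theorem phase_pi (x : Bool) : phase Real.pi x = sgn x := by
  cases x <;> simp [phase, sgn, Complex.exp_pi_mul_I]

/-- The doubly controlled sign. -/
theorem realizes_ccz {i j l : Fin A.qubits} (hij : i ≠ j) (hil : i ≠ l) (hjl : j ≠ l) :
    A.Realizes (fun ψ => ψ)
      (fun _ => monomial (fun b => b) (fun b => sgn (b i && b j && b l))) 0 17 := by
  -- For bits, 4xyz = x + y + z - (x⊕y) - (x⊕z) - (y⊕z) + (x⊕y⊕z). Phases ±π/4 on these seven
  -- parities therefore multiply to exp(iπxyz). The gate count is 3·1 + 3·3 + 5 = 17.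
  set w := Real.pi / 4
  have h := ((((((realizes_phase i w).diag_mul (realizes_phase j w)).diag_mul
    (realizes_phase l w)).diag_mul (realizes_phase_xor hij (-w))).diag_mul
    (realizes_phase_xor hil (-w))).diag_mul (realizes_phase_xor hjl (-w))).diag_mul
    (realizes_phase_xor_xor hil hjl w)
  refine (h.mono (by omega) (by omega)).congr fun g ψ => ?_
  congr 1
  funext b
  have e2 : Complex.exp (w * Complex.I) * Complex.exp (((-w : ℝ) : ℂ) * Complex.I) = 1 := by
    rw [← Complex.exp_add]; simp
  have e4 : Complex.exp (w * Complex.I) ^ 4 = -1 := by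
    rw [← Complex.exp_nat_mul, ← Complex.exp_pi_mul_I]
    congr 1
    simp only [w]; push_cast; ring
  have hz : ∀ x, phase w x = if x then Complex.exp (w * Complex.I) else 1 := fun _ => rfl
  have hz' : ∀ x, phase (-w) x = if x then Complex.exp (((-w : ℝ) : ℂ) * Complex.I) else 1 :=
    fun _ => rfl
  simp only [hz, hz']
  generalize Complex.exp (w * Complex.I) = z at *
  generalize Complex.exp (((-w : ℝ) : ℂ) * Complex.I) = z' at *
  cases b i <;> cases b j <;> cases b l <;>
    simp only [sgn, Bool.xor_true, Bool.xor_false, Bool.not_true, Bool.not_false, Bool.and_true,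
      Bool.and_false, Bool.and_self, if_true, if_false, Bool.false_eq_true, mul_one, one_mul] <;>
    first
    | linear_combination (z * z' + 1) * e2
    | linear_combination e4

end QuantumAlg

/-! ### Toffoli gates and multiply controlled signs -/

namespace QuantumAlg

variable {d : ℕ} {A : QuantumAlg d}

/-- The Hadamard gate. -/
def hadGate {m : ℕ} (j : Fin m) : Gate m := .single j ⟨hadMatrix, hadMatrix_mem⟩

theorem hadGate_act {m : ℕ} (j : Fin m) (ψ : Bits m → ℂ) (b : Bits m) :
    (hadGate j).act ψ b = ((√2)⁻¹ : ℝ) *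
      (ψ (Function.update b j false) + sgn (b j) * ψ (Function.update b j true)) := by
  simp only [hadGate, Gate.act, hadMatrix, Fintype.sum_bool, sgn]
  cases b j <;> simp <;> ring

/-- This is H Z H = X under a control. It works for any control x that ignores the target qubit,
hence turns the doubly controlled sign into the Toffoli gate. -/
theorem hadGate_monomial_hadGate {m : ℕ} {l : Fin m} (x : Bits m → Bool)
    (hx : ∀ b v, x (Function.update b l v) = x b) (ψ : Bits m → ℂ) :
    (hadGate l).act (monomial (fun b => b) (fun b => sgn (x b && b l)) ((hadGate l).act ψ)) =
      monomial (fun b => Function.update b l (xor (b l) (x b))) 1 ψ := by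
  funext b
  have h := sqrt_two_inv_mul_self
  simp only [hadGate_act, monomial, Function.update_self, Function.update_idem, Pi.one_apply, hx]
  generalize ((((√2)⁻¹ : ℝ) : ℂ)) = w at *
  cases b l <;> cases x b <;>
    simp only [sgn, Bool.and_true, Bool.and_false, Bool.false_eq_true, if_false, if_true, one_mul,
      Bool.xor_false, Bool.xor_true, Bool.not_true, Bool.not_false] <;>
    first
    | linear_combination 2 * ψ (Function.update b l false) * h
    | linear_combination 2 * ψ (Function.update b l true) * h

/-- The permutation of the basis by a Toffoli gate. -/
def toffoliPerm {m : ℕ} (i j l : Fin m) (b : Bits m) : Bits m :=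
  Function.update b l (xor (b l) (b i && b j))

theorem toffoliPerm_toffoliPerm {m : ℕ} {i j l : Fin m} (hil : i ≠ l) (hjl : j ≠ l) (b : Bits m) :
    toffoliPerm i j l (toffoliPerm i j l b) = b := by
  funext x
  by_cases hx : x = l
  · subst hx; simp [toffoliPerm, Function.update_of_ne hil, Function.update_of_ne hjl]
  · simp [toffoliPerm, Function.update_of_ne hx]

theorem realizes_toffoli {i j l : Fin A.qubits} (hij : i ≠ j) (hil : i ≠ l) (hjl : j ≠ l) :
    A.Realizes (fun ψ => ψ) (fun _ => monomial (toffoliPerm i j l) 1) 0 19 := by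
  refine ((((realizes_single l ⟨hadMatrix, hadMatrix_mem⟩).comp
    (realizes_ccz hij hil hjl)).comp (realizes_single l ⟨hadMatrix, hadMatrix_mem⟩)).mono
      (by omega) (by omega)).congr fun g ψ => ?_
  exact hadGate_monomial_hadGate (fun b => b i && b j)
    (fun b v => by simp [Function.update_of_ne hil, Function.update_of_ne hjl]) ψ

/-- The sign computed by a chain of Toffoli gates: with the control `i`, the further controls and
the auxiliary qubits in the list. -/
def chainSign {m : ℕ} : Fin m → List (Fin m × Fin m) → Bits m → ℂ
  | i, [], b => sgn (b i)
  | i, (j, l) :: r, b => chainSign l r (toffoliPerm i j l b)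

/-- The qubits of a chain are in general position. -/
def ChainOK {m : ℕ} : Fin m → List (Fin m × Fin m) → Prop
  | _, [] => True
  | i, (j, l) :: r => i ≠ j ∧ i ≠ l ∧ j ≠ l ∧ (∀ p ∈ r, p.1 ≠ l ∧ p.2 ≠ l) ∧ ChainOK l r

/-- Every Toffoli gate is done and undone around the rest of the chain, at 2·19 = 38 gates per link;
the final 1 is the sign itself. -/
theorem realizes_chainSign (i : Fin A.qubits) (r : List (Fin A.qubits × Fin A.qubits))
    (h : ChainOK i r) :
    A.Realizes (fun ψ => ψ) (fun _ => monomial (fun b => b) (chainSign i r)) 0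
      (38 * r.length + 1) := by
  induction r generalizing i with
  | nil =>
    refine (realizes_phase i Real.pi).congr fun g ψ => ?_
    simp [chainSign, phase_pi]
  | cons p r ih =>
    obtain ⟨j, l⟩ := p
    obtain ⟨hij, hil, hjl, -, h⟩ := h
    refine (Realizes.conj (realizes_toffoli hij hil hjl)
      (fun _ => toffoliPerm_toffoliPerm hil hjl) (ih l h)).mono (by omega) ?_
    simp only [List.length_cons]; omega

/-- A Toffoli gate whose target is zero stores the conjunction of its controls there. The next link
uses that target as its control, so the conjunctions accumulate along the chain. -/
theorem chainSign_eq {m : ℕ} (i : Fin m) (r : List (Fin m × Fin m)) (h : ChainOK i r)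
    (b : Bits m) (hb : ∀ p ∈ r, b p.2 = false) :
    chainSign i r b = sgn (b i && decide (∀ p ∈ r, b p.1 = true)) := by
  induction r generalizing i b with
  | nil => simp [chainSign]
  | cons p r ih =>
    obtain ⟨j, l⟩ := p
    obtain ⟨hij, hil, hjl, h', h⟩ := h
    have hl : b l = false := hb (j, l) (by simp)
    have key : ∀ x, x ≠ l → toffoliPerm i j l b x = b x := fun x hx => by
      simp [toffoliPerm, Function.update_of_ne hx]
    rw [chainSign, ih l h _ (fun p hp => by
      rw [key _ (h' p hp).2]; exact hb p (by simp [hp]))]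
    congr 1
    have : (∀ p ∈ r, toffoliPerm i j l b p.1 = true) ↔ (∀ p ∈ r, b p.1 = true) :=
      forall₂_congr fun p hp => by rw [key _ (h' p hp).1]
    simp only [this]
    simp [toffoliPerm, hl, Bool.and_assoc]

/-! ### The layout of the qubits and the operators on states with clean auxiliary qubits -/

/-- The qubits of the mean estimation algorithm: test qubits, index qubits, one sign qubit, value qubits,
auxiliary qubits. -/
abbrev QType (T : Type) (n v : ℕ) : Type := T ⊕ ((Fin n ⊕ Unit) ⊕ (Fin v ⊕ (Fin n ⊕ Unit)))

section Layout

variable (T : Type) [Fintype T] (n v : ℕ)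

/-- A numbering of the qubits. -/
def qEquiv : QType T n v ≃ Fin (Fintype.card (QType T n v)) := Fintype.equivFin _

/-- The algorithm without steps. -/
def layout (point : Bits n → (Fin d → ℝ)) (code : ℝ → Bits v) (decode : (T → Bool) → ℝ) :
    QuantumAlg d where
  qubits := Fintype.card (QType T n v)
  nIndex := n
  nValue := v
  index := ⟨fun i => qEquiv T n v (.inr (.inl (.inl i))), fun i j h => by simpa using h⟩
  value := ⟨fun i => qEquiv T n v (.inr (.inr (.inl i))), fun i j h => by simpa using h⟩
  disjoint i j h := by
    have := (qEquiv T n v).injective h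
    simp at this
  point := point
  code := code
  steps := []
  decode b := decode fun t => b (qEquiv T n v (.inl t))

variable {T n v}

/-- The states in which the value qubits and the auxiliary qubits are zero, written as functions of the test
qubits and the system qubits. -/
def embed (φ : (T → Bool) → (Fin n ⊕ Unit → Bool) → ℂ) (b : Bits (Fintype.card (QType T n v))) : ℂ :=
  if ∀ a, b (qEquiv T n v (.inr (.inr a))) = false then
    φ (fun t => b (qEquiv T n v (.inl t))) (fun s => b (qEquiv T n v (.inr (.inl s))))
  else 0

variable {point : Bits n → (Fin d → ℝ)} {code : ℝ → Bits v} {decode : (T → Bool) → ℝ}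

theorem update_qEquiv_of_ne {x y : QType T n v} (h : y ≠ x) (b : Bits (Fintype.card (QType T n v)))
    (w : Bool) : Function.update b (qEquiv T n v x) w (qEquiv T n v y) = b (qEquiv T n v y) :=
  Function.update_of_ne (by simpa using h) _ _

/-- A single qubit operator on the system qubits. -/
def sysOp {S : Type*} [DecidableEq S] (k : S) (u : Matrix Bool Bool ℂ) (φ : (S → Bool) → ℂ) :
    (S → Bool) → ℂ :=
  fun y => ∑ w, u (y k) w * φ (Function.update y k w)

variable [DecidableEq T]

theorem act_embed_sys (k : Fin n ⊕ Unit) (u : Matrix.unitaryGroup Bool ℂ)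
    (φ : (T → Bool) → (Fin n ⊕ Unit → Bool) → ℂ) :
    (Gate.single (qEquiv T n v (.inr (.inl k))) u).act (embed φ) =
      embed fun t => sysOp k (u : Matrix Bool Bool ℂ) (φ t) := by
  funext b
  simp only [Gate.act, embed, sysOp]
  have h1 : ∀ (w : Bool) a, Function.update b (qEquiv T n v (.inr (.inl k))) w
      (qEquiv T n v (.inr (.inr a))) = b (qEquiv T n v (.inr (.inr a))) :=
    fun w a => update_qEquiv_of_ne (by simp) _ _
  have h2 : ∀ (w : Bool) a, Function.update b (qEquiv T n v (.inr (.inl k))) w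
      (qEquiv T n v (.inl a)) = b (qEquiv T n v (.inl a)) :=
    fun w a => update_qEquiv_of_ne (by simp) _ _
  have h3 : ∀ w : Bool, (fun s => Function.update b (qEquiv T n v (.inr (.inl k))) w
      (qEquiv T n v (.inr (.inl s)))) =
      Function.update (fun s => b (qEquiv T n v (.inr (.inl s)))) k w := by
    intro w
    funext s
    by_cases hs : s = k
    · subst hs; simp [Function.update_self]
    · rw [update_qEquiv_of_ne (by simpa using hs), Function.update_of_ne hs]
  simp only [h1, h2, h3]
  split_ifs with h
  · rfl
  · simp

theorem realizes_sysOp (k : Fin n ⊕ Unit) (u : Matrix.unitaryGroup Bool ℂ) :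
    (layout T n v point code decode).Realizes embed
      (fun _ φ t => sysOp k (u : Matrix Bool Bool ℂ) (φ t)) 0 1 :=
  (realizes_single (A := layout T n v point code decode) (qEquiv T n v (.inr (.inl k))) u).lift
    fun _ φ => act_embed_sys k u φ

/-- A single qubit operator on the test qubits. -/
def testOp {S : Type*} (l : T) (u : Matrix Bool Bool ℂ) (φ : (T → Bool) → (S → Bool) → ℂ) :
    (T → Bool) → (S → Bool) → ℂ :=
  fun t y => ∑ w, u (t l) w * φ (Function.update t l w) y

theorem act_embed_test (l : T) (u : Matrix.unitaryGroup Bool ℂ)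
    (φ : (T → Bool) → (Fin n ⊕ Unit → Bool) → ℂ) :
    (Gate.single (qEquiv T n v (.inl l)) u).act (embed φ) =
      embed (testOp l (u : Matrix Bool Bool ℂ) φ) := by
  funext b
  simp only [Gate.act, embed, testOp]
  have h1 : ∀ (w : Bool) a, Function.update b (qEquiv T n v (.inl l)) w
      (qEquiv T n v (.inr a)) = b (qEquiv T n v (.inr a)) :=
    fun w a => update_qEquiv_of_ne (by simp) _ _
  have h3 : ∀ w : Bool, (fun s => Function.update b (qEquiv T n v (.inl l)) w
      (qEquiv T n v (.inl s))) =
      Function.update (fun s => b (qEquiv T n v (.inl s))) l w := by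
    intro w
    funext s
    by_cases hs : s = l
    · subst hs; simp
    · rw [update_qEquiv_of_ne (by simpa using hs), Function.update_of_ne hs]
  simp only [h1, h3]
  split_ifs with h
  · rfl
  · simp

theorem realizes_testOp (l : T) (u : Matrix.unitaryGroup Bool ℂ) :
    (layout T n v point code decode).Realizes embed
      (fun _ => testOp l (u : Matrix Bool Bool ℂ)) 0 1 :=
  (realizes_single (A := layout T n v point code decode) (qEquiv T n v (.inl l)) u).lift
    fun _ φ => act_embed_test l u φ

/-- Diagonal operators. -/
theorem Realizes.embed_diag {χ : ((Fin d → ℝ) → ℝ) → Bits (Fintype.card (QType T n v)) → ℂ} {q k : ℕ}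
    (h : (layout T n v point code decode).Realizes (fun ψ => ψ)
      (fun g => monomial (fun b => b) (χ g)) q k)
    (χ' : ((Fin d → ℝ) → ℝ) → (T → Bool) → (Fin n ⊕ Unit → Bool) → ℂ)
    (hχ : ∀ g b, (∀ a, b (qEquiv T n v (.inr (.inr a))) = false) →
      χ g b = χ' g (fun t => b (qEquiv T n v (.inl t))) (fun s => b (qEquiv T n v (.inr (.inl s))))) :
    (layout T n v point code decode).Realizes embed (fun g φ t y => χ' g t y * φ t y) q k := by
  refine h.lift fun g φ => ?_
  funext b
  simp only [monomial, embed]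
  split_ifs with hb
  · rw [hχ g b hb]
  · simp

/-- The sign change if the test qubit `l` is one and the system is not in the state zero. -/
def zeroSign {S : Type*} [Fintype S] (l : T) (t : T → Bool) (y : S → Bool) : ℂ :=
  sgn (t l && !decide (∀ s, y s = false))

/-- Negation of all system qubits. -/
theorem realizes_notAll :
    (layout T n v point code decode).Realizes embed
      (fun _ φ t y => φ t (fun s => !y s)) 0 (n + 1) := by
  have key : ∀ (l : List (Fin n ⊕ Unit)), l.Nodup → ∀ (φ : (T → Bool) → (Fin n ⊕ Unit → Bool) → ℂ)
      t y y', (∀ s ∈ l, y' s = !y s) → (∀ s, s ∉ l → y' s = y s) →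
      l.foldl (fun φ k t => sysOp k notMatrix (φ t)) φ t y = φ t y' := by
    intro l
    induction l with
    | nil => intro _ φ t y y' _ h; rw [show y' = y from funext fun s => h s (by simp)]; simp
    | cons k l ih =>
      intro hl φ t y y' h1 h2
      rw [List.nodup_cons] at hl
      rw [List.foldl_cons, ih hl.2 _ t y (Function.update y' k (y k))]
      · have : Function.update y' k (!y k) = y' := by
          rw [← h1 k (by simp), Function.update_eq_self]
        simp only [sysOp, Fintype.sum_bool, notMatrix, Function.update_self, Function.update_idem]
        cases hk : y k <;> rw [hk] at this <;> simp only [Bool.not_true, Bool.not_false] at this <;>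
          simp [this]
      · intro s hs
        have : s ≠ k := by rintro rfl; exact hl.1 hs
        rw [Function.update_of_ne this, h1 s (by simp [hs])]
      · intro s hs
        by_cases hsk : s = k
        · subst hsk; simp
        · rw [Function.update_of_ne hsk, h2 s (by simp [hsk, hs])]
  refine ((Realizes.foldl (fun k => realizes_sysOp k ⟨notMatrix, notMatrix_mem⟩)
    (Finset.univ : Finset (Fin n ⊕ Unit)).toList).mono (by simp) (by simp)).congr fun g φ => ?_
  funext t y
  exact key _ (Finset.nodup_toList _) _ _ _ _ (by simp) (by simp)

/-- The chain starts at the test qubit and consumes one auxiliary qubit per system qubit. This is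
why `QType` contains a second copy of the n + 1 system qubits. -/
theorem realizes_onesSign (l : T) :
    (layout T n v point code decode).Realizes embed
      (fun _ φ t y => sgn (t l && decide (∀ s, y s = true)) * φ t y) 0 (38 * (n + 1) + 1) := by
  set r := (Finset.univ : Finset (Fin n ⊕ Unit)).toList.map fun s =>
    (qEquiv T n v (.inr (.inl s)), qEquiv T n v (.inr (.inr (.inr s)))) with hr
  have hlen : r.length = n + 1 := by simp [hr]
  have key : ∀ (ks : List (Fin n ⊕ Unit)), ks.Nodup → ∀ i : Fin (Fintype.card (QType T n v)),
      (∀ s, i ≠ qEquiv T n v (.inr (.inl s))) →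
      (∀ s ∈ ks, i ≠ qEquiv T n v (.inr (.inr (.inr s)))) →
      ChainOK i (ks.map fun s =>
        (qEquiv T n v (.inr (.inl s)), qEquiv T n v (.inr (.inr (.inr s))))) := by
    intro ks
    induction ks with
    | nil => intro _ i _ _; trivial
    | cons k ks ih =>
      intro hl i h1 h2
      rw [List.nodup_cons] at hl
      refine ⟨h1 k, h2 k (by simp), by simp, ?_, ih hl.2 _ (by simp) ?_⟩
      · intro p hp
        obtain ⟨s, hs, rfl⟩ := List.mem_map.1 hp
        refine ⟨by simp, ?_⟩
        simp only [ne_eq, EmbeddingLike.apply_eq_iff_eq, Sum.inr.injEq]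
        rintro rfl
        exact hl.1 hs
      · intro s hs
        simp only [ne_eq, EmbeddingLike.apply_eq_iff_eq, Sum.inr.injEq]
        rintro rfl
        exact hl.1 hs
  have hok : ChainOK (qEquiv T n v (.inl l)) r :=
    key _ (Finset.nodup_toList _) _ (by simp) (by simp)
  have h := realizes_chainSign (A := layout T n v point code decode) (qEquiv T n v (.inl l)) r hok
  have hlen' : 38 * r.length + 1 ≤ 38 * (n + 1) + 1 := by rw [hlen]
  refine Realizes.embed_diag (h.mono le_rfl hlen') _ fun g b hb => ?_
  refine (chainSign_eq _ _ hok b ?_).trans ?_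
  · intro p hp
    obtain ⟨s, hs, rfl⟩ := List.mem_map.1 hp
    exact hb _
  · have : (∀ p ∈ r, b p.1 = true) ↔ ∀ s, b (qEquiv T n v (.inr (.inl s))) = true := by
      rw [hr, List.forall_mem_map]
      simp only [Finset.mem_toList, Finset.mem_univ, forall_const]
    simp only [this]

/-- Negating all system qubits moves the sign from the all-ones state to the zero state, and the
extra sign on the test qubit moves it from the zero state to its complement. -/
theorem realizes_zeroSign (l : T) :
    (layout T n v point code decode).Realizes embed (fun _ φ t y => zeroSign l t y * φ t y) 0
      (40 * (n + 1) + 2) := by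
  have h0 : (layout T n v point code decode).Realizes embed
      (fun _ φ t y => sgn (t l) * φ t y) 0 1 := by
    refine Realizes.embed_diag (realizes_phase (A := layout T n v point code decode)
      (qEquiv T n v (.inl l)) Real.pi) _ fun g b hb => ?_
    rw [phase_pi]
  refine ((((realizes_notAll.comp (realizes_onesSign l)).comp realizes_notAll).comp h0).mono
    (by omega) (by omega)).congr fun g φ => ?_
  funext t y
  simp only [Bool.not_not, zeroSign, Bool.not_eq_true', ← mul_assoc]
  congr 1
  by_cases h : ∀ s, y s = false
  · cases t l <;> simp only [sgn, h] <;> simp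
  · cases t l <;> simp only [sgn, h] <;> simp

theorem realizes_diag_list {A : QuantumAlg d} {β : Type*} {χ : β → Bits A.qubits → ℂ} {q k : ℕ}
    (h : ∀ j, A.Realizes (fun ψ => ψ) (fun _ => monomial (fun b => b) (χ j)) q k) (l : List β) :
    A.Realizes (fun ψ => ψ) (fun _ => monomial (fun b => b) (fun b => (l.map fun j => χ j b).prod))
      (l.length * q) (l.length * k) := by
  induction l with
  | nil =>
    refine (Realizes.refl.mono (by simp) (by simp)).congr fun g ψ => ?_
    funext b
    simp [monomial]
  | cons j l ih =>
    refine (((h j).diag_mul ih).mono ?_ ?_).congr fun g ψ => ?_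
    · simp only [List.length_cons]; ring_nf; omega
    · simp only [List.length_cons]; ring_nf; omega
    · simp

/-- Numerically (x⊕c) - c = (-1)^c x, so the control c chooses the sign of the phase. One extra
single-qubit phase thus replaces a controlled phase gate. -/
theorem phase_xor_mul_phase (θ : ℝ) (x c : Bool) :
    phase θ (xor x c) * phase (-θ) c =
      Complex.exp (((if c then -1 else 1 : ℝ) * (if x then θ else 0) : ℝ) * Complex.I) := by
  cases x <;> cases c <;> simp [phase, ← Complex.exp_add]

theorem xorValue_value (f : Bits v) (b : Bits (Fintype.card (QType T n v))) (j : Fin v) :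
    (layout T n v point code decode).xorValue f b (qEquiv T n v (.inr (.inr (.inl j)))) =
      xor (b (qEquiv T n v (.inr (.inr (.inl j))))) (f j) := by
  have : (∃ j', (layout (d := d) T n v point code decode).value j' = qEquiv T n v (.inr (.inr (.inl j))) ∧
      f j' = true) ↔ f j = true := by
    constructor
    · rintro ⟨j', h, hf⟩
      have := (qEquiv T n v).injective h
      simp only [Sum.inr.injEq] at this
      rw [← Sum.inl.inj this]
      exact hf
    · exact fun h => ⟨j, rfl, h⟩
  simp only [xorValue, this]
  simp

theorem xorValue_of_ne (f : Bits v) (b : Bits (Fintype.card (QType T n v))) (x : QType T n v)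
    (hx : ∀ j, x ≠ .inr (.inr (.inl j))) :
    (layout T n v point code decode).xorValue f b (qEquiv T n v x) = b (qEquiv T n v x) := by
  have : ¬ ∃ j, (layout (d := d) T n v point code decode).value j = qEquiv T n v x ∧ f j = true := by
    rintro ⟨j, hj, -⟩
    exact hx j ((qEquiv T n v).injective hj).symm
  simp only [xorValue, this]
  simp

/-- The permutation of the basis by a query. -/
def queryPerm (point : Bits n → (Fin d → ℝ)) (code : ℝ → Bits v) (g : (Fin d → ℝ) → ℝ)
    (b : Bits (Fintype.card (QType T n v))) : Bits (Fintype.card (QType T n v)) :=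
  (layout T n v point code fun _ => 0).xorValue
    (code (g (point fun i => b (qEquiv T n v (.inr (.inl (.inl i))))))) b

theorem queryPerm_value (g : (Fin d → ℝ) → ℝ) (b : Bits (Fintype.card (QType T n v))) (j : Fin v) :
    queryPerm point code g b (qEquiv T n v (.inr (.inr (.inl j)))) =
      xor (b (qEquiv T n v (.inr (.inr (.inl j)))))
        (code (g (point fun i => b (qEquiv T n v (.inr (.inl (.inl i)))))) j) :=
  xorValue_value _ _ _

theorem queryPerm_of_ne (g : (Fin d → ℝ) → ℝ) (b : Bits (Fintype.card (QType T n v)))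
    (x : QType T n v) (hx : ∀ j, x ≠ .inr (.inr (.inl j))) :
    queryPerm point code g b (qEquiv T n v x) = b (qEquiv T n v x) :=
  xorValue_of_ne _ _ _ hx

theorem queryPerm_queryPerm (g : (Fin d → ℝ) → ℝ) (b : Bits (Fintype.card (QType T n v))) :
    queryPerm point code g (queryPerm point code g b) = b := by
  funext x
  obtain ⟨x, rfl⟩ := (qEquiv T n v).surjective x
  by_cases hx : ∃ j, x = .inr (.inr (.inl j))
  · obtain ⟨j, rfl⟩ := hx
    simp only [queryPerm_value, queryPerm_of_ne g b (.inr (.inl (.inl _))) (by simp), Bool.xor_assoc,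
      Bool.xor_self, Bool.xor_false]
  · push Not at hx
    rw [queryPerm_of_ne _ _ _ hx, queryPerm_of_ne _ _ _ hx]

/-- The phase of the index `x`, with sign given by the sign qubit. -/
theorem realizes_valuePhase (θ : Fin v → ℝ) :
    (layout T n v point code decode).Realizes embed
      (fun g φ t y => Complex.exp (((if y (.inr ()) then -1 else 1 : ℝ) *
        ∑ j, if code (g (point fun i => y (.inl i))) j then θ j else 0 : ℝ) * Complex.I) * φ t y)
      2 (4 * v) := by
  have hq : (layout T n v point code decode).Realizes (fun ψ => ψ)
      (fun g => monomial (queryPerm point code g) 1) 1 0 :=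
    realizes_query.congr fun g ψ => by
      funext b
      simp only [queryAct, monomial, Pi.one_apply, one_mul]
      rfl
  have hd : ∀ j : Fin v, (layout T n v point code decode).Realizes (fun ψ => ψ)
      (fun _ => monomial (fun b => b) (fun b => phase (θ j)
        (xor (b (qEquiv T n v (.inr (.inr (.inl j))))) (b (qEquiv T n v (.inr (.inl (.inr ())))))) *
      phase (-θ j) (b (qEquiv T n v (.inr (.inl (.inr ()))))))) 0 4 := fun j =>
    ((realizes_phase_xor (A := layout T n v point code decode)
      (i := qEquiv T n v (.inr (.inl (.inr ()))))
      (j := qEquiv T n v (.inr (.inr (.inl j)))) (by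
        intro h; have := (qEquiv T n v).injective h; simp at this) (θ j)).diag_mul
      (realizes_phase (A := layout T n v point code decode)
        (qEquiv T n v (.inr (.inl (.inr ())))) (-θ j)))
  -- The query writes the code of the value, the phases are applied bit by bit, and a second query
  -- erases the code; hence two queries.
  have hc := Realizes.conj hq (fun g b => queryPerm_queryPerm g b)
    (realizes_diag_list hd (List.finRange v))
  refine Realizes.embed_diag (hc.mono (by simp) (by simp; omega)) _ fun g b hb => ?_
  simp only [phase_xor_mul_phase]
  rw [← Fin.prod_univ_def, ← Complex.exp_sum, ← Finset.sum_mul]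
  congr 2
  rw [← Complex.ofReal_sum, Finset.mul_sum]
  congr 1
  refine Finset.sum_congr rfl fun j _ => ?_
  rw [queryPerm_value, queryPerm_of_ne _ _ _ (by simp), hb]
  simp

end Layout

end QuantumAlg

/-! ### The two reflections and the eigenvectors of their product -/

namespace QuantumAlg

section Walk

variable {S : Type*} [Fintype S] [DecidableEq S]

theorem sysOp_add (k : S) (u : Matrix Bool Bool ℂ) (φ φ' : (S → Bool) → ℂ) :
    sysOp k u (φ + φ') = sysOp k u φ + sysOp k u φ' := by
  funext y; simp [sysOp, mul_add, Finset.sum_add_distrib]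

theorem sysOp_smul (k : S) (u : Matrix Bool Bool ℂ) (a : ℂ) (φ : (S → Bool) → ℂ) :
    sysOp k u (a • φ) = a • sysOp k u φ := by
  funext y; simp [sysOp, mul_left_comm, mul_add]

theorem sysOp_had_sysOp_had (k : S) (φ : (S → Bool) → ℂ) :
    sysOp k hadMatrix (sysOp k hadMatrix φ) = φ := by
  funext y
  have h := congrFun (congrFun hadMatrix_mul_self (y k))
  simp only [Matrix.mul_apply, Fintype.sum_bool, Matrix.one_apply] at h
  have h1 := h true
  have h2 := h false
  have hy : φ y = (if y k = true then (1 : ℂ) else 0) * φ (Function.update y k true) +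
      (if y k = false then (1 : ℂ) else 0) * φ (Function.update y k false) := by
    cases hk : y k <;> simp [← hk]
  rw [hy, ← h1, ← h2]
  simp only [sysOp, Fintype.sum_bool, Function.update_self, Function.update_idem]
  ring

theorem sum_sysOp_mul (k : S) (u : Matrix Bool Bool ℂ) (hu : ∀ a b, u a b = u b a)
    (φ ψ : (S → Bool) → ℂ) :
    ∑ y, sysOp k u φ y * ψ y = ∑ y, φ y * sysOp k u ψ y := by
  simp only [sysOp, Finset.sum_mul, Finset.mul_sum]
  rw [← Fintype.sum_prod_type', ← Fintype.sum_prod_type']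
  -- Exchanging the bit at k with the summation bit is an involution on the index set; it carries
  -- one double sum to the other because u is symmetric.
  have hinv : Function.Involutive
      (fun p : (S → Bool) × Bool => (Function.update p.1 k p.2, p.1 k)) := by
    rintro ⟨y, w⟩
    simp
  refine Fintype.sum_equiv hinv.toPerm _ _ ?_
  rintro ⟨y, w⟩
  simp only [Function.Involutive.coe_toPerm, Function.update_self, Function.update_idem,
    Function.update_eq_self]
  rw [hu]
  ring

/-- The Hadamard gates on the qubits of a list. -/
def hadList (l : List S) (φ : (S → Bool) → ℂ) : (S → Bool) → ℂ :=
  l.foldl (fun φ k => sysOp k hadMatrix φ) φ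

theorem hadList_add (l : List S) (φ φ' : (S → Bool) → ℂ) :
    hadList l (φ + φ') = hadList l φ + hadList l φ' := by
  induction l generalizing φ φ' with
  | nil => rfl
  | cons k l ih => simp only [hadList, List.foldl_cons] at ih ⊢; rw [sysOp_add, ih]

theorem hadList_smul (l : List S) (a : ℂ) (φ : (S → Bool) → ℂ) :
    hadList l (a • φ) = a • hadList l φ := by
  induction l generalizing φ with
  | nil => rfl
  | cons k l ih => simp only [hadList, List.foldl_cons] at ih ⊢; rw [sysOp_smul, ih]

theorem hadList_hadList_reverse (l : List S) (φ : (S → Bool) → ℂ) :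
    hadList l (hadList l.reverse φ) = φ := by
  induction l generalizing φ with
  | nil => rfl
  | cons k l ih =>
    rw [List.reverse_cons]
    simp only [hadList, List.foldl_append, List.foldl_cons, List.foldl_nil] at ih ⊢
    rw [sysOp_had_sysOp_had]
    exact ih φ

theorem sum_hadList_mul (l : List S) (φ ψ : (S → Bool) → ℂ) :
    ∑ y, hadList l φ y * ψ y = ∑ y, φ y * hadList l.reverse ψ y := by
  induction l generalizing φ with
  | nil => rfl
  | cons k l ih =>
    rw [List.reverse_cons]
    simp only [hadList, List.foldl_append, List.foldl_cons, List.foldl_nil] at ih ⊢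
    rw [ih, sum_sysOp_mul]
    intro a b
    cases a <;> cases b <;> rfl

theorem hadList_single (l : List S) (hl : l.Nodup) (y : S → Bool) [Decidable (∀ s, s ∉ l → y s = false)] :
    hadList l (Pi.single (fun _ => false) 1) y =
      if ∀ s, s ∉ l → y s = false then (((√2)⁻¹ : ℝ) : ℂ) ^ l.length else 0 := by
  classical
  induction l using List.reverseRecOn generalizing y with
  | nil =>
    simp only [hadList, List.foldl_nil, List.not_mem_nil, not_false_eq_true, forall_const,
      List.length_nil, pow_zero, Pi.single_apply]
    congr 1
    exact propext ⟨fun h s => by rw [h], fun h => funext h⟩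
  | append_singleton l k ih =>
    have hl' := List.nodup_append.1 hl
    have hk : k ∉ l := fun h => hl'.2.2 k h k (by simp) rfl
    have : hadList (l ++ [k]) (Pi.single (fun _ => false) 1) =
        sysOp k hadMatrix (hadList l (Pi.single (fun _ => false) 1)) := by
      simp [hadList, List.foldl_append]
    rw [this]
    simp only [sysOp, Fintype.sum_bool]
    rw [ih hl'.1, ih hl'.1]
    have h1 : ¬ ∀ s, s ∉ l → Function.update y k true s = false := fun h => by
      have := h k hk
      simp at this
    have h2 : (∀ s, s ∉ l → Function.update y k false s = false) ↔
        ∀ s, s ∉ l ++ [k] → y s = false := by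
      refine forall_congr' fun s => ?_
      by_cases hs : s = k
      · subst hs; simp
      · simp [hs]
    rw [if_neg h1]
    simp only [h2]
    have h3 : hadMatrix (y k) false = (((√2)⁻¹ : ℝ) : ℂ) := by cases y k <;> simp [hadMatrix]
    rw [h3]
    split_ifs <;> simp [pow_succ, mul_comm]

/-- The amplitude of the uniform superposition. -/
def unifAmp (S : Type*) [Fintype S] : ℂ := (((√2)⁻¹ : ℝ) : ℂ) ^ Fintype.card S

theorem hadList_univ_single :
    hadList (Finset.univ : Finset S).toList (Pi.single (fun _ => false) 1) = fun _ => unifAmp S := by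
  classical
  funext y
  rw [hadList_single _ (Finset.nodup_toList _)]
  simp [unifAmp]

theorem unifAmp_mul_self : unifAmp S * unifAmp S = 1 / 2 ^ Fintype.card S := by
  rw [unifAmp, ← mul_pow, sqrt_two_inv_mul_self]
  simp

theorem conj_unifAmp : (starRingEnd ℂ) (unifAmp S) = unifAmp S := by
  simp [unifAmp, Complex.conj_ofReal]

/-- The reflection about the uniform superposition. -/
def uniformRefl (φ : (S → Bool) → ℂ) : (S → Bool) → ℂ :=
  fun y => 2 * (∑ y', unifAmp S * φ y') * unifAmp S - φ y

/-- Inner part: 2|0⟩⟨0| - 1, which becomes the reflection about the uniform vector after conjugation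
by Hadamard gates. The first layer is in reversed order so that the two layers are formally inverse
to each other. -/
theorem hadList_zeroRefl (φ : (S → Bool) → ℂ) :
    hadList (Finset.univ : Finset S).toList (fun y => sgn (!decide (∀ s, y s = false)) *
      hadList (Finset.univ : Finset S).toList.reverse φ y) = uniformRefl φ := by
  set l := (Finset.univ : Finset S).toList
  have h : (fun y => sgn (!decide (∀ s, y s = false)) * hadList l.reverse φ y) =
      (2 * hadList l.reverse φ (fun _ => false)) • (Pi.single (fun _ => false) 1 : (S → Bool) → ℂ) +
        (-1 : ℂ) • hadList l.reverse φ := by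
    funext y
    by_cases hy : ∀ s, y s = false
    · obtain rfl : y = fun _ => false := funext hy
      simp [sgn]
      ring
    · have : y ≠ fun _ => false := fun h => hy fun s => by rw [h]
      simp [sgn, hy, Pi.single_eq_of_ne this]
  rw [h, hadList_add, hadList_smul, hadList_smul, hadList_hadList_reverse, hadList_univ_single]
  have h0 : hadList l.reverse φ (fun _ => false) = ∑ y', unifAmp S * φ y' := by
    have := sum_hadList_mul l (Pi.single (fun _ => false) 1) φ
    rw [hadList_univ_single] at this
    rw [this, Finset.sum_eq_single (fun _ => false)]
    · simp
    · intro b _ hb; simp [Pi.single_eq_of_ne hb]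
    · simp
  funext y
  simp only [uniformRefl, Pi.add_apply, Pi.smul_apply, smul_eq_mul, h0]
  ring

end Walk

section WalkPhase

variable {n : ℕ}

/-- Negation of the sign qubit. -/
def flipSign (y : Fin n ⊕ Unit → Bool) : Fin n ⊕ Unit → Bool :=
  Function.update y (.inr ()) (!y (.inr ()))

theorem flipSign_flipSign (y : Fin n ⊕ Unit → Bool) : flipSign (flipSign y) = y := by
  simp [flipSign]

theorem flipSign_inl (y : Fin n ⊕ Unit → Bool) (i : Fin n) : flipSign y (.inl i) = y (.inl i) := by
  simp [flipSign]

theorem flipSign_inr (y : Fin n ⊕ Unit → Bool) : flipSign y (.inr ()) = !y (.inr ()) := by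
  simp [flipSign]

/-- The phase `exp (± i Φ x)`, with sign given by the sign qubit. -/
def signedPhase (Φ : Bits n → ℝ) (y : Fin n ⊕ Unit → Bool) : ℂ :=
  Complex.exp (((if y (.inr ()) then -1 else 1 : ℝ) * Φ fun i => y (.inl i) : ℝ) * Complex.I)

/-- The sign qubit serves two purposes: flipping it inverts the phase, so that `phaseRefl` is an
involution, and averaging over it replaces exp(iΦ) by the real number cos Φ. -/
theorem signedPhase_mul_flip (Φ : Bits n → ℝ) (y : Fin n ⊕ Unit → Bool) :
    signedPhase Φ (flipSign y) * signedPhase Φ y = 1 := by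
  simp only [signedPhase, flipSign_inl, flipSign_inr]
  rw [← Complex.exp_add]
  cases y (.inr ()) <;> simp

theorem normSq_signedPhase (Φ : Bits n → ℝ) (y : Fin n ⊕ Unit → Bool) :
    (starRingEnd ℂ) (signedPhase Φ y) * signedPhase Φ y = 1 := by
  rw [signedPhase, ← Complex.exp_conj, ← Complex.exp_add]
  simp

/-- The reflection built from the phases. -/
def phaseRefl (Φ : Bits n → ℝ) (φ : (Fin n ⊕ Unit → Bool) → ℂ) : (Fin n ⊕ Unit → Bool) → ℂ :=
  fun y => signedPhase Φ (flipSign y) * φ (flipSign y)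

theorem phaseRefl_phaseRefl (Φ : Bits n → ℝ) (φ : (Fin n ⊕ Unit → Bool) → ℂ) :
    phaseRefl Φ (phaseRefl Φ φ) = φ := by
  funext y
  simp only [phaseRefl, flipSign_flipSign]
  rw [← mul_assoc, signedPhase_mul_flip, one_mul]

theorem phaseRefl_comb (Φ : Bits n → ℝ) (a b : ℂ) (φ ψ : (Fin n ⊕ Unit → Bool) → ℂ) :
    phaseRefl Φ (a • φ + b • ψ) = a • phaseRefl Φ φ + b • phaseRefl Φ ψ := by
  funext y; simp [phaseRefl]; ring

theorem uniformRefl_comb (a b : ℂ) (φ ψ : (Fin n ⊕ Unit → Bool) → ℂ) :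
    uniformRefl (a • φ + b • ψ) = a • uniformRefl φ + b • uniformRefl ψ := by
  funext y
  simp only [uniformRefl, Pi.add_apply, Pi.smul_apply, smul_eq_mul, mul_add,
    Finset.sum_add_distrib, Finset.mul_sum]
  have h1 : ∑ i, unifAmp (Fin n ⊕ Unit) * (a * φ i) = a * ∑ i, unifAmp (Fin n ⊕ Unit) * φ i := by
    rw [Finset.mul_sum]; exact Finset.sum_congr rfl fun _ _ => by ring
  have h2 : ∑ i, unifAmp (Fin n ⊕ Unit) * (b * ψ i) = b * ∑ i, unifAmp (Fin n ⊕ Unit) * ψ i := by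
    rw [Finset.mul_sum]; exact Finset.sum_congr rfl fun _ _ => by ring
  simp only [← Finset.mul_sum] at h1 h2 ⊢
  linear_combination 2 * unifAmp (Fin n ⊕ Unit) * h1 + 2 * unifAmp (Fin n ⊕ Unit) * h2

/-- The uniform superposition. -/
def uvec (n : ℕ) : (Fin n ⊕ Unit → Bool) → ℂ := fun _ => unifAmp (Fin n ⊕ Unit)

/-- The mean of `cos Φ`. -/
def meanCos (Φ : Bits n → ℝ) : ℝ := (∑ x, Real.cos (Φ x)) / 2 ^ n

theorem sum_signedPhase (Φ : Bits n → ℝ) :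
    ∑ y, signedPhase Φ y = 2 * ∑ x, (Real.cos (Φ x) : ℂ) := by
  rw [← (Equiv.sumArrowEquivProdArrow (Fin n) Unit Bool).symm.sum_comp, Fintype.sum_prod_type,
    Finset.mul_sum]
  refine Finset.sum_congr rfl fun x _ => ?_
  rw [← (Equiv.funUnique Unit Bool).symm.sum_comp, Fintype.sum_bool]
  simp only [signedPhase, Equiv.sumArrowEquivProdArrow_symm_apply_inr,
    Equiv.sumArrowEquivProdArrow_symm_apply_inl, Equiv.funUnique_symm_apply, uniqueElim_const,
    if_true, Bool.false_eq_true, if_false]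
  push_cast
  rw [Complex.cos]
  ring_nf

theorem card_system : Fintype.card (Fin n ⊕ Unit) = n + 1 := by simp

/-- With u the uniform vector and v its image under `phaseRefl`, this is ⟨u, v⟩. It is the only
number that enters the action of the walk on the plane of u and v, and it is the mean to be
estimated. -/
theorem sum_amp_mul_phaseRefl (Φ : Bits n → ℝ) :
    ∑ y, unifAmp (Fin n ⊕ Unit) * phaseRefl Φ (uvec n) y = meanCos Φ := by
  have h1 : ∑ y : Fin n ⊕ Unit → Bool, signedPhase Φ (flipSign y) = ∑ y, signedPhase Φ y :=
    Equiv.sum_comp (Function.Involutive.toPerm flipSign flipSign_flipSign) (signedPhase Φ)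
  simp only [phaseRefl, uvec]
  have h2 : ∀ y : Fin n ⊕ Unit → Bool, unifAmp (Fin n ⊕ Unit) *
      (signedPhase Φ (flipSign y) * unifAmp (Fin n ⊕ Unit)) =
      (1 / 2 ^ (n + 1)) * signedPhase Φ (flipSign y) := fun y => by
    rw [← card_system, ← unifAmp_mul_self]; ring
  simp only [h2]
  rw [← Finset.mul_sum, h1, sum_signedPhase, meanCos]
  push_cast
  rw [pow_succ]
  field_simp

theorem uniformRefl_uvec : uniformRefl (uvec n) = uvec n := by
  funext y
  simp only [uniformRefl, uvec, unifAmp_mul_self, Finset.sum_const, Finset.card_univ,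
    Fintype.card_fun, Fintype.card_bool, nsmul_eq_mul]
  push_cast
  field_simp
  ring

theorem uniformRefl_phaseRefl (Φ : Bits n → ℝ) :
    uniformRefl (phaseRefl Φ (uvec n)) =
      (2 * (meanCos Φ : ℂ)) • uvec n + (-1 : ℂ) • phaseRefl Φ (uvec n) := by
  funext y
  simp only [uniformRefl, sum_amp_mul_phaseRefl, Pi.add_apply, Pi.smul_apply, smul_eq_mul, uvec]
  ring

/-- The eigenvector of the walk operator for the eigenvalue `z`. -/
def walkVec (Φ : Bits n → ℝ) (z : ℂ) : (Fin n ⊕ Unit → Bool) → ℂ :=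
  (1 : ℂ) • phaseRefl Φ (uvec n) + (-z⁻¹) • uvec n

/-- Let c be the mean of the cosines. `uniformRefl` fixes u and sends v to 2cu - v, and `phaseRefl`
exchanges u and v. The product sends u to v and v to 2cv - u, so its eigenvalues solve z^2 - 2cz + 1
= 0, with eigenvectors v - u/z. -/
theorem walk_walkVec (Φ : Bits n → ℝ) {z : ℂ} (hz : z ≠ 0) (h : z + z⁻¹ = 2 * (meanCos Φ : ℂ)) :
    phaseRefl Φ (uniformRefl (walkVec Φ z)) = z • walkVec Φ z := by
  rw [walkVec, uniformRefl_comb, uniformRefl_uvec, uniformRefl_phaseRefl]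
  have : (1 : ℂ) • ((2 * (meanCos Φ : ℂ)) • uvec n + (-1 : ℂ) • phaseRefl Φ (uvec n)) +
      (-z⁻¹) • uvec n = z • uvec n + (-1 : ℂ) • phaseRefl Φ (uvec n) := by
    rw [← h]
    module
  rw [this, phaseRefl_comb, phaseRefl_phaseRefl, smul_add, smul_smul, smul_smul]
  have : z * -z⁻¹ = -1 := by field_simp
  rw [this]
  module

end WalkPhase

end QuantumAlg

namespace QuantumAlg

/-! ### Hadamard tests of the eigenvalues -/

section Tests

variable {n : ℕ} {T : Type} [Fintype T] [DecidableEq T]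

/-- The walk operator, controlled by the test qubit `l`. -/
def walkStep (Φ : Bits n → ℝ) (l : T) (φ : (T → Bool) → (Fin n ⊕ Unit → Bool) → ℂ) :
    (T → Bool) → (Fin n ⊕ Unit → Bool) → ℂ :=
  fun t => phaseRefl Φ (if t l then uniformRefl (φ t) else φ t)

/-- Combinations of the eigenvectors, with coefficients that depend on the test qubits. -/
def comb (Φ : Bits n → ℝ) (z : ℂ) (F F' : (T → Bool) → ℂ) :
    (T → Bool) → (Fin n ⊕ Unit → Bool) → ℂ :=
  fun t => F t • walkVec Φ z + F' t • walkVec Φ z⁻¹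

/-- Only `uniformRefl` is controlled; `phaseRefl`, which contains the queries, is applied in any
case. Over two steps the uncontrolled reflections cancel if the test bit is zero. Steps therefore
come in pairs, and the powers of z are even. -/
theorem walkStep_walkStep (Φ : Bits n → ℝ) {z : ℂ} (hz : z ≠ 0)
    (h : z + z⁻¹ = 2 * (meanCos Φ : ℂ)) (l : T) (F F' : (T → Bool) → ℂ) :
    walkStep Φ l (walkStep Φ l (comb Φ z F F')) =
      comb Φ z (fun t => (if t l then z ^ 2 else 1) * F t)
        (fun t => (if t l then z⁻¹ ^ 2 else 1) * F' t) := by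
  have h' : z⁻¹ + z⁻¹⁻¹ = 2 * (meanCos Φ : ℂ) := by rw [inv_inv, add_comm, h]
  funext t
  cases ht : t l
  · simp [walkStep, ht, comb, phaseRefl_phaseRefl]
  · simp only [walkStep, ht, comb, if_true]
    rw [uniformRefl_comb, phaseRefl_comb, walk_walkVec Φ hz h, walk_walkVec Φ (inv_ne_zero hz) h',
      smul_smul, smul_smul, uniformRefl_comb, phaseRefl_comb, walk_walkVec Φ hz h,
      walk_walkVec Φ (inv_ne_zero hz) h', smul_smul, smul_smul]
    congr 2 <;> ring

theorem walkStep_iterate (Φ : Bits n → ℝ) {z : ℂ} (hz : z ≠ 0)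
    (h : z + z⁻¹ = 2 * (meanCos Φ : ℂ)) (l : T) (M : ℕ) (F F' : (T → Bool) → ℂ) :
    (fun φ => walkStep Φ l (walkStep Φ l φ))^[M] (comb Φ z F F') =
      comb Φ z (fun t => (if t l then z ^ (2 * M) else 1) * F t)
        (fun t => (if t l then z⁻¹ ^ (2 * M) else 1) * F' t) := by
  induction M generalizing F F' with
  | zero => simp
  | succ M ih =>
    rw [Function.iterate_succ_apply]
    rw [walkStep_walkStep Φ hz h, ih]
    congr 1 <;> funext t <;> split_ifs <;> ring

/-- A single qubit operator on functions of the test qubits. -/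
def coefOp (l : T) (u : Matrix Bool Bool ℂ) (F : (T → Bool) → ℂ) (t : T → Bool) : ℂ :=
  ∑ w, u (t l) w * F (Function.update t l w)

theorem testOp_comb (Φ : Bits n → ℝ) (z : ℂ) (l : T) (u : Matrix Bool Bool ℂ)
    (F F' : (T → Bool) → ℂ) :
    testOp l u (comb Φ z F F') = comb Φ z (coefOp l u F) (coefOp l u F') := by
  funext t y
  simp only [testOp, comb, coefOp, Pi.add_apply, Pi.smul_apply, smul_eq_mul, Fintype.sum_bool]
  ring

/-- One test: a Hadamard gate, a phase, `2 M` controlled steps of the walk, and a Hadamard gate. -/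
def testRound (Φ : Bits n → ℝ) (l : T) (θ : ℝ) (M : ℕ)
    (φ : (T → Bool) → (Fin n ⊕ Unit → Bool) → ℂ) : (T → Bool) → (Fin n ⊕ Unit → Bool) → ℂ :=
  testOp l hadMatrix ((fun φ => walkStep Φ l (walkStep Φ l φ))^[M]
    (testOp l (phaseMatrix θ) (testOp l hadMatrix φ)))

/-- The amplitude of the outcome `b` of a test of the eigenvalue `ζ`. -/
def testAmp (θ : ℝ) (ζ : ℂ) (b : Bool) : ℂ := (1 + sgn b * (Complex.exp (θ * Complex.I) * ζ)) / 2

/-- The test qubit starts in the state zero and is split by the first Hadamard gate. One branch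
picks up exp(iθ)ζ, and the second Hadamard gate makes the branches interfere with sum and
difference. -/
theorem coef_testRound (l : T) (θ : ℝ) (ζ : ℂ) (G : (T → Bool) → ℂ)
    (hG : ∀ t w, G (Function.update t l w) = G t) :
    coefOp l hadMatrix (fun t => (if t l then ζ else 1) *
      coefOp l (phaseMatrix θ) (coefOp l hadMatrix (fun t => (if t l then 0 else 1) * G t)) t) =
    fun t => testAmp θ ζ (t l) * G t := by
  funext t
  have h := sqrt_two_inv_mul_self
  simp only [coefOp, Fintype.sum_bool, Function.update_self, Function.update_idem, hG, hadMatrix,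
    phaseMatrix, Matrix.diagonal_apply, testAmp]
  generalize (((√2)⁻¹ : ℝ) : ℂ) = w at *
  cases t l <;> simp [sgn]
  · linear_combination (G t + G t * ζ * Complex.exp (θ * Complex.I)) * h
  · linear_combination (G t - G t * ζ * Complex.exp (θ * Complex.I)) * h

theorem testRound_comb (Φ : Bits n → ℝ) {z : ℂ} (hz : z ≠ 0)
    (h : z + z⁻¹ = 2 * (meanCos Φ : ℂ)) (l : T) (θ : ℝ) (M : ℕ) (G G' : (T → Bool) → ℂ)
    (hG : ∀ t w, G (Function.update t l w) = G t)
    (hG' : ∀ t w, G' (Function.update t l w) = G' t) :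
    testRound Φ l θ M (comb Φ z (fun t => (if t l then 0 else 1) * G t)
      (fun t => (if t l then 0 else 1) * G' t)) =
    comb Φ z (fun t => testAmp θ (z ^ (2 * M)) (t l) * G t)
      (fun t => testAmp θ (z⁻¹ ^ (2 * M)) (t l) * G' t) := by
  rw [testRound, testOp_comb, testOp_comb, walkStep_iterate Φ hz h, testOp_comb,
    coef_testRound l θ _ G hG, coef_testRound l θ _ G' hG']

/-- The coefficient after the tests in `D`. -/
def testCoef (θ : T → ℝ) (M : T → ℕ) (z a : ℂ) (D : Finset T) (t : T → Bool) : ℂ :=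
  a * ∏ s, if s ∈ D then testAmp (θ s) (z ^ (2 * M s)) (t s) else if t s then 0 else 1

theorem testRound_testCoef (Φ : Bits n → ℝ) {z : ℂ} (hz : z ≠ 0)
    (h : z + z⁻¹ = 2 * (meanCos Φ : ℂ)) (θ : T → ℝ) (M : T → ℕ) (a a' : ℂ) (D : Finset T) (l : T)
    (hl : l ∉ D) :
    testRound Φ l (θ l) (M l) (comb Φ z (testCoef θ M z a D) (testCoef θ M z⁻¹ a' D)) =
      comb Φ z (testCoef θ M z a (insert l D)) (testCoef θ M z⁻¹ a' (insert l D)) := by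
  set G : ℂ → ℂ → (T → Bool) → ℂ := fun z a t => a * ∏ s ∈ Finset.univ.erase l,
    if s ∈ D then testAmp (θ s) (z ^ (2 * M s)) (t s) else if t s then 0 else 1 with hGdef
  have hG : ∀ z a t w, G z a (Function.update t l w) = G z a t := by
    intro z a t w
    simp only [hGdef]
    congr 1
    refine Finset.prod_congr rfl fun s hs => ?_
    rw [Function.update_of_ne (Finset.ne_of_mem_erase hs)]
  have h1 : ∀ z a, testCoef θ M z a D = fun t => (if t l then 0 else 1) * G z a t := by
    intro z a
    funext t
    rw [testCoef, ← Finset.mul_prod_erase _ _ (Finset.mem_univ l), if_neg hl]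
    simp only [hGdef]
    ring
  have h2 : ∀ z a, testCoef θ M z a (insert l D) =
      fun t => testAmp (θ l) (z ^ (2 * M l)) (t l) * G z a t := by
    intro z a
    funext t
    rw [testCoef, ← Finset.mul_prod_erase _ _ (Finset.mem_univ l), if_pos (Finset.mem_insert_self _ _)]
    simp only [hGdef]
    rw [mul_left_comm]
    congr 2
    refine Finset.prod_congr rfl fun s hs => ?_
    have : s ∈ insert l D ↔ s ∈ D := by simp [Finset.ne_of_mem_erase hs]
    simp only [this]
  rw [h1, h1, h2, h2, testRound_comb Φ hz h _ _ _ _ _ (hG _ _) (hG _ _)]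

/-- Each eigencomponent keeps its own coefficient, which factors over the tests. Given the
eigenvalue, the measured test bits are therefore independent. -/
theorem foldl_testRound (Φ : Bits n → ℝ) {z : ℂ} (hz : z ≠ 0)
    (h : z + z⁻¹ = 2 * (meanCos Φ : ℂ)) (θ : T → ℝ) (M : T → ℕ) (a a' : ℂ) :
    (Finset.univ : Finset T).toList.foldl (fun φ l => testRound Φ l (θ l) (M l) φ)
      (comb Φ z (testCoef θ M z a ∅) (testCoef θ M z⁻¹ a' ∅)) =
    comb Φ z (fun t => a * ∏ s, testAmp (θ s) (z ^ (2 * M s)) (t s))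
      (fun t => a' * ∏ s, testAmp (θ s) (z⁻¹ ^ (2 * M s)) (t s)) := by
  have key : ∀ (l : List T) (D : Finset T), l.Nodup → (∀ s ∈ l, s ∉ D) →
      l.foldl (fun φ l => testRound Φ l (θ l) (M l) φ)
        (comb Φ z (testCoef θ M z a D) (testCoef θ M z⁻¹ a' D)) =
      comb Φ z (testCoef θ M z a (l.toFinset ∪ D)) (testCoef θ M z⁻¹ a' (l.toFinset ∪ D)) := by
    intro l
    induction l with
    | nil => intro D _ _; simp
    | cons k l ih =>
      intro D hl hD
      rw [List.nodup_cons] at hl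
      rw [List.foldl_cons, testRound_testCoef Φ hz h θ M a a' D k (hD k (by simp)),
        ih _ hl.2 (fun s hs => by
          rw [Finset.mem_insert, not_or]
          exact ⟨fun h => hl.1 (h ▸ hs), hD s (by simp [hs])⟩)]
      have : l.toFinset ∪ insert k D = (k :: l).toFinset ∪ D := by
        ext x; simp
      rw [this]
  rw [key _ ∅ (Finset.nodup_toList _) (by simp)]
  have : ∀ z a, testCoef θ M z a ((Finset.univ : Finset T).toList.toFinset ∪ ∅) =
      fun t => a * ∏ s, testAmp (θ s) (z ^ (2 * M s)) (t s) := by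
    intro z a
    funext t
    simp [testCoef]
  rw [this, this]

theorem conj_mul_phaseRefl_uvec (Φ : Bits n → ℝ) (y : Fin n ⊕ Unit → Bool) :
    (starRingEnd ℂ) (phaseRefl Φ (uvec n) y) * phaseRefl Φ (uvec n) y = 1 / 2 ^ (n + 1) := by
  simp only [phaseRefl, uvec, map_mul, conj_unifAmp]
  rw [mul_mul_mul_comm, normSq_signedPhase, one_mul, unifAmp_mul_self, card_system]

theorem sum_const_system (a : ℂ) : ∑ _y : Fin n ⊕ Unit → Bool, a / 2 ^ (n + 1) = a := by
  rw [Finset.sum_const, Finset.card_univ, Fintype.card_fun, card_system, Fintype.card_bool,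
    nsmul_eq_mul]
  push_cast
  field_simp

/-- The eigenvectors for z and its inverse are orthogonal and have the same squared norm 2 - 2c^2.
So the probabilities of the two eigencomponents add without interference. -/
theorem sum_normSq_comb (Φ : Bits n → ℝ) {z : ℂ} (hz : (starRingEnd ℂ) z = z⁻¹)
    (h : z + z⁻¹ = 2 * (meanCos Φ : ℂ)) (hz0 : z ≠ 0) (a b : ℂ) :
    ∑ y, ‖(a • walkVec Φ z + b • walkVec Φ z⁻¹) y‖ ^ 2 =
      (2 - 2 * meanCos Φ ^ 2) * (‖a‖ ^ 2 + ‖b‖ ^ 2) := by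
  have hs := sum_amp_mul_phaseRefl Φ
  have hs' : ∑ y, unifAmp (Fin n ⊕ Unit) * (starRingEnd ℂ) (phaseRefl Φ (uvec n) y) = meanCos Φ := by
    have := congrArg (starRingEnd ℂ) hs
    rw [map_sum] at this
    simpa [map_mul, conj_unifAmp, Complex.conj_ofReal] using this
  have hw := conj_mul_phaseRefl_uvec Φ
  have hu := unifAmp_mul_self (S := Fin n ⊕ Unit)
  rw [card_system] at hu
  have hc := conj_unifAmp (S := Fin n ⊕ Unit)
  apply Complex.ofReal_injective
  push_cast
  simp only [← Complex.conj_mul']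
  have hzi : (starRingEnd ℂ) z⁻¹ = z := by rw [map_inv₀, hz, inv_inv]
  simp only [walkVec, uvec, Pi.add_apply, Pi.smul_apply, smul_eq_mul, map_add, map_mul, map_neg,
    hc, hzi, hz, inv_inv, one_mul]
  set c : ℂ := (meanCos Φ : ℂ)
  set a' := (starRingEnd ℂ) a
  set b' := (starRingEnd ℂ) b
  have hterm : ∀ y, (a' * ((starRingEnd ℂ) (phaseRefl Φ (uvec n) y) +
        -z * unifAmp (Fin n ⊕ Unit)) +
      b' * ((starRingEnd ℂ) (phaseRefl Φ (uvec n) y) +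
        -z⁻¹ * unifAmp (Fin n ⊕ Unit))) *
      (a * (phaseRefl Φ (uvec n) y + -z⁻¹ * unifAmp (Fin n ⊕ Unit)) +
      b * (phaseRefl Φ (uvec n) y + -z * unifAmp (Fin n ⊕ Unit))) =
      ((a' + b') * (a + b) + (a' * z + b' * z⁻¹) * (a * z⁻¹ + b * z)) / 2 ^ (n + 1)
      - (a' + b') * (a * z⁻¹ + b * z) *
        (unifAmp (Fin n ⊕ Unit) * (starRingEnd ℂ) (phaseRefl Φ (uvec n) y))
      - (a' * z + b' * z⁻¹) * (a + b) * (unifAmp (Fin n ⊕ Unit) * phaseRefl Φ (uvec n) y) := by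
    intro y
    have hwy := hw y
    generalize phaseRefl Φ (uvec n) y = p at *
    generalize unifAmp (Fin n ⊕ Unit) = σ at *
    generalize (starRingEnd ℂ) p = p' at *
    have : ((a' + b') * (a + b) + (a' * z + b' * z⁻¹) * (a * z⁻¹ + b * z)) / 2 ^ (n + 1) =
      (a' + b') * (a + b) * (1 / 2 ^ (n + 1)) +
        (a' * z + b' * z⁻¹) * (a * z⁻¹ + b * z) * (1 / 2 ^ (n + 1)) := by ring
    rw [this]
    linear_combination (a' + b') * (a + b) * hwy + (a' * z + b' * z⁻¹) * (a * z⁻¹ + b * z) * hu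
  rw [Finset.sum_congr rfl fun y _ => hterm y, Finset.sum_sub_distrib, Finset.sum_sub_distrib,
    ← Finset.mul_sum _ _ ((a' + b') * (a * z⁻¹ + b * z)),
    ← Finset.mul_sum _ _ ((a' * z + b' * z⁻¹) * (a + b)), hs, hs', sum_const_system]
  have hzz : z * z⁻¹ = 1 := mul_inv_cancel₀ hz0
  have hc' : c = (z + z⁻¹) / 2 := by rw [h]; ring
  rw [hc']
  generalize z⁻¹ = w at *
  linear_combination (a' * a + b' * b) * hzz + (- a' * b - a * b') * hzz

end Tests

end QuantumAlg

namespace QuantumAlg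

/-! ### The distribution of the test results -/

section Assembly

variable {d n v : ℕ} {T : Type} [Fintype T] [DecidableEq T]
  {point : Bits n → (Fin d → ℝ)} {code : ℝ → Bits v} {decode : (T → Bool) → ℝ}

/-- The angle coded by the bits `x`. -/
def bitAngle (θ : Fin v → ℝ) (x : Bits v) : ℝ := ∑ j, if x j then θ j else 0

theorem hadList_foldl_state (l : List (Fin n ⊕ Unit)) (φ : (T → Bool) → (Fin n ⊕ Unit → Bool) → ℂ) :
    l.foldl (fun φ k t => sysOp k hadMatrix (φ t)) φ = fun t => hadList l (φ t) := by
  induction l generalizing φ with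
  | nil => rfl
  | cons k l ih => rw [List.foldl_cons, ih]; rfl

theorem realizes_hadList (l : List (Fin n ⊕ Unit)) :
    (layout T n v point code decode).Realizes embed
      (fun _ φ t => hadList l (φ t)) 0 l.length := by
  refine ((Realizes.foldl (fun k => realizes_sysOp k ⟨hadMatrix, hadMatrix_mem⟩) l).mono
    (by simp) (by simp)).congr fun g φ => ?_
  exact hadList_foldl_state l φ

/-- Only the sign off the zero state needs the control: when the test bit is zero, the surrounding
Hadamard layers cancel. The value phase followed by a not gate on the sign qubit is `phaseRefl`. -/
theorem realizes_walkStep (θ : Fin v → ℝ) (l : T) :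
    (layout T n v point code decode).Realizes embed
      (fun g => walkStep (fun x => bitAngle θ (code (g (point x)))) l) 2
      (42 * (n + 1) + 4 * v + 3) := by
  have hlen : (Finset.univ : Finset (Fin n ⊕ Unit)).toList.length = n + 1 := by simp
  refine (((((realizes_hadList (Finset.univ : Finset (Fin n ⊕ Unit)).toList.reverse).comp
    (realizes_zeroSign l)).comp (realizes_hadList (Finset.univ : Finset (Fin n ⊕ Unit)).toList)).comp
    (realizes_valuePhase θ)).comp (realizes_sysOp (.inr ()) ⟨notMatrix, notMatrix_mem⟩)).mono
    (by omega) (by rw [List.length_reverse, hlen]; omega) |>.congr fun g φ => ?_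
  funext t y
  simp only [sysOp, notMatrix, Fintype.sum_bool, walkStep, phaseRefl]
  have hflip : ∀ h : (Fin n ⊕ Unit → Bool) → ℂ, ((if y (.inr ()) = true then 0 else 1) *
      h (Function.update y (.inr ()) true) + (if y (.inr ()) = false then 0 else 1) *
      h (Function.update y (.inr ()) false)) = h (flipSign y) := by
    intro h
    rw [flipSign]
    cases y (.inr ()) <;> simp
  rw [hflip fun y => Complex.exp (((if y (.inr ()) then -1 else 1 : ℝ) *
        ∑ j, if code (g (point fun i => y (.inl i))) j then θ j else 0 : ℝ) * Complex.I) *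
        hadList (Finset.univ : Finset (Fin n ⊕ Unit)).toList
          (fun y => zeroSign l t y *
            hadList (Finset.univ : Finset (Fin n ⊕ Unit)).toList.reverse (φ t) y) y]
  congr 1
  cases ht : t l
  · simp [zeroSign, ht, sgn, hadList_hadList_reverse]
  · simp only [zeroSign, ht, Bool.true_and, if_true, ← hadList_zeroRefl]

theorem realizes_testRound (θ : Fin v → ℝ) (l : T) (θ' : ℝ) (M : ℕ) :
    (layout T n v point code decode).Realizes embed
      (fun g => testRound (fun x => bitAngle θ (code (g (point x)))) l θ' M) (4 * M)
      (2 * M * (42 * (n + 1) + 4 * v + 3) + 3) := by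
  refine (((((realizes_testOp l ⟨hadMatrix, hadMatrix_mem⟩).comp
    (realizes_testOp l ⟨phaseMatrix θ', phaseMatrix_mem θ'⟩)).comp
    (((realizes_walkStep θ l).comp (realizes_walkStep θ l)).iterate M)).comp
    (realizes_testOp l ⟨hadMatrix, hadMatrix_mem⟩))).mono (by ring_nf; omega) (by ring_nf; omega)
    |>.congr fun g φ => rfl

theorem sum_embed (h : (T → Bool) → ℂ → ℝ) (h0 : ∀ t, h t 0 = 0)
    (φ : (T → Bool) → (Fin n ⊕ Unit → Bool) → ℂ) :
    ∑ b : Bits (Fintype.card (QType T n v)), h (fun t => b (qEquiv T n v (.inl t))) (embed φ b) =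
      ∑ t, ∑ y, h t (φ t y) := by
  rw [← ((qEquiv T n v).arrowCongr (Equiv.refl Bool)).sum_comp,
    ← (Equiv.sumArrowEquivProdArrow T _ Bool).symm.sum_comp, Fintype.sum_prod_type]
  refine Finset.sum_congr rfl fun t _ => ?_
  rw [← (Equiv.sumArrowEquivProdArrow _ _ Bool).symm.sum_comp, Fintype.sum_prod_type]
  refine Finset.sum_congr rfl fun y _ => ?_
  rw [Finset.sum_eq_single (fun _ => false)]
  · simp [embed]
  · intro a _ ha
    have : ¬ ∀ x, a x = false := fun h => ha (funext h)
    simp only [embed, Equiv.arrowCongr_apply, Equiv.coe_refl, Function.comp_apply, id_eq,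
      Equiv.symm_apply_apply, Equiv.sumArrowEquivProdArrow_symm_apply_inr,
      Equiv.sumArrowEquivProdArrow_symm_apply_inl, if_neg this, h0]
  · simp

/-- Subtracting the eigenvectors v - u/z and v - zu leaves (z - 1/z)u, so the uniform start vector
has coefficients of equal modulus on both eigenvectors. -/
theorem comb_init (Φ : Bits n → ℝ) {z : ℂ} (hz : z - z⁻¹ ≠ 0) (θ : T → ℝ) (M : T → ℕ) :
    (fun t : T → Bool => (if t = fun _ => false then (1 : ℂ) else 0) • uvec n) =
      comb Φ z (testCoef θ M z (z - z⁻¹)⁻¹ ∅) (testCoef θ M z⁻¹ (-(z - z⁻¹)⁻¹) ∅) := by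
  have hF : ∀ z a, ∀ t, testCoef θ M z a ∅ t = a * if t = fun _ => false then (1 : ℂ) else 0 := by
    intro z a t
    simp only [testCoef, Finset.notMem_empty, if_false]
    congr 1
    split_ifs with h
    · subst h; simp
    · obtain ⟨s, hs⟩ := Function.ne_iff.1 h
      exact Finset.prod_eq_zero (Finset.mem_univ s) (by simpa using hs)
  funext t y
  simp only [comb, hF, walkVec, Pi.add_apply, Pi.smul_apply, smul_eq_mul, inv_inv]
  split_ifs
  · have ha : (z - z⁻¹)⁻¹ * (z - z⁻¹) = 1 := inv_mul_cancel₀ hz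
    linear_combination (-uvec n y) * ha
  · simp

theorem final_layout (l : List (Step (layout T n v point code decode).qubits))
    (g : (Fin d → ℝ) → ℝ) :
    QuantumAlg.final { layout T n v point code decode with steps := l } g =
      (layout T n v point code decode).exec g l
        (Pi.single (fun _ => false) 1 : Bits (Fintype.card (QType T n v)) → ℂ) := by
  have : ∀ (ψ : Bits (Fintype.card (QType T n v)) → ℂ) (s : Step (layout (d := d) T n v point code decode).qubits),
      QuantumAlg.stepAct { layout T n v point code decode with steps := l } g s ψ =
      (layout T n v point code decode).stepAct g s ψ := by
    intro ψ s
    cases s <;> rfl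
  exact congrArg (fun F => List.foldl F _ l) (funext fun ψ => funext fun s => this ψ s)

/-- The mean estimation algorithm: the distribution of the test results. -/
theorem exists_test_algorithm (point : Bits n → (Fin d → ℝ)) (code : ℝ → Bits v)
    (decode : (T → Bool) → ℝ) (θ : Fin v → ℝ) (θ' : T → ℝ) (M : T → ℕ) (N : ℕ) (hM : ∀ s, M s ≤ N) :
    ∃ A : QuantumAlg d, A.qubits = Fintype.card T + 2 * (n + 1) + v ∧
      A.queries ≤ Fintype.card T * (4 * N) ∧
      A.ops ≤ (n + 1) + Fintype.card T * (2 * N * (42 * (n + 1) + 4 * v + 3) + 3) ∧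
      ∀ (g : (Fin d → ℝ) → ℝ) (ϑ : ℝ),
        meanCos (fun x => bitAngle θ (code (g (point x)))) = Real.cos ϑ → Real.sin ϑ ≠ 0 →
        ∀ S : Set ℝ, A.prob g S = open Classical in ∑ t, if decode t ∈ S then
          (1 / 2) * (∏ s, ‖testAmp (θ' s) (Complex.exp (ϑ * Complex.I) ^ (2 * M s)) (t s)‖ ^ 2 +
            ∏ s, ‖testAmp (θ' s) (Complex.exp (-ϑ * Complex.I) ^ (2 * M s)) (t s)‖ ^ 2) else 0 := by
  classical
  have hR := (realizes_hadList (T := T) (point := point) (code := code) (decode := decode)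
    (Finset.univ : Finset (Fin n ⊕ Unit)).toList).comp
    (Realizes.foldl (fun l => (realizes_testRound (point := point) (code := code) (decode := decode)
      θ l (θ' l) (M l)).mono (Nat.mul_le_mul_left 4 (hM l))
      (Nat.add_le_add_right (Nat.mul_le_mul_right _ (Nat.mul_le_mul_left 2 (hM l))) 3))
      (Finset.univ : Finset T).toList)
  obtain ⟨l, h1, h2, h3⟩ := hR
  refine ⟨{ layout T n v point code decode with steps := l }, ?_, ?_, ?_, ?_⟩
  · simp [layout]; ring
  · refine (le_of_eq ?_).trans (h1.trans (by simp))
    simp only [queries]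
    congr 1
    funext s
    cases s <;> rfl
  · refine (le_of_eq ?_).trans (h2.trans (by simp))
    simp only [ops]
    congr 1
    funext s
    cases s <;> rfl
  · intro g ϑ hc hs S
    set Φ := fun x => bitAngle θ (code (g (point x))) with hΦ
    set z := Complex.exp (ϑ * Complex.I) with hzdef
    have hzi : z⁻¹ = Complex.exp (-ϑ * Complex.I) := by
      rw [hzdef, ← Complex.exp_neg]; ring_nf
    have hz0 : z ≠ 0 := Complex.exp_ne_zero _
    have hzc : (starRingEnd ℂ) z = z⁻¹ := by
      rw [hzi, hzdef, ← Complex.exp_conj]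
      simp
    have hsum : z + z⁻¹ = 2 * (meanCos Φ : ℂ) := by
      rw [hc, hzi, Complex.ofReal_cos, Complex.cos]
      ring
    have hdiff : z - z⁻¹ = 2 * Complex.I * (Real.sin ϑ : ℂ) := by
      rw [hzi, Complex.ofReal_sin, Complex.sin]
      have := Complex.I_mul_I
      linear_combination (Complex.exp (ϑ * Complex.I) - Complex.exp (-ϑ * Complex.I)) * this
    have hne : z - z⁻¹ ≠ 0 := by
      rw [hdiff]
      exact mul_ne_zero (mul_ne_zero two_ne_zero Complex.I_ne_zero) (by exact_mod_cast hs)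
    have hfinal : QuantumAlg.final { layout T n v point code decode with steps := l } g =
        embed (comb Φ z (fun t => (z - z⁻¹)⁻¹ * ∏ s, testAmp (θ' s) (z ^ (2 * M s)) (t s))
          (fun t => (-(z - z⁻¹)⁻¹) * ∏ s, testAmp (θ' s) (z⁻¹ ^ (2 * M s)) (t s))) := by
      rw [← foldl_testRound Φ hz0 hsum θ' M, ← comb_init Φ hne θ' M]
      have h0 : (Pi.single (fun _ => false) 1 : Bits (Fintype.card (QType T n v)) → ℂ) =
          embed (fun t y => if t = (fun _ => false) then
            (Pi.single (fun _ => false) 1 : (Fin n ⊕ Unit → Bool) → ℂ) y else 0) := by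
        funext b
        have hb : b = (fun _ => false) ↔ (∀ a, b (qEquiv T n v (.inr (.inr a))) = false) ∧
            (fun t => b (qEquiv T n v (.inl t))) = (fun _ => false) ∧
            (fun s => b (qEquiv T n v (.inr (.inl s)))) = fun _ => false := by
          constructor
          · rintro rfl; simp
          · rintro ⟨ha, ht, hs⟩
            funext x
            obtain ⟨x, rfl⟩ := (qEquiv T n v).surjective x
            rcases x with t | s | a
            · exact congrFun ht t
            · exact congrFun hs s
            · exact ha a
        simp only [embed, Pi.single_apply, hb]
        split_ifs <;> simp_all
      have h4 := h3 g (fun t y => if t = (fun _ => false) then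
            (Pi.single (fun _ => false) 1 : (Fin n ⊕ Unit → Bool) → ℂ) y else 0)
      rw [← h0] at h4
      refine (final_layout l g).trans (h4.trans ?_)
      refine congrArg (fun φ => embed (List.foldl (fun φ l => testRound Φ l (θ' l) (M l) φ) φ
        (Finset.univ : Finset T).toList)) (funext fun t => ?_)
      by_cases ht : t = fun _ => false
      · simp only [if_pos ht, one_smul]; exact hadList_univ_single
      · simp only [if_neg ht, zero_smul]
        have := hadList_smul (Finset.univ : Finset (Fin n ⊕ Unit)).toList 0 0
        rw [zero_smul, zero_smul] at this
        exact this
    have hprob : QuantumAlg.prob { layout T n v point code decode with steps := l } g S =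
        ∑ b : Bits (Fintype.card (QType T n v)), (fun t (a : ℂ) => if decode t ∈ S then ‖a‖ ^ 2 else 0)
          (fun t => b (qEquiv T n v (.inl t)))
          (QuantumAlg.final { layout T n v point code decode with steps := l } g b) := rfl
    rw [hprob, hfinal]
    refine (sum_embed (fun t (a : ℂ) => if decode t ∈ S then ‖a‖ ^ 2 else 0) (by simp) _).trans ?_
    refine Finset.sum_congr rfl fun t _ => ?_
    split_ifs with ht
    · simp only [comb]
      rw [sum_normSq_comb Φ hzc hsum hz0, norm_mul, norm_mul, norm_neg, norm_inv, hdiff, hc, ← hzi,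
        norm_prod, norm_prod, Finset.prod_pow, Finset.prod_pow]
      -- Each coefficient has squared modulus 1/(4 sin^2 ϑ) and each eigenvector has squared norm 2
      -- sin^2 ϑ. The two eigenvalues thus get weight 1/2 each.
      have h5 : ‖2 * Complex.I * (Real.sin ϑ : ℂ)‖ ^ 2 = 4 * Real.sin ϑ ^ 2 := by
        rw [norm_mul, norm_mul, Complex.norm_I, Complex.norm_real, mul_pow, mul_pow, Real.norm_eq_abs,
          sq_abs]
        norm_num
      have h6 : 2 - 2 * Real.cos ϑ ^ 2 = 2 * Real.sin ϑ ^ 2 := by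
        rw [Real.sin_sq]; ring
      rw [mul_pow, mul_pow, inv_pow, h5, h6]
      field_simp
      ring
    · simp

end Assembly

end QuantumAlg

/-! ### Concentration of the test frequencies -/

section Concentration

variable {T : Type*} [Fintype T] [DecidableEq T]

theorem sum_prod_bool (f : T → Bool → ℝ) : ∑ t : T → Bool, ∏ s, f s (t s) = ∏ s, ∑ b, f s b := by
  rw [Finset.prod_univ_sum, Fintype.piFinset_univ]

/-- The second moment of a centered sum of independent bits. -/
theorem sum_weight_mul_sq_le (w : T → Bool → ℝ)
    (hw1 : ∀ s, w s true + w s false = 1) (G : Finset T) :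
    ∑ t : T → Bool, (∏ s, w s (t s)) *
      (∑ s ∈ G, ((if t s then 1 else 0) - w s true)) ^ 2 ≤ G.card / 4 := by
  set x : T → Bool → ℝ := fun s b => (if b then 1 else 0) - w s true with hx
  have h0 : ∀ s, ∑ b, w s b * x s b = 0 := fun s => by
    simp only [Fintype.sum_bool, hx, if_true, Bool.false_eq_true, if_false]
    linear_combination (-w s true) * hw1 s
  have h2 : ∀ s, ∑ b, w s b * x s b ^ 2 ≤ 1 / 4 := fun s => by
    simp only [Fintype.sum_bool, hx, if_true, Bool.false_eq_true, if_false]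
    have : w s false = 1 - w s true := by linarith [hw1 s]
    rw [this]
    nlinarith [sq_nonneg (w s true - 1 / 2)]
  have h1 : ∀ s, ∑ b, w s b = 1 := fun s => by rw [Fintype.sum_bool]; exact hw1 s
  have key : ∀ s s', ∑ t : T → Bool, (∏ r, w r (t r)) * (x s (t s) * x s' (t s')) ≤
      if s = s' then 1 / 4 else 0 := by
    intro s s'
    have hfac : ∀ t : T → Bool, (∏ r, w r (t r)) * (x s (t s) * x s' (t s')) =
        ∏ r, (w r (t r) * ((if r = s then x s (t r) else 1) * if r = s' then x s' (t r) else 1)) := by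
      intro t
      rw [Finset.prod_mul_distrib, Finset.prod_mul_distrib]
      simp
    rw [Finset.sum_congr rfl fun t _ => hfac t,
      sum_prod_bool fun r b => w r b * ((if r = s then x s b else 1) * if r = s' then x s' b else 1)]
    split_ifs with hs
    · subst hs
      rw [← Finset.mul_prod_erase _ _ (Finset.mem_univ s), Finset.prod_eq_one]
      · simp only [if_true, mul_one]
        calc _ = ∑ b, w s b * x s b ^ 2 := by simp only [sq]
          _ ≤ _ := h2 s
      · intro r hr
        simp [Finset.ne_of_mem_erase hr]
        simpa using h1 r
    · refine (Finset.prod_eq_zero (Finset.mem_univ s) ?_).le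
      simpa [hs] using h0 s
  calc ∑ t : T → Bool, (∏ s, w s (t s)) * (∑ s ∈ G, ((if t s then 1 else 0) - w s true)) ^ 2
      = ∑ s ∈ G, ∑ s' ∈ G, ∑ t : T → Bool, (∏ r, w r (t r)) * (x s (t s) * x s' (t s')) := by
        have : ∀ t : T → Bool, (∏ s, w s (t s)) *
            (∑ s ∈ G, ((if t s then 1 else 0) - w s true)) ^ 2 =
            ∑ s ∈ G, ∑ s' ∈ G, (∏ r, w r (t r)) * (x s (t s) * x s' (t s')) := by
          intro t
          rw [sq, Finset.sum_mul_sum, Finset.mul_sum]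
          exact Finset.sum_congr rfl fun s _ => by rw [Finset.mul_sum]
        rw [Finset.sum_congr rfl fun t _ => this t, Finset.sum_comm]
        refine Finset.sum_congr rfl fun s _ => ?_
        rw [Finset.sum_comm]
    _ ≤ ∑ s ∈ G, ∑ s' ∈ G, if s = s' then (1 / 4 : ℝ) else 0 :=
        Finset.sum_le_sum fun s _ => Finset.sum_le_sum fun s' _ => key s s'
    _ = G.card / 4 := by
        simp only [Finset.sum_ite_eq]
        rw [Finset.sum_congr rfl fun s hs => if_pos hs, Finset.sum_const, nsmul_eq_mul]
        ring

/-- Chebyshev's inequality for a family of groups of independent bits. -/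
theorem sum_weight_good_ge {ι R : Type*} [Fintype ι] [DecidableEq ι] [Fintype R] [DecidableEq R]
    [Nonempty R] (w : ι → Bool → ℝ) (hw : ∀ s b, 0 ≤ w s b) (hw1 : ∀ s, w s true + w s false = 1)
    {η : ℝ} (hη : 0 < η) (good : Set (ι × R → Bool)) [DecidablePred (· ∈ good)]
    (hgood : ∀ t, (∀ i, |(∑ r, if t (i, r) then (1 : ℝ) else 0) - Fintype.card R * w i true| ≤
      η * Fintype.card R) → t ∈ good) :
    1 - Fintype.card ι / (4 * η ^ 2 * Fintype.card R) ≤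
      ∑ t : ι × R → Bool, if t ∈ good then ∏ s, w s.1 (t s) else 0 := by
  have hR : (0 : ℝ) < Fintype.card R := by exact_mod_cast Fintype.card_pos
  have htot : ∑ t : ι × R → Bool, ∏ s, w s.1 (t s) = 1 := by
    rw [sum_prod_bool fun (s : ι × R) b => w s.1 b]
    refine Finset.prod_eq_one fun s _ => ?_
    rw [Fintype.sum_bool]
    exact hw1 _
  set dev : ι → (ι × R → Bool) → ℝ := fun i t =>
    (∑ r, if t (i, r) then (1 : ℝ) else 0) - Fintype.card R * w i true with hdev
  have hvar : ∀ i, ∑ t : ι × R → Bool, (∏ s, w s.1 (t s)) * dev i t ^ 2 ≤ Fintype.card R / 4 := by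
    intro i
    have h := sum_weight_mul_sq_le (fun s : ι × R => w s.1) (fun s => hw1 s.1)
      (Finset.univ.map ⟨fun r : R => (i, r), fun a b h => by simpa using h⟩)
    rw [Finset.card_map, Finset.card_univ] at h
    refine le_trans (le_of_eq ?_) h
    refine Finset.sum_congr rfl fun t _ => ?_
    congr 2
    rw [Finset.sum_map]
    change _ = ∑ r : R, ((if t (i, r) then (1 : ℝ) else 0) - w i true)
    rw [Finset.sum_sub_distrib]
    simp [hdev]
  -- Chebyshev and union bound at once: outside the good set some group has a normalized squared
  -- deviation of at least 1, so the left side is not positive there.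
  have hpt : ∀ t : ι × R → Bool, (∏ s, w s.1 (t s)) - ∑ i, (∏ s, w s.1 (t s)) * dev i t ^ 2 /
      (η * Fintype.card R) ^ 2 ≤ if t ∈ good then ∏ s, w s.1 (t s) else 0 := by
    intro t
    have hp : 0 ≤ ∏ s, w s.1 (t s) := Finset.prod_nonneg fun s _ => hw _ _
    split_ifs with ht
    · have : 0 ≤ ∑ i, (∏ s, w s.1 (t s)) * dev i t ^ 2 / (η * Fintype.card R) ^ 2 :=
        Finset.sum_nonneg fun i _ => by positivity
      linarith
    · have : ∃ i, ¬ |dev i t| ≤ η * Fintype.card R := by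
        by_contra! h
        exact ht (hgood t h)
      obtain ⟨i, hi⟩ := this
      push Not at hi
      have h1 : (∏ s, w s.1 (t s)) ≤ (∏ s, w s.1 (t s)) * dev i t ^ 2 / (η * Fintype.card R) ^ 2 := by
        rw [mul_div_assoc]
        refine le_mul_of_one_le_right hp ?_
        rw [one_le_div (by positivity), ← sq_abs (dev i t)]
        exact pow_le_pow_left₀ (by positivity) hi.le 2
      have h2 := Finset.single_le_sum (f := fun i => (∏ s, w s.1 (t s)) * dev i t ^ 2 /
        (η * Fintype.card R) ^ 2) (fun i _ => by positivity) (Finset.mem_univ i)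
      linarith
  refine le_trans ?_ (Finset.sum_le_sum fun t _ => hpt t)
  rw [Finset.sum_sub_distrib, htot, Finset.sum_comm]
  have : ∑ i, ∑ t : ι × R → Bool, (∏ s, w s.1 (t s)) * dev i t ^ 2 / (η * Fintype.card R) ^ 2 ≤
      ∑ i : ι, 1 / (4 * η ^ 2 * Fintype.card R) := by
    refine Finset.sum_le_sum fun i _ => ?_
    rw [← Finset.sum_div, div_le_iff₀ (by positivity)]
    refine (hvar i).trans (le_of_eq ?_)
    field_simp
  rw [Finset.sum_const, Finset.card_univ, nsmul_eq_mul] at this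
  have e : (Fintype.card ι : ℝ) * (1 / (4 * η ^ 2 * Fintype.card R)) =
    Fintype.card ι / (4 * η ^ 2 * Fintype.card R) := by ring
  linarith

end Concentration

/-! ### Decoding the angle, coding the values, and the mean estimation algorithm -/

/-- An angle is small if the sines of its multiples by powers of three are. -/
theorem abs_mul_le_of_sin {J : ℕ} {δ : ℝ} (hδ : |δ| ≤ 2 * Real.pi / 3)
    (h : ∀ j ≤ J, |Real.sin (3 ^ j * δ)| ≤ 1 / 10) : 3 ^ J * |δ| ≤ 1 / 2 := by
  have hpi := Real.pi_gt_three
  have hpi' := Real.pi_le_four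
  have hpi'' := Real.pi_lt_d2
  have hsin : ∀ x : ℝ, 0 ≤ x → |Real.sin x| ≤ 1 / 10 → x ≤ Real.pi / 2 → x ≤ 1 / 2 := by
    intro x hx hs hx'
    have h1 := Real.mul_le_sin hx hx'
    have h2 := (le_abs_self _).trans hs
    have h3 : 2 / Real.pi * x ≤ 1 / 10 := h1.trans h2
    rw [div_mul_eq_mul_div, div_le_iff₀ Real.pi_pos] at h3
    linarith
  have habs : ∀ j, |Real.sin (3 ^ j * |δ|)| = |Real.sin (3 ^ j * δ)| := by
    intro j
    rcases abs_choice δ with h | h <;> rw [h]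
    rw [mul_neg, Real.sin_neg, abs_neg]
  induction J with
  | zero =>
    have h0 := h 0 le_rfl
    rw [← habs] at h0
    simp only [pow_zero, one_mul] at h0 ⊢
    by_cases hle : |δ| ≤ Real.pi / 2
    · exact hsin _ (abs_nonneg _) h0 hle
    · exfalso
      push Not at hle
      -- Between π/2 and 2π/3 the sine is at least √3/2, so a small sine excludes this range. The
      -- bound 2π/3 is the largest difference of two angles in [-π/3, π/3].
      have h1 : Real.cos (Real.pi / 6) ≤ Real.cos (|δ| - Real.pi / 2) :=
        Real.cos_le_cos_of_nonneg_of_le_pi (by linarith) (by linarith) (by linarith)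
      rw [Real.cos_sub_pi_div_two, Real.cos_pi_div_six] at h1
      have h2 := (le_abs_self _).trans h0
      have h3 : (1 : ℝ) ≤ √3 := by rw [Real.one_le_sqrt]; norm_num
      linarith
  -- An angle of at most 1/2 becomes at most 3/2 < π/2 after multiplication by 3. In that range a
  -- small sine means a small angle, which restores the bound 1/2.
  | succ J ih =>
    have h1 := ih fun j hj => h j (by omega)
    have h2 := h (J + 1) le_rfl
    rw [← habs] at h2
    refine hsin _ (by positivity) h2 ?_
    rw [pow_succ]
    nlinarith

theorem exists_bits (v N : ℕ) (hN : N < 2 ^ v) :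
    ∃ x : Bits v, ∑ j, (if x j then (2 : ℝ) ^ (j : ℕ) else 0) = N := by
  induction v generalizing N with
  | zero => exact ⟨fun _ => false, by simp at hN; simp [hN]⟩
  | succ v ih =>
    obtain ⟨x, hx⟩ := ih (N / 2) (by rw [pow_succ] at hN; omega)
    refine ⟨Fin.cons (α := fun _ => Bool) (decide (N % 2 = 1)) x, ?_⟩
    rw [Fin.sum_univ_succ]
    rw [Fin.cons_zero]
    simp only [Fin.cons_succ, Fin.val_succ, decide_eq_true_eq]
    have : ∑ j : Fin v, (if x j then (2 : ℝ) ^ ((j : ℕ) + 1) else 0) = 2 * (N / 2 : ℕ) := by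
      rw [← hx, Finset.mul_sum]
      refine Finset.sum_congr rfl fun j _ => ?_
      split_ifs
      · ring
      · ring
    rw [this]
    have h := Nat.div_add_mod N 2
    rcases Nat.mod_two_eq_zero_or_one N with h' | h'
    · rw [h'] at h ⊢
      rw [← h]; push_cast; simp
    · rw [h'] at h ⊢
      conv_rhs => rw [← h]
      push_cast; simp; ring

/-- Angles in `[0, 2)` can be coded by bits. -/
theorem exists_code (v : ℕ) {φ : ℝ} (h0 : 0 ≤ φ) (h2 : φ < 2) :
    ∃ x : Bits v, QuantumAlg.bitAngle (fun j : Fin v => 2 ^ (j : ℕ) * (2 / 2 ^ v)) x ≤ φ ∧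
      φ - 2 / 2 ^ v ≤ QuantumAlg.bitAngle (fun j : Fin v => 2 ^ (j : ℕ) * (2 / 2 ^ v)) x := by
  have hp : (0 : ℝ) < 2 ^ v := by positivity
  set N := ⌊φ * 2 ^ v / 2⌋₊
  have hN : (N : ℝ) ≤ φ * 2 ^ v / 2 := Nat.floor_le (by positivity)
  have hN' : φ * 2 ^ v / 2 < N + 1 := Nat.lt_floor_add_one _
  obtain ⟨x, hx⟩ := exists_bits v N (by
    have : (N : ℝ) < 2 ^ v := by nlinarith
    exact_mod_cast this)
  have : QuantumAlg.bitAngle (fun j : Fin v => 2 ^ (j : ℕ) * (2 / 2 ^ v)) x = N * (2 / 2 ^ v) := by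
    rw [QuantumAlg.bitAngle, ← hx, Finset.sum_mul]
    refine Finset.sum_congr rfl fun j _ => ?_
    split_ifs <;> simp
  refine ⟨x, ?_, ?_⟩
  · rw [this, mul_div_assoc', div_le_iff₀ hp]
    linarith
  · rw [this, mul_div_assoc', sub_le_iff_le_add, ← add_div, le_div_iff₀ hp]
    linarith

/-- The probability of the outcome `b` of a test of the phase `β`. -/
def testProb (β : ℝ) (b : Bool) : ℝ := (1 + (if b then -1 else 1) * Real.cos β) / 2

theorem testProb_nonneg (β : ℝ) (b : Bool) : 0 ≤ testProb β b := by
  have h1 := Real.neg_one_le_cos β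
  have h2 := Real.cos_le_one β
  cases b <;> simp [testProb] <;> linarith

theorem testProb_add (β : ℝ) : testProb β true + testProb β false = 1 := by
  simp [testProb]; ring

theorem normSq_testAmp (θ α : ℝ) (b : Bool) (N : ℕ) :
    ‖QuantumAlg.testAmp θ (Complex.exp (α * Complex.I) ^ N) b‖ ^ 2 = testProb (θ + N * α) b := by
  have h : Complex.exp (θ * Complex.I) * Complex.exp (α * Complex.I) ^ N =
      Complex.exp (((θ + N * α : ℝ) : ℂ) * Complex.I) := by
    rw [← Complex.exp_nat_mul, ← Complex.exp_add]
    push_cast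
    ring_nf
  rw [QuantumAlg.testAmp, h, Complex.exp_mul_I, ← Complex.ofReal_cos, ← Complex.ofReal_sin]
  set x := θ + N * α
  have hsc := Real.sin_sq_add_cos_sq x
  rw [← Complex.normSq_eq_norm_sq, Complex.normSq_apply]
  rw [testProb]
  generalize Real.cos x = C at *
  generalize Real.sin x = D at *
  cases b <;> simp [QuantumAlg.sgn] <;> linear_combination hsc / 4

/-- The phases of the tests. -/
def testPhase (J : ℕ) (ϑ : ℝ) (i : Fin (J + 1) × Bool) : ℝ :=
  (if i.2 then -(Real.pi / 2) else 0) + (2 * 3 ^ (i.1 : ℕ) : ℕ) * ϑ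

/-- The tests with phases 0 and -π/2 determine cosine and sine of 2·3^j ϑ to 1/8 each. The squared
chord between two such points is 4 sin^2 of half the angle, and the half angle is exactly 3^j(ϑ' -
ϑ), so its sine is at most 1/10. -/
theorem angle_close {J : ℕ} {ϑ ϑ' : ℝ} (h : |ϑ' - ϑ| ≤ 2 * Real.pi / 3)
    (hp : ∀ i, |testProb (testPhase J ϑ' i) true - testProb (testPhase J ϑ i) true| ≤ 1 / 16) :
    3 ^ J * |ϑ' - ϑ| ≤ 1 / 2 := by
  refine abs_mul_le_of_sin h fun j hj => ?_
  have h1 := hp (⟨j, by omega⟩, false)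
  have h2 := hp (⟨j, by omega⟩, true)
  simp only [testProb, testPhase, if_true, Bool.false_eq_true, if_false, zero_add,
    neg_add_eq_sub, Real.cos_sub_pi_div_two] at h1 h2
  push_cast at h1 h2
  set a := 2 * 3 ^ j * ϑ' with ha
  set b := 2 * 3 ^ j * ϑ with hb
  have e : (3 : ℝ) ^ j * (ϑ' - ϑ) = (a - b) / 2 := by rw [ha, hb]; ring
  have h3 : (Real.cos a - Real.cos b) ^ 2 ≤ (1 / 8) ^ 2 := by
    rw [← sq_abs]
    refine pow_le_pow_left₀ (abs_nonneg _) ?_ 2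
    rw [abs_le] at h1 ⊢
    constructor <;> linarith
  have h4 : (Real.sin a - Real.sin b) ^ 2 ≤ (1 / 8) ^ 2 := by
    rw [← sq_abs]
    refine pow_le_pow_left₀ (abs_nonneg _) ?_ 2
    rw [abs_le] at h2 ⊢
    constructor <;> linarith
  have h5 : 4 * Real.sin ((a - b) / 2) ^ 2 = (Real.cos a - Real.cos b) ^ 2 +
      (Real.sin a - Real.sin b) ^ 2 := by
    have h6 : Real.cos (a - b) = 1 - 2 * Real.sin ((a - b) / 2) ^ 2 := by
      have := Real.cos_two_mul ((a - b) / 2)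
      rw [Real.cos_sq'] at this
      rw [show a - b = 2 * ((a - b) / 2) by ring, this]
      ring_nf
    rw [Real.cos_sub] at h6
    linear_combination 2 * h6 - Real.sin_sq_add_cos_sq a - Real.sin_sq_add_cos_sq b
  rw [e]
  refine abs_le_of_sq_le_sq ?_ (by norm_num)
  nlinarith

/-- This leaves room for rounding: angles with cosine at most 3/4 stay positive when rounded down by
at most 1/2. The mean of the cosines is then below 1, and sin ϑ does not vanish. -/
theorem half_lt_arccos : 1 / 2 < Real.arccos (3 / 4) := by
  by_contra! h
  have h1 : Real.cos (1 / 2) ≤ Real.cos (Real.arccos (3 / 4)) :=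
    Real.cos_le_cos_of_nonneg_of_le_pi (Real.arccos_nonneg _) (by linarith [Real.pi_gt_three]) h
  rw [Real.cos_arccos (by norm_num) (by norm_num)] at h1
  have := Real.one_sub_sq_div_two_le_cos (x := 1 / 2)
  norm_num at this
  linarith

/-- The rounded angles for the values in `[-K, K]`. -/
theorem exists_angle_code (v : ℕ) (hv : 2 ≤ v) {K : ℝ} (hK : 0 < K) :
    ∃ code : ℝ → Bits v, ∀ y, |y| ≤ K →
      Real.cos (QuantumAlg.bitAngle (fun j : Fin v => 2 ^ (j : ℕ) * (2 / 2 ^ v)) (code y)) < 1 ∧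
      1 / 2 ≤ Real.cos (QuantumAlg.bitAngle (fun j : Fin v => 2 ^ (j : ℕ) * (2 / 2 ^ v)) (code y)) ∧
      |8 * K * (Real.cos (QuantumAlg.bitAngle (fun j : Fin v => 2 ^ (j : ℕ) * (2 / 2 ^ v)) (code y))
        - 5 / 8) - y| ≤ 16 * K / 2 ^ v := by
  have hpi := Real.pi_gt_three
  have hpi' := Real.pi_lt_d2
  have h2v : (2 : ℝ) / 2 ^ v ≤ 1 / 2 := by
    rw [div_le_div_iff₀ (by positivity) (by norm_num)]
    have : (2 : ℝ) ^ 2 ≤ 2 ^ v := pow_le_pow_right₀ (by norm_num) hv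
    linarith
  have key : ∀ y, ∃ x : Bits v, |y| ≤ K →
      Real.cos (QuantumAlg.bitAngle (fun j : Fin v => 2 ^ (j : ℕ) * (2 / 2 ^ v)) x) < 1 ∧
      1 / 2 ≤ Real.cos (QuantumAlg.bitAngle (fun j : Fin v => 2 ^ (j : ℕ) * (2 / 2 ^ v)) x) ∧
      |8 * K * (Real.cos (QuantumAlg.bitAngle (fun j : Fin v => 2 ^ (j : ℕ) * (2 / 2 ^ v)) x)
        - 5 / 8) - y| ≤ 16 * K / 2 ^ v := by
    intro y
    by_cases hy : |y| ≤ K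
    swap
    · exact ⟨fun _ => false, fun h => absurd h hy⟩
    -- The values are mapped affinely into [1/2, 3/4]. The upper end keeps the angle away from 0;
    -- the lower end keeps it within π/3, as the decoding requires.
    set a := 5 / 8 + y / (8 * K) with ha
    have hy8 : |y / (8 * K)| ≤ 1 / 8 := by
      rw [abs_div, abs_of_pos (by positivity : 0 < 8 * K), div_le_iff₀ (by positivity)]
      linarith
    rw [abs_le] at hy8
    have ha1 : 1 / 2 ≤ a := by linarith [hy8.1]
    have ha2 : a ≤ 3 / 4 := by linarith [hy8.2]
    set φ := Real.arccos a with hφ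
    have hcos : Real.cos φ = a := Real.cos_arccos (by linarith) (by linarith)
    have hφ1 : 1 / 2 < φ := half_lt_arccos.trans_le (Real.arccos_le_arccos ha2)
    have hφ2 : φ ≤ Real.pi / 3 := by
      have h1 : Real.arccos (1 / 2) = Real.pi / 3 := by
        rw [← Real.cos_pi_div_three, Real.arccos_cos (by positivity) (by linarith)]
      rw [← h1]
      exact Real.arccos_le_arccos ha1
    obtain ⟨x, hx1, hx2⟩ := exists_code v (by linarith : 0 ≤ φ) (by linarith)
    refine ⟨x, fun _ => ?_⟩
    set ψ := QuantumAlg.bitAngle (fun j : Fin v => 2 ^ (j : ℕ) * (2 / 2 ^ v)) x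
    have hψ0 : 0 < ψ := by linarith
    refine ⟨?_, ?_, ?_⟩
    · rw [← Real.cos_zero]
      exact Real.cos_lt_cos_of_nonneg_of_le_pi le_rfl (by linarith) hψ0
    · rw [← Real.cos_pi_div_three]
      exact Real.cos_le_cos_of_nonneg_of_le_pi hψ0.le (by linarith) (by linarith)
    · have h1 : |Real.cos ψ - Real.cos φ| ≤ |ψ - φ| := by
        have := Real.lipschitzWith_cos.dist_le_mul ψ φ
        simpa [Real.dist_eq] using this
      have h2 : |ψ - φ| ≤ 2 / 2 ^ v := by
        rw [abs_le]; constructor <;> linarith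
      have h3 : 8 * K * (Real.cos ψ - 5 / 8) - y = 8 * K * (Real.cos ψ - Real.cos φ) := by
        rw [hcos, ha]; field_simp; ring
      rw [h3, abs_mul, abs_of_pos (by positivity : 0 < 8 * K)]
      calc 8 * K * |Real.cos ψ - Real.cos φ| ≤ 8 * K * (2 / 2 ^ v) := by
            gcongr; exact h1.trans h2
        _ = 16 * K / 2 ^ v := by ring
  choose code hcode using key
  exact ⟨code, hcode⟩

/-- Estimation of the mean of `2 ^ n` function values on a quantum computer. -/
theorem exists_mean_algorithm {d : ℕ} (n v J : ℕ) (hv : 2 ≤ v) {K : ℝ} (hK : 0 < K)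
    (point : Bits n → (Fin d → ℝ)) :
    ∃ A : QuantumAlg d, A.qubits = 4096 * (J + 1) ^ 2 + 2 * (n + 1) + v ∧
      A.queries ≤ 4096 * (J + 1) ^ 2 * (4 * 3 ^ J) ∧
      A.ops ≤ (n + 1) + 4096 * (J + 1) ^ 2 * (2 * 3 ^ J * (42 * (n + 1) + 4 * v + 3) + 3) ∧
      ∀ g : (Fin d → ℝ) → ℝ, (∀ x, |g (point x)| ≤ K) →
        3 / 4 ≤ A.prob g {y | |(∑ x, g (point x)) / 2 ^ n - y| ≤ 4 * K / 3 ^ J + 16 * K / 2 ^ v} := by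
  classical
  obtain ⟨code, hcode⟩ := exists_angle_code v hv hK
  -- There are 2(J+1) groups of tests. Tolerance η = 1/32 gives the failure probability 2(J+1)/(4η^2
  -- R) = 512(J+1)/R = 1/4.
  set R := 2048 * (J + 1) with hR
  have : Nonempty (Fin R) := ⟨⟨0, by omega⟩⟩
  set θ : Fin v → ℝ := fun j => 2 ^ (j : ℕ) * (2 / 2 ^ v) with hθ
  let close : ((Fin (J + 1) × Bool) × Fin R → Bool) → ℝ → Prop := fun t ϑ =>
    |ϑ| ≤ Real.pi / 3 ∧ ∀ i, |(∑ r, if t (i, r) then (1 : ℝ) else 0) -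
      Fintype.card (Fin R) * testProb (testPhase J ϑ i) true| ≤ 1 / 32 * Fintype.card (Fin R)
  -- Any angle consistent with all frequencies will do: two consistent angles are close by
  -- `angle_close`. The output uses only the cosine, so it does not matter whether ϑ or -ϑ is found.
  let decode : ((Fin (J + 1) × Bool) × Fin R → Bool) → ℝ := fun t =>
    if h : ∃ ϑ, close t ϑ then 8 * K * (Real.cos h.choose - 5 / 8) else 0
  obtain ⟨A, hA1, hA2, hA3, hA4⟩ := QuantumAlg.exists_test_algorithm point code decode θ
    (fun s => if s.1.2 then -(Real.pi / 2) else 0) (fun s => 3 ^ (s.1.1 : ℕ)) (3 ^ J)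
    (fun s => Nat.pow_le_pow_right (by norm_num) (by omega))
  have hcard : Fintype.card ((Fin (J + 1) × Bool) × Fin R) = 4096 * (J + 1) ^ 2 := by
    simp [hR]; ring
  rw [hcard] at hA1 hA2 hA3
  refine ⟨A, hA1, hA2, hA3, fun g hg => ?_⟩
  set Φ := fun x => QuantumAlg.bitAngle θ (code (g (point x))) with hΦ
  set c := QuantumAlg.meanCos Φ with hc
  have h2n : (0 : ℝ) < 2 ^ n := by positivity
  have hcardn : (Finset.univ : Finset (Bits n)).card = 2 ^ n := by simp
  have hc1 : c < 1 := by
    rw [hc, QuantumAlg.meanCos, div_lt_one h2n]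
    calc ∑ x, Real.cos (Φ x) < ∑ _x : Bits n, (1 : ℝ) :=
          Finset.sum_lt_sum_of_nonempty ⟨fun _ => false, Finset.mem_univ _⟩
            fun x _ => (hcode _ (hg x)).1
      _ = 2 ^ n := by simp
  have hc2 : 1 / 2 ≤ c := by
    rw [hc, QuantumAlg.meanCos, le_div_iff₀ h2n]
    calc 1 / 2 * 2 ^ n = ∑ _x : Bits n, (1 / 2 : ℝ) := by simp; ring
      _ ≤ _ := Finset.sum_le_sum fun x _ => (hcode _ (hg x)).2.1
  have hmean : |8 * K * (c - 5 / 8) - (∑ x, g (point x)) / 2 ^ n| ≤ 16 * K / 2 ^ v := by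
    have : 8 * K * (c - 5 / 8) - (∑ x, g (point x)) / 2 ^ n =
        (∑ x, (8 * K * (Real.cos (Φ x) - 5 / 8) - g (point x))) / 2 ^ n := by
      rw [Finset.sum_sub_distrib, ← Finset.mul_sum, Finset.sum_sub_distrib, Finset.sum_const,
        hcardn, hc, QuantumAlg.meanCos, nsmul_eq_mul]
      push_cast
      field_simp
    rw [this, abs_div, abs_of_pos h2n, div_le_iff₀ h2n]
    calc _ ≤ ∑ x, |8 * K * (Real.cos (Φ x) - 5 / 8) - g (point x)| := Finset.abs_sum_le_sum_abs _ _
      _ ≤ ∑ _x : Bits n, 16 * K / 2 ^ v := Finset.sum_le_sum fun x _ => (hcode _ (hg x)).2.2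
      _ = _ := by rw [Finset.sum_const, hcardn, nsmul_eq_mul]; push_cast; ring
  set ϑ := Real.arccos c with hϑ
  have hcos : Real.cos ϑ = c := Real.cos_arccos (by linarith) hc1.le
  have hϑ0 : 0 < ϑ := Real.arccos_pos.2 hc1
  have hϑ1 : ϑ ≤ Real.pi / 3 := by
    have h1 : Real.arccos (1 / 2) = Real.pi / 3 := by
      rw [← Real.cos_pi_div_three, Real.arccos_cos (by positivity) (by linarith [Real.pi_pos])]
    rw [← h1]
    exact Real.arccos_le_arccos hc2
  have hsin : Real.sin ϑ ≠ 0 :=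
    (Real.sin_pos_of_pos_of_lt_pi hϑ0 (by linarith [Real.pi_pos])).ne'
  set S : Set ℝ := {y | |(∑ x, g (point x)) / 2 ^ n - y| ≤ 4 * K / 3 ^ J + 16 * K / 2 ^ v} with hS
  -- a consistent set of test results leads to a good output
  have hgood : ∀ σ : ℝ, |σ| ≤ Real.pi / 3 → Real.cos σ = c → ∀ t, close t σ → decode t ∈ S := by
    intro σ hσ hσc t ht
    have hex : ∃ ϑ, close t ϑ := ⟨σ, ht⟩
    have hdec : decode t = 8 * K * (Real.cos hex.choose - 5 / 8) := dif_pos hex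
    set τ := hex.choose with hτ
    have hτc : close t τ := hex.choose_spec
    have hRpos : (0 : ℝ) < Fintype.card (Fin R) := by simp [hR]; positivity
    have hdiff : 3 ^ J * |τ - σ| ≤ 1 / 2 := by
      refine angle_close ?_ fun i => ?_
      · have := abs_sub τ σ
        linarith [hτc.1, hσ]
      · have h1 := hτc.2 i
        have h2 := ht.2 i
        rw [← mul_le_mul_iff_of_pos_left hRpos, ← abs_of_pos hRpos, ← abs_mul, abs_of_pos hRpos]
        rw [abs_le] at h1 h2 ⊢
        constructor <;> linarith
    have hcosd : |Real.cos τ - c| ≤ |τ - σ| := by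
      rw [← hσc]
      have := Real.lipschitzWith_cos.dist_le_mul τ σ
      simpa [Real.dist_eq] using this
    have h3 : |8 * K * (Real.cos τ - 5 / 8) - 8 * K * (c - 5 / 8)| ≤ 4 * K / 3 ^ J := by
      have e : 8 * K * (Real.cos τ - 5 / 8) - 8 * K * (c - 5 / 8) = 8 * K * (Real.cos τ - c) := by
        ring
      rw [e, abs_mul, abs_of_pos (by positivity : 0 < 8 * K), le_div_iff₀ (by positivity)]
      have h4 : |Real.cos τ - c| * 3 ^ J ≤ 1 / 2 := by
        refine le_trans ?_ hdiff
        rw [mul_comm]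
        gcongr
      calc 8 * K * |Real.cos τ - c| * 3 ^ J = 8 * K * (|Real.cos τ - c| * 3 ^ J) := by ring
        _ ≤ 8 * K * (1 / 2) := by gcongr
        _ = 4 * K := by ring
    rw [hS, Set.mem_ofPred_eq, hdec]
    rw [abs_le] at h3 hmean ⊢
    constructor <;> linarith [h3.1, h3.2, hmean.1, hmean.2]
  -- Applied to σ = ϑ and to σ = -ϑ, the angles of the two eigenvalues; their mixture with weights
  -- 1/2 inherits the bound 3/4.
  have hside : ∀ σ : ℝ, |σ| ≤ Real.pi / 3 → Real.cos σ = c →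
      3 / 4 ≤ ∑ t : (Fin (J + 1) × Bool) × Fin R → Bool, if decode t ∈ S then
        ∏ s, testProb (testPhase J σ s.1) (t s) else 0 := by
    intro σ hσ hσc
    have h := sum_weight_good_ge (R := Fin R) (fun i => testProb (testPhase J σ i))
      (fun i => testProb_nonneg _) (fun i => testProb_add _) (by norm_num : (0 : ℝ) < 1 / 32)
      {t | decode t ∈ S} (fun t ht => hgood σ hσ hσc t ⟨hσ, ht⟩)
    refine le_trans (le_of_eq ?_) h
    simp [hR]
    field_simp
    norm_num
  rw [hA4 g ϑ (by rw [hcos]) hsin S]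
  have hp1 := hside ϑ (by rw [abs_of_pos hϑ0]; exact hϑ1) hcos
  have hp2 := hside (-ϑ) (by rw [abs_neg, abs_of_pos hϑ0]; exact hϑ1) (by rw [Real.cos_neg, hcos])
  have hsum : ∀ t : (Fin (J + 1) × Bool) × Fin R → Bool, (if decode t ∈ S then
      (1 / 2) * (∏ s, ‖QuantumAlg.testAmp (if s.1.2 then -(Real.pi / 2) else 0)
          (Complex.exp (ϑ * Complex.I) ^ (2 * 3 ^ (s.1.1 : ℕ))) (t s)‖ ^ 2 +
        ∏ s, ‖QuantumAlg.testAmp (if s.1.2 then -(Real.pi / 2) else 0)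
          (Complex.exp (-ϑ * Complex.I) ^ (2 * 3 ^ (s.1.1 : ℕ))) (t s)‖ ^ 2) else 0) =
      1 / 2 * ((if decode t ∈ S then ∏ s, testProb (testPhase J ϑ s.1) (t s) else 0) +
        (if decode t ∈ S then ∏ s, testProb (testPhase J (-ϑ) s.1) (t s) else 0)) := by
    intro t
    rw [← Complex.ofReal_neg]
    simp only [normSq_testAmp]
    split_ifs
    · rfl
    · simp
  rw [Finset.sum_congr rfl fun t _ => hsum t, ← Finset.mul_sum, Finset.sum_add_distrib]
  linarith

/-! ### The Gaussian measure: eigen-coordinates, projections, reflections, moments -/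

instance : SecondCountableTopology H := by
  have : Fact ((2 : ℝ≥0∞) ≠ ∞) := ⟨by norm_num⟩
  infer_instance

namespace Setting

variable {X : Type*} [NormedAddCommGroup X] [NormedSpace ℝ X] [CompleteSpace X]
    [TopologicalSpace.SeparableSpace X] [MeasurableSpace X] [BorelSpace X]

/-- The `i`-th coordinate of `Im x` with respect to the eigenvectors. -/
def coord (P : Setting X) (i : ℕ) : X →L[ℝ] ℝ := (innerSL ℝ (P.Im (P.e i))).comp P.Im

theorem coord_apply (P : Setting X) (i : ℕ) (x : X) :
    P.coord i x = inner ℝ (P.Im (P.e i)) (P.Im x) := rfl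

/-- The projection of `X` onto the span of the first `d` eigenvectors. -/
def proj (P : Setting X) (d : ℕ) : X →L[ℝ] X :=
  ∑ i : Fin d, (P.coord i).smulRight (P.e i)

theorem proj_apply (P : Setting X) (d : ℕ) (x : X) :
    P.proj d x = ∑ i : Fin d, P.coord i x • P.e i := by
  simp [proj]

theorem coord_e (P : Setting X) (i j : ℕ) : P.coord i (P.e j) = if i = j then 1 else 0 := by
  rw [coord_apply]
  exact orthonormal_iff_ite.1 P.orthonormal i j

theorem coord_proj (P : Setting X) (d i : ℕ) (x : X) :
    P.coord i (P.proj d x) = if i < d then P.coord i x else 0 := by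
  simp only [proj_apply, map_sum, map_smul, coord_e, smul_eq_mul, mul_ite, mul_one, mul_zero]
  split_ifs with h
  · rw [Finset.sum_eq_single ⟨i, h⟩]
    · simp
    · intro j _ hj
      rw [if_neg]
      rintro rfl
      exact hj rfl
    · simp
  · refine Finset.sum_eq_zero fun j _ => if_neg ?_
    have := j.2
    omega

theorem memLp_norm (P : Setting X) (p : ℝ≥0∞) (hp : p ≠ ∞) : MemLp (fun x : X => x) p P.μ := by
  have := P.gaussian
  exact IsGaussian.memLp_id P.μ p hp

theorem memLp_coord (P : Setting X) (i : ℕ) : MemLp (P.coord i) 2 P.μ := by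
  have := P.gaussian
  exact IsGaussian.memLp_dual P.μ (P.coord i) 2 (by norm_num)

theorem memLp_dual (P : Setting X) (L : X →L[ℝ] ℝ) : MemLp L 2 P.μ := by
  have := P.gaussian
  exact IsGaussian.memLp_dual P.μ L 2 (by norm_num)

/-- The covariance of a coordinate with any continuous linear functional. -/
theorem integral_coord_mul (P : Setting X) (i : ℕ) (L : X →L[ℝ] ℝ) :
    ∫ x, P.coord i x * L x ∂P.μ = P.lam i * L (P.e i) := by
  have hint : Integrable (fun x => P.coord i x • x) P.μ :=
    memLp_one_iff_integrable.1 ((P.memLp_norm 2 (by norm_num)).smul (P.memLp_coord i))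
  -- The eigenvalue equation only concerns functionals that factor through Im. Stated for a vector
  -- valued integral in X, it follows by injectivity of Im, and then every continuous functional may
  -- be applied.
  have hv : ∫ x, P.coord i x • x ∂P.μ = P.lam i • P.e i := by
    apply P.Im_injective
    rw [← P.Im.integral_comp_comm hint]
    refine ext_inner_right ℝ fun h => ?_
    have hint' : Integrable (fun x => P.Im (P.coord i x • x)) P.μ :=
      P.Im.integrable_comp hint
    rw [real_inner_comm, ← integral_inner hint' h, map_smul, inner_smul_left]
    simp only [map_smul, inner_smul_right]
    rw [RCLike.conj_to_real, ← P.eigen i h]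
    refine integral_congr_ae (ae_of_all _ fun x => ?_)
    simp only [coord_apply]
    rw [real_inner_comm (P.Im x) h, real_inner_comm (P.Im x) (P.Im (P.e i))]
  have := L.integral_comp_comm hint
  rw [hv] at this
  simpa using this

theorem covariance_coord (P : Setting X) (i : ℕ) (L : X →L[ℝ] ℝ) :
    cov[P.coord i, L; P.μ] = P.lam i * L (P.e i) := by
  have := P.gaussian
  rw [covariance_eq_sub (P.memLp_coord i) (P.memLp_dual L), P.zero_mean, zero_mul, sub_zero]
  exact P.integral_coord_mul i L

theorem hasGaussianLaw_coord (P : Setting X) {ι : Type*} [Fintype ι] (s : ι → ℕ) :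
    HasGaussianLaw (fun x : X => fun i => P.coord (s i) x) P.μ := by
  have := P.gaussian
  have h := (IsGaussian.hasGaussianLaw_id (μ := P.μ)).map
    (ContinuousLinearMap.pi fun i => P.coord (s i))
  exact h

theorem map_coord (P : Setting X) (i : ℕ) :
    P.μ.map (P.coord i) = gaussianReal 0 (P.lam i).toNNReal := by
  have := P.gaussian
  rw [IsGaussian.map_eq_gaussianReal, P.zero_mean,
    ← covariance_self (P.coord i).continuous.measurable.aemeasurable, P.covariance_coord,
    P.coord_e, if_pos rfl, mul_one]

theorem map_coords (P : Setting X) {ι : Type*} [Fintype ι] (s : ι → ℕ)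
    (hs : Function.Injective s) :
    P.μ.map (fun x : X => fun i => P.coord (s i) x) =
      Measure.pi fun i => gaussianReal 0 (P.lam (s i)).toNNReal := by
  have := P.gaussian
  have hind : iIndepFun (fun i => (P.coord (s i) : X → ℝ)) P.μ := by
    refine (P.hasGaussianLaw_coord s).iIndepFun_of_covariance_eq_zero fun i j hij => ?_
    rw [P.covariance_coord, P.coord_e, if_neg fun h => hij (hs h).symm, mul_zero]
  rw [(iIndepFun_iff_map_fun_eq_pi_map
    fun i => (P.coord (s i)).continuous.measurable.aemeasurable).1 hind]
  simp only [map_coord]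

/-- The first coordinates are independent normal variables under μ. Both integrals thus live on the
same probability space, and the truncation error becomes the mean of a difference. -/
theorem Id_eq (P : Setting X) (d : ℕ) (f : X → ℝ) (hf : Continuous f) :
    P.Id d f = ∫ x, f (P.proj d x) ∂P.μ := by
  rw [Id, ← P.map_coords (fun i : Fin d => (i : ℕ)) Fin.val_injective, integral_map]
  · simp only [restrict, proj_apply]
  · exact (measurable_pi_lambda _ fun i : Fin d =>
      (P.coord i).continuous.measurable).aemeasurable
  · refine Continuous.aestronglyMeasurable ?_
    unfold restrict
    fun_prop

/-- The reflection that fixes the first `d` eigenvectors and changes the sign of the rest. -/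
def refl (P : Setting X) (d : ℕ) : X →L[ℝ] X := (2 : ℝ) • P.proj d - ContinuousLinearMap.id ℝ X

theorem refl_apply (P : Setting X) (d : ℕ) (x : X) : P.refl d x = (2 : ℝ) • P.proj d x - x := rfl

/-- The projection and the remainder are uncorrelated: with M = L ∘ proj, cov(M, L) = Var M. So in
Var(2M - L) the terms 4 Var M and 4 cov(M, L) cancel. -/
theorem variance_comp_refl (P : Setting X) (d : ℕ) (L : X →L[ℝ] ℝ) :
    Var[L.comp (P.refl d); P.μ] = Var[L; P.μ] := by
  have := P.gaussian
  set M : X →L[ℝ] ℝ := L.comp (P.proj d) with hM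
  have e1 : (L.comp (P.refl d) : X → ℝ) = (2 : ℝ) • (M : X → ℝ) - (L : X → ℝ) := by
    ext x; simp [refl_apply, hM]
  have key : ∀ L' : X →L[ℝ] ℝ, cov[M, L'; P.μ] =
      ∑ i : Fin d, P.lam i * (L (P.e i) * L' (P.e i)) := by
    intro L'
    have e2 : (M : X → ℝ) = ∑ i : Fin d, fun x => L (P.e i) * P.coord i x := by
      ext x
      simp [hM, proj_apply, mul_comm]
    rw [e2, covariance_sum_left
      (fun i : Fin d => (P.memLp_coord i).const_mul _) (P.memLp_dual L')]
    refine Finset.sum_congr rfl fun i _ => ?_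
    rw [covariance_const_mul_left, P.covariance_coord]
    ring
  have hMe : ∀ i : Fin d, M (P.e i) = L (P.e i) := by
    intro i
    have : P.proj d (P.e i) = P.e i := by
      rw [proj_apply, Finset.sum_eq_single i]
      · simp [coord_e]
      · intro j _ hj
        rw [coord_e, if_neg fun h => hj (Fin.ext h), zero_smul]
      · simp
    simp [hM, this]
  have hmM := P.memLp_dual M
  have hmL := P.memLp_dual L
  rw [e1, variance_sub (hmM.const_smul 2) hmL, variance_smul, covariance_smul_left,
    ← covariance_self hmM.1.aemeasurable, key, key]
  simp only [hMe]
  ring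

/-- A zero mean Gaussian measure is determined by the variances of the continuous functionals. -/
theorem map_refl (P : Setting X) (d : ℕ) : P.μ.map (P.refl d) = P.μ := by
  have := P.gaussian
  have : IsGaussian (P.μ.map (P.refl d)) := inferInstance
  refine Measure.ext_of_charFunDual ?_
  ext L
  have h0 : ∀ L : X →L[ℝ] ℝ, ∫ x, L x ∂(P.μ.map (P.refl d)) = 0 := by
    intro L
    rw [integral_map (P.refl d).continuous.measurable.aemeasurable
      L.continuous.aestronglyMeasurable]
    exact P.zero_mean (L.comp (P.refl d))
  rw [IsGaussian.charFunDual_eq_of_forall_strongDual_eq_zero h0,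
    IsGaussian.charFunDual_eq_of_forall_strongDual_eq_zero P.zero_mean,
    variance_map L.continuous.measurable.aemeasurable (P.refl d).continuous.measurable.aemeasurable]
  rw [← P.variance_comp_refl d L]
  rfl

theorem sub_proj_eq (P : Setting X) (d : ℕ) (x : X) :
    x - P.proj d x = (1 / 2 : ℝ) • (x - P.refl d x) := by
  rw [refl_apply]
  module

theorem integrable_norm_pow (P : Setting X) (p : ℕ) : Integrable (fun x => ‖x‖ ^ p) P.μ := by
  have := P.gaussian
  rcases eq_or_ne p 0 with rfl | hp
  · simp
  have h := (P.memLp_norm p (by simp)).integrable_norm_rpow (by exact_mod_cast hp) (by simp)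
  simpa using h

theorem integrable_clm_norm_pow (P : Setting X) {Y : Type*} [NormedAddCommGroup Y]
    [NormedSpace ℝ Y] (T : X →L[ℝ] Y) (p : ℕ) : Integrable (fun x => ‖T x‖ ^ p) P.μ := by
  refine ((P.integrable_norm_pow p).const_mul (‖T‖ ^ p)).mono'
    (T.continuous.norm.pow p).aestronglyMeasurable (ae_of_all _ fun x => ?_)
  rw [Real.norm_of_nonneg (by positivity), ← mul_pow]
  gcongr
  exact T.le_opNorm x

theorem integral_comp_refl (P : Setting X) (d : ℕ) {Y : Type*} [NormedAddCommGroup Y]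
    [NormedSpace ℝ Y] {g : X → Y} (hg : Continuous g) :
    ∫ x, g (P.refl d x) ∂P.μ = ∫ x, g x ∂P.μ := by
  have : SecondCountableTopology X := UniformSpace.secondCountable_of_separable X
  have h := integral_map (f := g) (μ := P.μ) (P.refl d).continuous.measurable.aemeasurable
    hg.aestronglyMeasurable
  rw [← h, P.map_refl]

/-- The moments of the remainder are at most those of `μ`. -/
theorem integral_norm_sub_proj_pow_le (P : Setting X) (d p : ℕ) :
    ∫ x, ‖x - P.proj d x‖ ^ p ∂P.μ ≤ ∫ x, ‖x‖ ^ p ∂P.μ := by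
  have hi1 := P.integrable_norm_pow p
  have hi2 := P.integrable_clm_norm_pow (P.refl d) p
  have hb : ∀ x, ‖x - P.proj d x‖ ^ p ≤ (‖x‖ ^ p + ‖P.refl d x‖ ^ p) / 2 := by
    intro x
    have h1 : ‖x - P.proj d x‖ ≤ 1 / 2 * ‖x‖ + 1 / 2 * ‖P.refl d x‖ := by
      rw [sub_proj_eq, norm_smul, Real.norm_of_nonneg (by norm_num)]
      have := norm_sub_le x (P.refl d x)
      linarith
    have h2 := (convexOn_pow p).2 (norm_nonneg x) (norm_nonneg (P.refl d x))
      (by norm_num : (0 : ℝ) ≤ 1 / 2) (by norm_num : (0 : ℝ) ≤ 1 / 2) (by norm_num)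
    simp only [smul_eq_mul] at h2
    calc ‖x - P.proj d x‖ ^ p ≤ (1 / 2 * ‖x‖ + 1 / 2 * ‖P.refl d x‖) ^ p :=
          pow_le_pow_left₀ (norm_nonneg _) h1 p
      _ ≤ _ := h2
      _ = _ := by ring
  calc ∫ x, ‖x - P.proj d x‖ ^ p ∂P.μ ≤ ∫ x, (‖x‖ ^ p + ‖P.refl d x‖ ^ p) / 2 ∂P.μ := by
        refine integral_mono_of_nonneg (ae_of_all _ fun x => by positivity)
          ((hi1.add hi2).div_const 2) (ae_of_all _ hb)
    _ = ∫ x, ‖x‖ ^ p ∂P.μ := by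
        rw [integral_div, integral_add hi1 hi2,
          P.integral_comp_refl d (g := fun x => ‖x‖ ^ p) (by fun_prop)]
        ring

theorem inner_Im_ae_eq_zero (P : Setting X) {h : H}
    (hh : ∀ i, inner ℝ (P.Im (P.e i)) h = 0) : ∀ᵐ x ∂P.μ, inner ℝ (P.Im x) h = 0 := by
  have h0 := P.complete h hh h
  have hsq : (fun x => inner ℝ (P.Im x) h * inner ℝ (P.Im x) h) = fun x =>
      ‖((innerSL ℝ h).comp P.Im) x‖ ^ 2 := by
    ext x
    simp [real_inner_comm, sq]
  have hi : Integrable (fun x => inner ℝ (P.Im x) h * inner ℝ (P.Im x) h) P.μ := by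
    rw [hsq]
    exact P.integrable_clm_norm_pow _ 2
  have := (integral_eq_zero_iff_of_nonneg (fun x => mul_self_nonneg _) hi).1 h0
  filter_upwards [this] with x hx
  simpa using hx

/-- The closed linear span of the eigenvectors. -/
def eigenSpan (P : Setting X) : Submodule ℝ H :=
  (Submodule.span ℝ (Set.range fun i => P.Im (P.e i))).topologicalClosure

instance (P : Setting X) : CompleteSpace P.eigenSpan :=
  (Submodule.isClosed_topologicalClosure _).completeSpace_coe

/-- Each functional that kills all eigenvectors has variance zero and so vanishes almost surely on
Im x. Applied to the component of Im x orthogonal to the span, tested against every c, this makes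
the component zero almost surely. -/
theorem Im_mem_eigenSpan (P : Setting X) : ∀ᵐ x ∂P.μ, P.Im x ∈ P.eigenSpan := by
  have h : (fun x => P.Im x - P.eigenSpan.starProjection (P.Im x)) =ᵐ[P.μ] 0 := by
    refine ae_eq_zero_of_forall_inner (𝕜 := ℝ) fun c => ?_
    have hc : ∀ i, inner ℝ (P.Im (P.e i)) (c - P.eigenSpan.starProjection c) = 0 := fun i =>
      Submodule.inner_right_of_mem_orthogonal (K := P.eigenSpan)
        (Submodule.le_topologicalClosure _ (Submodule.subset_span ⟨i, rfl⟩))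
        (Submodule.sub_starProjection_mem_orthogonal c)
    filter_upwards [P.inner_Im_ae_eq_zero hc] with x hx
    rw [inner_sub_right] at hx
    rw [inner_sub_right, Pi.zero_apply, ← Submodule.inner_starProjection_left_eq_right,
      real_inner_comm, real_inner_comm (P.Im x)]
    exact hx
  filter_upwards [h] with x hx
  rw [Pi.zero_apply, sub_eq_zero] at hx
  rw [hx]
  exact Submodule.starProjection_apply_mem _ _

/-- Parseval's identity in the closed span of the eigenvectors. -/
theorem hasSum_inner_sq (P : Setting X) {h : H} (hh : h ∈ P.eigenSpan) :
    HasSum (fun i => inner ℝ (P.Im (P.e i)) h ^ 2) (‖h‖ ^ 2) := by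
  have hmem : ∀ i, P.Im (P.e i) ∈ P.eigenSpan := fun i =>
    Submodule.le_topologicalClosure _ (Submodule.subset_span ⟨i, rfl⟩)
  let v : ℕ → P.eigenSpan := fun i => ⟨P.Im (P.e i), hmem i⟩
  have hv : Orthonormal ℝ v := by
    rw [orthonormal_iff_ite]
    exact orthonormal_iff_ite.1 P.orthonormal
  have hspan : (Submodule.span ℝ (Set.range v))ᗮ = ⊥ := by
    rw [eq_bot_iff]
    rintro ⟨y, hy⟩ hy'
    rw [Submodule.mem_bot, Subtype.ext_iff]
    have h1 : y ∈ P.eigenSpanᗮ := by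
      rw [eigenSpan, Submodule.orthogonal_closure]
      rw [Submodule.mem_orthogonal]
      intro u hu
      induction hu using Submodule.span_induction with
      | mem u hu =>
        obtain ⟨i, rfl⟩ := hu
        exact (Submodule.mem_orthogonal _ _).1 hy' (v i) (Submodule.subset_span ⟨i, rfl⟩)
      | zero => simp
      | add a b _ _ ha hb => rw [inner_add_left, ha, hb, add_zero]
      | smul a b _ hb => rw [inner_smul_left, hb, mul_zero]
    have := (Submodule.mem_orthogonal _ _).1 h1 y hy
    exact inner_self_eq_zero.1 this
  let b := HilbertBasis.mkOfOrthogonalEqBot hv hspan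
  have := b.hasSum_inner_mul_inner (⟨h, hh⟩ : P.eigenSpan) ⟨h, hh⟩
  rw [real_inner_self_eq_norm_sq] at this
  have e : (fun i => inner ℝ (P.Im (P.e i)) h ^ 2) = fun i =>
      inner ℝ (⟨h, hh⟩ : P.eigenSpan) (b i) * inner ℝ (b i) (⟨h, hh⟩ : P.eigenSpan) := by
    ext i
    rw [real_inner_comm _ (b i), sq]
    simp [b, v, real_inner_comm]
  rw [e]
  exact this

theorem integral_coord_sq (P : Setting X) (i : ℕ) :
    ∫ x, P.coord i x ^ 2 ∂P.μ = P.lam i := by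
  have := P.integral_coord_mul i (P.coord i)
  rw [P.coord_e, if_pos rfl, mul_one] at this
  rw [← this]
  congr 1 with x
  ring

/-- The mean square of the remainder in `L₂([0,1])` is the tail of the series of eigenvalues. -/
theorem hasSum_lam_tail (P : Setting X) (d : ℕ) :
    HasSum (fun j => P.lam (j + d)) (∫ x, ‖P.Im (x - P.proj d x)‖ ^ 2 ∂P.μ) := by
  have hint : Integrable (fun x => ‖P.Im (x - P.proj d x)‖ ^ 2) P.μ := by
    exact P.integrable_clm_norm_pow (P.Im.comp (ContinuousLinearMap.id ℝ X - P.proj d)) 2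
  have hae : ∀ᵐ x ∂P.μ,
      HasSum (fun j => P.coord (j + d) x ^ 2) (‖P.Im (x - P.proj d x)‖ ^ 2) := by
    filter_upwards [P.Im_mem_eigenSpan] with x hx
    have hm : P.Im (x - P.proj d x) ∈ P.eigenSpan := by
      rw [map_sub, proj_apply, map_sum]
      refine sub_mem hx (sum_mem fun i _ => ?_)
      rw [map_smul]
      exact Submodule.smul_mem _ _
        (Submodule.le_topologicalClosure _ (Submodule.subset_span ⟨i, rfl⟩))
    have h := P.hasSum_inner_sq hm
    have hc : ∀ i, inner ℝ (P.Im (P.e i)) (P.Im (x - P.proj d x)) =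
        if i < d then 0 else P.coord i x := by
      intro i
      rw [← coord_apply, map_sub, coord_proj]
      split_ifs <;> simp
    simp only [hc] at h
    rw [← hasSum_nat_add_iff' d] at h
    have h0 : ∑ i ∈ Finset.range d, (if i < d then 0 else P.coord i x) ^ 2 = 0 :=
      Finset.sum_eq_zero fun i hi => by simp [Finset.mem_range.1 hi]
    rw [h0, sub_zero] at h
    simpa using h
  -- Bessel's inequality comes first: it gives the summability of the eigenvalues that justifies
  -- exchanging sum and integral below.
  have hsum : ∀ n, ∑ j ∈ Finset.range n, P.lam (j + d) ≤
      ∫ x, ‖P.Im (x - P.proj d x)‖ ^ 2 ∂P.μ := by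
    intro n
    calc ∑ j ∈ Finset.range n, P.lam (j + d)
        = ∫ x, ∑ j ∈ Finset.range n, P.coord (j + d) x ^ 2 ∂P.μ := by
          rw [integral_finsetSum _ fun j _ => (P.memLp_coord (j + d)).integrable_sq]
          simp only [integral_coord_sq]
      _ ≤ _ := by
          refine integral_mono_ae (integrable_finsetSum _ fun j _ =>
            (P.memLp_coord (j + d)).integrable_sq) hint ?_
          filter_upwards [hae] with x hx
          exact sum_le_hasSum _ (fun i _ => sq_nonneg _) hx
  have hs : Summable fun j => P.lam (j + d) :=
    summable_of_sum_range_le (fun j => (P.lam_pos _).le) hsum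
  have h := hasSum_integral_of_summable_integral_norm
    (F := fun j x => P.coord (j + d) x ^ 2) (μ := P.μ)
    (fun j => (P.memLp_coord (j + d)).integrable_sq) (by
      convert hs using 2 with j
      simp only [Real.norm_eq_abs, abs_pow, sq_abs, integral_coord_sq])
  simp only [integral_coord_sq] at h
  rwa [integral_congr_ae (hae.mono fun x hx => hx.tsum_eq)] at h

end Setting

/-! ### Interpolation: from a Lipschitz condition on the top derivative to the function itself -/

/-- A bounded function whose derivative varies slowly varies slowly. -/
theorem norm_sub_le_of_fderiv {X Y Z : Type*} [NormedAddCommGroup X] [NormedSpace ℝ X]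
    [NormedAddCommGroup Y] [NormedSpace ℝ Y] [NormedAddCommGroup Z] [NormedSpace ℝ Z]
    (J : X →L[ℝ] Z) {f : X → Y} (hf : Differentiable ℝ f) {κ C : ℝ} (hC : 0 ≤ C) {b : ℕ}
    (hκ : ∀ x, ‖f x‖ ≤ κ)
    (h' : ∀ T : ℝ, 1 ≤ T → ∀ x h,
      ‖fderiv ℝ f (x + h) - fderiv ℝ f x‖ ≤ C * (1 + ‖h‖) ^ b * (1 / T + ‖J h‖ * T ^ b))
    (T : ℝ) (hT : 1 ≤ T) (x h : X) :
    ‖f (x + h) - f x‖ ≤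
      (2 * κ + C) * (1 + ‖h‖) ^ ((b + 1) ^ 2) * (1 / T + ‖J h‖ * T ^ ((b + 1) ^ 2)) := by
  have hT0 : 0 < T := by linarith
  have hκ0 : 0 ≤ κ := (norm_nonneg _).trans (hκ 0)
  set B := (2 * κ + C) * (1 + ‖h‖) ^ ((b + 1) ^ 2) * (1 / T + ‖J h‖ * T ^ ((b + 1) ^ 2)) with hB
  have hh1 : 1 ≤ 1 + ‖h‖ := by linarith [norm_nonneg h]
  -- the directional derivative is small
  have key : ∀ y, ‖fderiv ℝ f y h‖ ≤ B := by
    intro y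
    -- A step of length T along h changes f by at most 2κ, while f'(y)(Th) is this change up to the
    -- variation D·T of the derivative; hence |f'(y)h| ≤ 2κ/T + D. The hypothesis is used with
    -- parameter S. Its factor (1 + T‖h‖)^b costs T^b, and T^b/S = 1/T.
    set S := T ^ (b + 1) with hS
    have hS1 : 1 ≤ S := one_le_pow₀ hT
    set D := C * ((1 + ‖h‖) * T) ^ b * (1 / S + T * ‖J h‖ * S ^ b) * ‖h‖ with hD
    have h1 : ‖f (y + T • h) - f y - fderiv ℝ f y (T • h)‖ ≤ D * T := by
      have hder : ∀ t ∈ Set.Icc (0 : ℝ) T, HasDerivWithinAt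
          (fun t : ℝ => f (y + t • h) - t • fderiv ℝ f y h)
          (fderiv ℝ f (y + t • h) h - fderiv ℝ f y h) (Set.Icc 0 T) t := by
        intro t _
        have e1 : HasDerivAt (fun t : ℝ => y + t • h) h t := by
          simpa using ((hasDerivAt_id t).smul_const h).const_add y
        have e2 := (hf (y + t • h)).hasFDerivAt.comp_hasDerivAt t e1
        have e3 : HasDerivAt (fun t : ℝ => t • fderiv ℝ f y h) (fderiv ℝ f y h) t := by
          simpa using (hasDerivAt_id t).smul_const (fderiv ℝ f y h)
        exact (e2.sub e3).hasDerivWithinAt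
      have hbd : ∀ t ∈ Set.Ico (0 : ℝ) T,
          ‖fderiv ℝ f (y + t • h) h - fderiv ℝ f y h‖ ≤ D := by
        intro t ht
        rw [← sub_apply]
        refine (ContinuousLinearMap.le_opNorm _ _).trans ?_
        rw [hD]
        gcongr
        refine (h' S hS1 y (t • h)).trans ?_
        have e1 : ‖t • h‖ ≤ T * ‖h‖ := by
          rw [norm_smul, Real.norm_of_nonneg ht.1]
          gcongr
          exact ht.2.le
        have e2 : ‖J (t • h)‖ ≤ T * ‖J h‖ := by
          rw [map_smul, norm_smul, Real.norm_of_nonneg ht.1]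
          gcongr
          exact ht.2.le
        have e3 : 1 + ‖t • h‖ ≤ (1 + ‖h‖) * T := by nlinarith [norm_nonneg h]
        gcongr
      have := norm_image_sub_le_of_norm_deriv_le_segment' hder hbd T (Set.right_mem_Icc.2 hT0.le)
      simp only [zero_smul, add_zero, sub_zero, map_smul] at this ⊢
      rwa [sub_right_comm]
    have h2 : T * ‖fderiv ℝ f y h‖ ≤ 2 * κ + D * T := by
      have e : T * ‖fderiv ℝ f y h‖ = ‖fderiv ℝ f y (T • h)‖ := by
        rw [map_smul, norm_smul, Real.norm_of_nonneg hT0.le]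
      rw [e]
      have e2 := norm_sub_le (f (y + T • h)) (f y)
      have e3 := norm_sub_norm_le (fderiv ℝ f y (T • h)) (f (y + T • h) - f y)
      rw [norm_sub_rev (fderiv ℝ f y (T • h)) (f (y + T • h) - f y)] at e3
      linarith [hκ (y + T • h), hκ y]
    have h3 : ‖fderiv ℝ f y h‖ ≤ 2 * κ / T + D := by
      rw [← mul_le_mul_iff_of_pos_left hT0]
      refine h2.trans (le_of_eq ?_)
      field_simp
    have h4 : D ≤ C * (1 + ‖h‖) ^ ((b + 1) ^ 2) * (1 / T + ‖J h‖ * T ^ ((b + 1) ^ 2)) := by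
      have e1 : T ^ b * (1 / S + T * ‖J h‖ * S ^ b) = 1 / T + ‖J h‖ * T ^ ((b + 1) ^ 2) := by
        rw [hS]
        have : T ^ ((b + 1) ^ 2) = T ^ b * T * (T ^ (b + 1)) ^ b := by
          rw [← pow_mul, ← pow_succ, ← pow_add]
          ring_nf
        rw [this, pow_succ]
        field_simp
      have e2 : (1 + ‖h‖) ^ b * ‖h‖ ≤ (1 + ‖h‖) ^ ((b + 1) ^ 2) :=
        calc (1 + ‖h‖) ^ b * ‖h‖ ≤ (1 + ‖h‖) ^ b * (1 + ‖h‖) := by gcongr; linarith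
          _ = (1 + ‖h‖) ^ (b + 1) := (pow_succ _ _).symm
          _ ≤ _ := pow_le_pow_right₀ hh1 (by nlinarith)
      calc D = C * ((1 + ‖h‖) ^ b * ‖h‖) * (T ^ b * (1 / S + T * ‖J h‖ * S ^ b)) := by
            rw [hD, mul_pow]; ring
        _ ≤ _ := by rw [e1]; gcongr
    have h5 : 2 * κ / T ≤
        2 * κ * (1 + ‖h‖) ^ ((b + 1) ^ 2) * (1 / T + ‖J h‖ * T ^ ((b + 1) ^ 2)) := by
      calc 2 * κ / T = 2 * κ * 1 * (1 / T + 0) := by ring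
        _ ≤ _ := by
          gcongr
          · exact one_le_pow₀ hh1
          · positivity
    rw [hB]
    linarith
  have hder : ∀ t ∈ Set.Icc (0 : ℝ) 1, HasDerivWithinAt (fun t : ℝ => f (x + t • h))
      (fderiv ℝ f (x + t • h) h) (Set.Icc 0 1) t := by
    intro t _
    have e1 : HasDerivAt (fun t : ℝ => x + t • h) h t := by
      simpa using ((hasDerivAt_id t).smul_const h).const_add x
    exact ((hf (x + t • h)).hasFDerivAt.comp_hasDerivAt t e1).hasDerivWithinAt
  have := norm_image_sub_le_of_norm_deriv_le_segment' hder (fun t _ => key _) 1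
    (Set.right_mem_Icc.2 zero_le_one)
  simpa using this

theorem norm_iteratedFDeriv_fderiv_sub {X Y : Type*} [NormedAddCommGroup X] [NormedSpace ℝ X]
    [NormedAddCommGroup Y] [NormedSpace ℝ Y] (f : X → Y) (n : ℕ) (x y : X) :
    ‖iteratedFDeriv ℝ n (fderiv ℝ f) x - iteratedFDeriv ℝ n (fderiv ℝ f) y‖ =
      ‖iteratedFDeriv ℝ (n + 1) f x - iteratedFDeriv ℝ (n + 1) f y‖ := by
  simp only [iteratedFDeriv_succ_eq_comp_right, Function.comp_apply]
  rw [← dist_eq_norm, ← dist_eq_norm]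
  exact (LinearIsometryEquiv.dist_map _ _ _).symm

section

variable {X Y Z : Type*} [NormedAddCommGroup X] [NormedSpace ℝ X] [NormedAddCommGroup Y]
  [NormedSpace ℝ Y] [NormedAddCommGroup Z] [NormedSpace ℝ Z]

/-- The derivatives of `f` up to the order `m` are bounded by `κ`, and the last one is Lipschitz
with respect to `J`. -/
def Smooth (J : X →L[ℝ] Z) (m : ℕ) (κ : ℕ → ℝ) (f : X → Y) : Prop :=
  ContDiff ℝ m f ∧ (∀ i ≤ m, ∀ x, ‖iteratedFDeriv ℝ i f x‖ ≤ κ i) ∧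
  ∀ x y, ‖iteratedFDeriv ℝ m f x - iteratedFDeriv ℝ m f y‖ ≤ κ (m + 1) * ‖J (x - y)‖

theorem Smooth.fderiv {J : X →L[ℝ] Z} {m : ℕ} {κ : ℕ → ℝ} {f : X → Y} (h : Smooth J (m + 1) κ f) :
    Smooth J m (fun i => κ (i + 1)) (fderiv ℝ f) := by
  refine ⟨h.1.fderiv_right (by norm_cast), fun i hi x => ?_, fun x y => ?_⟩
  · rw [norm_iteratedFDeriv_fderiv]
    exact h.2.1 _ (by omega) x
  · rw [norm_iteratedFDeriv_fderiv_sub]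
    exact h.2.2 x y

theorem Smooth.norm_le {J : X →L[ℝ] Z} {m : ℕ} {κ : ℕ → ℝ} {f : X → Y} (h : Smooth J m κ f)
    (x : X) : ‖f x‖ ≤ κ 0 := by
  simpa using h.2.1 0 (Nat.zero_le _) x

theorem Smooth.norm_sub_le {J : X →L[ℝ] Z} {κ : ℕ → ℝ} {f : X → Y} (h : Smooth J 0 κ f)
    (x y : X) : ‖f x - f y‖ ≤ κ 1 * ‖J (x - y)‖ := by
  have h1 := h.2.2 x y
  rwa [iteratedFDeriv_zero_eq_comp, Function.comp_apply,
    Function.comp_apply, ← map_sub, LinearIsometryEquiv.norm_map] at h1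

theorem Smooth.norm_add_sub_le {J : X →L[ℝ] Z} {κ : ℕ → ℝ} {f : X → Y} (h : Smooth J 0 κ f)
    (hκ : 0 ≤ κ 1) (T : ℝ) (hT : 1 ≤ T) (x u : X) :
    ‖f (x + u) - f x‖ ≤ κ 1 * (1 + ‖u‖) ^ 0 * (1 / T + ‖J u‖ * T ^ 0) := by
  refine (h.norm_sub_le (x + u) x).trans ?_
  rw [add_sub_cancel_left]
  simp only [pow_zero, mul_one]
  gcongr
  have : 0 < 1 / T := by positivity
  linarith

end

/-- Induction on the number of derivatives. The target Y is in the universe of X because the step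
passes to the derivative, whose values are operators from X to Y. Real valued functions are
therefore treated separately, in `exists_abs_sub_le`, with one more interpolation step. -/
theorem exists_norm_sub_le.{u, w} (m : ℕ) : ∀ κ : ℕ → ℝ, (∀ i ≤ m + 1, 0 ≤ κ i) →
    ∃ C : ℝ, ∃ b : ℕ, 0 ≤ C ∧ ∀ {X Y : Type u} {Z : Type w} [NormedAddCommGroup X]
    [NormedSpace ℝ X] [NormedAddCommGroup Y] [NormedSpace ℝ Y] [NormedAddCommGroup Z]
    [NormedSpace ℝ Z] (J : X →L[ℝ] Z) (f : X → Y), Smooth J m κ f → ∀ T : ℝ, 1 ≤ T → ∀ x h,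
    ‖f (x + h) - f x‖ ≤ C * (1 + ‖h‖) ^ b * (1 / T + ‖J h‖ * T ^ b) := by
  induction m with
  | zero =>
    exact fun κ hκ => ⟨κ 1, 0, hκ 1 le_rfl, fun J f h => h.norm_add_sub_le (hκ 1 le_rfl)⟩
  | succ m ih =>
    intro κ hκ
    obtain ⟨C, b, hC, h⟩ := ih (fun i => κ (i + 1)) fun i hi => hκ _ (by omega)
    refine ⟨2 * κ 0 + C, (b + 1) ^ 2, ?_, fun J f hf => ?_⟩
    · have := hκ 0 (by omega); linarith
    exact norm_sub_le_of_fderiv J (hf.1.differentiable (by simp)) hC hf.norm_le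
      (h J (fderiv ℝ f) hf.fderiv)

/-- A smooth bounded function does not change much in directions that are small with respect to the
seminorm of the Lipschitz condition. -/
theorem exists_abs_sub_le.{u, w} (m : ℕ) (κ : ℕ → ℝ) (hκ : ∀ i ≤ m + 1, 0 ≤ κ i) :
    ∃ C : ℝ, ∃ b : ℕ, 0 ≤ C ∧ ∀ {X : Type u} {Z : Type w} [NormedAddCommGroup X]
    [NormedSpace ℝ X] [NormedAddCommGroup Z] [NormedSpace ℝ Z] (J : X →L[ℝ] Z) (f : X → ℝ),
    Smooth J m κ f → ∀ T : ℝ, 1 ≤ T → ∀ x h,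
    |f (x + h) - f x| ≤ C * (1 + ‖h‖) ^ b * (1 / T + ‖J h‖ * T ^ b) := by
  cases m with
  | zero =>
    exact ⟨κ 1, 0, hκ 1 le_rfl, fun J f h => h.norm_add_sub_le (hκ 1 le_rfl)⟩
  | succ m =>
    obtain ⟨C, b, hC, h⟩ := exists_norm_sub_le m (fun i => κ (i + 1)) fun i hi => hκ _ (by omega)
    refine ⟨2 * κ 0 + C, (b + 1) ^ 2, ?_, fun J f hf => ?_⟩
    · have := hκ 0 (by omega); linarith
    exact norm_sub_le_of_fderiv J (hf.1.differentiable (by simp)) hC hf.norm_le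
      (h J (fderiv ℝ f) hf.fderiv)

/-! ### Upper bounds for the truncation error and the dimension -/

namespace Setting

variable {X : Type*} [NormedAddCommGroup X] [NormedSpace ℝ X] [CompleteSpace X]
    [TopologicalSpace.SeparableSpace X] [MeasurableSpace X] [BorelSpace X]

theorem mem_F_iff (P : Setting X) {K : ℕ → ℝ} {r : ℕ} (hr : 1 ≤ r) {f : X → ℝ} :
    f ∈ P.F K r ↔ Smooth P.Im (r - 1) K f := by
  unfold F Smooth
  rw [Nat.sub_add_cancel hr]
  rfl

theorem abs_le_of_mem_F (P : Setting X) {K : ℕ → ℝ} {r : ℕ} {f : X → ℝ} (hf : f ∈ P.F K r)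
    (x : X) : |f x| ≤ K 0 := by
  simpa using hf.2.1 0 (Nat.zero_le _) x

theorem continuous_of_mem_F (P : Setting X) {K : ℕ → ℝ} {r : ℕ} {f : X → ℝ} (hf : f ∈ P.F K r) :
    Continuous f := hf.1.continuous

theorem integrable_comp_of_mem_F (P : Setting X) {K : ℕ → ℝ} {r : ℕ} {f : X → ℝ}
    (hf : f ∈ P.F K r) {T : X → X} (hT : Continuous T) : Integrable (fun x => f (T x)) P.μ := by
  have := P.gaussian
  exact Integrable.of_bound ((P.continuous_of_mem_F hf).comp hT).aestronglyMeasurable (K 0)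
    (ae_of_all _ fun x => P.abs_le_of_mem_F hf _)

/-- The mean square of the remainder in `L₂([0,1])`. -/
def tail (P : Setting X) (d : ℕ) : ℝ := ∫ x, ‖P.Im (x - P.proj d x)‖ ^ 2 ∂P.μ

theorem tail_nonneg (P : Setting X) (d : ℕ) : 0 ≤ P.tail d :=
  integral_nonneg fun _ => sq_nonneg _

theorem integrable_tail (P : Setting X) (d : ℕ) :
    Integrable (fun x => ‖P.Im (x - P.proj d x)‖ ^ 2) P.μ :=
  P.integrable_clm_norm_pow (P.Im.comp (ContinuousLinearMap.id ℝ X - P.proj d)) 2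

theorem abs_I_sub_Id_le (P : Setting X) {K : ℕ → ℝ} {r : ℕ} {f : X → ℝ} (hf : f ∈ P.F K r)
    (d : ℕ) {g : X → ℝ} (hg : Integrable g P.μ) (h : ∀ x, |f x - f (P.proj d x)| ≤ g x) :
    |P.I f - P.Id d f| ≤ ∫ x, g x ∂P.μ := by
  rw [P.Id_eq d f (P.continuous_of_mem_F hf), I,
    ← integral_sub (P.integrable_comp_of_mem_F hf (T := fun x => x) continuous_id')
      (P.integrable_comp_of_mem_F hf (P.proj d).continuous)]
  exact (abs_integral_le_integral_abs).trans
    (integral_mono_of_nonneg (ae_of_all _ fun _ => abs_nonneg _) hg (ae_of_all _ h))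

/-- The interpolation bound is applied to the remainder h = x - `proj d` x. The arithmetic-geometric
mean inequality separates the powers of ‖h‖, whose moments are bounded uniformly in d, from the
square of ‖Im h‖, whose mean is the tail. T remains free. -/
theorem exists_abs_I_sub_Id_le (P : Setting X) {K : ℕ → ℝ} {r : ℕ} (hr : 1 ≤ r)
    (hK : ∀ i ≤ r, 0 < K i) : ∃ C : ℝ, ∃ b : ℕ, 0 < C ∧ ∀ d : ℕ, ∀ T : ℝ, 1 ≤ T → ∀ f ∈ P.F K r,
      |P.I f - P.Id d f| ≤ C * (1 / T + T ^ b * P.tail d) := by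
  have := P.gaussian
  obtain ⟨C, b, hC, h⟩ := exists_abs_sub_le (r - 1) K fun i hi => (hK i (by omega)).le
  set M := ∫ x, (2 ^ (2 * b) + 2 ^ (2 * b) * ‖x‖ ^ (2 * b)) ∂P.μ with hM
  have hM0 : 0 ≤ M := integral_nonneg fun _ => by positivity
  refine ⟨C * (2 * M + 1) + 1, 2 * b + 1, by positivity, fun d T hT f hf => ?_⟩
  have hT0 : 0 < T := by linarith
  set g : X → ℝ := fun x => C * (2 / T * (2 ^ (2 * b) + 2 ^ (2 * b) * ‖x - P.proj d x‖ ^ (2 * b)) +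
    T ^ (2 * b + 1) * ‖P.Im (x - P.proj d x)‖ ^ 2) with hg
  have hi0 : Integrable (fun x => ‖x - P.proj d x‖ ^ (2 * b)) P.μ :=
    P.integrable_clm_norm_pow (ContinuousLinearMap.id ℝ X - P.proj d) (2 * b)
  have hi1 : Integrable (fun x => 2 ^ (2 * b) + 2 ^ (2 * b) * ‖x - P.proj d x‖ ^ (2 * b)) P.μ :=
    (integrable_const _).add (hi0.const_mul _)
  have hgi : Integrable g P.μ :=
    ((hi1.const_mul _).add ((P.integrable_tail d).const_mul _)).const_mul _
  refine (P.abs_I_sub_Id_le hf d hgi fun x => ?_).trans ?_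
  · have h1 := h P.Im f ((P.mem_F_iff hr).1 hf) T hT (P.proj d x) (x - P.proj d x)
    rw [add_sub_cancel] at h1
    refine h1.trans ?_
    set z := x - P.proj d x
    rw [hg, mul_assoc]
    dsimp only
    gcongr
    have hz : 1 ≤ 1 + ‖z‖ := by linarith [norm_nonneg z]
    have e0 : ((1 + ‖z‖) ^ b) ^ 2 ≤ 2 ^ (2 * b) + 2 ^ (2 * b) * ‖z‖ ^ (2 * b) := by
      rw [← pow_mul, mul_comm b 2]
      rcases le_total ‖z‖ 1 with h | h
      · calc (1 + ‖z‖) ^ (2 * b) ≤ 2 ^ (2 * b) := by gcongr; linarith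
          _ ≤ _ := by simp
      · calc (1 + ‖z‖) ^ (2 * b) ≤ (2 * ‖z‖) ^ (2 * b) := by gcongr; linarith
          _ = 2 ^ (2 * b) * ‖z‖ ^ (2 * b) := mul_pow _ _ _
          _ ≤ _ := by simp
    have e1 : (1 + ‖z‖) ^ b ≤ ((1 + ‖z‖) ^ b) ^ 2 := le_self_pow₀ (one_le_pow₀ hz) (by norm_num)
    have e2 : (1 + ‖z‖) ^ b * (‖P.Im z‖ * T ^ b) ≤
        1 / T * ((1 + ‖z‖) ^ b) ^ 2 + T ^ (2 * b + 1) * ‖P.Im z‖ ^ 2 := by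
      have e4 := two_mul_le_add_sq ((1 + ‖z‖) ^ b) (T * (‖P.Im z‖ * T ^ b))
      have e5 : (1 + ‖z‖) ^ b * (‖P.Im z‖ * T ^ b) =
        1 / T * ((1 + ‖z‖) ^ b * (T * (‖P.Im z‖ * T ^ b))) := by field_simp
      have e6 : T ^ (2 * b + 1) * ‖P.Im z‖ ^ 2 = 1 / T * (T * (‖P.Im z‖ * T ^ b)) ^ 2 := by
        field_simp
        ring
      rw [e5, e6, ← mul_add]
      gcongr
      have : 0 ≤ (1 + ‖z‖) ^ b * (T * (‖P.Im z‖ * T ^ b)) := by positivity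
      linarith
    calc (1 + ‖z‖) ^ b * (1 / T + ‖P.Im z‖ * T ^ b)
        = 1 / T * (1 + ‖z‖) ^ b + (1 + ‖z‖) ^ b * (‖P.Im z‖ * T ^ b) := by ring
      _ ≤ 1 / T * ((1 + ‖z‖) ^ b) ^ 2 +
          (1 / T * ((1 + ‖z‖) ^ b) ^ 2 + T ^ (2 * b + 1) * ‖P.Im z‖ ^ 2) := by gcongr
      _ = 2 / T * ((1 + ‖z‖) ^ b) ^ 2 + T ^ (2 * b + 1) * ‖P.Im z‖ ^ 2 := by ring
      _ ≤ _ := by gcongr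
  · have h2 : ∫ x, (2 ^ (2 * b) + 2 ^ (2 * b) * ‖x - P.proj d x‖ ^ (2 * b)) ∂P.μ ≤ M := by
      rw [hM, integral_add (integrable_const _) (hi0.const_mul _), integral_const_mul,
        integral_add (integrable_const _) ((P.integrable_norm_pow _).const_mul _),
        integral_const_mul]
      have := P.integral_norm_sub_proj_pow_le d (2 * b)
      gcongr
    rw [hg, integral_const_mul, integral_add (hi1.const_mul _) ((P.integrable_tail d).const_mul _),
      integral_const_mul, integral_const_mul]
    have h3 := P.tail_nonneg d
    rw [tail] at h3 ⊢
    generalize ∫ x, ‖P.Im (x - P.proj d x)‖ ^ 2 ∂P.μ = t at *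
    calc _ ≤ C * (2 / T * M + T ^ (2 * b + 1) * t) := by gcongr
      _ = (C * (2 * M)) * (1 / T) + C * (T ^ (2 * b + 1) * t) := by ring
      _ ≤ (C * (2 * M + 1) + 1) * (1 / T) + (C * (2 * M + 1) + 1) * (T ^ (2 * b + 1) * t) := by
          gcongr <;> nlinarith
      _ = _ := by ring

theorem tail_eq (P : Setting X) (d : ℕ) : P.tail d = ∑' j, P.lam (j + d) :=
  (P.hasSum_lam_tail d).tsum_eq.symm

/-- The exponent is split as k = (k-1)/2 + (k+1)/2. The second part exceeds 1 and makes the series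
converge; the first is left as the rate in d. -/
theorem exists_tail_le (P : Setting X) {k : ℝ} (hk : 1 < k) {c₂ : ℝ}
    (hlam : ∀ j : ℕ, P.lam j ≤ c₂ * ((j : ℝ) + 1) ^ (-k)) :
    ∃ A : ℝ, 0 < A ∧ ∀ d : ℕ, P.tail d ≤ A * ((d : ℝ) + 1) ^ (-((k - 1) / 2)) := by
  have hc : 0 < c₂ := by
    have := hlam 0
    simp only [Nat.cast_zero, zero_add, Real.one_rpow, mul_one] at this
    exact (P.lam_pos 0).trans_le this
  have hs : Summable fun j : ℕ => ((j : ℝ) + 1) ^ (-((k + 1) / 2)) := by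
    have := (summable_nat_add_iff 1).2 (Real.summable_nat_rpow (p := -((k + 1) / 2)) |>.2 (by linarith))
    simpa using this
  refine ⟨c₂ * (∑' j : ℕ, ((j : ℝ) + 1) ^ (-((k + 1) / 2))), ?_, fun d => ?_⟩
  · refine mul_pos hc (hs.tsum_pos (fun j => by positivity) 0 (by norm_num))
  rw [tail_eq, mul_right_comm, ← tsum_mul_left]
  refine (P.hasSum_lam_tail d).summable.tsum_le_tsum (fun j => ?_) (hs.mul_left _)
  refine (hlam _).trans ?_
  rw [mul_assoc]
  gcongr
  have hd : (0 : ℝ) < (d : ℝ) + 1 := by positivity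
  have hj : (0 : ℝ) < (j : ℝ) + 1 := by positivity
  have e : -k = -((k - 1) / 2) + -((k + 1) / 2) := by ring
  rw [e, Real.rpow_add (by positivity)]
  have h1 : (d : ℝ) + 1 ≤ ((j + d : ℕ) : ℝ) + 1 := by push_cast; linarith [j.cast_nonneg (α := ℝ)]
  have h2 : (j : ℝ) + 1 ≤ ((j + d : ℕ) : ℝ) + 1 := by push_cast; linarith [d.cast_nonneg (α := ℝ)]
  exact mul_le_mul (Real.rpow_le_rpow_of_nonpos hd h1 (by linarith))
    (Real.rpow_le_rpow_of_nonpos hj h2 (by linarith)) (by positivity) (by positivity)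

theorem dim_le (P : Setting X) {K : ℕ → ℝ} {r : ℕ} {ε : ℝ} {d : ℕ}
    (h : ∀ f ∈ P.F K r, |P.I f - P.Id d f| ≤ ε / 2) : P.dim K r ε ≤ d := Nat.sInf_le h

theorem exists_truncation (P : Setting X) {k : ℝ} (hk : 1 < k) {c₂ : ℝ}
    (hlam : ∀ j : ℕ, P.lam j ≤ c₂ * ((j : ℝ) + 1) ^ (-k)) {K : ℕ → ℝ} {r : ℕ} (hr : 1 ≤ r)
    (hK : ∀ i ≤ r, 0 < K i) : ∃ C : ℝ, ∃ s : ℕ, 0 < C ∧ ∀ ε : ℝ, 0 < ε → ε ≤ 1 →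
      ∃ d : ℕ, (d : ℝ) ≤ C * (1 / ε) ^ s ∧ ∀ f ∈ P.F K r, |P.I f - P.Id d f| ≤ ε / 2 := by
  obtain ⟨C, b, hC, h⟩ := P.exists_abs_I_sub_Id_le hr hK
  obtain ⟨A, hA, hA'⟩ := P.exists_tail_le hk hlam
  set a := (k - 1) / 2 with ha
  have ha0 : 0 < a := by rw [ha]; linarith
  -- With T = (4C+1)/ε the term C/T is at most ε/4. The index d is chosen so that the tail is at
  -- most A ε^(b+1)/B, and this B makes the other term equal to ε/4.
  set B := 4 * C * A * (4 * C + 1) ^ b with hB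
  have hB0 : 0 < B := by positivity
  set s := ⌈((b + 1 : ℕ) : ℝ) * a⁻¹⌉₊ with hs
  refine ⟨B ^ a⁻¹ + 1, s, by positivity, fun ε hε hε1 => ?_⟩
  have h1ε : 1 ≤ 1 / ε := by rw [le_div_iff₀ hε]; linarith
  refine ⟨⌈(B * (1 / ε) ^ (b + 1)) ^ a⁻¹⌉₊, ?_, fun f hf => ?_⟩
  · refine (Nat.ceil_lt_add_one (by positivity)).le.trans ?_
    rw [Real.mul_rpow hB0.le (by positivity), ← Real.rpow_natCast, ← Real.rpow_mul (by positivity),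
      ← Real.rpow_natCast, add_mul]
    have h2 : (1 / ε) ^ (((b + 1 : ℕ) : ℝ) * a⁻¹) ≤ (1 / ε) ^ (s : ℝ) :=
      Real.rpow_le_rpow_of_exponent_le h1ε (Nat.le_ceil _)
    have h3 : 1 ≤ (1 / ε) ^ (s : ℝ) := Real.one_le_rpow h1ε (by positivity)
    have : 0 < B ^ a⁻¹ := by positivity
    rw [one_mul]
    gcongr
  · set d := ⌈(B * (1 / ε) ^ (b + 1)) ^ a⁻¹⌉₊ with hd
    set T := (4 * C + 1) * (1 / ε) with hT
    have hT1 : 1 ≤ T := by nlinarith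
    refine (h d T hT1 f hf).trans ?_
    have hd1 : (B * (1 / ε) ^ (b + 1)) ^ a⁻¹ ≤ (d : ℝ) + 1 := (Nat.le_ceil _).trans (by linarith)
    have hd2 : B * (1 / ε) ^ (b + 1) ≤ ((d : ℝ) + 1) ^ a := by
      have := Real.rpow_le_rpow (by positivity) hd1 ha0.le
      rwa [← Real.rpow_mul (by positivity), inv_mul_cancel₀ ha0.ne', Real.rpow_one] at this
    have hd3 : P.tail d ≤ A / (B * (1 / ε) ^ (b + 1)) := by
      refine (hA' d).trans ?_
      rw [Real.rpow_neg (by positivity), ← div_eq_mul_inv]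
      gcongr
    have e1 : C * (1 / T) ≤ ε / 4 := by
      rw [hT, mul_one_div, div_le_iff₀ (by positivity)]
      have : ε / 4 * ((4 * C + 1) * (1 / ε)) = (4 * C + 1) / 4 := by field_simp
      rw [this]
      linarith
    have e2 : C * (T ^ b * P.tail d) ≤ ε / 4 := by
      calc C * (T ^ b * P.tail d) ≤ C * (T ^ b * (A / (B * (1 / ε) ^ (b + 1)))) := by gcongr
        _ = ε / 4 := by
          rw [hT, hB, mul_pow, pow_succ]
          field_simp
    linarith

theorem exists_dim_le (P : Setting X) {k : ℝ} (hk : 1 < k) {c₂ : ℝ}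
    (hlam : ∀ j : ℕ, P.lam j ≤ c₂ * ((j : ℝ) + 1) ^ (-k)) {K : ℕ → ℝ} {r : ℕ} (hr : 1 ≤ r)
    (hK : ∀ i ≤ r, 0 < K i) : ∃ C : ℝ, ∃ s : ℕ, 0 < C ∧ ∀ ε : ℝ, 0 < ε → ε ≤ 1 →
      (P.dim K r ε : ℝ) ≤ C * (1 / ε) ^ s := by
  obtain ⟨C, s, hC, h⟩ := P.exists_truncation hk hlam hr hK
  refine ⟨C, s, hC, fun ε hε hε1 => ?_⟩
  obtain ⟨d, hd, hd'⟩ := h ε hε hε1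
  exact (Nat.cast_le.2 (P.dim_le hd')).trans hd

theorem abs_I_sub_Id_dim_le (P : Setting X) {k : ℝ} (hk : 1 < k) {c₂ : ℝ}
    (hlam : ∀ j : ℕ, P.lam j ≤ c₂ * ((j : ℝ) + 1) ^ (-k)) {K : ℕ → ℝ} {r : ℕ} (hr : 1 ≤ r)
    (hK : ∀ i ≤ r, 0 < K i) {ε : ℝ} (hε : 0 < ε) :
    ∀ f ∈ P.F K r, |P.I f - P.Id (P.dim K r ε) f| ≤ ε / 2 := by
  obtain ⟨C, s, hC, h⟩ := P.exists_truncation hk hlam hr hK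
  obtain ⟨d, -, hd⟩ := h (min ε 1) (by positivity) (min_le_right _ _)
  have hne : {d | ∀ f ∈ P.F K r, |P.I f - P.Id d f| ≤ ε / 2}.Nonempty :=
    ⟨d, fun f hf => (hd f hf).trans (by linarith [min_le_left ε 1])⟩
  exact Nat.sInf_mem hne

end Setting

/-! ### Lower bounds for the truncation error and the dimension -/

theorem pow_mul_exp_neg_sq_le (m : ℕ) {t : ℝ} (ht : 0 ≤ t) :
    (1 + t) ^ m * Real.exp (-t ^ 2) ≤ m.factorial * Real.exp 2 := by
  have h1 := Real.pow_div_factorial_le_exp (1 + t) (by positivity) m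
  rw [div_le_iff₀ (by positivity)] at h1
  calc (1 + t) ^ m * Real.exp (-t ^ 2) ≤ Real.exp (1 + t) * m.factorial * Real.exp (-t ^ 2) := by
        gcongr
    _ = m.factorial * Real.exp (1 + t + -t ^ 2) := by rw [Real.exp_add (1 + t)]; ring
    _ ≤ _ := by
        gcongr
        nlinarith [sq_nonneg (t - 1 / 2)]

/-- All derivatives of the function `exp (-‖x‖ ^ 2)` on a Hilbert space are bounded. -/
theorem exists_norm_iteratedFDeriv_exp_neg_norm_sq_le (V : Type*) [NormedAddCommGroup V]
    [InnerProductSpace ℝ V] (n : ℕ) : ∃ κ : ℝ, 0 < κ ∧ ∀ i ≤ n, ∀ u : V,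
      ‖iteratedFDeriv ℝ i (fun u : V => Real.exp (-‖u‖ ^ 2)) u‖ ≤ κ := by
  obtain ⟨k, C, hC, h⟩ :=
    (Function.hasTemperateGrowth_norm_sq (H := V)).norm_iteratedFDeriv_le_uniform n
  set M := (1 + C) ^ n * n.factorial * ((k * n).factorial * Real.exp 2) with hM
  refine ⟨M, by positivity, fun i hi u => ?_⟩
  have hg : ContDiff ℝ i fun t : ℝ => Real.exp (-t) := by fun_prop
  have hf : ContDiff ℝ i fun u : V => ‖u‖ ^ 2 := contDiff_norm_sq ℝ
  have h1u : 1 ≤ 1 + ‖u‖ := by linarith [norm_nonneg u]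
  have hD1 : 1 ≤ (1 + C) * (1 + ‖u‖) ^ k := by
    have := one_le_pow₀ h1u (n := k)
    nlinarith
  -- The derivatives are bounded by a polynomial in ‖u‖ times exp(-‖u‖^2): the inner function ‖u‖^2
  -- has temperate growth, and the outer one reproduces itself up to sign.
  have key := norm_iteratedFDeriv_comp_le hg hf le_rfl u (C := Real.exp (-‖u‖ ^ 2))
    (D := (1 + C) * (1 + ‖u‖) ^ k) (fun j _ => ?_) (fun j hj hj' => ?_)
  · refine key.trans ?_
    calc (i.factorial : ℝ) * Real.exp (-‖u‖ ^ 2) * ((1 + C) * (1 + ‖u‖) ^ k) ^ i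
        ≤ n.factorial * Real.exp (-‖u‖ ^ 2) * ((1 + C) * (1 + ‖u‖) ^ k) ^ n := by
          gcongr
      _ = (1 + C) ^ n * n.factorial * ((1 + ‖u‖) ^ (k * n) * Real.exp (-‖u‖ ^ 2)) := by
          rw [mul_pow, ← pow_mul]; ring
      _ ≤ M := by
          rw [hM]
          refine mul_le_mul_of_nonneg_left ?_ (by positivity)
          exact pow_mul_exp_neg_sq_le _ (norm_nonneg u)
  · rw [norm_iteratedFDeriv_eq_norm_iteratedDeriv]
    have := iteratedDeriv_exp_const_mul j (-1)
    simp only [neg_mul, one_mul] at this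
    rw [this]
    simp
  · refine (h j (by omega) u).trans ?_
    calc C * (1 + ‖u‖) ^ k ≤ (1 + C) * (1 + ‖u‖) ^ k := by gcongr; linarith
      _ ≤ _ := le_self_pow₀ hD1 (by omega)

namespace Setting

variable {X : Type*} [NormedAddCommGroup X] [NormedSpace ℝ X] [CompleteSpace X]
    [TopologicalSpace.SeparableSpace X] [MeasurableSpace X] [BorelSpace X]

/-- A function with bounded derivatives on another space gives rise to functions in `F_r`. -/
theorem comp_mem_F (P : Setting X) {Y : Type*} [NormedAddCommGroup Y] [NormedSpace ℝ Y]
    (Q : H →L[ℝ] Y) {q Λ : ℝ} (hq : ‖Q‖ ≤ q) (hΛ : ‖P.Im‖ ≤ Λ) (hΛ1 : 1 ≤ Λ) {r : ℕ} (hr : 1 ≤ r)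
    {g : Y → ℝ} (hg : ContDiff ℝ r g) {κ K : ℕ → ℝ} (hκ : ∀ i ≤ r, ∀ y,
      ‖iteratedFDeriv ℝ i g y‖ ≤ κ i) (h : ∀ i ≤ r, κ i * (q * Λ) ^ i ≤ K i) :
    (fun x => g (Q (P.Im x))) ∈ P.F K r := by
  have hq0 : 0 ≤ q := (norm_nonneg _).trans hq
  set T : X →L[ℝ] Y := Q.comp P.Im with hT
  have hTn : ‖T‖ ≤ q * Λ := (Q.opNorm_comp_le P.Im).trans (by gcongr)
  have hκ0 : ∀ i ≤ r, 0 ≤ κ i := fun i hi => (norm_nonneg _).trans (hκ i hi 0)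
  have hD : ∀ i ≤ r, ∀ x, iteratedFDeriv ℝ i (g ∘ T) x =
      (iteratedFDeriv ℝ i g (T x)).compContinuousLinearMap fun _ => T := fun i hi x =>
    T.iteratedFDeriv_comp_right hg x (by exact_mod_cast hi)
  rw [P.mem_F_iff hr]
  change Smooth P.Im (r - 1) K (g ∘ T)
  refine ⟨?_, fun i hi x => ?_, fun x y => ?_⟩
  · exact (hg.comp T.contDiff).of_le (by norm_cast; omega)
  · rw [hD i (by omega)]
    refine (ContinuousMultilinearMap.norm_compContinuousLinearMap_le _ _).trans ?_
    rw [Finset.prod_const, Finset.card_univ, Fintype.card_fin]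
    refine le_trans ?_ (h i (by omega))
    have := hκ i (by omega) (T x)
    have := hκ0 i (by omega)
    gcongr
  · have hsub : iteratedFDeriv ℝ (r - 1) (g ∘ T) x - iteratedFDeriv ℝ (r - 1) (g ∘ T) y =
        (iteratedFDeriv ℝ (r - 1) g (T x) -
          iteratedFDeriv ℝ (r - 1) g (T y)).compContinuousLinearMap fun _ => T := by
      rw [hD _ (by omega), hD _ (by omega)]
      rfl
    rw [hsub]
    refine (ContinuousMultilinearMap.norm_compContinuousLinearMap_le _ _).trans ?_
    rw [Finset.prod_const, Finset.card_univ, Fintype.card_fin, Nat.sub_add_cancel hr]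
    have h1 : ‖iteratedFDeriv ℝ (r - 1) g (T x) - iteratedFDeriv ℝ (r - 1) g (T y)‖ ≤
        κ r * ‖T x - T y‖ := by
      refine Convex.norm_image_sub_le_of_norm_fderiv_le (𝕜 := ℝ) (s := Set.univ)
        (fun z _ => ?_) (fun z _ => ?_) convex_univ trivial trivial
      · exact (hg.differentiable_iteratedFDeriv (by norm_cast; omega)) z
      · rw [norm_fderiv_iteratedFDeriv, Nat.sub_add_cancel hr]
        exact hκ r le_rfl z
    have h2 : ‖T x - T y‖ ≤ q * Λ * ‖P.Im (x - y)‖ := by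
      rw [← map_sub, hT, ContinuousLinearMap.comp_apply]
      refine (Q.le_opNorm _).trans ?_
      gcongr
      nlinarith
    have := hκ0 r le_rfl
    calc _ ≤ κ r * (q * Λ * ‖P.Im (x - y)‖) * (q * Λ) ^ (r - 1) := by
          gcongr
          exact h1.trans (by gcongr)
      _ = κ r * (q * Λ) ^ (r - 1 + 1) * ‖P.Im (x - y)‖ := by rw [pow_succ]; ring
      _ ≤ _ := by
          rw [Nat.sub_add_cancel hr]
          gcongr
          exact h r le_rfl

/-- The projection of `L₂([0,1])` onto the span of the eigenvectors with indices in `J`. -/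
def projH (P : Setting X) (J : Finset ℕ) : H →L[ℝ] H :=
  ∑ j ∈ J, (innerSL ℝ (P.Im (P.e j))).smulRight (P.Im (P.e j))

theorem norm_projH_sq (P : Setting X) (J : Finset ℕ) (h : H) :
    ‖P.projH J h‖ ^ 2 = ∑ j ∈ J, inner ℝ (P.Im (P.e j)) h ^ 2 := by
  have e : P.projH J h = ∑ j ∈ J, inner ℝ (P.Im (P.e j)) h • P.Im (P.e j) := by simp [projH]
  rw [← real_inner_self_eq_norm_sq, e, P.orthonormal.inner_sum]
  simp [sq]

theorem norm_projH_le (P : Setting X) (J : Finset ℕ) : ‖P.projH J‖ ≤ 1 := by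
  refine ContinuousLinearMap.opNorm_le_bound _ zero_le_one fun h => ?_
  rw [one_mul]
  refine abs_le_of_sq_le_sq' ?_ (norm_nonneg _) |>.2
  rw [norm_projH_sq]
  have := P.orthonormal.sum_inner_products_le h (s := J)
  simpa using this

/-- The fourth moment of the standard normal distribution. -/
def fourthMoment : ℝ := ∫ t, t ^ 4 ∂(gaussianReal 0 1)

theorem integral_coord_pow_four (P : Setting X) (i : ℕ) :
    ∫ x, P.coord i x ^ 4 ∂P.μ = P.lam i ^ 2 * fourthMoment := by
  have h1 : ∫ x, P.coord i x ^ 4 ∂P.μ = ∫ t, t ^ 4 ∂(P.μ.map (P.coord i)) := by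
    rw [integral_map (P.coord i).continuous.measurable.aemeasurable (by fun_prop)]
  have h2 : gaussianReal 0 (P.lam i).toNNReal =
      (gaussianReal 0 1).map (Real.sqrt (P.lam i) * ·) := by
    rw [gaussianReal_map_const_mul]
    congr 1
    · simp
    · ext
      simp [Real.sq_sqrt (P.lam_pos i).le, (P.lam_pos i).le]
  rw [h1, map_coord, h2, integral_map (by fun_prop) (by fun_prop), fourthMoment,
    ← integral_const_mul]
  congr 1 with t
  rw [mul_pow, show (4 : ℕ) = 2 * 2 from rfl, pow_mul, Real.sq_sqrt (P.lam_pos i).le]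

theorem fourthMoment_nonneg : 0 ≤ fourthMoment := integral_nonneg fun t => by positivity

theorem integrable_coord_pow (P : Setting X) (i n : ℕ) :
    Integrable (fun x => P.coord i x ^ n) P.μ :=
  (P.integrable_clm_norm_pow (P.coord i) n).mono'
    ((P.coord i).continuous.pow n).aestronglyMeasurable (ae_of_all _ fun x => by simp)

/-- Cauchy-Schwarz with weights λ_j reduces the square of the sum to fourth powers of single
coordinates. This gives the right order without independence. -/
theorem integral_sum_sq_sq_le (P : Setting X) (J : Finset ℕ) :
    ∫ x, (∑ j ∈ J, P.coord j x ^ 2) ^ 2 ∂P.μ ≤ fourthMoment * (∑ j ∈ J, P.lam j) ^ 2 := by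
  have hb : ∀ x, (∑ j ∈ J, P.coord j x ^ 2) ^ 2 ≤
      (∑ j ∈ J, P.lam j) * ∑ j ∈ J, P.coord j x ^ 4 / P.lam j := fun x =>
    Finset.sum_sq_le_sum_mul_sum_of_sq_le_mul J (fun j _ => (P.lam_pos j).le)
      (fun j _ => div_nonneg (by positivity) (P.lam_pos j).le) fun j _ => by
        refine le_of_eq ?_
        field_simp [(P.lam_pos j).ne']
  have hi : ∀ j ∈ J, Integrable (fun x => P.coord j x ^ 4 / P.lam j) P.μ := fun j _ =>
    (P.integrable_coord_pow j 4).div_const _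
  refine (integral_mono_of_nonneg (ae_of_all _ fun x => sq_nonneg _)
    ((integrable_finsetSum _ hi).const_mul _) (ae_of_all _ hb)).trans (le_of_eq ?_)
  rw [integral_const_mul, integral_finsetSum _ hi]
  have : ∀ j, ∫ x, P.coord j x ^ 4 / P.lam j ∂P.μ = fourthMoment * P.lam j := by
    intro j
    rw [integral_div, integral_coord_pow_four]
    field_simp [(P.lam_pos j).ne']
  simp only [this]
  rw [← Finset.mul_sum]
  ring

/-- Take reciprocals in 1 + y + y^2/2 ≤ exp y and use that the two quadratics have product 1 + y^4/4
≥ 1. -/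
theorem exp_neg_le {y : ℝ} (hy : 0 ≤ y) : Real.exp (-y) ≤ 1 - y + y ^ 2 / 2 := by
  have h := Real.quadratic_le_exp_of_nonneg hy
  have h0 : 0 < 1 - y + y ^ 2 / 2 := by nlinarith [sq_nonneg (y - 1)]
  rw [Real.exp_neg, inv_le_comm₀ (Real.exp_pos y) h0]
  refine le_trans ?_ h
  rw [inv_le_iff_one_le_mul₀ h0]
  nlinarith [sq_nonneg (y ^ 2)]

/-- Functions in `F_r` that vary in the directions of the eigenvectors with indices in `J`. -/
theorem exists_mem_F_sub_ge (P : Setting X) {r : ℕ} (hr : 1 ≤ r) {K : ℕ → ℝ} :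
    ∃ κ : ℝ, 0 < κ ∧ ∀ (A B : ℝ) (d : ℕ) (J : Finset ℕ), 0 < A → 0 < B → (∀ j ∈ J, d ≤ j) →
      (∀ i ≤ r, A * κ * (1 / Real.sqrt B) ^ i ≤ K i) → (fourthMoment + 1) * ∑ j ∈ J, P.lam j ≤ B →
      ∃ f ∈ P.F K r, A * (∑ j ∈ J, P.lam j) / (2 * B) ≤ P.Id d f - P.I f := by
  have := P.gaussian
  obtain ⟨κ, hκ, hκ'⟩ := exists_norm_iteratedFDeriv_exp_neg_norm_sq_le H r
  set Λ := max 1 ‖P.Im‖ with hΛ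
  have hΛ1 : 1 ≤ Λ := le_max_left _ _
  refine ⟨κ * Λ ^ r, by positivity, fun A B d J hA hB hJ hK hJB => ?_⟩
  -- The function of x is A exp(-S/B), where S is the sum of the squared coordinates in J. All
  -- indices in J are at least d, so it equals A on X_d. Its mean under μ is smaller by about Aσ/B;
  -- half of this survives the second order term because (m₄ + 1)σ ≤ B, with m₄ the fourth moment.
  set g : H → ℝ := fun u => A * Real.exp (-‖u‖ ^ 2) with hg
  have hgc : ContDiff ℝ r g := contDiff_const.mul
    (Real.contDiff_exp.comp (contDiff_norm_sq ℝ).neg)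
  set s := 1 / Real.sqrt B with hs
  set Q : H →L[ℝ] H := s • P.projH J with hQ
  have hs0 : 0 ≤ s := by positivity
  have hQn : ‖Q‖ ≤ s := by
    rw [hQ, norm_smul, Real.norm_of_nonneg hs0]
    have := P.norm_projH_le J
    nlinarith
  have hmem : (fun x => g (Q (P.Im x))) ∈ P.F K r := by
    refine P.comp_mem_F Q hQn (le_max_right 1 _) hΛ1 hr hgc (κ := fun _ => A * κ) ?_ ?_
    · intro i hi y
      have e : g = fun u => A • Real.exp (-‖u‖ ^ 2) := rfl
      have hc : ContDiff ℝ i fun u : H => Real.exp (-‖u‖ ^ 2) :=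
        Real.contDiff_exp.comp (contDiff_norm_sq ℝ).neg
      rw [e, iteratedFDeriv_const_smul_apply' hc.contDiffAt, norm_smul,
        Real.norm_of_nonneg hA.le]
      have := hκ' i hi y
      gcongr
    · intro i hi
      refine le_trans ?_ (hK i hi)
      have h1 : Λ ^ i ≤ Λ ^ r := pow_le_pow_right₀ hΛ1 hi
      calc A * κ * (s * Λ) ^ i = A * κ * s ^ i * Λ ^ i := by rw [mul_pow]; ring
        _ ≤ A * κ * s ^ i * Λ ^ r := by gcongr
        _ = _ := by ring
  refine ⟨_, hmem, ?_⟩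
  set S : X → ℝ := fun x => ∑ j ∈ J, P.coord j x ^ 2 with hS
  have hgS : ∀ x, g (Q (P.Im x)) = A * Real.exp (-(S x / B)) := by
    intro x
    have e : ‖Q (P.Im x)‖ ^ 2 = S x / B := by
      rw [hQ, smul_apply, norm_smul, mul_pow, norm_projH_sq,
        Real.norm_of_nonneg hs0, hs, div_pow, Real.sq_sqrt hB.le]
      simp only [hS, coord_apply]
      ring
    rw [hg]
    dsimp only
    rw [e]
  set σ := ∑ j ∈ J, P.lam j with hσ
  have hId : P.Id d (fun x => g (Q (P.Im x))) = A := by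
    rw [P.Id_eq d _ (P.continuous_of_mem_F hmem)]
    have : ∀ x, g (Q (P.Im (P.proj d x))) = A := by
      intro x
      rw [hgS]
      have : S (P.proj d x) = 0 := Finset.sum_eq_zero fun j hj => by
        rw [coord_proj, if_neg (by have := hJ j hj; omega)]
        norm_num
      simp [this]
    simp [this]
  have hS0 : ∀ x, 0 ≤ S x := fun x => Finset.sum_nonneg fun j _ => sq_nonneg _
  have hiS : Integrable S P.μ := integrable_finsetSum _ fun j _ => P.integrable_coord_pow j 2
  have hiS2 : Integrable (fun x => S x ^ 2) P.μ := by
    have e : (fun x => S x ^ 2) = fun x =>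
        ‖((P.projH J).comp P.Im) x‖ ^ 4 := by
      ext x
      rw [show (4 : ℕ) = 2 * 2 from rfl, pow_mul]
      simp only [ContinuousLinearMap.comp_apply, norm_projH_sq, hS, coord_apply]
    rw [e]
    exact P.integrable_clm_norm_pow _ 4
  have hIS : ∫ x, S x ∂P.μ = σ := by
    rw [hS, integral_finsetSum _ fun j _ => P.integrable_coord_pow j 2]
    simp only [integral_coord_sq, hσ]
  have hI : P.I (fun x => g (Q (P.Im x))) ≤
      A * (1 - σ / B + fourthMoment * σ ^ 2 / (2 * B ^ 2)) := by
    have hi : Integrable (fun x => A * (1 - S x / B + S x ^ 2 / (2 * B ^ 2))) P.μ :=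
      (((integrable_const _).sub (hiS.div_const _)).add (hiS2.div_const _)).const_mul _
    calc P.I (fun x => g (Q (P.Im x))) ≤
          ∫ x, A * (1 - S x / B + S x ^ 2 / (2 * B ^ 2)) ∂P.μ := by
          refine integral_mono (P.integrable_comp_of_mem_F hmem (T := fun x => x) continuous_id')
            hi fun x => ?_
          dsimp only
          rw [hgS]
          gcongr
          refine (exp_neg_le (div_nonneg (hS0 x) hB.le)).trans (le_of_eq ?_)
          rw [div_pow]
          ring
      _ = A * (1 - σ / B + (∫ x, S x ^ 2 ∂P.μ) / (2 * B ^ 2)) := by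
          rw [integral_const_mul, integral_add (f := fun x => 1 - S x / B)
            ((integrable_const _).sub (hiS.div_const _))
            (hiS2.div_const _), integral_sub (integrable_const _) (hiS.div_const _),
            integral_div, integral_div, hIS]
          simp
      _ ≤ _ := by
          have := P.integral_sum_sq_sq_le J
          gcongr
  rw [hId]
  have hσ0 : 0 ≤ σ := Finset.sum_nonneg fun j _ => (P.lam_pos j).le
  have h1 : fourthMoment * σ ^ 2 / (2 * B ^ 2) ≤ σ / (2 * B) := by
    rw [div_le_div_iff₀ (by positivity) (by positivity)]
    have : fourthMoment * σ ≤ B := by nlinarith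
    calc fourthMoment * σ ^ 2 * (2 * B) = fourthMoment * σ * (2 * B * σ) := by ring
      _ ≤ B * (2 * B * σ) := by gcongr
      _ = _ := by ring
  have h2 : A * (1 - σ / B + fourthMoment * σ ^ 2 / (2 * B ^ 2)) ≤
      A * (1 - σ / B + σ / (2 * B)) := by gcongr
  have h3 : A * (1 - σ / B + σ / (2 * B)) = A - A * σ / (2 * B) := by
    field_simp
    ring
  linarith

theorem sum_lam_le (P : Setting X) (J : Finset ℕ) : ∑ j ∈ J, P.lam j ≤ P.tail 0 := by
  have h := P.hasSum_lam_tail 0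
  simp only [add_zero] at h
  exact sum_le_hasSum J (fun j _ => (P.lam_pos j).le) h

theorem exists_pos_le_bounds {r : ℕ} {K : ℕ → ℝ} (hK : ∀ i ≤ r, 0 < K i) :
    ∃ m : ℝ, 0 < m ∧ ∀ i ≤ r, m ≤ K i := by
  obtain ⟨i, hi, h⟩ := Finset.exists_min_image (Finset.range (r + 1)) K ⟨0, by simp⟩
  exact ⟨K i, hK i (by simpa [Nat.lt_succ_iff] using hi), fun j hj => h j (by simpa [Nat.lt_succ_iff] using hj)⟩

/-- A lower bound for the truncation error, linear in the neglected eigenvalues. -/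
theorem exists_mem_F_sub_ge_linear (P : Setting X) {r : ℕ} (hr : 1 ≤ r) {K : ℕ → ℝ}
    (hK : ∀ i ≤ r, 0 < K i) : ∃ c : ℝ, 0 < c ∧ ∀ (d : ℕ) (J : Finset ℕ), (∀ j ∈ J, d ≤ j) →
      ∃ f ∈ P.F K r, c * ∑ j ∈ J, P.lam j ≤ P.Id d f - P.I f := by
  obtain ⟨κ, hκ, h⟩ := P.exists_mem_F_sub_ge hr (K := K)
  obtain ⟨m, hm, hmK⟩ := exists_pos_le_bounds hK
  set B := (fourthMoment + 1) * P.tail 0 + 1 with hB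
  have h0 := P.tail_nonneg 0
  have h4 := fourthMoment_nonneg
  have hB1 : 1 ≤ B := by
    have : 0 ≤ (fourthMoment + 1) * P.tail 0 := by positivity
    linarith
  refine ⟨m / κ / (2 * B), by positivity, fun d J hJ => ?_⟩
  have hA : ∀ i ≤ r, m / κ * κ * (1 / Real.sqrt B) ^ i ≤ K i := by
    intro i hi
    rw [div_mul_cancel₀ _ hκ.ne']
    refine le_trans ?_ (hmK i hi)
    have : (1 / Real.sqrt B) ^ i ≤ 1 := pow_le_one₀ (by positivity) (by
      rw [div_le_one (by positivity)]
      exact Real.one_le_sqrt.2 hB1)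
    nlinarith
  have hσB : (fourthMoment + 1) * ∑ j ∈ J, P.lam j ≤ B := by
    have := P.sum_lam_le J
    rw [hB]
    nlinarith
  obtain ⟨f, hf, hf'⟩ := h (m / κ) B d J (by positivity) (by positivity) hJ hA hσB
  exact ⟨f, hf, le_trans (le_of_eq (by ring)) hf'⟩

/-- For `r = 1`, the truncation error is at least of the order of the standard deviation of the
neglected part. -/
theorem exists_mem_F_sub_ge_sqrt (P : Setting X) {K : ℕ → ℝ} (hK : ∀ i ≤ 1, 0 < K i) :
    ∃ c : ℝ, 0 < c ∧ ∀ (d : ℕ) (J : Finset ℕ), J.Nonempty → (∀ j ∈ J, d ≤ j) →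
      ∃ f ∈ P.F K 1, c * Real.sqrt (∑ j ∈ J, P.lam j) ≤ P.Id d f - P.I f := by
  obtain ⟨κ, hκ, h⟩ := P.exists_mem_F_sub_ge le_rfl (K := K)
  obtain ⟨m, hm, hmK⟩ := exists_pos_le_bounds hK
  have h4 := fourthMoment_nonneg
  have h0 := P.tail_nonneg 0
  set B₀ := (fourthMoment + 1) * P.tail 0 with hB₀
  have hB₀0 : 0 ≤ B₀ := by positivity
  -- Here B is proportional to σ and the height A = a√B shrinks with it. The function stays bounded
  -- and its Lipschitz constant stays of order a, which is all that r = 1 demands; the gap Aσ/(2B)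
  -- is then of order √σ.
  set a := m / κ / (Real.sqrt B₀ + 1) with ha
  have ha0 : 0 < a := by positivity
  refine ⟨a / (2 * (fourthMoment + 1)), by positivity, fun d J hJn hJ => ?_⟩
  set σ := ∑ j ∈ J, P.lam j with hσ
  have hσ0 : 0 < σ := Finset.sum_pos (fun j _ => P.lam_pos j) hJn
  set B := (fourthMoment + 1) * σ with hB
  have hB0 : 0 < B := by positivity
  have hBB : B ≤ B₀ := by
    have := P.sum_lam_le J
    rw [hB, hB₀]
    gcongr
  have hsB : Real.sqrt B ≤ Real.sqrt B₀ := Real.sqrt_le_sqrt hBB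
  have haκ : a * κ * (Real.sqrt B₀ + 1) = m := by
    rw [ha]
    field_simp
  have hA : ∀ i ≤ 1, a * Real.sqrt B * κ * (1 / Real.sqrt B) ^ i ≤ K i := by
    intro i hi
    refine le_trans ?_ (hmK i hi)
    have hs : 0 < Real.sqrt B := Real.sqrt_pos.2 hB0
    interval_cases i
    · rw [pow_zero, mul_one, ← haκ]
      calc a * Real.sqrt B * κ = a * κ * Real.sqrt B := by ring
        _ ≤ _ := by gcongr; linarith
    · rw [pow_one, ← haκ]
      calc a * Real.sqrt B * κ * (1 / Real.sqrt B) = a * κ * 1 := by field_simp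
        _ ≤ _ := by gcongr; linarith [Real.sqrt_nonneg B₀]
  obtain ⟨f, hf, hf'⟩ := h (a * Real.sqrt B) B d J (by positivity) hB0 hJ hA le_rfl
  refine ⟨f, hf, le_trans ?_ hf'⟩
  have e : a * Real.sqrt B * σ / (2 * B) = a / (2 * (fourthMoment + 1)) * Real.sqrt B := by
    rw [hB]
    field_simp
  rw [e]
  gcongr
  rw [hB]
  nlinarith

/-- The first eigendirection alone already produces a truncation error at d = 0. The purpose is to
make c d ≥ a, so that costs of function values dominate additive constants. -/
theorem exists_one_le_dim (P : Setting X) {K : ℕ → ℝ} {r : ℕ} (hr : 1 ≤ r)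
    (hK : ∀ i ≤ r, 0 < K i)
    (hdim : ∀ ε : ℝ, 0 < ε → ∀ f ∈ P.F K r, |P.I f - P.Id (P.dim K r ε) f| ≤ ε / 2) :
    ∃ ε₀ : ℝ, 0 < ε₀ ∧ ∀ ε : ℝ, 0 < ε → ε < ε₀ → 1 ≤ P.dim K r ε := by
  obtain ⟨c, hc, h⟩ := P.exists_mem_F_sub_ge_linear hr hK
  have h0 := P.lam_pos 0
  refine ⟨c * P.lam 0, by positivity, fun ε hε hε' => ?_⟩
  by_contra! hlt
  obtain ⟨f, hf, hf'⟩ := h 0 {0} (by simp)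
  have h1 := hdim ε hε f hf
  rw [Nat.lt_one_iff.1 hlt, abs_le] at h1
  rw [Finset.sum_singleton] at hf'
  linarith [h1.1]

/-- The d + 1 eigenvalues with indices from d to 2d have sum at least of order 1/d. The test
functions for this block have truncation error of order 1/d, or of order d^{-1/2} when r = 1. -/
theorem exists_le_dim (P : Setting X) {c₁ : ℝ} (hc₁ : 0 < c₁)
    (hlam : ∀ j : ℕ, c₁ / ((j : ℝ) + 1) ^ 2 ≤ P.lam j) {K : ℕ → ℝ} {r : ℕ} (hr : 1 ≤ r)
    (hK : ∀ i ≤ r, 0 < K i)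
    (hdim : ∀ ε : ℝ, 0 < ε → ∀ f ∈ P.F K r, |P.I f - P.Id (P.dim K r ε) f| ≤ ε / 2) :
    ∃ c : ℝ, 0 < c ∧ ∀ ε : ℝ, 0 < ε → c * (1 / ε) ^ (1 + gam r) ≤ P.dim K r ε + 1 := by
  have hσ : ∀ d : ℕ, c₁ / 4 / ((d : ℝ) + 1) ≤ ∑ j ∈ Finset.Ico d (2 * d + 1), P.lam j := by
    intro d
    have h1 : ∀ j ∈ Finset.Ico d (2 * d + 1), c₁ / 4 / ((d : ℝ) + 1) ^ 2 ≤ P.lam j := by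
      intro j hj
      refine le_trans ?_ (hlam j)
      rw [div_div]
      have : (j : ℝ) ≤ 2 * d := by exact_mod_cast Nat.lt_succ_iff.1 (Finset.mem_Ico.1 hj).2
      have h2 : ((j : ℝ) + 1) ^ 2 ≤ 4 * ((d : ℝ) + 1) ^ 2 := by
        calc ((j : ℝ) + 1) ^ 2 ≤ (2 * ((d : ℝ) + 1)) ^ 2 := by gcongr; linarith
          _ = _ := by ring
      gcongr
    have h2 := Finset.card_nsmul_le_sum _ _ _ h1
    refine le_trans (le_of_eq ?_) h2
    rw [Nat.card_Ico, show 2 * d + 1 - d = d + 1 by omega, nsmul_eq_mul]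
    push_cast
    field_simp
  have hJ : ∀ d : ℕ, ∀ j ∈ Finset.Ico d (2 * d + 1), d ≤ j := fun d j hj => (Finset.mem_Ico.1 hj).1
  rcases eq_or_ne r 1 with rfl | hr1
  · obtain ⟨c, hc, h⟩ := P.exists_mem_F_sub_ge_sqrt hK
    refine ⟨c ^ 2 * c₁, by positivity, fun ε hε => ?_⟩
    set d := P.dim K 1 ε with hd
    obtain ⟨f, hf, hf'⟩ := h d (Finset.Ico d (2 * d + 1)) ⟨d, by simp; omega⟩ (hJ d)
    have h1 := hdim ε hε f hf
    rw [abs_le] at h1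
    have h2 : c * Real.sqrt (∑ j ∈ Finset.Ico d (2 * d + 1), P.lam j) ≤ ε / 2 := by linarith [h1.1]
    have h3 : c ^ 2 * (c₁ / 4 / ((d : ℝ) + 1)) ≤ (ε / 2) ^ 2 := by
      have h4 := pow_le_pow_left₀ (by positivity) h2 2
      rw [mul_pow, Real.sq_sqrt (Finset.sum_nonneg fun j _ => (P.lam_pos j).le)] at h4
      refine le_trans ?_ h4
      have := hσ d
      gcongr
    have e : (1 : ℝ) + gam 1 = (2 : ℕ) := by norm_num [gam]
    rw [e, Real.rpow_natCast, one_div, inv_pow, ← div_eq_mul_inv, div_le_iff₀ (by positivity)]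
    have hd1 : (0 : ℝ) < (d : ℝ) + 1 := by positivity
    have h5 : c ^ 2 * (c₁ / 4 / ((d : ℝ) + 1)) * (4 * ((d : ℝ) + 1)) = c ^ 2 * c₁ := by field_simp
    rw [← h5]
    calc _ ≤ (ε / 2) ^ 2 * (4 * ((d : ℝ) + 1)) := by gcongr
      _ = _ := by ring
  · obtain ⟨c, hc, h⟩ := P.exists_mem_F_sub_ge_linear hr hK
    refine ⟨c * c₁ / 2, by positivity, fun ε hε => ?_⟩
    set d := P.dim K r ε with hd
    obtain ⟨f, hf, hf'⟩ := h d (Finset.Ico d (2 * d + 1)) (hJ d)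
    have h1 := hdim ε hε f hf
    rw [abs_le] at h1
    have h2 : c * (c₁ / 4 / ((d : ℝ) + 1)) ≤ ε / 2 := by
      have := hσ d
      calc _ ≤ c * ∑ j ∈ Finset.Ico d (2 * d + 1), P.lam j := by gcongr
        _ ≤ _ := by linarith [h1.1]
    rw [gam, if_neg hr1, add_zero, Real.rpow_one, mul_one_div, div_le_iff₀ hε]
    have h5 : c * (c₁ / 4 / ((d : ℝ) + 1)) * (2 * ((d : ℝ) + 1)) = c * c₁ / 2 := by
      field_simp
      norm_num
    rw [← h5]
    calc _ ≤ (ε / 2) * (2 * ((d : ℝ) + 1)) := by gcongr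
      _ = _ := by ring

end Setting

/-! ### Disjoint bumps in the first D coordinates -/

/-- A smooth bump function near the origin. -/
def bump (D : ℕ) : ContDiffBump (0 : Fin D → ℝ) := ⟨1 / 6, 1 / 3, by norm_num, by norm_num⟩

theorem exists_norm_iteratedFDeriv_bump_le (D r : ℕ) : ∃ κ : ℝ, 0 < κ ∧ ∀ i ≤ r, ∀ u,
    ‖iteratedFDeriv ℝ i (bump D) u‖ ≤ κ := by
  have h : ∀ i : ℕ, ∃ C, ∀ u, ‖iteratedFDeriv ℝ i (bump D) u‖ ≤ C := fun i =>
    ((bump D).hasCompactSupport.iteratedFDeriv i).exists_bound_of_continuous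
      ((bump D).contDiff.continuous_iteratedFDeriv (n := i) le_rfl)
  choose C hC using h
  refine ⟨1 + ∑ i ∈ Finset.range (r + 1), |C i|, by positivity, fun i hi u => (hC i u).trans ?_⟩
  have := Finset.single_le_sum (f := fun i => |C i|) (fun i _ => abs_nonneg _)
    (Finset.mem_range.2 (Nat.lt_succ_iff.2 hi))
  linarith [le_abs_self (C i)]

/-- The centers of the bumps. -/
def center {D M : ℕ} (i : Fin D → Fin M) : Fin D → ℝ := fun k => (i k : ℕ)

theorem one_le_dist_center {D M : ℕ} {i j : Fin D → Fin M} (h : i ≠ j) :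
    1 ≤ ‖center i - center j‖ := by
  obtain ⟨k, hk⟩ := Function.ne_iff.1 h
  refine le_trans ?_ (norm_le_pi_norm _ k)
  have h1 : ((i k : ℕ) : ℤ) - ((j k : ℕ) : ℤ) ≠ 0 := by
    rw [sub_ne_zero]
    exact fun h => hk (Fin.ext (by exact_mod_cast h))
  have h2 := Int.one_le_abs h1
  rw [Pi.sub_apply, Real.norm_eq_abs, center, center]
  exact_mod_cast h2

theorem mem_ball_of_iteratedFDeriv_bump_ne_zero {D : ℕ} (m : ℕ) {c u : Fin D → ℝ}
    (h : iteratedFDeriv ℝ m (fun u => bump D (u - c)) u ≠ 0) : ‖u - c‖ ≤ 1 / 3 := by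
  rw [iteratedFDeriv_comp_sub] at h
  have h1 := support_iteratedFDeriv_subset (𝕜 := ℝ) (n := m) (f := bump D) h
  rw [(bump D).tsupport_eq, mem_closedBall_zero_iff] at h1
  exact h1

/-- At most one bump contributes at any point. -/
theorem exists_unique_bump {D M : ℕ} (hM : 1 ≤ M) (m : ℕ) (u : Fin D → ℝ) :
    ∃ i₀ : Fin D → Fin M, ∀ i ≠ i₀, iteratedFDeriv ℝ m (fun u => bump D (u - center i)) u = 0 := by
  by_cases h : ∃ i₀ : Fin D → Fin M, iteratedFDeriv ℝ m (fun u => bump D (u - center i₀)) u ≠ 0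
  · obtain ⟨i₀, h0⟩ := h
    refine ⟨i₀, fun i hi => ?_⟩
    by_contra h1
    have h2 := mem_ball_of_iteratedFDeriv_bump_ne_zero m h0
    have h3 := mem_ball_of_iteratedFDeriv_bump_ne_zero m h1
    have h4 := one_le_dist_center hi
    have h5 : center i - center i₀ = (u - center i₀) - (u - center i) := by abel
    rw [h5] at h4
    linarith [norm_sub_le (u - center i₀) (u - center i)]
  · push Not at h
    exact ⟨fun _ => ⟨0, hM⟩, fun i _ => h i⟩

theorem norm_sum_le_of_unique {ι E : Type*} [Fintype ι] [NormedAddCommGroup E] {v : ι → E}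
    {i₀ : ι} (h : ∀ i ≠ i₀, v i = 0) {C : ℝ} (hC : ‖v i₀‖ ≤ C) : ‖∑ i, v i‖ ≤ C := by
  rwa [Finset.sum_eq_single i₀ (fun i _ hi => h i hi) (by simp)]

theorem gaussianReal_Icc_ge {v : ℝ≥0} (hv : v ≠ 0) {a b : ℝ} (ha : -1 ≤ a)
    (hb : b ≤ 1) : ENNReal.ofReal (gaussianPDFReal 0 v 1 * (b - a)) ≤
      gaussianReal 0 v (Set.Icc a b) := by
  rw [gaussianReal_apply 0 hv, ENNReal.ofReal_mul (gaussianPDFReal_nonneg _ _ _), ← Real.volume_Icc,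
    ← setLIntegral_const]
  refine setLIntegral_mono (measurable_gaussianPDF _ _) fun t ht => ?_
  refine ENNReal.ofReal_le_ofReal ?_
  simp only [gaussianPDFReal, sub_zero]
  have h : t ^ 2 ≤ 1 := by
    rw [sq_le_one_iff_abs_le_one, abs_le]
    exact ⟨ha.trans ht.1, ht.2.trans hb⟩
  refine mul_le_mul_of_nonneg_left (Real.exp_le_exp.2 ?_) (by positivity)
  refine div_le_div_of_nonneg_right ?_ (by positivity)
  linarith

namespace Setting

variable {X : Type*} [NormedAddCommGroup X] [NormedSpace ℝ X] [CompleteSpace X]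
    [TopologicalSpace.SeparableSpace X] [MeasurableSpace X] [BorelSpace X]

/-- The first `D` coordinates, as functions on `L₂([0,1])`. -/
def coordsH (P : Setting X) (D : ℕ) : H →L[ℝ] (Fin D → ℝ) :=
  ContinuousLinearMap.pi fun k => innerSL ℝ (P.Im (P.e k))

theorem norm_coordsH_le (P : Setting X) (D : ℕ) : ‖P.coordsH D‖ ≤ 1 := by
  refine ContinuousLinearMap.opNorm_le_bound _ zero_le_one fun h => ?_
  rw [one_mul, pi_norm_le_iff_of_nonneg (norm_nonneg _)]
  intro k
  have := norm_inner_le_norm (𝕜 := ℝ) (P.Im (P.e k)) h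
  rwa [P.orthonormal.1, one_mul] at this

/-- The bump equals 1 on a cube with sides 1/(3M), which lies in [-1,1]^D; there each marginal
density is at least its value at 1. -/
theorem integral_bump_ge (P : Setting X) (D : ℕ) {M : ℕ} (hM : 1 ≤ M) (i : Fin D → Fin M) :
    (∏ k : Fin D, gaussianPDFReal 0 (P.lam k).toNNReal 1 / 3) / (M : ℝ) ^ D ≤
      ∫ x, bump D ((M : ℝ) • P.coordsH D (P.Im x) - center i) ∂P.μ := by
  have := P.gaussian
  have hM0 : (0 : ℝ) < M := by exact_mod_cast hM
  set a : Fin D → ℝ := fun k => ((i k : ℕ) - 1 / 6) / M with ha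
  set b : Fin D → ℝ := fun k => ((i k : ℕ) + 1 / 6) / M with hb
  set s : Set X := (fun x : X => fun k : Fin D => P.coord k x) ⁻¹'
    (Set.univ.pi fun k => Set.Icc (a k) (b k)) with hs
  have hmeas : Measurable fun x : X => fun k : Fin D => P.coord k x :=
    measurable_pi_lambda _ fun k : Fin D => (P.coord k).continuous.measurable
  have hsm : MeasurableSet s :=
    hmeas (MeasurableSet.univ_pi fun k => measurableSet_Icc)
  have h1 : ENNReal.ofReal ((∏ k : Fin D, gaussianPDFReal 0 (P.lam k).toNNReal 1 / 3) /
      (M : ℝ) ^ D) ≤ P.μ s := by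
    rw [hs, ← Measure.map_apply hmeas (MeasurableSet.univ_pi fun k => measurableSet_Icc),
      P.map_coords (fun k : Fin D => (k : ℕ)) Fin.val_injective, Measure.pi_pi]
    have e : (∏ k : Fin D, gaussianPDFReal 0 (P.lam k).toNNReal 1 / 3) / (M : ℝ) ^ D =
        ∏ k : Fin D, gaussianPDFReal 0 (P.lam k).toNNReal 1 * (b k - a k) := by
      have : ∀ k : Fin D, gaussianPDFReal 0 (P.lam k).toNNReal 1 * (b k - a k) =
          gaussianPDFReal 0 (P.lam k).toNNReal 1 / 3 / M := by
        intro k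
        simp only [ha, hb]
        field_simp
        ring
      simp only [this]
      rw [Finset.prod_div_distrib (g := fun _ => (M : ℝ)), Finset.prod_const, Finset.card_univ,
        Fintype.card_fin]
    have hab : ∀ k, a k ≤ b k := fun k => by simp only [ha, hb]; gcongr; linarith
    rw [e, ENNReal.ofReal_prod_of_nonneg fun k _ =>
      mul_nonneg (gaussianPDFReal_nonneg _ _ _) (sub_nonneg.2 (hab k))]
    refine Finset.prod_le_prod' fun k _ => gaussianReal_Icc_ge ?_ ?_ ?_
    · simpa using P.lam_pos k
    · simp only [ha]
      rw [le_div_iff₀ hM0]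
      have h1 : (1 : ℝ) ≤ M := by exact_mod_cast hM
      have h2 : (0 : ℝ) ≤ (i k : ℕ) := Nat.cast_nonneg _
      linarith
    · simp only [hb]
      rw [div_le_one hM0]
      have h1 : ((i k : ℕ) : ℝ) + 1 ≤ M := by exact_mod_cast (i k).2
      linarith
  have hc : Continuous fun x => bump D ((M : ℝ) • P.coordsH D (P.Im x) - center i) :=
    (bump D).continuous.comp (by fun_prop)
  have hint : Integrable (fun x => bump D ((M : ℝ) • P.coordsH D (P.Im x) - center i)) P.μ :=
    Integrable.of_bound hc.aestronglyMeasurable 1 (ae_of_all _ fun x => by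
      rw [Real.norm_of_nonneg (bump D).nonneg]
      exact (bump D).le_one)
  have h2 : P.μ.real s ≤ ∫ x, bump D ((M : ℝ) • P.coordsH D (P.Im x) - center i) ∂P.μ := by
    rw [← integral_indicator_one hsm]
    refine integral_mono ((integrable_const 1).indicator hsm) hint fun x => ?_
    by_cases hx : x ∈ s
    · rw [Set.indicator_of_mem hx, Pi.one_apply]
      refine ((bump D).one_of_mem_closedBall ?_).ge
      rw [mem_closedBall_zero_iff]
      refine (pi_norm_le_iff_of_nonneg (by norm_num [bump])).2 fun k => ?_
      have hk := hx k trivial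
      simp only [ha, hb, Set.mem_Icc] at hk
      rw [div_le_iff₀ hM0, le_div_iff₀ hM0] at hk
      have e : ((M : ℝ) • P.coordsH D (P.Im x) - center i) k = P.coord k x * M - (i k : ℕ) := by
        simp [coordsH, center, coord_apply, mul_comm]
      rw [e, Real.norm_eq_abs, abs_le]
      simp only [bump]
      constructor <;> linarith [hk.1, hk.2]
    · rw [Set.indicator_of_notMem hx]
      exact (bump D).nonneg
  refine le_trans ?_ h2
  rw [Measure.real]
  exact (ENNReal.ofReal_le_iff_le_toReal (measure_ne_top _ _)).1 h1

/-- Many functions with disjoint supports: all their combinations with coefficients in `[-1,1]`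
are in `F_r`. -/
theorem exists_bumps (P : Setting X) {r : ℕ} (hr : 1 ≤ r) {K : ℕ → ℝ} (hK : ∀ i ≤ r, 0 < K i)
    (D : ℕ) : ∃ c : ℝ, 0 < c ∧ ∀ M : ℕ, 1 ≤ M → ∃ b : (Fin D → Fin M) → X → ℝ,
      (∀ y : (Fin D → Fin M) → ℝ, (∀ i, |y i| ≤ 1) → (fun x => ∑ i, y i * b i x) ∈ P.F K r) ∧
      (∀ x, ∃ i₀, ∀ i ≠ i₀, b i x = 0) ∧
      ∀ y : (Fin D → Fin M) → ℝ, P.I (fun x => ∑ i, y i * b i x) =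
        c / (M : ℝ) ^ (r + D) * ∑ i, y i := by
  have := P.gaussian
  obtain ⟨κ, hκ, hκ'⟩ := exists_norm_iteratedFDeriv_bump_le D r
  obtain ⟨m, hm, hmK⟩ := exists_pos_le_bounds hK
  set Λ := max 1 ‖P.Im‖ with hΛ
  have hΛ1 : 1 ≤ Λ := le_max_left _ _
  set w := ∏ k : Fin D, gaussianPDFReal 0 (P.lam k).toNNReal 1 / 3 with hw
  have hw0 : 0 < w := Finset.prod_pos fun k _ => by
    have := gaussianPDFReal_pos 0 (P.lam k).toNNReal 1 (by simpa using P.lam_pos k)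
    positivity
  set θ := m / (κ * Λ ^ r) with hθ
  have hθ0 : 0 < θ := by positivity
  refine ⟨θ * w, by positivity, fun M hM => ?_⟩
  have hM1 : (1 : ℝ) ≤ M := by exact_mod_cast hM
  set J : (Fin D → Fin M) → ℝ := fun i =>
    ∫ x, bump D ((M : ℝ) • P.coordsH D (P.Im x) - center i) ∂P.μ with hJ
  have hJw : ∀ i, w / (M : ℝ) ^ D ≤ J i := P.integral_bump_ge D hM
  have hJ0 : ∀ i, 0 < J i := fun i => lt_of_lt_of_le (by positivity) (hJw i)
  -- The bumps have different Gaussian integrals. They are scaled down, by factors at most 1, to the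
  -- common lower bound, so that I sees only the sum of the coefficients.
  set ρ : (Fin D → Fin M) → ℝ := fun i => w / (M : ℝ) ^ D / J i with hρ
  have hρ0 : ∀ i, 0 ≤ ρ i := fun i => by have := hJ0 i; positivity
  have hρ1 : ∀ i, ρ i ≤ 1 := fun i => (div_le_one (hJ0 i)).2 (hJw i)
  -- Compression by M multiplies derivatives of order i ≤ r by M^i ≤ M^r. As the supports are
  -- disjoint, sums of bumps obey the same bounds as single bumps.
  set a := θ / (M : ℝ) ^ r with ha
  have ha0 : 0 < a := by positivity
  refine ⟨fun i x => a * ρ i * bump D ((M : ℝ) • P.coordsH D (P.Im x) - center i),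
    fun y hy => ?_, fun x => ?_, fun y => ?_⟩
  · set g : (Fin D → ℝ) → ℝ := fun u => ∑ i, (y i * (a * ρ i)) • bump D (u - center i) with hg
    have hcb : ∀ i : Fin D → Fin M, ContDiff ℝ r fun u : Fin D → ℝ => bump D (u - center i) :=
      fun i => (bump D).contDiff.comp (contDiff_id.sub contDiff_const)
    have hgc : ContDiff ℝ r g := ContDiff.sum fun i _ => (hcb i).const_smul _
    have hQ : ‖(M : ℝ) • P.coordsH D‖ ≤ M := by
      rw [norm_smul, Real.norm_of_nonneg (by positivity)]
      have := P.norm_coordsH_le D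
      nlinarith
    have hmem := P.comp_mem_F ((M : ℝ) • P.coordsH D) hQ (le_max_right 1 _) hΛ1 hr hgc
      (κ := fun _ => a * κ) (K := K) ?_ ?_
    · convert hmem using 2 with x
      simp only [hg, smul_eq_mul, smul_apply]
      refine Finset.sum_congr rfl fun i _ => by ring
    · intro j hj u
      have e : iteratedFDeriv ℝ j g u = ∑ i, (y i * (a * ρ i)) •
          iteratedFDeriv ℝ j (fun u => bump D (u - center i)) u := by
        rw [hg, iteratedFDeriv_fun_sum_apply fun i _ =>
          ((hcb i).const_smul (y i * (a * ρ i))).of_le (by exact_mod_cast hj) |>.contDiffAt]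
        refine Finset.sum_congr rfl fun i _ => ?_
        exact iteratedFDeriv_const_smul_apply' ((hcb i).of_le (by exact_mod_cast hj)).contDiffAt
      obtain ⟨i₀, hi₀⟩ := exists_unique_bump (D := D) hM j u
      rw [e]
      refine norm_sum_le_of_unique (i₀ := i₀) (fun i hi => by rw [hi₀ i hi, smul_zero]) ?_
      rw [norm_smul, iteratedFDeriv_comp_sub]
      have h1 := hκ' j hj (u - center i₀)
      have h2 : ‖y i₀ * (a * ρ i₀)‖ ≤ a := by
        rw [norm_mul, Real.norm_eq_abs, Real.norm_of_nonneg (mul_nonneg ha0.le (hρ0 _))]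
        calc |y i₀| * (a * ρ i₀) ≤ 1 * (a * 1) := by
              have := hy i₀
              have := hρ1 i₀
              have := hρ0 i₀
              gcongr
          _ = a := by ring
      gcongr
    · intro i hi
      refine le_trans ?_ (hmK i hi)
      rw [ha, hθ, mul_pow]
      have h1 : Λ ^ i ≤ Λ ^ r := pow_le_pow_right₀ hΛ1 hi
      have h2 : (M : ℝ) ^ i ≤ (M : ℝ) ^ r := pow_le_pow_right₀ hM1 hi
      calc m / (κ * Λ ^ r) / (M : ℝ) ^ r * κ * ((M : ℝ) ^ i * Λ ^ i)
          ≤ m / (κ * Λ ^ r) / (M : ℝ) ^ r * κ * ((M : ℝ) ^ r * Λ ^ r) := by gcongr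
        _ = m := by field_simp
  · obtain ⟨i₀, hi₀⟩ := exists_unique_bump (D := D) hM 0 ((M : ℝ) • P.coordsH D (P.Im x))
    refine ⟨i₀, fun i hi => ?_⟩
    have h := congrArg (fun q => q fun _ => 0) (hi₀ i hi)
    simp only [iteratedFDeriv_zero_apply, zero_apply] at h
    exact mul_eq_zero_of_right _ h
  · have hint : ∀ i : Fin D → Fin M, Integrable
        (fun x => bump D ((M : ℝ) • P.coordsH D (P.Im x) - center i)) P.μ := fun i =>
      Integrable.of_bound ((bump D).continuous.comp (by fun_prop)).aestronglyMeasurable 1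
        (ae_of_all _ fun x => by
          rw [Real.norm_of_nonneg (bump D).nonneg]
          exact (bump D).le_one)
    rw [I, integral_finsetSum _ fun i _ => ((hint i).const_mul _).const_mul _, Finset.mul_sum]
    refine Finset.sum_congr rfl fun i _ => ?_
    rw [integral_const_mul, integral_const_mul]
    change y i * (a * ρ i * J i) = _
    have := (hJ0 i).ne'
    rw [hρ, ha, pow_add]
    field_simp

end Setting

/-! ### Classical lower bounds: untouched coefficients and random signs -/

section

variable {d : ℕ} {ι : Type} [Fintype ι] [DecidableEq ι]

/-- The combination of the functions `β i` with coefficients `y i`. -/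
def combination (β : ι → (Fin d → ℝ) → ℝ) (y : ι → ℝ) (t : Fin d → ℝ) : ℝ := ∑ i, y i * β i t

/-- At every point, at most one of the functions does not vanish. -/
def Disjointed (β : ι → (Fin d → ℝ) → ℝ) : Prop := ∀ t, ∃ i₀, ∀ i ≠ i₀, β i t = 0

theorem combination_eq {β : ι → (Fin d → ℝ) → ℝ} {t : Fin d → ℝ} {i₀ : ι}
    (h : ∀ i ≠ i₀, β i t = 0) (y : ι → ℝ) : combination β y t = y i₀ * β i₀ t :=
  Finset.sum_eq_single i₀ (fun i _ hi => by rw [h i hi, mul_zero]) (by simp)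

/-- A deterministic program does not notice changes of coefficients that it does not touch. -/
theorem RealProg.exists_untouched {β : ι → (Fin d → ℝ) → ℝ} (hβ : Disjointed β) (p : RealProg d) :
    ∀ m : List ℝ, ∃ T : Finset ι, T.card ≤ p.values (combination β 0) m ∧
      ∀ y : ι → ℝ, (∀ i ∈ T, y i = 0) →
        p.run (combination β y) m = p.run (combination β 0) m := by
  induction p with
  | output i => exact fun m => ⟨∅, by simp, fun y _ => rfl⟩
  | const a p ih => exact fun m => ih (a :: m)
  | arith o i j p ih => exact fun m => ih _
  | branch i j p q ihp ihq =>
    intro m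
    by_cases h : m.getD i 0 ≤ m.getD j 0
    · obtain ⟨T, hT, h'⟩ := ihp m
      refine ⟨T, ?_, fun y hy => ?_⟩
      · simpa only [RealProg.values, if_pos h] using hT
      · simpa only [RealProg.run, if_pos h] using h' y hy
    · obtain ⟨T, hT, h'⟩ := ihq m
      refine ⟨T, ?_, fun y hy => ?_⟩
      · simpa only [RealProg.values, if_neg h] using hT
      · simpa only [RealProg.run, if_neg h] using h' y hy
  | value t p ih =>
    intro m
    -- At the point u at most one of the functions is nonzero, so this value reveals at most one
    -- coefficient, which is added to the touched set.
    set u : Fin d → ℝ := fun i => m.getD (t i) 0 with hu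
    obtain ⟨i₀, hi₀⟩ := hβ u
    obtain ⟨T, hT, h⟩ := ih (combination β 0 u :: m)
    refine ⟨insert i₀ T, ?_, fun y hy => ?_⟩
    · exact (Finset.card_insert_le _ _).trans (Nat.succ_le_succ hT)
    · have e : combination β y u = combination β 0 u := by
        rw [combination_eq hi₀, combination_eq hi₀, hy i₀ (Finset.mem_insert_self _ _)]
        rfl
      change p.run _ (combination β y u :: m) = p.run _ (combination β 0 u :: m)
      rw [e]
      exact h y fun i hi => hy i (Finset.mem_insert_of_mem hi)

/-- A deterministic program that computes `α ∑ y i` up to `ε` uses many function values. -/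
theorem RealProg.le_values {β : ι → (Fin d → ℝ) → ℝ} (hβ : Disjointed β) (p : RealProg d)
    {α ε : ℝ} (hα : 0 < α) (h : ∀ y : ι → ℝ, (∀ i, |y i| ≤ 1) →
      |α * ∑ i, y i - p.run (combination β y) []| ≤ ε) :
    Fintype.card ι - 2 * ε / α ≤ p.values (combination β 0) [] := by
  obtain ⟨T, hT, hT'⟩ := p.exists_untouched hβ []
  -- The largest change that the program cannot see: its output is the same as for y = 0, so α times
  -- the number of untouched coefficients is at most 2ε.
  set y : ι → ℝ := fun i => if i ∈ T then 0 else 1 with hy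
  have h1 := h y fun i => by by_cases hi : i ∈ T <;> simp [hy, hi]
  have h2 := h 0 fun i => by simp
  rw [hT' y fun i hi => by simp [hy, hi]] at h1
  have h3 : ∑ i, y i = Fintype.card ι - T.card := by
    have : ∑ i, y i = (Tᶜ.card : ℝ) := by
      rw [Finset.card_eq_sum_ones, Nat.cast_sum, ← Finset.sum_subset (Finset.subset_univ Tᶜ)]
      · refine Finset.sum_congr rfl fun i hi => ?_
        rw [Finset.mem_compl] at hi
        simp [hy, hi]
      · intro i _ hi
        rw [Finset.mem_compl, not_not] at hi
        simp [hy, hi]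
    rw [this, Finset.card_compl, Nat.cast_sub (Finset.card_le_univ T)]
  have h4 : (∑ i, (0 : ι → ℝ) i) = 0 := by simp
  rw [h4] at h2
  rw [abs_le] at h1 h2
  have h5 : α * ∑ i, y i ≤ 2 * ε := by linarith [h1.2, h2.1]
  have h6 : ∑ i, y i ≤ 2 * ε / α := by rw [le_div_iff₀ hα]; linarith
  have h7 : (T.card : ℝ) ≤ p.values (combination β 0) [] := by exact_mod_cast hT
  linarith

/-- The set of the signs. -/
def signs : Finset ℝ := {1, -1}

/-- The cosine is the real part of a product of exponentials, so the sum over the cube factorizes. A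
fixed coordinate contributes modulus 1, and a free one contributes 2|cos l|. -/
theorem cos_le_of_cube (t : ι → Finset ℝ) (ht : ∀ i, t i = {1} ∨ t i = {-1} ∨ t i = signs)
    (l a : ℝ) : ∑ y ∈ Fintype.piFinset t, Real.cos (l * ∑ i, y i - a) ≤
      (Fintype.piFinset t).card * |Real.cos l| ^ (Finset.univ.filter fun i => t i = signs).card := by
  have h1 : ∑ y ∈ Fintype.piFinset t, Real.cos (l * ∑ i, y i - a) =
      (Complex.exp (-(a : ℂ) * Complex.I) * ∏ i, ∑ s ∈ t i,
        Complex.exp (((l * s : ℝ) : ℂ) * Complex.I)).re := by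
    rw [Finset.prod_univ_sum, Finset.mul_sum, Complex.re_sum]
    refine Finset.sum_congr rfl fun y _ => ?_
    rw [← Complex.exp_sum, ← Complex.exp_add]
    have e : -(a : ℂ) * Complex.I + ∑ i, ((l * y i : ℝ) : ℂ) * Complex.I =
        ((l * ∑ i, y i - a : ℝ) : ℂ) * Complex.I := by
      push_cast
      rw [← Finset.sum_mul, ← Finset.mul_sum]
      ring
    rw [e, Complex.exp_ofReal_mul_I_re]
  rw [h1]
  refine (Complex.re_le_norm _).trans ?_
  have e : -(a : ℂ) * Complex.I = ((-a : ℝ) : ℂ) * Complex.I := by push_cast; ring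
  rw [norm_mul, e, Complex.norm_exp_ofReal_mul_I, one_mul, norm_prod, Fintype.card_piFinset,
    Nat.cast_prod, Finset.card_filter, ← Finset.prod_pow_eq_pow_sum, ← Finset.prod_mul_distrib]
  refine Finset.prod_le_prod (fun i _ => norm_nonneg _) fun i _ => ?_
  have hs : signs ≠ {1} := by
    intro h
    have : (-1 : ℝ) ∈ ({1} : Finset ℝ) := h ▸ (by simp [signs])
    norm_num at this
  have hs' : signs ≠ {-1} := by
    intro h
    have : (1 : ℝ) ∈ ({-1} : Finset ℝ) := h ▸ (by simp [signs])
    norm_num at this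
  rcases ht i with h | h | h
  · rw [h, if_neg hs.symm]
    simp [Complex.norm_exp_ofReal_mul_I, -Complex.ofReal_mul]
  · rw [h, if_neg hs'.symm, Finset.sum_singleton, Complex.norm_exp_ofReal_mul_I]
    simp
  · rw [h, if_pos rfl, pow_one, signs, Finset.sum_pair (by norm_num),
      Finset.card_pair (by norm_num)]
    have e1 : Complex.exp (((l * 1 : ℝ) : ℂ) * Complex.I) +
        Complex.exp (((l * -1 : ℝ) : ℂ) * Complex.I) = ((2 * Real.cos l : ℝ) : ℂ) := by
      rw [mul_one, mul_neg_one]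
      push_cast
      rw [Complex.cos]
      ring_nf
    rw [e1, Complex.norm_real, norm_mul]
    simp

/-- The mean distance of a random sum of signs from a fixed number. -/
theorem le_sum_abs_sub_of_cube (t : ι → Finset ℝ) (ht : ∀ i, t i = {1} ∨ t i = {-1} ∨ t i = signs)
    {l α : ℝ} (hl : 0 < l) (hα : 0 ≤ α) (a : ℝ) :
    (Fintype.piFinset t).card * (α / l *
      (1 - |Real.cos l| ^ (Finset.univ.filter fun i => t i = signs).card)) ≤
      ∑ y ∈ Fintype.piFinset t, |α * ∑ i, y i - a| := by
  rcases hα.eq_or_lt with rfl | hα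
  · simp only [zero_div, zero_mul, mul_zero]
    exact Finset.sum_nonneg fun _ _ => abs_nonneg _
  -- The inequality |u| ≥ 1 - cos u trades the distance for a trigonometric function whose mean over
  -- the cube can be computed.
  have hb : ∀ y : ι → ℝ, α / l * (1 - Real.cos (l * ∑ i, y i - l * (a / α))) ≤
      |α * ∑ i, y i - a| := by
    intro y
    set u := l * ∑ i, y i - l * (a / α) with hu
    have e : α * ∑ i, y i - a = α / l * u := by rw [hu]; field_simp
    rw [e, abs_mul, abs_of_pos (by positivity : 0 < α / l)]
    gcongr
    have h2 := Real.lipschitzWith_cos.dist_le_mul u 0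
    simp only [Real.dist_eq, Real.cos_zero, sub_zero, NNReal.coe_one, one_mul] at h2
    linarith [neg_abs_le (Real.cos u - 1)]
  refine le_trans ?_ (Finset.sum_le_sum fun y _ => hb y)
  rw [← Finset.mul_sum, Finset.sum_sub_distrib, Finset.sum_const, nsmul_eq_mul, mul_one]
  have h1 := cos_le_of_cube t ht l (l * (a / α))
  rw [mul_left_comm]
  gcongr
  linarith

/-- A program that computes `α ∑ y i` has, on the average over all signs, a large error or many
function values. -/
theorem RealProg.le_sum_abs_add_values {β : ι → (Fin d → ℝ) → ℝ} (hβ : Disjointed β)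
    {α l b φ : ℝ} (hα : 0 ≤ α) (hl : 0 < l) (hb : 0 ≤ b)
    (hφ : ∀ s ≤ Fintype.card ι, φ - b * (Fintype.card ι - s) ≤ α / l * (1 - |Real.cos l| ^ s))
    (p : RealProg d) : ∀ (m : List ℝ) (t : ι → Finset ℝ),
      (∀ i, t i = {1} ∨ t i = {-1} ∨ t i = signs) →
      (Fintype.piFinset t).card *
        (φ - b * (Fintype.card ι - (Finset.univ.filter fun i => t i = signs).card)) ≤
      ∑ y ∈ Fintype.piFinset t, (|α * ∑ i, y i - p.run (combination β y) m| +
        b * p.values (combination β y) m) := by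
  -- The subcube t records what is known, and the memory m is the same for all y in it, so all of
  -- them take the same branch. A value that reveals a free sign halves the cube. The potential φ -
  -- b(n - s), with s free signs, drops by b, which is what b times one function value pays for. At
  -- an output, `le_sum_abs_sub_of_cube` bounds the error.
  induction p with
  | output i =>
    intro m t ht
    have h := le_sum_abs_sub_of_cube t ht hl hα (m.getD i 0)
    refine (mul_le_mul_of_nonneg_left (hφ _ (Finset.card_le_univ _)) (by positivity)).trans
      (h.trans (le_of_eq ?_))
    refine Finset.sum_congr rfl fun y _ => ?_
    simp [RealProg.run, RealProg.values]
  | const a p ih => exact fun m t ht => ih (a :: m) t ht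
  | arith o i j p ih => exact fun m t ht => ih _ t ht
  | branch i j p q ihp ihq =>
    intro m t ht
    by_cases h : m.getD i 0 ≤ m.getD j 0
    · simpa only [RealProg.run, RealProg.values, if_pos h] using ihp m t ht
    · simpa only [RealProg.run, RealProg.values, if_neg h] using ihq m t ht
  | value τ p ih =>
    intro m t ht
    set u : Fin d → ℝ := fun i => m.getD (τ i) 0 with hu
    obtain ⟨i₀, hi₀⟩ := hβ u
    -- the case of a coefficient that is known
    have known : ∀ (t : ι → Finset ℝ), (∀ i, t i = {1} ∨ t i = {-1} ∨ t i = signs) →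
        ∀ s : ℝ, t i₀ = {s} → (Fintype.piFinset t).card *
        (φ - b * (Fintype.card ι - (Finset.univ.filter fun i => t i = signs).card) + b) ≤
        ∑ y ∈ Fintype.piFinset t, (|α * ∑ i, y i - (RealProg.value τ p).run (combination β y) m| +
          b * (RealProg.value τ p).values (combination β y) m) := by
      intro t ht s hs
      have h := ih (s * β i₀ u :: m) t ht
      rw [mul_add, ← nsmul_eq_mul (Fintype.piFinset t).card b, ← Finset.sum_const]
      refine (add_le_add_left h _).trans (le_of_eq ?_)
      rw [← Finset.sum_add_distrib]
      refine Finset.sum_congr rfl fun y hy => ?_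
      have hy0 : y i₀ = s := by
        have := Fintype.mem_piFinset.1 hy i₀
        rwa [hs, Finset.mem_singleton] at this
      have e : combination β y u = s * β i₀ u := by rw [combination_eq hi₀, hy0]
      simp only [RealProg.run, RealProg.values]
      rw [← hu, e]
      push_cast
      ring
    rcases ht i₀ with h | h | h
    · refine le_trans ?_ (known t ht 1 h)
      gcongr
      linarith
    · refine le_trans ?_ (known t ht (-1) h)
      gcongr
      linarith
    · have hne : ∀ s : ℝ, ({s} : Finset ℝ) ≠ signs := by
        intro s hs
        have h1 := congrArg Finset.card hs
        rw [signs, Finset.card_pair (by norm_num), Finset.card_singleton] at h1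
        omega
      have hsplit : ∀ F : (ι → ℝ) → ℝ, ∑ y ∈ Fintype.piFinset t, F y =
          ∑ y ∈ Fintype.piFinset (Function.update t i₀ {1}), F y +
          ∑ y ∈ Fintype.piFinset (Function.update t i₀ {-1}), F y := by
        intro F
        rw [← Finset.sum_union]
        · refine Finset.sum_congr ?_ fun _ _ => rfl
          ext y
          simp only [Finset.mem_union, Fintype.mem_piFinset]
          constructor
          · intro hy
            have h0 := hy i₀
            rw [h, signs, Finset.mem_insert, Finset.mem_singleton] at h0
            refine h0.imp (fun h0 i => ?_) (fun h0 i => ?_) <;>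
            · rcases eq_or_ne i i₀ with rfl | hi
              · simp [h0]
              · simpa [hi] using hy i
          · rintro (hy | hy) i <;>
            · rcases eq_or_ne i i₀ with rfl | hi
              · have := hy i
                rw [Function.update_self, Finset.mem_singleton] at this
                simp [h, signs, this]
              · simpa [hi] using hy i
        · rw [Finset.disjoint_left]
          intro y hy hy'
          have h1 := Fintype.mem_piFinset.1 hy i₀
          have h2 := Fintype.mem_piFinset.1 hy' i₀
          rw [Function.update_self, Finset.mem_singleton] at h1 h2
          rw [h1] at h2
          norm_num at h2
      have hcard : ∀ s : ℝ,
          ((Finset.univ.filter fun i => Function.update t i₀ {s} i = signs).card : ℝ) =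
          (Finset.univ.filter fun i => t i = signs).card - 1 := by
        intro s
        have e : (Finset.univ.filter fun i => Function.update t i₀ {s} i = signs) =
            (Finset.univ.filter fun i => t i = signs).erase i₀ := by
          ext i
          rcases eq_or_ne i i₀ with rfl | hi
          · simp [hne]
          · simp [hi]
        have hm : i₀ ∈ Finset.univ.filter fun i => t i = signs := by simp [h]
        rw [e, Finset.card_erase_of_mem hm, Nat.cast_sub (Finset.card_pos.2 ⟨_, hm⟩)]
        simp
      have hvalid : ∀ s : ℝ, s = 1 ∨ s = -1 → ∀ i, Function.update t i₀ {s} i = {1} ∨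
          Function.update t i₀ {s} i = {-1} ∨ Function.update t i₀ {s} i = signs := by
        intro s hs i
        rcases eq_or_ne i i₀ with rfl | hi
        · rw [Function.update_self]
          rcases hs with rfl | rfl <;> simp
        · rw [Function.update_of_ne hi]
          exact ht i
      have k1 := known _ (hvalid 1 (.inl rfl)) 1 (Function.update_self ..)
      have k2 := known _ (hvalid (-1) (.inr rfl)) (-1) (Function.update_self ..)
      rw [hcard] at k1 k2
      have hc := hsplit fun _ => 1
      simp only [Finset.sum_const, nsmul_eq_mul, mul_one] at hc
      rw [hsplit, hc, add_mul]
      refine (add_le_add ?_ ?_).trans (add_le_add k1 k2) <;>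
      · gcongr
        linarith

end

/-! ### The quantum lower bound: norm preservation and functions of few bits -/

section Norm

/-- Change one bit. -/
def flipBit {m : ℕ} (j : Fin m) (b : Bits m) : Bits m := Function.update b j (!(b j))

theorem flipBit_flipBit {m : ℕ} (j : Fin m) (b : Bits m) : flipBit j (flipBit j b) = b := by
  simp [flipBit]

theorem two_mul_sum_bits {m : ℕ} (j : Fin m) (f : Bits m → ℝ) :
    2 * ∑ b, f b = ∑ b, ∑ a : Bool, f (Function.update b j a) := by
  have h1 : ∑ b, f (flipBit j b) = ∑ b, f b :=
    Equiv.sum_comp (Function.Involutive.toPerm _ (flipBit_flipBit j)) f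
  rw [two_mul]
  nth_rewrite 2 [← h1]
  rw [← Finset.sum_add_distrib]
  refine Finset.sum_congr rfl fun b _ => ?_
  rw [Fintype.sum_bool]
  have e : Function.update b j (b j) = b := Function.update_eq_self j b
  cases h : b j
  · rw [h] at e
    rw [e, flipBit, h, add_comm]
    rfl
  · rw [h] at e
    rw [e, flipBit, h]
    rfl

theorem sum_norm_sq_unitary (u : Matrix.unitaryGroup Bool ℂ) (w : Bool → ℂ) :
    ∑ a, ‖∑ v, (u : Matrix Bool Bool ℂ) a v * w v‖ ^ 2 = ∑ v, ‖w v‖ ^ 2 := by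
  have h : star (((u : Matrix Bool Bool ℂ).mulVec w)) ⬝ᵥ ((u : Matrix Bool Bool ℂ).mulVec w) =
      star w ⬝ᵥ w := by
    rw [Matrix.star_mulVec, Matrix.dotProduct_mulVec, Matrix.vecMul_vecMul]
    have : (u : Matrix Bool Bool ℂ).conjTranspose * (u : Matrix Bool Bool ℂ) = 1 :=
      Matrix.mem_unitaryGroup_iff'.1 u.2
    rw [this, Matrix.vecMul_one]
  have e : ∀ w : Bool → ℂ, star w ⬝ᵥ w = ((∑ v, ‖w v‖ ^ 2 : ℝ) : ℂ) := by
    intro w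
    rw [dotProduct, Complex.ofReal_sum]
    refine Finset.sum_congr rfl fun v _ => ?_
    rw [Pi.star_apply, Complex.star_def, Complex.conj_mul']
    push_cast
    rfl
  rw [e, e] at h
  exact_mod_cast h

theorem Gate.sum_norm_sq_act {m : ℕ} (u : Gate m) (ψ : Bits m → ℂ) :
    ∑ b, ‖u.act ψ b‖ ^ 2 = ∑ b, ‖ψ b‖ ^ 2 := by
  cases u with
  | single j u =>
    have h : ∀ f : Bits m → ℝ, ∑ b, f b = (∑ b, ∑ a : Bool, f (Function.update b j a)) / 2 :=
      fun f => by rw [← two_mul_sum_bits j f]; ring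
    rw [h, h fun b => ‖ψ b‖ ^ 2]
    congr 1
    refine Finset.sum_congr rfl fun b _ => ?_
    rw [← sum_norm_sq_unitary u fun v => ψ (Function.update b j v)]
    refine Finset.sum_congr rfl fun a _ => ?_
    simp only [Gate.act, Function.update_self, Function.update_idem]
  | cnot i j hne =>
    rw [← Equiv.sum_comp (Function.Involutive.toPerm _ (QuantumAlg.cnotPerm_cnotPerm hne))
      fun b => ‖ψ b‖ ^ 2]
    refine Finset.sum_congr rfl fun b _ => ?_
    change ‖ψ _‖ ^ 2 = ‖ψ (QuantumAlg.cnotPerm i j b)‖ ^ 2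
    congr 3
    rw [QuantumAlg.cnotPerm]
    cases h : b i <;> simp

variable {d : ℕ} (A : QuantumAlg d)

theorem QuantumAlg.xorValue_xorValue (v : Bits A.nValue) (b : Bits A.qubits) :
    A.xorValue v (A.xorValue v b) = b := by
  funext q
  simp [QuantumAlg.xorValue]

theorem QuantumAlg.xorValue_index (v : Bits A.nValue) (b : Bits A.qubits) (i : Fin A.nIndex) :
    A.xorValue v b (A.index i) = b (A.index i) := by
  have : ¬∃ j, A.value j = A.index i ∧ v j = true := fun ⟨j, hj, _⟩ => A.disjoint i j hj.symm
  simp [QuantumAlg.xorValue, this]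

theorem QuantumAlg.sum_norm_sq_stepAct (g : (Fin d → ℝ) → ℝ) (s : Step A.qubits)
    (ψ : Bits A.qubits → ℂ) : ∑ b, ‖A.stepAct g s ψ b‖ ^ 2 = ∑ b, ‖ψ b‖ ^ 2 := by
  cases s with
  | gate u => exact u.sum_norm_sq_act ψ
  | query =>
    have hinv : Function.Involutive fun b : Bits A.qubits =>
        A.xorValue (A.code (g (A.point fun i => b (A.index i)))) b := by
      intro b
      simp only [QuantumAlg.xorValue_index, QuantumAlg.xorValue_xorValue]
    exact Equiv.sum_comp hinv.toPerm fun b => ‖ψ b‖ ^ 2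

theorem QuantumAlg.sum_norm_sq_final (g : (Fin d → ℝ) → ℝ) : ∑ b, ‖A.final g b‖ ^ 2 = 1 := by
  have h : ∀ (l : List (Step A.qubits)) (ψ : Bits A.qubits → ℂ),
      ∑ b, ‖l.foldl (fun ψ s => A.stepAct g s ψ) ψ b‖ ^ 2 = ∑ b, ‖ψ b‖ ^ 2 := by
    intro l
    induction l with
    | nil => exact fun _ => rfl
    | cons s l ih => exact fun ψ => (ih _).trans (A.sum_norm_sq_stepAct g s ψ)
  rw [QuantumAlg.final, h, Finset.sum_eq_single fun _ => false]
  · simp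
  · intro b _ hb
    rw [Pi.single_eq_of_ne hb]
    simp
  · simp

theorem QuantumAlg.prob_add_prob_le (g : (Fin d → ℝ) → ℝ) {S T : Set ℝ} (h : Disjoint S T) :
    A.prob g S + A.prob g T ≤ 1 := by
  classical
  rw [← A.sum_norm_sq_final g, QuantumAlg.prob, QuantumAlg.prob, ← Finset.sum_add_distrib]
  refine Finset.sum_le_sum fun b _ => ?_
  have h0 : 0 ≤ ‖A.final g b‖ ^ 2 := sq_nonneg _
  by_cases hS : A.decode b ∈ S
  · rw [if_pos hS, if_neg (Set.disjoint_left.1 h hS), add_zero]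
  · rw [if_neg hS, zero_add]
    split_ifs <;> linarith

theorem QuantumAlg.prob_mono (g : (Fin d → ℝ) → ℝ) {S T : Set ℝ} (h : S ⊆ T) :
    A.prob g S ≤ A.prob g T := by
  classical
  refine Finset.sum_le_sum fun b _ => ?_
  by_cases hS : A.decode b ∈ S
  · rw [if_pos hS, if_pos (h hS)]
  · rw [if_neg hS]
    split_ifs <;> positivity

end Norm

section Junta

variable {ι : Type} [Fintype ι] [DecidableEq ι]

/-- The linear span of the functions of at most `k` bits. -/
def juntaSpan (ι : Type) [Fintype ι] [DecidableEq ι] (k : ℕ) : Submodule ℂ ((ι → Bool) → ℂ) :=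
  Submodule.span ℂ {F | ∃ S : Finset ι, S.card ≤ k ∧ DependsOn F (S : Set ι)}

theorem const_mem_juntaSpan (a : ℂ) (k : ℕ) : (fun _ : ι → Bool => a) ∈ juntaSpan ι k :=
  Submodule.subset_span ⟨∅, by simp, fun _ _ _ => rfl⟩

theorem mul_mem_juntaSpan {k l : ℕ} {F G : (ι → Bool) → ℂ} (hF : F ∈ juntaSpan ι k)
    (hG : G ∈ juntaSpan ι l) : F * G ∈ juntaSpan ι (k + l) := by
  have h := Submodule.mul_mem_mul hF hG
  rw [juntaSpan, juntaSpan, Submodule.span_mul_span] at h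
  refine Submodule.span_mono ?_ h
  rintro _ ⟨F, ⟨S, hS, hF⟩, G, ⟨T, hT, hG⟩, rfl⟩
  refine ⟨S ∪ T, (Finset.card_union_le S T).trans (add_le_add hS hT), fun x y hxy => ?_⟩
  rw [Finset.coe_union] at hxy
  simp only [Pi.mul_apply]
  rw [hF fun i hi => hxy i (.inl hi), hG fun i hi => hxy i (.inr hi)]

theorem star_mem_juntaSpan {k : ℕ} {F : (ι → Bool) → ℂ} (hF : F ∈ juntaSpan ι k) :
    (fun y => (starRingEnd ℂ) (F y)) ∈ juntaSpan ι k := by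
  induction hF using Submodule.span_induction with
  | mem F hF =>
    obtain ⟨S, hS, hF⟩ := hF
    exact Submodule.subset_span ⟨S, hS, fun x y hxy => by simp only [hF hxy]⟩
  | zero => simpa using const_mem_juntaSpan (ι := ι) 0 k
  | add F G _ _ hF hG => 
    have := add_mem hF hG
    convert this using 1
    funext y
    simp
  | smul a F _ hF =>
    have := Submodule.smul_mem _ ((starRingEnd ℂ) a) hF
    convert this using 1
    funext y
    simp

theorem ite_mem_juntaSpan (i : ι) {k : ℕ} {F G : (ι → Bool) → ℂ} (hF : F ∈ juntaSpan ι k)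
    (hG : G ∈ juntaSpan ι k) : (fun y => if y i then F y else G y) ∈ juntaSpan ι (k + 1) := by
  have h1 : ∀ a b : ℂ, (fun y : ι → Bool => if y i then a else b) ∈ juntaSpan ι 1 := fun a b =>
    Submodule.subset_span ⟨{i}, by simp, fun x y hxy => by
      simp only [hxy i (Finset.mem_coe.2 (Finset.mem_singleton_self i))]⟩
  have h2 := add_mem (mul_mem_juntaSpan hF (h1 1 0)) (mul_mem_juntaSpan hG (h1 0 1))
  convert h2 using 1
  funext y
  by_cases hy : y i <;> simp [hy]

/-- The parity of a vector of bits. -/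
def parity (y : ι → Bool) : ℝ := ∏ i, if y i then -1 else 1

/-- A function of less than all bits is not correlated with the parity. -/
theorem sum_parity_mul {k : ℕ} (hk : k < Fintype.card ι) {F : (ι → Bool) → ℂ}
    (hF : F ∈ juntaSpan ι k) : ∑ y, (parity y : ℂ) * F y = 0 := by
  induction hF using Submodule.span_induction with
  | mem F hF =>
    obtain ⟨S, hS, hF⟩ := hF
    obtain ⟨i, hi⟩ : ∃ i, i ∉ S := by
      by_contra! h
      rw [Finset.eq_univ_iff_forall.2 h, Finset.card_univ] at hS
      omega
    have hpar : ∀ y : ι → Bool, parity (Function.update y i (!(y i))) = -parity y := by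
      intro y
      rw [parity, parity, ← Finset.mul_prod_erase _ _ (Finset.mem_univ i),
        ← Finset.mul_prod_erase _ (fun i => if y i then (-1 : ℝ) else 1) (Finset.mem_univ i)]
      rw [Finset.prod_congr rfl fun j hj => by
        rw [Function.update_of_ne (Finset.ne_of_mem_erase hj)], Function.update_self]
      cases y i <;> simp
    refine Finset.sum_involution (fun y _ => Function.update y i (!(y i))) (fun y _ => ?_)
      (fun y _ _ h => ?_) (fun _ _ => Finset.mem_univ _) (fun y _ => by simp)
    · have : F (Function.update y i (!(y i))) = F y := hF fun j hj => by
        rw [Function.update_of_ne]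
        rintro rfl
        exact hi hj
      rw [hpar, this]
      push_cast
      ring
    · have := congrFun h i
      simp at this
  | zero => simp
  | add F G _ _ hF hG => simp only [Pi.add_apply, mul_add, Finset.sum_add_distrib, hF, hG, add_zero]
  | smul a F _ hF =>
    simp only [Pi.smul_apply, smul_eq_mul, mul_left_comm _ a]
    rw [← Finset.mul_sum, hF, mul_zero]

end Junta

section

variable {d : ℕ} {ι : Type} [Fintype ι] [DecidableEq ι]

/-- Bits as coefficients. -/
def bitCoef (y : ι → Bool) (i : ι) : ℝ := if y i then 1 else 0

/-- The amplitudes after `k` queries are combinations of functions of at most `k` bits. -/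
theorem QuantumAlg.foldl_mem_juntaSpan {β : ι → (Fin d → ℝ) → ℝ} (hβ : Disjointed β)
    (A : QuantumAlg d) (l : List (Step A.qubits)) : ∀ (k : ℕ) (ψ : (ι → Bool) → Bits A.qubits → ℂ),
      (∀ b, (fun y => ψ y b) ∈ juntaSpan ι k) → ∀ b,
      (fun y => l.foldl (fun ψ s => A.stepAct (combination β (bitCoef y)) s ψ) (ψ y) b) ∈
        juntaSpan ι (k + l.countP fun s => match s with
          | .query => true
          | .gate _ => false) := by
  induction l with
  | nil => exact fun k ψ h => h
  | cons s l ih =>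
    intro k ψ hψ b
    cases s with
    | gate u =>
      rw [List.countP_cons_of_neg (by simp)]
      refine ih k (fun y => u.act (ψ y)) (fun b => ?_) b
      cases u with
      | single j u =>
        have e : (fun y => (Gate.single j u).act (ψ y) b) =
            ∑ v : Bool, (u : Matrix Bool Bool ℂ) (b j) v •
              fun y => ψ y (Function.update b j v) := by
          funext y
          simp [Gate.act]
        rw [e]
        exact sum_mem fun v _ => Submodule.smul_mem _ _ (hψ _)
      | cnot i j hne => exact hψ _
    | query =>
      rw [List.countP_cons_of_pos (by simp), add_comm _ 1, ← add_assoc]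
      refine ih (k + 1) (fun y => A.queryAct (combination β (bitCoef y)) (ψ y)) (fun b => ?_) b
      -- On a fixed basis state the query asks at one point, where only the function with index i₀
      -- may be nonzero. The new amplitude is one of two old amplitudes, chosen by the bit i₀, so
      -- one query adds one bit.
      obtain ⟨i₀, hi₀⟩ := hβ (A.point fun i => b (A.index i))
      have h := ite_mem_juntaSpan i₀
        (hψ (A.xorValue (A.code (1 * β i₀ (A.point fun i => b (A.index i)))) b))
        (hψ (A.xorValue (A.code (0 * β i₀ (A.point fun i => b (A.index i)))) b))
      convert h using 1
      funext y
      simp only [QuantumAlg.queryAct]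
      rw [combination_eq hi₀, bitCoef]
      cases y i₀ <;> simp

/-- A probability is a sum of amplitudes times their conjugates, which doubles the number of bits.
-/
theorem QuantumAlg.prob_mem_juntaSpan {β : ι → (Fin d → ℝ) → ℝ} (hβ : Disjointed β)
    (A : QuantumAlg d) (S : Set ℝ) :
    (fun y => (A.prob (combination β (bitCoef y)) S : ℂ)) ∈
      juntaSpan ι (A.queries + A.queries) := by
  classical
  have h : ∀ b, (fun y => A.final (combination β (bitCoef y)) b) ∈ juntaSpan ι A.queries := by
    intro b
    have := A.foldl_mem_juntaSpan hβ A.steps 0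
      (fun _ => Pi.single (fun _ => false) 1) (fun b => const_mem_juntaSpan _ _) b
    rwa [zero_add] at this
  have e : (fun y => (A.prob (combination β (bitCoef y)) S : ℂ)) = ∑ b,
      (if A.decode b ∈ S then (1 : ℂ) else 0) •
      ((fun y => (starRingEnd ℂ) (A.final (combination β (bitCoef y)) b)) *
        fun y => A.final (combination β (bitCoef y)) b) := by
    funext y
    rw [QuantumAlg.prob, Finset.sum_apply, Complex.ofReal_sum]
    refine Finset.sum_congr rfl fun b _ => ?_
    rw [Pi.smul_apply, Pi.mul_apply, Complex.conj_mul', smul_eq_mul]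
    split_ifs <;> simp
  rw [e]
  exact sum_mem fun b _ => Submodule.smul_mem _ _ (mul_mem_juntaSpan (star_mem_juntaSpan (h b)) (h b))

/-- A quantum algorithm that counts bits exactly needs half as many queries as there are bits. -/
theorem QuantumAlg.le_two_mul_queries {β : ι → (Fin d → ℝ) → ℝ} (hβ : Disjointed β)
    (A : QuantumAlg d) {α ε : ℝ} (hε : 2 * ε < α)
    (h : ∀ y : ι → Bool, 3 / 4 ≤
      A.prob (combination β (bitCoef y)) {z | |α * ∑ i, bitCoef y i - z| ≤ ε}) :
    Fintype.card ι ≤ 2 * A.queries := by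
  by_contra! hlt
  -- Because 2ε < α, an output that is correct for an odd count is not in E. The probability of E is
  -- thus at least 3/4 for even and at most 1/4 for odd counts, so its deviation from 1/2 correlates
  -- positively with the parity. This is impossible for functions of too few bits.
  set E : Set ℝ := {z | ∃ k : ℕ, Even k ∧ |α * k - z| ≤ ε} with hE
  have hsum : ∀ y : ι → Bool, ∑ i, bitCoef y i = ((Finset.univ.filter fun i => y i).card : ℝ) := by
    intro y
    simp [bitCoef]
  have hpar : ∀ y : ι → Bool, parity y = (-1) ^ (Finset.univ.filter fun i => y i).card := by
    intro y
    rw [parity, Finset.prod_ite]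
    simp
  have hpos : ∀ y : ι → Bool, 1 / 4 ≤
      parity y * (A.prob (combination β (bitCoef y)) E - 1 / 2) := by
    intro y
    have hy := h y
    rw [hsum] at hy
    set c := (Finset.univ.filter fun i => y i).card with hc
    rcases Nat.even_or_odd c with he | ho
    · rw [hpar, ← hc, he.neg_one_pow, one_mul]
      have := A.prob_mono (combination β (bitCoef y)) (S := {z | |α * c - z| ≤ ε}) (T := E)
        fun z hz => ⟨c, he, hz⟩
      linarith
    · rw [hpar, ← hc, ho.neg_one_pow]
      have hd : Disjoint {z : ℝ | |α * c - z| ≤ ε} E := by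
        rw [Set.disjoint_left]
        rintro z hz ⟨k, hk, hkz⟩
        have hne : (c : ℤ) - k ≠ 0 := by
          intro h0
          have : c = k := by omega
          rw [this] at ho
          exact (Nat.not_even_iff_odd.2 ho) hk
        have h1 : (1 : ℝ) ≤ |(c : ℝ) - k| := by exact_mod_cast Int.one_le_abs hne
        have h2 : α * |(c : ℝ) - k| ≤ 2 * ε := by
          have hα : 0 ≤ α := by
            have := (abs_nonneg _).trans hkz
            linarith
          have e0 : α * |(c : ℝ) - k| = |α * ((c : ℝ) - k)| := by rw [abs_mul, abs_of_nonneg hα]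
          rw [e0]
          have e : α * ((c : ℝ) - k) = (α * c - z) - (α * k - z) := by ring
          rw [e]
          refine (abs_sub _ _).trans ?_
          have : |α * c - z| ≤ ε := hz
          linarith
        have hε0 : 0 ≤ ε := (abs_nonneg _).trans hkz
        nlinarith
      have := A.prob_add_prob_le (combination β (bitCoef y)) hd
      linarith
  have h0 : ∑ y : ι → Bool, parity y * (A.prob (combination β (bitCoef y)) E - 1 / 2) = 0 := by
    have hm : (fun y => ((A.prob (combination β (bitCoef y)) E - 1 / 2 : ℝ) : ℂ)) ∈
        juntaSpan ι (A.queries + A.queries) := by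
      have := sub_mem (A.prob_mem_juntaSpan hβ E)
        (const_mem_juntaSpan (ι := ι) (1 / 2) (A.queries + A.queries))
      convert this using 1
      funext y
      simp
    have := sum_parity_mul (by omega) hm
    exact_mod_cast this
  have h1 : (0 : ℝ) < ∑ y : ι → Bool, parity y * (A.prob (combination β (bitCoef y)) E - 1 / 2) :=
    Finset.sum_pos (fun y _ => by linarith [hpos y]) Finset.univ_nonempty
  linarith

end

/-! ### The randomized lower bound for sums of signs -/

/-- The constant in the lower bound for randomized algorithms. -/
def signConst : ℝ := 1 - Real.exp (-(1 / Real.pi ^ 2))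

theorem signConst_pos : 0 < signConst := by
  rw [signConst, sub_pos, Real.exp_lt_one_iff, neg_lt_zero]
  positivity

/-- For |l| ≤ π, cos l ≤ exp(-2l^2/π^2). With l^2 = 1/n and s ≥ n/2 free signs, the power s is at
most exp(-1/π^2). -/
theorem signConst_le {n s : ℕ} (hn : 1 ≤ n) (hs : n ≤ 2 * s) :
    signConst ≤ 1 - |Real.cos (1 / Real.sqrt n)| ^ s := by
  have hn0 : (0 : ℝ) < n := by exact_mod_cast hn
  have hn1 : (1 : ℝ) ≤ n := by exact_mod_cast hn
  set l := 1 / Real.sqrt n with hl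
  have hl0 : 0 < l := by positivity
  have hl1 : l ≤ 1 := by
    rw [hl, div_le_one (by positivity)]
    exact Real.one_le_sqrt.2 hn1
  have hl2 : l ^ 2 = 1 / n := by rw [hl, div_pow, Real.sq_sqrt hn0.le, one_pow]
  have hpi := Real.pi_gt_three
  have hcos0 : 0 ≤ Real.cos l :=
    Real.cos_nonneg_of_mem_Icc ⟨by linarith, by linarith⟩
  have h1 : Real.cos l ≤ Real.exp (-(2 / Real.pi ^ 2 * l ^ 2)) := by
    have h2 := Real.cos_le_one_sub_mul_cos_sq (x := l) (by rw [abs_of_pos hl0]; linarith)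
    have h3 := Real.add_one_le_exp (-(2 / Real.pi ^ 2 * l ^ 2))
    linarith
  rw [abs_of_nonneg hcos0, signConst]
  gcongr
  refine (pow_le_pow_left₀ hcos0 h1 s).trans ?_
  rw [← Real.exp_nat_mul, Real.exp_le_exp, hl2]
  have h4 : (n : ℝ) ≤ 2 * s := by exact_mod_cast hs
  have h5 : (s : ℝ) * -(2 / Real.pi ^ 2 * (1 / n)) = -(2 * s / n * (1 / Real.pi ^ 2)) := by ring
  rw [h5, neg_le_neg_iff]
  have h6 : 1 ≤ 2 * (s : ℝ) / n := by rwa [le_div_iff₀ hn0, one_mul]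
  exact le_mul_of_one_le_left (by positivity) h6

section

variable {d : ℕ} {ι : Type} [Fintype ι] [DecidableEq ι]

/-- A randomized algorithm that computes sums of signs needs many function values. -/
theorem RandomProg.le_values {β : ι → (Fin d → ℝ) → ℝ} (hβ : Disjointed β) (A : RandomProg d)
    (hn : 1 ≤ Fintype.card ι) {α ε : ℝ} (hα : 0 < α)
    (hε : 2 * ε ≤ signConst * α * Real.sqrt (Fintype.card ι)) {N : ℝ≥0∞}
    (hmeas : ∀ y : ι → ℝ, (∀ i, |y i| ≤ 1) → A.MeasurableOn (combination β y))
    (herr : ∀ y : ι → ℝ, (∀ i, |y i| ≤ 1) → A.expect (fun ω =>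
      |α * ∑ i, y i - (A.prog ω).run (combination β y) []|) ≤ ENNReal.ofReal ε)
    (hN : ∀ y : ι → ℝ, (∀ i, |y i| ≤ 1) → A.expect (fun ω =>
      ((A.prog ω).values (combination β y) [] : ℝ)) ≤ N) :
    ENNReal.ofReal (Fintype.card ι / 4) ≤ N := by
  let _ := A.mΩ
  have := A.isProb
  set n := Fintype.card ι with hncard
  have hn0 : (0 : ℝ) < n := by exact_mod_cast hn
  have hsn : 0 < Real.sqrt n := Real.sqrt_pos.2 hn0
  have hγ := signConst_pos
  set φ := signConst * α * Real.sqrt n with hφ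
  have hφ0 : 0 < φ := by positivity
  -- With this slope the potential φ - b(n - s) is not positive once at most half of the signs are
  -- free, so the Fourier bound is needed only for s ≥ n/2.
  set b := 2 * φ / n with hb
  have hb0 : 0 < b := by positivity
  have hpot : ∀ s ≤ n, φ - b * (n - s) ≤
      α / (1 / Real.sqrt n) * (1 - |Real.cos (1 / Real.sqrt n)| ^ s) := by
    intro s _
    have e : α / (1 / Real.sqrt n) = α * Real.sqrt n := by field_simp
    rw [e]
    by_cases h2 : n ≤ 2 * s
    · have h3 := signConst_le hn h2
      have h4 : φ ≤ α * Real.sqrt n * (1 - |Real.cos (1 / Real.sqrt n)| ^ s) := by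
        rw [hφ]
        calc _ = α * Real.sqrt n * signConst := by ring
          _ ≤ _ := by gcongr
      have h5 : (s : ℝ) ≤ n := by exact_mod_cast (by assumption : s ≤ n)
      nlinarith
    · have h3 : 2 * (s : ℝ) ≤ n := by exact_mod_cast (by omega : 2 * s ≤ n)
      have h4 : |Real.cos (1 / Real.sqrt n)| ^ s ≤ 1 :=
        pow_le_one₀ (abs_nonneg _) (Real.abs_cos_le_one _)
      have h5 : φ ≤ b * (n - s) := by
        have : b * n = 2 * φ := by rw [hb]; field_simp
        nlinarith
      have h6 : 0 ≤ α * Real.sqrt n * (1 - |Real.cos (1 / Real.sqrt n)| ^ s) :=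
        mul_nonneg (by positivity) (by linarith)
      linarith
  set cube : Finset (ι → ℝ) := Fintype.piFinset fun _ => signs with hcube
  have hcube1 : ∀ y ∈ cube, ∀ i, |y i| ≤ 1 := by
    intro y hy i
    have := Fintype.mem_piFinset.1 hy i
    rw [signs, Finset.mem_insert, Finset.mem_singleton] at this
    rcases this with h | h <;> simp [h]
  have hcard : 0 < cube.card := by
    rw [hcube, Fintype.card_piFinset]
    exact Finset.prod_pos fun _ _ => by simp [signs]
  have key : ∀ ω, ENNReal.ofReal (cube.card * φ) ≤ ∑ y ∈ cube,
      (ENNReal.ofReal |α * ∑ i, y i - (A.prog ω).run (combination β y) []| +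
        ENNReal.ofReal b * ENNReal.ofReal ((A.prog ω).values (combination β y) [] : ℝ)) := by
    intro ω
    have h := RealProg.le_sum_abs_add_values hβ hα.le (by positivity : 0 < 1 / Real.sqrt n) hb0.le
      hpot (A.prog ω) [] (fun _ => signs) fun _ => .inr (.inr rfl)
    simp only [Finset.filter_true, Finset.card_univ] at h
    rw [← hncard, sub_self, mul_zero, sub_zero] at h
    refine (ENNReal.ofReal_le_ofReal h).trans (le_of_eq ?_)
    rw [ENNReal.ofReal_sum_of_nonneg fun y _ => by positivity]
    refine Finset.sum_congr rfl fun y _ => ?_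
    rw [ENNReal.ofReal_add (abs_nonneg _) (by positivity), ENNReal.ofReal_mul hb0.le]
  have hint := lintegral_mono (μ := A.law) key
  rw [lintegral_const, measure_univ, mul_one] at hint
  have hm1 : ∀ y ∈ cube, Measurable fun ω =>
      ENNReal.ofReal |α * ∑ i, y i - (A.prog ω).run (combination β y) []| := fun y hy =>
    ((hmeas y (hcube1 y hy)).1.const_sub _).abs.ennreal_ofReal
  have hm2 : ∀ y ∈ cube, Measurable fun ω =>
      ENNReal.ofReal ((A.prog ω).values (combination β y) [] : ℝ) := fun y hy =>
    (measurable_from_nat.comp (hmeas y (hcube1 y hy)).2.1).ennreal_ofReal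
  have hm3 : ∀ y ∈ cube, AEMeasurable (fun ω =>
      ENNReal.ofReal |α * ∑ i, y i - (A.prog ω).run (combination β y) []| +
        ENNReal.ofReal b * ENNReal.ofReal ((A.prog ω).values (combination β y) [] : ℝ)) A.law :=
    fun y hy => ((hm1 y hy).add ((hm2 y hy).const_mul _)).aemeasurable
  rw [lintegral_finsetSum' _ hm3] at hint
  have hle : ∑ y ∈ cube, ∫⁻ ω,
      (ENNReal.ofReal |α * ∑ i, y i - (A.prog ω).run (combination β y) []| +
        ENNReal.ofReal b * ENNReal.ofReal ((A.prog ω).values (combination β y) [] : ℝ)) ∂A.law ≤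
      ∑ _y ∈ cube, (ENNReal.ofReal ε + ENNReal.ofReal b * N) := by
    refine Finset.sum_le_sum fun y hy => ?_
    rw [lintegral_add_left (hm1 y hy), lintegral_const_mul _ (hm2 y hy)]
    exact add_le_add (herr y (hcube1 y hy)) (mul_le_mul_right (hN y (hcube1 y hy)) _)
  have htot := hint.trans hle
  rw [Finset.sum_const, nsmul_eq_mul, ENNReal.ofReal_mul (by positivity), ENNReal.ofReal_natCast,
    ENNReal.mul_le_mul_iff_right (by exact_mod_cast hcard.ne') (ENNReal.natCast_ne_top _)] at htot
  rcases eq_or_ne N ∞ with rfl | hNtop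
  · exact le_top
  -- The error pays for at most half of φ. The other half must come from b times the expected number
  -- of values, which gives n/4.
  have hε0 : ENNReal.ofReal ε ≤ ENNReal.ofReal (φ / 2) := ENNReal.ofReal_le_ofReal (by linarith)
  have h1 : ENNReal.ofReal φ ≤ ENNReal.ofReal (φ / 2 + b * N.toReal) := by
    rw [ENNReal.ofReal_add (by positivity) (by positivity), ENNReal.ofReal_mul hb0.le,
      ENNReal.ofReal_toReal hNtop]
    exact htot.trans (by gcongr)
  rw [ENNReal.ofReal_le_ofReal_iff (by positivity)] at h1
  rw [← ENNReal.ofReal_toReal hNtop]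
  refine ENNReal.ofReal_le_ofReal ?_
  have h2 : b * (n / 4) = φ / 2 := by rw [hb]; field_simp; norm_num
  have h3 : b * (n / 4) ≤ b * N.toReal := by linarith
  exact le_of_mul_le_mul_left h3 hb0

end

/-! ### The three lower bounds for path integration -/

namespace Setting

variable {X : Type*} [NormedAddCommGroup X] [NormedSpace ℝ X] [CompleteSpace X]
    [TopologicalSpace.SeparableSpace X] [MeasurableSpace X] [BorelSpace X]

/-- The bumps as functions on `X_d`. -/
theorem exists_disjointed (P : Setting X) {r : ℕ} (hr : 1 ≤ r) {K : ℕ → ℝ}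
    (hK : ∀ i ≤ r, 0 < K i) (D : ℕ) : ∃ c : ℝ, 0 < c ∧ ∀ M : ℕ, 1 ≤ M → ∀ d : ℕ,
      ∃ β : (Fin D → Fin M) → (Fin d → ℝ) → ℝ, Disjointed β ∧
      ∀ y : (Fin D → Fin M) → ℝ, (∀ i, |y i| ≤ 1) → ∃ f ∈ P.F K r,
        P.restrict d f = combination β y ∧ P.I f = c / (M : ℝ) ^ (r + D) * ∑ i, y i := by
  obtain ⟨c, hc, h⟩ := P.exists_bumps hr hK D
  refine ⟨c, hc, fun M hM d => ?_⟩
  obtain ⟨b, hb, hb', hI⟩ := h M hM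
  exact ⟨fun i t => b i (∑ j, t j • P.e j), fun t => hb' _, fun y hy => ⟨_, hb y hy, rfl, hI y⟩⟩

/-- The worst case sum of M^D coefficients is of size M^D, which cancels the M^D in the weight. The
condition on ε therefore contains only M^r, while D is free in the number of values. -/
theorem exists_le_values_of_detSolves (P : Setting X) {r : ℕ} (hr : 1 ≤ r) {K : ℕ → ℝ}
    (hK : ∀ i ≤ r, 0 < K i) (D : ℕ) : ∃ c : ℝ, 0 < c ∧ ∀ (M : ℕ) (ε : ℝ), 1 ≤ M →
      ε * (M : ℝ) ^ r ≤ c → ∀ (d : ℕ) (A : RealProg d), P.DetSolves K r ε A →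
      ∃ f ∈ P.F K r, (M : ℝ) ^ D / 2 ≤ A.values (P.restrict d f) [] := by
  obtain ⟨c, hc, h⟩ := P.exists_disjointed hr hK D
  refine ⟨c / 4, by positivity, fun M ε hM hε d A hA => ?_⟩
  have hM0 : (0 : ℝ) < M := by exact_mod_cast hM
  obtain ⟨β, hβ, hf⟩ := h M hM d
  have hα : 0 < c / (M : ℝ) ^ (r + D) := by positivity
  have h1 := A.le_values hβ (ε := ε) hα fun y hy => by
    obtain ⟨f, hfF, hfr, hfI⟩ := hf y hy
    rw [← hfr, ← hfI]
    exact hA f hfF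
  obtain ⟨f, hfF, hfr, -⟩ := hf 0 fun i => by simp
  refine ⟨f, hfF, ?_⟩
  rw [hfr]
  refine le_trans ?_ h1
  have h2 : 2 * ε / (c / (M : ℝ) ^ (r + D)) = 2 * (ε * (M : ℝ) ^ r) / c * (M : ℝ) ^ D := by
    rw [pow_add]
    field_simp
  have h3 : 2 * (ε * (M : ℝ) ^ r) / c ≤ 1 / 2 := by
    rw [div_le_iff₀ hc]
    linarith
  have h4 : (0 : ℝ) ≤ (M : ℝ) ^ D := by positivity
  rw [h2, Fintype.card_fun, Fintype.card_fin, Fintype.card_fin]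
  push_cast
  nlinarith

/-- Bumps in 2D dimensions are used so that the standard deviation of the sum of M^(2D) signs is
M^D, without square roots. -/
theorem exists_le_of_ranSolves (P : Setting X) {r : ℕ} (hr : 1 ≤ r) {K : ℕ → ℝ}
    (hK : ∀ i ≤ r, 0 < K i) (D : ℕ) : ∃ c : ℝ, 0 < c ∧ ∀ (M : ℕ) (ε : ℝ), 1 ≤ M →
      ε * (M : ℝ) ^ (r + D) ≤ c → ∀ (d : ℕ) (A : RandomProg d), P.RanSolves K r ε A →
      ∀ N : ℝ≥0∞, (∀ f ∈ P.F K r, A.expect (fun ω => ((A.prog ω).values (P.restrict d f) [] : ℝ)) ≤ N) →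
      ENNReal.ofReal ((M : ℝ) ^ (2 * D) / 4) ≤ N := by
  obtain ⟨c, hc, h⟩ := P.exists_disjointed hr hK (2 * D)
  have hγ := signConst_pos
  refine ⟨signConst * c / 2, by positivity, fun M ε hM hε d A hA N hN => ?_⟩
  have hM0 : (0 : ℝ) < M := by exact_mod_cast hM
  obtain ⟨β, hβ, hf⟩ := h M hM d
  have hα : 0 < c / (M : ℝ) ^ (r + 2 * D) := by positivity
  have hcard : Fintype.card (Fin (2 * D) → Fin M) = M ^ (2 * D) := by simp
  have h1 := A.le_values hβ (by rw [hcard]; exact Nat.one_le_pow _ _ hM) (ε := ε) hα ?_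
    (N := N) (fun y hy => ?_) (fun y hy => ?_) fun y hy => ?_
  · rw [hcard] at h1
    exact_mod_cast h1
  · rw [hcard]
    have e : Real.sqrt ((M ^ (2 * D) : ℕ) : ℝ) = (M : ℝ) ^ D := by
      rw [Nat.cast_pow, mul_comm 2 D, pow_mul, Real.sqrt_sq (by positivity)]
    have e2 : signConst * (c / (M : ℝ) ^ (r + 2 * D)) * (M : ℝ) ^ D =
        signConst * c / (M : ℝ) ^ (r + D) := by
      rw [show r + 2 * D = (r + D) + D by ring, pow_add _ (r + D)]
      field_simp
    rw [e, e2, le_div_iff₀ (by positivity)]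
    linarith
  · obtain ⟨f, hfF, hfr, -⟩ := hf y hy
    rw [← hfr]
    exact (hA f hfF).1
  · obtain ⟨f, hfF, hfr, hfI⟩ := hf y hy
    rw [← hfr, ← hfI]
    exact (hA f hfF).2
  · obtain ⟨f, hfF, hfr, -⟩ := hf y hy
    rw [← hfr]
    exact hN f hfF

/-- The condition makes ε less than half the weight of a single bump, so the algorithm has to count
the bits exactly. -/
theorem exists_le_of_quantumSolves (P : Setting X) {r : ℕ} (hr : 1 ≤ r) {K : ℕ → ℝ}
    (hK : ∀ i ≤ r, 0 < K i) (D : ℕ) : ∃ c : ℝ, 0 < c ∧ ∀ (M : ℕ) (ε : ℝ), 1 ≤ M →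
      ε * (M : ℝ) ^ (r + D) ≤ c → ∀ (d : ℕ) (A : QuantumAlg d), P.QuantumSolves K r ε A →
      (M : ℝ) ^ D ≤ 2 * A.queries := by
  obtain ⟨c, hc, h⟩ := P.exists_disjointed hr hK D
  refine ⟨c / 4, by positivity, fun M ε hM hε d A hA => ?_⟩
  have hM0 : (0 : ℝ) < M := by exact_mod_cast hM
  obtain ⟨β, hβ, hf⟩ := h M hM d
  have h1 := A.le_two_mul_queries hβ (ε := ε) (α := c / (M : ℝ) ^ (r + D)) ?_ fun y => ?_
  · rw [Fintype.card_fun, Fintype.card_fin, Fintype.card_fin] at h1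
    exact_mod_cast h1
  · rw [lt_div_iff₀ (by positivity)]
    linarith
  · obtain ⟨f, hfF, hfr, hfI⟩ := hf (bitCoef y) fun i => by
      rw [bitCoef]
      split_ifs <;> simp
    rw [← hfr, ← hfI]
    exact hA f hfF

end Setting

/-! ### The Monte Carlo method as a program -/

section

variable {d : ℕ}

/-- Store a list of constants, then go on with `p`. -/
def RealProg.consts (l : List ℝ) (p : RealProg d) : RealProg d :=
  l.foldl (fun p a => RealProg.const a p) p

theorem RealProg.run_consts (g : (Fin d → ℝ) → ℝ) (l : List ℝ) : ∀ (p : RealProg d) (m : List ℝ),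
    (p.consts l).run g m = p.run g (l ++ m) := by
  induction l with
  | nil => exact fun _ _ => rfl
  | cons a l ih => exact fun p m => ih (RealProg.const a p) m

theorem RealProg.values_consts (g : (Fin d → ℝ) → ℝ) (l : List ℝ) :
    ∀ (p : RealProg d) (m : List ℝ), (p.consts l).values g m = p.values g (l ++ m) := by
  induction l with
  | nil => exact fun _ _ => rfl
  | cons a l ih => exact fun p m => ih (RealProg.const a p) m

theorem RealProg.ops_consts (g : (Fin d → ℝ) → ℝ) (l : List ℝ) :
    ∀ (p : RealProg d) (m : List ℝ), (p.consts l).ops g m = p.ops g (l ++ m) := by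
  induction l with
  | nil => exact fun _ _ => rfl
  | cons a l ih => exact fun p m => ih (RealProg.const a p) m

/-- Add the function values at the given points to the content of the front cell, and multiply the
result by `w`. -/
def RealProg.average (w : ℝ) : List (Fin d → ℝ) → RealProg d
  | [] => .const w (.arith .mul 0 1 (.output 0))
  | t :: l => RealProg.consts (List.ofFn t)
      -- The value is read at the cells 0, …, d-1, which hold the point. Once the value itself is in
      -- front, the running sum sits behind d + 1 cells.
      (.value (fun i => i) (.arith .add 0 (d + 1) (RealProg.average w l)))

theorem getD_ofFn_append (t : Fin d → ℝ) (m : List ℝ) (i : Fin d) :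
    (List.ofFn t ++ m).getD i 0 = t i := by
  rw [List.getD_append _ _ _ _ (by simp)]
  simp

theorem RealProg.run_average (g : (Fin d → ℝ) → ℝ) (w : ℝ) (l : List (Fin d → ℝ)) :
    ∀ (a : ℝ) (m : List ℝ),
      (RealProg.average w l).run g (a :: m) = w * (a + (l.map g).sum) := by
  induction l with
  | nil => intro a m; simp [RealProg.average, RealProg.run, ArithOp.eval]
  | cons t l ih =>
    intro a m
    rw [RealProg.average, RealProg.run_consts]
    simp only [RealProg.run, getD_ofFn_append]
    rw [ih]
    have h : (g t :: (List.ofFn t ++ a :: m)).getD (d + 1) 0 = a := by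
      rw [List.getD_cons_succ, List.getD_append_right _ _ _ _ (by simp)]
      simp
    rw [h]
    simp only [ArithOp.eval, List.getD_cons_zero, List.map_cons, List.sum_cons]
    ring

theorem RealProg.values_average (g : (Fin d → ℝ) → ℝ) (w : ℝ) (l : List (Fin d → ℝ)) :
    ∀ m : List ℝ, (RealProg.average w l).values g m = l.length := by
  induction l with
  | nil => intro m; simp [RealProg.average, RealProg.values]
  | cons t l ih =>
    intro m
    rw [RealProg.average, RealProg.values_consts]
    simp only [RealProg.values]
    rw [ih, List.length_cons]

theorem RealProg.ops_average (g : (Fin d → ℝ) → ℝ) (w : ℝ) (l : List (Fin d → ℝ)) :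
    ∀ m : List ℝ, (RealProg.average w l).ops g m = l.length + 1 := by
  induction l with
  | nil => intro m; simp [RealProg.average, RealProg.ops]
  | cons t l ih =>
    intro m
    rw [RealProg.average, RealProg.ops_consts]
    simp only [RealProg.ops]
    rw [ih, List.length_cons]

/-- The Monte Carlo method with `n` independent sample points. -/
def monteCarlo (γ : Measure (Fin d → ℝ)) [IsProbabilityMeasure γ] (n : ℕ) : RandomProg d where
  Ω := Fin n → Fin d → ℝ
  mΩ := inferInstance
  law := Measure.pi fun _ => γ
  isProb := inferInstance
  prog ω := .const 0 (RealProg.average (1 / n) (List.ofFn ω))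

theorem monteCarlo_run (γ : Measure (Fin d → ℝ)) [IsProbabilityMeasure γ] (n : ℕ)
    (g : (Fin d → ℝ) → ℝ) (ω : Fin n → Fin d → ℝ) :
    ((monteCarlo γ n).prog ω).run g [] = 1 / n * ∑ i, g (ω i) := by
  change (RealProg.average (1 / (n : ℝ)) (List.ofFn ω)).run g (0 :: []) = _
  rw [RealProg.run_average, List.map_ofFn, List.sum_ofFn, zero_add]
  rfl

theorem monteCarlo_values (γ : Measure (Fin d → ℝ)) [IsProbabilityMeasure γ] (n : ℕ)
    (g : (Fin d → ℝ) → ℝ) (ω : Fin n → Fin d → ℝ) :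
    ((monteCarlo γ n).prog ω).values g [] = n := by
  change (RealProg.average (1 / (n : ℝ)) (List.ofFn ω)).values g (0 :: []) = _
  rw [RealProg.values_average, List.length_ofFn]

theorem monteCarlo_ops (γ : Measure (Fin d → ℝ)) [IsProbabilityMeasure γ] (n : ℕ)
    (g : (Fin d → ℝ) → ℝ) (ω : Fin n → Fin d → ℝ) :
    ((monteCarlo γ n).prog ω).ops g [] = n + 1 := by
  change (RealProg.average (1 / (n : ℝ)) (List.ofFn ω)).ops g (0 :: []) = _
  rw [RealProg.ops_average, List.length_ofFn]

theorem monteCarlo_measurableOn (γ : Measure (Fin d → ℝ)) [IsProbabilityMeasure γ] (n : ℕ)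
    {g : (Fin d → ℝ) → ℝ} (hg : Measurable g) : (monteCarlo γ n).MeasurableOn g := by
  refine ⟨?_, ?_, ?_⟩
  · change Measurable fun ω : Fin n → Fin d → ℝ => ((monteCarlo γ n).prog ω).run g []
    simp only [monteCarlo_run]
    fun_prop
  · change Measurable fun ω : Fin n → Fin d → ℝ => ((monteCarlo γ n).prog ω).values g []
    simp only [monteCarlo_values]
    exact measurable_const
  · change Measurable fun ω : Fin n → Fin d → ℝ => ((monteCarlo γ n).prog ω).ops g []
    simp only [monteCarlo_ops]
    exact measurable_const

/-- The error of the Monte Carlo method for bounded functions. -/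
theorem monteCarlo_error (γ : Measure (Fin d → ℝ)) [IsProbabilityMeasure γ] {n : ℕ} (hn : 1 ≤ n)
    {g : (Fin d → ℝ) → ℝ} (hg : Measurable g) {κ s : ℝ} (hκ : ∀ t, |g t| ≤ κ) (hs : 0 < s)
    (hns : κ ^ 2 ≤ n * s ^ 2) (a : ℝ) :
    (monteCarlo γ n).expect (fun ω => |a - ((monteCarlo γ n).prog ω).run g []|) ≤
      ENNReal.ofReal (|a - ∫ t, g t ∂γ| + s) := by
  have hn0 : (0 : ℝ) < n := by exact_mod_cast hn
  set m := ∫ t, g t ∂γ with hm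
  set Y : (Fin n → Fin d → ℝ) → ℝ := fun ω => 1 / n * ∑ i, g (ω i) with hY
  have hκ0 : 0 ≤ κ := (abs_nonneg _).trans (hκ 0)
  have hgL : MemLp g 2 γ := MemLp.of_bound hg.aestronglyMeasurable κ (ae_of_all _ hκ)
  have hcomp : ∀ i, Integrable (fun ω : Fin n → Fin d → ℝ => g (ω i)) (Measure.pi fun _ => γ) :=
    fun i => Integrable.of_bound
      (hg.comp (measurable_pi_apply i)).aestronglyMeasurable κ (ae_of_all _ fun ω => hκ _)
  have hYm : Measurable Y := by rw [hY]; fun_prop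
  have hYb : ∀ ω, |Y ω| ≤ κ := by
    intro ω
    rw [hY, abs_mul, abs_of_pos (by positivity : (0 : ℝ) < 1 / n), one_div, inv_mul_le_iff₀ hn0]
    refine (Finset.abs_sum_le_sum_abs _ _).trans ((Finset.sum_le_sum fun i _ => hκ _).trans ?_)
    simp
  have hYL : MemLp Y 2 (Measure.pi fun _ => γ) :=
    MemLp.of_bound hYm.aestronglyMeasurable κ (ae_of_all _ hYb)
  have hEY : ∫ ω, Y ω ∂(Measure.pi fun _ : Fin n => γ) = m := by
    rw [hY, integral_const_mul, integral_finsetSum _ fun i _ => hcomp i]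
    have : ∀ i : Fin n, ∫ ω : Fin n → Fin d → ℝ, g (ω i) ∂(Measure.pi fun _ => γ) = m := fun i =>
      integral_comp_eval (μ := fun _ : Fin n => γ) hg.aestronglyMeasurable
    simp only [this, Finset.sum_const, Finset.card_univ, Fintype.card_fin, nsmul_eq_mul]
    field_simp
  have hVar : ∫ ω, (Y ω - m) ^ 2 ∂(Measure.pi fun _ : Fin n => γ) ≤ s ^ 2 := by
    have h1 : Var[Y; Measure.pi fun _ : Fin n => γ] = ∫ ω, (Y ω - m) ^ 2 ∂(Measure.pi fun _ => γ) := by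
      rw [variance_eq_integral hYm.aemeasurable, hEY]
    have h2 : Var[Y; Measure.pi fun _ : Fin n => γ] = (1 / n) ^ 2 * (n * Var[g; γ]) := by
      have e : Y = fun ω => 1 / (n : ℝ) * (∑ i, fun ω : Fin n → Fin d → ℝ => g (ω i)) ω := by
        funext ω
        simp [hY]
      rw [e, variance_const_mul, variance_sum_pi fun _ => hgL]
      simp
    have h3 : Var[g; γ] ≤ κ ^ 2 := by
      refine (variance_le_expectation_sq hg.aestronglyMeasurable).trans ?_
      have : ∫ t, (g ^ 2) t ∂γ ≤ ∫ _, κ ^ 2 ∂γ := by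
        refine integral_mono hgL.integrable_sq (integrable_const _) fun t => ?_
        simp only [Pi.pow_apply]
        rw [← sq_abs]
        have := hκ t
        gcongr
      simpa using this
    rw [← h1, h2]
    have h4 : (1 / (n : ℝ)) ^ 2 * (n * Var[g; γ]) ≤ (1 / (n : ℝ)) ^ 2 * (n * (n * s ^ 2)) := by
      gcongr
      exact h3.trans hns
    refine h4.trans (le_of_eq ?_)
    field_simp
  have hdev : Integrable (fun ω => (Y ω - m) ^ 2) (Measure.pi fun _ : Fin n => γ) :=
    (hYL.sub (memLp_const m)).integrable_sq
  -- A linearized form of the inequality between first and second moment; if the variance is at most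
  -- s^2, the bracket has mean at most s.
  have hbound : ∀ ω, |a - Y ω| ≤ |a - m| + ((Y ω - m) ^ 2 / (2 * s) + s / 2) := by
    intro ω
    have h1 : |a - Y ω| ≤ |a - m| + |Y ω - m| := by
      have := abs_sub (a - m) (Y ω - m)
      rwa [sub_sub_sub_cancel_right] at this
    have h2 : |Y ω - m| ≤ (Y ω - m) ^ 2 / (2 * s) + s / 2 := by
      rw [← sq_abs (Y ω - m)]
      have h3 := two_mul_le_add_sq |Y ω - m| s
      have e : |Y ω - m| ^ 2 / (2 * s) + s / 2 = (|Y ω - m| ^ 2 + s ^ 2) / (2 * s) := by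
        field_simp
      rw [e, le_div_iff₀ (by positivity)]
      linarith
    linarith
  have hint : Integrable (fun ω => |a - m| + ((Y ω - m) ^ 2 / (2 * s) + s / 2))
      (Measure.pi fun _ : Fin n => γ) :=
    (integrable_const _).add ((hdev.div_const _).add (integrable_const _))
  change ∫⁻ ω, ENNReal.ofReal |a - ((monteCarlo γ n).prog ω).run g []| ∂(Measure.pi fun _ => γ) ≤ _
  simp only [monteCarlo_run]
  refine (lintegral_mono fun ω => ENNReal.ofReal_le_ofReal (hbound ω)).trans ?_
  rw [← ofReal_integral_eq_lintegral_ofReal hint (ae_of_all _ fun ω => by positivity)]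
  refine ENNReal.ofReal_le_ofReal ?_
  rw [integral_add (f := fun _ => |a - m|) (g := fun ω => (Y ω - m) ^ 2 / (2 * s) + s / 2)
      (integrable_const _) ((hdev.div_const _).add (integrable_const _)),
    integral_add (f := fun ω => (Y ω - m) ^ 2 / (2 * s)) (g := fun _ => s / 2)
      (hdev.div_const _) (integrable_const _), integral_div]
  simp only [integral_const, probReal_univ, smul_eq_mul, one_mul]
  gcongr
  have : (∫ ω, (Y ω - m) ^ 2 ∂(Measure.pi fun _ : Fin n => γ)) / (2 * s) ≤ s ^ 2 / (2 * s) := by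
    gcongr
  have e : s ^ 2 / (2 * s) = s / 2 := by field_simp
  linarith

end

namespace Setting

variable {X : Type*} [NormedAddCommGroup X] [NormedSpace ℝ X] [CompleteSpace X]
    [TopologicalSpace.SeparableSpace X] [MeasurableSpace X] [BorelSpace X]

/-- The number of samples that the Monte Carlo method needs. -/
def sampleSize (κ ε : ℝ) : ℕ := ⌈(2 * κ / ε) ^ 2⌉₊ + 1

/-- The error ε is split evenly between truncation and sampling. The numbers of values and
operations are deterministic. -/
theorem exists_ranSolves (P : Setting X) {K : ℕ → ℝ} {r : ℕ} {ε : ℝ} (hε : 0 < ε)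
    (hdim : ∀ f ∈ P.F K r, |P.I f - P.Id (P.dim K r ε) f| ≤ ε / 2) :
    ∃ A : RandomProg (P.dim K r ε), P.RanSolves K r ε A ∧ (∀ ω g, (A.prog ω).values g [] = sampleSize (K 0) ε) ∧
      ∀ ω g, (A.prog ω).ops g [] = sampleSize (K 0) ε + 1 := by
  set d := P.dim K r ε
  refine ⟨monteCarlo (Measure.pi fun i : Fin d => gaussianReal 0 (P.lam i).toNNReal)
    (sampleSize (K 0) ε), fun f hf => ?_, fun ω g => monteCarlo_values _ _ g ω,
    fun ω g => monteCarlo_ops _ _ g ω⟩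
  have hc : Continuous (P.restrict d f) := by
    have := P.continuous_of_mem_F hf
    unfold restrict
    fun_prop
  refine ⟨monteCarlo_measurableOn _ _ hc.measurable, ?_⟩
  refine (monteCarlo_error _ (Nat.succ_le_succ (Nat.zero_le _)) hc.measurable
    (n := sampleSize (K 0) ε) (κ := K 0) (s := ε / 2) (fun t => P.abs_le_of_mem_F hf _) (by positivity) ?_ _).trans ?_
  · have h1 : (2 * K 0 / ε) ^ 2 ≤ (sampleSize (K 0) ε : ℝ) := by
      rw [sampleSize]
      push_cast
      exact (Nat.le_ceil _).trans (by linarith)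
    calc K 0 ^ 2 = (2 * K 0 / ε) ^ 2 * (ε / 2) ^ 2 := by field_simp
      _ ≤ _ := by gcongr
  · refine ENNReal.ofReal_le_ofReal ?_
    have := hdim f hf
    rw [Id] at this
    linarith

theorem nRan_le (P : Setting X) {K : ℕ → ℝ} {r : ℕ} {ε : ℝ} (hε : 0 < ε)
    (hdim : ∀ f ∈ P.F K r, |P.I f - P.Id (P.dim K r ε) f| ≤ ε / 2) :
    P.nRan K r ε ≤ sampleSize (K 0) ε := by
  obtain ⟨A, hA, hv, -⟩ := P.exists_ranSolves hε hdim
  refine sInf_le ⟨A, hA, fun f hf => ?_⟩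
  let _ := A.mΩ
  have := A.isProb
  change ∫⁻ ω, _ ∂A.law ≤ _
  simp [hv]

theorem compRan_le (P : Setting X) {K : ℕ → ℝ} {r : ℕ} {ε : ℝ} (hε : 0 < ε)
    (hdim : ∀ f ∈ P.F K r, |P.I f - P.Id (P.dim K r ε) f| ≤ ε / 2) (c : ℕ → ℝ) :
    P.compRan K r c ε ≤ ENNReal.ofReal
      (c (P.dim K r ε) * sampleSize (K 0) ε + (sampleSize (K 0) ε + 1)) := by
  obtain ⟨A, hA, hv, ho⟩ := P.exists_ranSolves hε hdim
  refine sInf_le ⟨A, hA, fun f hf => ?_⟩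
  let _ := A.mΩ
  have := A.isProb
  change ∫⁻ ω, _ ∂A.law ≤ _
  simp [RealProg.cost, hv, ho]

end Setting

/-! ### Equal weight cubature by quantization of the coordinates -/

theorem continuous_cdf (γ : Measure ℝ) [IsProbabilityMeasure γ] [NullSingletonClass γ] :
    Continuous (cdf γ) := by
  rw [continuous_iff_continuousAt]
  intro x
  rw [(monotone_cdf γ).continuousAt_iff_leftLim_eq_rightLim, (cdf γ).rightLim_eq]
  have h := (cdf γ).measure_singleton x
  rw [measure_cdf, measure_singleton, eq_comm, ENNReal.ofReal_eq_zero] at h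
  exact le_antisymm ((monotone_cdf γ).leftLim_le le_rfl) (by linarith)

/-- For a < 1 the sublevel set is a closed half line. At its end point the distribution function is
at most a, and by continuity from the right at least a. -/
theorem measureReal_cdf_le (γ : Measure ℝ) [IsProbabilityMeasure γ] [NullSingletonClass γ] {a : ℝ}
    (ha : 0 < a) (ha1 : a ≤ 1) : γ.real {x | cdf γ x ≤ a} = a := by
  rcases ha1.eq_or_lt with rfl | ha1
  · simp [cdf_le_one]
  set S := {x | cdf γ x ≤ a} with hS
  have hne : S.Nonempty :=
    ((tendsto_cdf_atBot γ).eventually_lt_const ha).exists.imp fun _ h => h.le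
  obtain ⟨u, hu⟩ := ((tendsto_cdf_atTop γ).eventually (lt_mem_nhds ha1)).exists
  have hbd : BddAbove S := ⟨u, fun x hx => by
    by_contra! h
    exact absurd (hu.trans_le (monotone_cdf γ h.le)) (not_lt.2 hx)⟩
  have hcl : IsClosed S := isClosed_le (continuous_cdf γ) continuous_const
  have hmem := hcl.csSup_mem hne hbd
  have hSI : S = Set.Iic (sSup S) := by
    ext x
    exact ⟨fun hx => le_csSup hbd hx, fun hx => (monotone_cdf γ hx).trans hmem⟩
  rw [hSI, ← cdf_eq_real]
  refine le_antisymm hmem ?_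
  refine ge_of_tendsto ((continuous_cdf γ).continuousAt.tendsto.mono_left
    (nhdsWithin_le_nhds (s := Set.Ioi (sSup S)))) ?_
  filter_upwards [self_mem_nhdsWithin] with x hx
  by_contra! h
  exact absurd (le_csSup hbd (show x ∈ S from h.le)) (not_le.2 hx)

/-- The index of the cell of `x` in a partition of the line into `N + 1` intervals of equal
measure. -/
def cell (γ : Measure ℝ) (N : ℕ) (x : ℝ) : Fin (N + 1) :=
  -- Where the distribution function vanishes, the ceiling is 0 and truncated subtraction assigns
  -- the first cell. The ceiling never exceeds N + 1, so no reduction modulo N + 1 takes place.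
  Fin.ofNat (N + 1) (⌈(N + 1) * cdf γ x⌉₊ - 1)

theorem cell_le_iff (γ : Measure ℝ) (N : ℕ) (x : ℝ) (j : Fin (N + 1)) :
    cell γ N x ≤ j ↔ cdf γ x ≤ (j + 1) / (N + 1) := by
  have h1 : ⌈((N : ℝ) + 1) * cdf γ x⌉₊ ≤ N + 1 := by
    refine Nat.ceil_le.2 ?_
    push_cast
    exact mul_le_of_le_one_right (by positivity) (cdf_le_one _ _)
  have h2 : ((cell γ N x : Fin (N + 1)) : ℕ) = ⌈((N : ℝ) + 1) * cdf γ x⌉₊ - 1 :=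
    Nat.mod_eq_of_lt (by omega)
  rw [Fin.le_def, h2, Nat.sub_le_iff_le_add, Nat.ceil_le, le_div_iff₀ (by positivity), mul_comm]
  push_cast
  rfl

theorem monotone_cell (γ : Measure ℝ) (N : ℕ) : Monotone (cell γ N) := fun _ y h =>
  (cell_le_iff ..).2 ((monotone_cdf γ h).trans ((cell_le_iff γ N y _).1 le_rfl))

theorem measurable_cell (γ : Measure ℝ) (N : ℕ) : Measurable (cell γ N) :=
  (monotone_cell γ N).measurable

theorem measureReal_cell_le (γ : Measure ℝ) [IsProbabilityMeasure γ] [NullSingletonClass γ] (N : ℕ)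
    (j : Fin (N + 1)) : γ.real {x | cell γ N x ≤ j} = (j + 1) / (N + 1) := by
  simp only [cell_le_iff]
  refine measureReal_cdf_le γ (by positivity) ?_
  rw [div_le_one (by positivity)]
  have := j.2
  norm_cast

theorem measureReal_cell_eq (γ : Measure ℝ) [IsProbabilityMeasure γ] [NullSingletonClass γ] (N : ℕ)
    (j : Fin (N + 1)) : γ.real {x | cell γ N x = j} = 1 / (N + 1) := by
  rcases Fin.eq_zero_or_eq_succ j with rfl | ⟨i, rfl⟩
  · have := measureReal_cell_le γ N 0
    simpa using this
  · have h1 := measureReal_cell_le γ N i.succ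
    have h2 := measureReal_cell_le γ N i.castSucc
    have h : {x | cell γ N x = i.succ} = {x | cell γ N x ≤ i.succ} \ {x | cell γ N x ≤ i.castSucc} := by
      ext x
      simp only [Set.mem_ofPred_eq, Set.mem_sdiff, not_le, Fin.castSucc_lt_iff_succ_le]
      exact ⟨fun h => ⟨h.le, h.ge⟩, fun h => le_antisymm h.1 h.2⟩
    rw [h, measureReal_sdiff, h1, h2]
    · simp only [Fin.val_succ, Fin.val_castSucc]
      push_cast
      ring
    · intro x hx
      exact le_trans hx (Fin.castSucc_lt_succ).le
    · exact measurable_cell γ N measurableSet_Iic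

/-- Clip at T = σ 2^p. By the second moment this costs at most σ^2/T = σ/2^p. The clipped identity
is monotone, so its oscillations over the cells telescope to at most 4T; each cell has mass 4^{-p},
which gives 4σ/2^p. Nothing but the variance of γ is used. -/
theorem exists_quantizer (γ : Measure ℝ) [IsProbabilityMeasure γ] [NullSingletonClass γ] {σ : ℝ} (hσ : 0 < σ)
    (hint : Integrable (fun x => x ^ 2) γ) (hvar : ∫ x, x ^ 2 ∂γ ≤ σ ^ 2) (N p : ℕ)
    (hN : N + 1 = 4 ^ p) :
    ∃ y : Fin (N + 1) → ℝ, ∀ g : ℝ → ℝ, g = (fun x => |x - y (cell γ N x)|) →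
      Integrable g γ ∧ ∫ x, g x ∂γ ≤ 5 * σ / 2 ^ p := by
  set T : ℝ := σ * 2 ^ p with hT
  have hT0 : 0 < T := by positivity
  have hne : ∀ j : Fin (N + 1), ∃ x, cell γ N x = j := by
    intro j
    by_contra! h
    have := measureReal_cell_eq γ N j
    rw [show {x | cell γ N x = j} = ∅ from Set.eq_empty_of_forall_notMem h] at this
    have h0 : (0 : ℝ) < 1 / (N + 1) := by positivity
    simp only [measureReal_empty] at this
    linarith
  choose w hw using hne
  set cl : ℝ → ℝ := fun x => max (-T) (min T x) with hcl
  have hclm : Monotone cl := fun a b h => by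
    simp only [hcl]
    gcongr
  have hcl1 : ∀ x, -T ≤ cl x := fun x => le_max_left _ _
  have hcl2 : ∀ x, cl x ≤ T := fun x => max_le (by linarith) (min_le_left _ _)
  have hcl3 : ∀ x, |x - cl x| ≤ x ^ 2 / T := by
    intro x
    rw [le_div_iff₀ hT0]
    simp only [hcl]
    rcases le_total x T with h | h
    · rw [min_eq_right h]
      rcases le_total (-T) x with h' | h'
      · rw [max_eq_right h']
        simpa using sq_nonneg x
      · rw [max_eq_left h', abs_of_nonpos (by linarith)]
        nlinarith
    · rw [min_eq_left h, max_eq_right (by linarith), abs_of_nonneg (by linarith)]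
      nlinarith
  -- Clipped representatives of the cells, shifted by one and padded by -T below and T above. A
  -- clipped point of cell j lies between b j and b (j + 2), the values of the neighbouring cells.
  set b : ℕ → ℝ := fun n => if n = 0 then -T else if h : n - 1 < N + 1 then cl (w ⟨n - 1, h⟩) else T
    with hb
  have hb1 : ∀ n, -T ≤ b n := by
    intro n
    simp only [hb]
    split_ifs
    exacts [le_rfl, hcl1 _, by linarith]
  have hb2 : ∀ n, b n ≤ T := by
    intro n
    simp only [hb]
    split_ifs
    exacts [by linarith, hcl2 _, le_rfl]
  have hbw : ∀ j : Fin (N + 1), b (j + 1) = cl (w j) := by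
    intro j
    simp only [hb, Nat.add_sub_cancel, Nat.succ_ne_zero, if_false, j.2, dif_pos]
  have hup : ∀ x, cl x ≤ b (cell γ N x + 2) := by
    intro x
    by_cases h : (cell γ N x : ℕ) + 1 < N + 1
    · have e := hbw ⟨cell γ N x + 1, h⟩
      simp only at e
      rw [e]
      refine hclm (le_of_not_gt fun hlt => ?_)
      have h1 := monotone_cell γ N hlt.le
      rw [hw, Fin.le_def] at h1
      simp at h1
    · have e : b (cell γ N x + 2) = T := by
        simp only [hb]
        rw [if_neg (by omega), dif_neg (by omega)]
      rw [e]
      exact hcl2 x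
  have hlo : ∀ x, b (cell γ N x) ≤ cl x := by
    intro x
    rcases Nat.eq_zero_or_pos (cell γ N x : ℕ) with h | h
    · rw [h]
      exact hcl1 x
    · have e := hbw ⟨cell γ N x - 1, by omega⟩
      simp only at e
      rw [Nat.sub_add_cancel h] at e
      rw [e]
      refine hclm (le_of_not_gt fun hlt => ?_)
      have h1 := monotone_cell γ N hlt.le
      rw [hw, Fin.le_def] at h1
      simp only at h1
      omega
  set D : Fin (N + 1) → ℝ := fun j => b (j + 2) - b j with hD
  have hDsum : ∑ j, D j ≤ 4 * T := by
    rw [hD, Fin.sum_univ_eq_sum_range (fun n => b (n + 2) - b n)]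
    have h := Finset.sum_range_sub (fun n => b (n + 1) + b n) (N + 1)
    have e : ∀ n, b (n + 2) - b n = b (n + 1 + 1) + b (n + 1) - (b (n + 1) + b n) := fun n => by ring
    simp only [e, h]
    linarith [hb1 0, hb1 (0 + 1), hb2 (N + 1), hb2 (N + 1 + 1)]
  have hDint : Integrable (fun x => D (cell γ N x)) γ :=
    Integrable.of_bound ((measurable_of_countable D).comp (measurable_cell γ N)).aestronglyMeasurable
      (∑ j, ‖D j‖) (ae_of_all _ fun x =>
        Finset.single_le_sum (f := fun j => ‖D j‖) (fun _ _ => norm_nonneg _) (Finset.mem_univ _))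
  have hDval : ∫ x, D (cell γ N x) ∂γ = (∑ j, D j) / (N + 1) := by
    have hp := Measure.isProbabilityMeasure_map (μ := γ) (measurable_cell γ N).aemeasurable
    rw [← integral_map (φ := cell γ N) (f := D) (measurable_cell γ N).aemeasurable
      (measurable_of_countable D).aestronglyMeasurable, integral_fintype .of_finite, Finset.sum_div]
    refine Finset.sum_congr rfl fun j _ => ?_
    rw [map_measureReal_apply (measurable_cell γ N) (measurableSet_singleton j)]
    have := measureReal_cell_eq γ N j
    rw [show cell γ N ⁻¹' {j} = {x | cell γ N x = j} from rfl, this, smul_eq_mul]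
    ring
  have hpt : ∀ x, |x - cl (w (cell γ N x))| ≤ x ^ 2 / T + D (cell γ N x) := by
    intro x
    have h1 := hcl3 x
    have h2 : |cl x - cl (w (cell γ N x))| ≤ D (cell γ N x) := by
      rw [← hbw, abs_sub_le_iff]
      have h3 := hup x
      have h4 := hlo x
      have h5 := hup (w (cell γ N x))
      have h6 := hlo (w (cell γ N x))
      rw [hw, ← hbw] at h5 h6
      exact ⟨by simp only [hD]; linarith, by simp only [hD]; linarith⟩
    exact (abs_sub_le _ (cl x) _).trans (add_le_add h1 h2)
  have hbd : Integrable (fun x => x ^ 2 / T + D (cell γ N x)) γ := (hint.div_const _).add hDint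
  refine ⟨fun j => cl (w j), ?_⟩
  rintro g rfl
  have hgint : Integrable (fun x => |x - cl (w (cell γ N x))|) γ := by
    refine hbd.mono' ?_ (ae_of_all _ fun x => ?_)
    · exact (measurable_id.sub ((measurable_of_countable fun j => cl (w j)).comp
        (measurable_cell γ N))).abs.aestronglyMeasurable
    · rw [Real.norm_eq_abs, abs_abs]
      exact hpt x
  refine ⟨hgint, (integral_mono hgint hbd hpt).trans ?_⟩
  rw [integral_add (f := fun x => x ^ 2 / T) (g := fun x => D (cell γ N x)) (hint.div_const _) hDint,
    integral_div, hDval]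
  have h1 : (∫ x, x ^ 2 ∂γ) / T ≤ σ ^ 2 / T := by gcongr
  have hN' : ((N : ℝ) + 1) = 2 ^ p * 2 ^ p := by
    rw [← mul_pow]
    norm_num
    exact_mod_cast hN
  have h2 : (∑ j, D j) / ((N : ℝ) + 1) ≤ 4 * T / (N + 1) := by gcongr
  have e1 : σ ^ 2 / T = σ / 2 ^ p := by
    rw [hT]
    field_simp
  have e2 : 4 * T / ((N : ℝ) + 1) = 4 * σ / 2 ^ p := by
    rw [hT, hN']
    field_simp
  rw [e1] at h1
  rw [e2] at h2
  calc _ ≤ σ / 2 ^ p + 4 * σ / 2 ^ p := add_le_add h1 h2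
    _ = _ := by ring

/-- Equal weight cubature with `2 ^ (d * 2p)` points for a product measure on `ℝ^d`. -/
theorem exists_cubature {d : ℕ} (γ : Fin d → Measure ℝ) [∀ i, IsProbabilityMeasure (γ i)]
    [∀ i, NullSingletonClass (γ i)] {σ : Fin d → ℝ} (hσ : ∀ i, 0 < σ i)
    (hint : ∀ i, Integrable (fun x => x ^ 2) (γ i)) (hvar : ∀ i, ∫ x, x ^ 2 ∂(γ i) ≤ σ i ^ 2)
    (p : ℕ) : ∃ point : Bits (d * (2 * p)) → (Fin d → ℝ), ∀ (g : (Fin d → ℝ) → ℝ) (L : Fin d → ℝ),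
      Continuous g → (∀ i, 0 ≤ L i) → (∀ t u, |g t - g u| ≤ ∑ i, L i * |t i - u i|) →
      |∫ t, g t ∂(Measure.pi γ) - (∑ x, g (point x)) / 2 ^ (d * (2 * p))| ≤
        5 / 2 ^ p * ∑ i, L i * σ i := by
  obtain ⟨N, hN⟩ : ∃ N, N + 1 = 4 ^ p := ⟨4 ^ p - 1, Nat.sub_add_cancel (Nat.one_le_pow _ _ (by norm_num))⟩
  choose y hy using fun i => exists_quantizer (γ i) (hσ i) (hint i) (hvar i) N p hN
  replace hy := fun i => hy i _ rfl
  have hcard : Fintype.card (Bits (d * (2 * p))) = Fintype.card (Fin d → Fin (N + 1)) := by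
    simp only [Fintype.card_pi, Fintype.card_bool, Finset.prod_const, Finset.card_univ,
      Fintype.card_fin, hN]
    rw [mul_comm d, pow_mul, pow_mul]
    norm_num
  set E := Fintype.equivOfCardEq hcard
  refine ⟨fun x i => y i (E x i), fun g L hg hL hgL => ?_⟩
  set m : (Fin d → ℝ) → Fin d → Fin (N + 1) := fun t i => cell (γ i) N (t i) with hm
  have hmm : Measurable m := measurable_pi_iff.2 fun i =>
    (measurable_cell (γ i) N).comp (measurable_pi_apply i)
  set G : (Fin d → Fin (N + 1)) → ℝ := fun j => g fun i => y i (j i) with hG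
  have hp : ∀ i, IsProbabilityMeasure ((γ i).map (cell (γ i) N)) := fun i =>
    Measure.isProbabilityMeasure_map (measurable_cell (γ i) N).aemeasurable
  have hmap : (Measure.pi γ).map m = Measure.pi fun i => (γ i).map (cell (γ i) N) :=
    Measure.pi_map_pi fun i => (measurable_cell (γ i) N).aemeasurable
  have hGval : ∫ t, G (m t) ∂(Measure.pi γ) = (∑ x, g fun i => y i (E x i)) / 2 ^ (d * (2 * p)) := by
    rw [← integral_map (φ := m) (f := G) hmm.aemeasurable
      (measurable_of_countable G).aestronglyMeasurable, hmap, integral_fintype .of_finite,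
      ← Equiv.sum_comp E, Finset.sum_div]
    refine Finset.sum_congr rfl fun x _ => ?_
    have h1 : (Measure.pi fun i => (γ i).map (cell (γ i) N)).real {E x} = 1 / 2 ^ (d * (2 * p)) := by
      rw [measureReal_def, Measure.pi_singleton, ENNReal.toReal_prod]
      have h2 : ∀ i, (((γ i).map (cell (γ i) N)) {E x i}).toReal = 1 / 4 ^ p := by
        intro i
        rw [← measureReal_def, map_measureReal_apply (measurable_cell _ N) (measurableSet_singleton _)]
        refine (measureReal_cell_eq (γ i) N _).trans ?_
        rw [show ((N : ℝ) + 1) = 4 ^ p by exact_mod_cast hN]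
      simp only [h2, Finset.prod_const, Finset.card_univ, Fintype.card_fin]
      rw [div_pow, one_pow, ← pow_mul, mul_comm d, pow_mul, pow_mul, pow_mul]
      norm_num
    rw [h1, smul_eq_mul]
    simp only [hG]
    ring
  have hcomp : ∀ i, Integrable (fun t : Fin d → ℝ => L i * |t i - y i (m t i)|) (Measure.pi γ) :=
    fun i => (integrable_comp_eval (μ := γ) (i := i)
      (f := fun x => |x - y i (cell (γ i) N x)|) (hy i).1).const_mul (L i)
  have hsum : Integrable (fun t : Fin d → ℝ => ∑ i, L i * |t i - y i (m t i)|) (Measure.pi γ) :=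
    integrable_finsetSum _ fun i _ => hcomp i
  have hGint : Integrable (fun t => G (m t)) (Measure.pi γ) :=
    Integrable.of_bound ((measurable_of_countable G).comp hmm).aestronglyMeasurable
      (∑ j, ‖G j‖) (ae_of_all _ fun x =>
        Finset.single_le_sum (f := fun j => ‖G j‖) (fun _ _ => norm_nonneg _) (Finset.mem_univ _))
  have hdiff : Integrable (fun t => g t - G (m t)) (Measure.pi γ) :=
    hsum.mono' (hg.measurable.sub ((measurable_of_countable G).comp hmm)).aestronglyMeasurable
      (ae_of_all _ fun t => hgL _ _)
  have hgint : Integrable g (Measure.pi γ) := by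
    have := hdiff.add hGint
    refine this.congr (ae_of_all _ fun t => ?_)
    simp
  rw [← hGval, ← integral_sub hgint hGint]
  refine (abs_integral_le_integral_abs).trans ((integral_mono hdiff.abs hsum fun t => hgL _ _).trans ?_)
  rw [integral_finsetSum _ fun i _ => hcomp i, Finset.mul_sum]
  refine Finset.sum_le_sum fun i _ => ?_
  rw [integral_const_mul]
  have h := integral_comp_eval (μ := γ) (i := i) (f := fun x => |x - y i (cell (γ i) N x)|)
    (hy i).1.aestronglyMeasurable
  simp only [hm]
  rw [h]
  calc L i * _ ≤ L i * (5 * σ i / 2 ^ p) := mul_le_mul_of_nonneg_left (hy i).2 (hL i)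
    _ = _ := by ring

namespace Setting
variable {X : Type*} [NormedAddCommGroup X] [NormedSpace ℝ X] [CompleteSpace X]
    [TopologicalSpace.SeparableSpace X] [MeasurableSpace X] [BorelSpace X]

theorem norm_Im_e (P : Setting X) (i : ℕ) : ‖P.Im (P.e i)‖ = 1 := P.orthonormal.1 i

/-- With a norming functional L of e_i, λ_i ‖e_i‖ is the covariance of the i-th coordinate and L.
The arithmetic-geometric mean inequality with weight √λ_i bounds it by √λ_i times a constant. So
‖e_i‖ grows at most like λ_i^{-1/2}. -/
theorem norm_e_mul_sqrt_lam_le (P : Setting X) (i : ℕ) :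
    ‖P.e i‖ * Real.sqrt (P.lam i) ≤ (1 + ∫ x, ‖x‖ ^ 2 ∂P.μ) / 2 := by
  set s := Real.sqrt (P.lam i) with hs
  have hs0 : 0 < s := Real.sqrt_pos.2 (P.lam_pos i)
  have hs2 : s ^ 2 = P.lam i := Real.sq_sqrt (P.lam_pos i).le
  obtain ⟨L, hL, hLe⟩ := exists_dual_vector'' ℝ (P.e i)
  have hi1 : Integrable (fun x => P.coord i x ^ 2) P.μ := (P.memLp_coord i).integrable_sq
  have hi2 := P.integrable_norm_pow 2
  have h1 : P.lam i * ‖P.e i‖ ≤ ∫ x, (P.coord i x ^ 2 / (2 * s) + s / 2 * ‖x‖ ^ 2) ∂P.μ := by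
    have e : P.lam i * ‖P.e i‖ = ∫ x, P.coord i x * L x ∂P.μ := by
      rw [P.integral_coord_mul, hLe]
      rfl
    rw [e]
    refine integral_mono ((P.memLp_coord i).integrable_mul (P.memLp_dual L))
      ((hi1.div_const _).add (hi2.const_mul _)) fun x => ?_
    have h2 : |L x| ≤ ‖x‖ := (L.le_opNorm x).trans (mul_le_of_le_one_left (norm_nonneg _) hL)
    have h3 : L x ^ 2 ≤ ‖x‖ ^ 2 := by
      rw [← sq_abs]
      gcongr
    have h4 : P.coord i x * L x ≤ P.coord i x ^ 2 / (2 * s) + s / 2 * L x ^ 2 := by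
      have e2 : P.coord i x ^ 2 / (2 * s) + s / 2 * L x ^ 2 - P.coord i x * L x =
          (P.coord i x - s * L x) ^ 2 / (2 * s) := by
        field_simp
        ring
      have : 0 ≤ (P.coord i x - s * L x) ^ 2 / (2 * s) := by positivity
      linarith
    refine h4.trans ?_
    gcongr
  rw [integral_add (f := fun x => P.coord i x ^ 2 / (2 * s)) (g := fun x => s / 2 * ‖x‖ ^ 2)
    (hi1.div_const _) (hi2.const_mul _), integral_div, integral_const_mul, P.integral_coord_sq,
    ← hs2] at h1
  have e : s ^ 2 / (2 * s) + s / 2 * ∫ x, ‖x‖ ^ 2 ∂P.μ = s * ((1 + ∫ x, ‖x‖ ^ 2 ∂P.μ) / 2) := by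
    field_simp
  rw [e, pow_two, mul_assoc] at h1
  rw [mul_comm]
  exact le_of_mul_le_mul_left h1 hs0

/-- The cubature error depends on L_i times the standard deviation √λ_i, which has to be bounded
uniformly in i and d. For r = 1 the Lipschitz condition through Im gives L_i = K 1; for r ≥ 2 the
derivative is bounded only in X, and L_i = K 1 ‖e_i‖ is compensated by √λ_i. -/
theorem exists_restrict_lipschitz (P : Setting X) {K : ℕ → ℝ} {r : ℕ} (hr : 1 ≤ r)
    (hK : ∀ i ≤ r, 0 < K i) : ∃ B : ℝ, 0 < B ∧ ∀ d : ℕ, ∃ L : Fin d → ℝ, (∀ i, 0 ≤ L i) ∧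
      (∀ i, L i * Real.sqrt (P.lam i) ≤ B) ∧ ∀ f ∈ P.F K r, ∀ t u : Fin d → ℝ,
        |P.restrict d f t - P.restrict d f u| ≤ ∑ i, L i * |t i - u i| := by
  have hK1 := hK 1 hr
  have hsub : ∀ (d : ℕ) (t u : Fin d → ℝ),
      ∑ i, t i • P.e i - ∑ i, u i • P.e i = ∑ i, (t i - u i) • P.e i := by
    intro d t u
    rw [← Finset.sum_sub_distrib]
    exact Finset.sum_congr rfl fun i _ => (sub_smul _ _ _).symm
  rcases hr.eq_or_lt with rfl | hr2
  · refine ⟨K 1 * Real.sqrt (P.lam 0), mul_pos hK1 (Real.sqrt_pos.2 (P.lam_pos 0)), fun d =>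
      ⟨fun _ => K 1, fun _ => hK1.le, fun i => ?_, fun f hf t u => ?_⟩⟩
    · have := P.lam_antitone (Nat.zero_le i)
      gcongr
    · have h := ((P.mem_F_iff le_rfl).1 hf).norm_sub_le (∑ i, t i • P.e i) (∑ i, u i • P.e i)
      rw [hsub, map_sum] at h
      refine h.trans ?_
      rw [← Finset.mul_sum]
      gcongr
      refine (norm_sum_le _ _).trans (Finset.sum_le_sum fun i _ => ?_)
      rw [map_smul, norm_smul, P.norm_Im_e, mul_one, Real.norm_eq_abs]
  · have hE : 0 ≤ ∫ x, ‖x‖ ^ 2 ∂P.μ := integral_nonneg fun x => by positivity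
    refine ⟨K 1 * ((1 + ∫ x, ‖x‖ ^ 2 ∂P.μ) / 2), by positivity, fun d =>
      ⟨fun i => K 1 * ‖P.e i‖, fun _ => by positivity, fun i => ?_, fun f hf t u => ?_⟩⟩
    · rw [mul_assoc]
      have := P.norm_e_mul_sqrt_lam_le i
      gcongr
    · have hd : Differentiable ℝ f := hf.1.differentiable (by
        have : r - 1 ≠ 0 := by omega
        exact_mod_cast this)
      have hb : ∀ x, ‖fderiv ℝ f x‖ ≤ K 1 := by
        intro x
        have h := hf.2.1 1 (by omega) x
        rwa [norm_iteratedFDeriv_one] at h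
      have h := Convex.norm_image_sub_le_of_norm_fderiv_le (𝕜 := ℝ) (fun x _ => hd x)
        (fun x _ => hb x) convex_univ (Set.mem_univ (∑ i, u i • P.e i))
        (Set.mem_univ (∑ i, t i • P.e i))
      rw [hsub] at h
      refine h.trans ?_
      simp only [mul_assoc]
      rw [← Finset.mul_sum]
      gcongr
      refine (norm_sum_le _ _).trans (Finset.sum_le_sum fun i _ => ?_)
      rw [norm_smul, Real.norm_eq_abs, mul_comm]

/-- The Gaussian integral over `X_d` is close to the mean of function values at `2 ^ (d * 2p)`
points. -/
theorem exists_points (P : Setting X) {K : ℕ → ℝ} {r : ℕ} (hr : 1 ≤ r) (hK : ∀ i ≤ r, 0 < K i) :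
    ∃ B : ℝ, 0 < B ∧ ∀ d p : ℕ, ∃ point : Bits (d * (2 * p)) → (Fin d → ℝ), ∀ f ∈ P.F K r,
      |P.Id d f - (∑ x, P.restrict d f (point x)) / 2 ^ (d * (2 * p))| ≤ B * d / 2 ^ p := by
  obtain ⟨B, hB, h⟩ := P.exists_restrict_lipschitz hr hK
  refine ⟨5 * B, by positivity, fun d p => ?_⟩
  obtain ⟨L, hL0, hL, hLf⟩ := h d
  have hn : ∀ i, (P.lam i).toNNReal ≠ 0 := fun i => (Real.toNNReal_pos.2 (P.lam_pos i)).ne'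
  have hna : ∀ i : Fin d, NullSingletonClass (gaussianReal 0 (P.lam i).toNNReal) := fun i =>
    nullSingletonClass_gaussianReal (hn i)
  have hvar : ∀ i : Fin d, ∫ x, x ^ 2 ∂(gaussianReal 0 (P.lam i).toNNReal) =
      Real.sqrt (P.lam i) ^ 2 := by
    intro i
    rw [Real.sq_sqrt (P.lam_pos i).le, ← P.map_coord, integral_map (by fun_prop) (by fun_prop)]
    exact P.integral_coord_sq i
  have hint : ∀ i : Fin d, Integrable (fun x => x ^ 2) (gaussianReal 0 (P.lam i).toNNReal) :=
    fun i => (memLp_id_gaussianReal 2).integrable_sq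
  obtain ⟨point, hpoint⟩ := exists_cubature (fun i : Fin d => gaussianReal 0 (P.lam i).toNNReal)
    (fun i => Real.sqrt_pos.2 (P.lam_pos i)) hint (fun i => (hvar i).le) p
  refine ⟨point, fun f hf => ?_⟩
  have hc : Continuous (P.restrict d f) := by
    have := P.continuous_of_mem_F hf
    unfold restrict
    fun_prop
  refine (hpoint _ L hc hL0 (hLf f hf)).trans ?_
  have : ∑ i : Fin d, L i * Real.sqrt (P.lam i) ≤ ∑ i : Fin d, B := Finset.sum_le_sum fun i _ => hL i
  simp only [Finset.sum_const, Finset.card_univ, Fintype.card_fin, nsmul_eq_mul] at this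
  calc _ ≤ 5 / 2 ^ p * (d * B) := by gcongr
    _ = _ := by ring

end Setting

/-! ### Resources of the quantum algorithms -/

/-- Logarithms are dominated by powers. -/
theorem exists_succ_le_mul_rpow {δ : ℝ} (hδ : 0 < δ) :
    ∃ C : ℝ, 0 < C ∧ ∀ (n : ℕ) (x : ℝ), (2 : ℝ) ^ n ≤ x → (n : ℝ) + 1 ≤ C * x ^ δ := by
  have hl := Real.log_pos one_lt_two
  refine ⟨1 + 1 / (δ * Real.log 2), by positivity, fun n x hx => ?_⟩
  have h1 : δ * Real.log 2 * n + 1 ≤ ((2 : ℝ) ^ n) ^ δ := by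
    rw [Real.rpow_def_of_pos (by positivity), Real.log_pow]
    calc δ * Real.log 2 * n + 1 = n * Real.log 2 * δ + 1 := by ring
      _ ≤ _ := Real.add_one_le_exp _
  have h2 : ((2 : ℝ) ^ n) ^ δ ≤ x ^ δ := by gcongr
  calc (n : ℝ) + 1 ≤ (1 + 1 / (δ * Real.log 2)) * (δ * Real.log 2 * n + 1) := by
        have e : (1 + 1 / (δ * Real.log 2)) * (δ * Real.log 2 * n + 1) =
          n + 1 + (δ * Real.log 2 * n + 1 / (δ * Real.log 2)) := by
          field_simp
          ring
        rw [e]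
        have : 0 ≤ δ * Real.log 2 * n + 1 / (δ * Real.log 2) := by positivity
        linarith
    _ ≤ _ := by
        gcongr
        exact h1.trans h2

theorem exists_pow_between {b x : ℝ} (hb : 1 < b) (hx : 0 ≤ x) :
    ∃ n : ℕ, x ≤ b ^ (n + 1) ∧ b ^ (n + 1) ≤ b * (x + 1) := by
  obtain ⟨n, h1, h2⟩ := exists_nat_pow_near (by linarith : 1 ≤ x + 1) hb
  refine ⟨n, by linarith, ?_⟩
  rw [pow_succ']
  gcongr

/-- Used with x = 1/ε, T = 3^J and t = x^(δ/4), which dominates the logarithmic quantities p, v and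
J. At most three such factors occur in any term, so t^4 = x^δ suffices, and the powers of Y up to 4
are collected in one constant. -/
theorem resource_bounds {B Y x t d p v J T : ℝ} (hB : 0 < B) (hY0 : 0 < Y) (hx1 : 1 ≤ x)
    (ht1 : 1 ≤ t) (hd0 : 0 ≤ d) (hp0 : 0 ≤ p) (hv0 : 0 ≤ v) (hJ0 : 0 ≤ J) (hT0 : 0 ≤ T)
    (hp' : p + 1 ≤ Y * t) (hv' : v + 1 ≤ Y * t) (hJ' : J + 1 ≤ Y * t) (hJ : T ≤ B * (1 + x)) :
    4096 * (J + 1) ^ 2 + 2 * (d * (2 * p) + 1) + v ≤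
      1000000 * (Y ^ 2 + Y + Y ^ 4 + 1) * (2 * B + 1) * (d + 1) * t ^ 4 ∧
    4096 * (J + 1) ^ 2 * (4 * T) ≤
      1000000 * (Y ^ 2 + Y + Y ^ 4 + 1) * (2 * B + 1) * (x * t ^ 4) ∧
    (d * (2 * p) + 1) + 4096 * (J + 1) ^ 2 * (2 * T * (42 * (d * (2 * p) + 1) + 4 * v + 3) + 3) ≤
      1000000 * (Y ^ 2 + Y + Y ^ 4 + 1) * (2 * B + 1) * (d + 1) * (x * t ^ 4) := by
  have hx0 : 0 < x := by linarith
  have ht0 : 0 < t := by linarith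
  have hn : d * (2 * p) + 1 ≤ (d + 1) * (2 * (Y * t)) := by
    have : (1 : ℝ) ≤ p + 1 := by linarith [hp0]
    calc d * (2 * p) + 1 ≤ (d + 1) * (2 * (p + 1)) := by nlinarith
      _ ≤ _ := by gcongr
  have hv'' : (v : ℝ) ≤ (d + 1) * (Y * t) := by
    have : 0 < Y * t := by positivity
    nlinarith
  have hYt : 1 ≤ Y * t := by linarith [hp0]
  have h3J : T ≤ 2 * B * x := hJ.trans (by
    calc B * (1 + x) ≤ B * (x + x) := by gcongr
      _ = _ := by ring)
  have hJ2 : (J + 1) ^ 2 ≤ (Y * t) ^ 2 := by gcongr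
  have ht2 : t ^ 2 ≤ t ^ 4 := pow_le_pow_right₀ ht1 (by norm_num)
  have ht4 : t ≤ t ^ 4 := le_self_pow₀ ht1 (by norm_num)
  have ht3 : t ^ 3 ≤ t ^ 4 := pow_le_pow_right₀ ht1 (by norm_num)
  have hY3 : Y ^ 3 ≤ Y ^ 4 + Y ^ 2 := by nlinarith [sq_nonneg (Y ^ 2 - Y), pow_pos hY0 3]
  set W := Y ^ 2 + Y + Y ^ 4 + 1 with hW
  have hW2 : (Y * t) ^ 2 ≤ W * t ^ 4 := by
    rw [mul_pow]
    have : Y ^ 2 ≤ W := by rw [hW]; nlinarith [pow_pos hY0 4]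
    gcongr
  have hW1 : Y * t ≤ W * t ^ 4 := by
    have : Y ≤ W := by rw [hW]; nlinarith [pow_pos hY0 4, pow_pos hY0 2]
    gcongr
  have hW3 : (Y * t) ^ 3 ≤ W * t ^ 4 := by
    rw [mul_pow]
    have : Y ^ 3 ≤ W := by rw [hW]; linarith
    gcongr
  have hW0 : 0 < W := by positivity
  have hWt : 0 < W * t ^ 4 := by positivity
  refine ⟨?_, ?_, ?_⟩
  · calc 4096 * (J + 1) ^ 2 + 2 * (d * (2 * p) + 1) + v
        ≤ 4096 * ((Y * t) ^ 2) + 2 * ((d + 1) * (2 * (Y * t))) + (d + 1) * (Y * t) := by gcongr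
      _ ≤ 4096 * (W * t ^ 4) + 2 * ((d + 1) * (2 * (W * t ^ 4))) + (d + 1) * (W * t ^ 4) := by gcongr
      _ ≤ 1000000 * ((d + 1) * (W * t ^ 4)) := by
          have : 0 ≤ d * (W * t ^ 4) := by positivity
          linarith
      _ ≤ 1000000 * ((d + 1) * (W * t ^ 4)) * (2 * B + 1) :=
          le_mul_of_one_le_right (by positivity) (by linarith)
      _ = _ := by ring
  · calc 4096 * (J + 1) ^ 2 * (4 * T) ≤ 4096 * (W * t ^ 4) * (4 * (2 * B * x)) := by
          gcongr
          exact hJ2.trans hW2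
      _ ≤ 1000000 * (W * t ^ 4) * ((2 * B + 1) * x) := by
          have : 0 ≤ W * t ^ 4 * x * B := by positivity
          have : 0 ≤ W * t ^ 4 * x := by positivity
          linarith
      _ = _ := by ring
  · have h1 : 42 * (d * (2 * p) + 1) + 4 * v + 3 ≤ 91 * ((d + 1) * (Y * t)) := by
      have : 1 ≤ (d + 1) * (Y * t) := one_le_mul_of_one_le_of_one_le (by linarith) hYt
      linarith
    calc (d * (2 * p) + 1) + 4096 * (J + 1) ^ 2 *
          (2 * T * (42 * (d * (2 * p) + 1) + 4 * v + 3) + 3) ≤ (d + 1) * (2 * (Y * t)) + 4096 * (Y * t) ^ 2 *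
          (2 * (2 * B * x) * (91 * ((d + 1) * (Y * t))) + 3) := by gcongr
      _ = 2 * ((d + 1) * (Y * t)) + 4096 * (364 * (B * x * (d + 1) * (Y * t) ^ 3) + 3 * (Y * t) ^ 2) := by
          ring
      _ ≤ 2 * ((d + 1) * (W * t ^ 4)) + 4096 * (364 * (B * x * (d + 1) * (W * t ^ 4)) +
          3 * (W * t ^ 4)) := by gcongr
      _ ≤ 2 * ((d + 1) * (W * t ^ 4) * x) + 4096 * (364 * (B * x * (d + 1) * (W * t ^ 4)) +
          3 * ((d + 1) * (W * t ^ 4) * x)) := by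
          have h1 : (d + 1) * (W * t ^ 4) ≤ (d + 1) * (W * t ^ 4) * x :=
            le_mul_of_one_le_right (by positivity) hx1
          have h2 : W * t ^ 4 ≤ (d + 1) * (W * t ^ 4) := le_mul_of_one_le_left hWt.le (by linarith)
          linarith [h2.trans h1]
      _ ≤ 1000000 * W * (2 * B + 1) * (d + 1) * (x * t ^ 4) := by
          have h1 : 0 ≤ (d + 1) * (W * t ^ 4) * x := by positivity
          have h2 : 0 ≤ B * x * (d + 1) * (W * t ^ 4) := by positivity
          linarith

namespace Setting
variable {X : Type*} [NormedAddCommGroup X] [NormedSpace ℝ X] [CompleteSpace X]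
    [TopologicalSpace.SeparableSpace X] [MeasurableSpace X] [BorelSpace X]

/-- The error budget is ε/2 for the truncation and ε/6 each for the cubature (p), the rounding of
the values (v) and the estimation of the angle (J). The bounds on 2^p, 2^v and 3^J say that these
parameters are logarithmic. -/
theorem exists_quantumSolves (P : Setting X) {K : ℕ → ℝ} {r : ℕ} (hr : 1 ≤ r)
    (hK : ∀ i ≤ r, 0 < K i)
    (hdim : ∀ ε : ℝ, 0 < ε → ∀ f ∈ P.F K r, |P.I f - P.Id (P.dim K r ε) f| ≤ ε / 2) :
    ∃ B : ℝ, 0 < B ∧ ∀ ε : ℝ, 0 < ε → ∃ A : QuantumAlg (P.dim K r ε), P.QuantumSolves K r ε A ∧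
      ∃ p v J : ℕ, (2 : ℝ) ^ p ≤ B * (P.dim K r ε + 1) * (1 + 1 / ε) ∧ (2 : ℝ) ^ v ≤ B * (1 + 1 / ε) ∧
        (3 : ℝ) ^ J ≤ B * (1 + 1 / ε) ∧
        P.dim K r ε ≤ A.qubits ∧
        A.qubits = 4096 * (J + 1) ^ 2 + 2 * (P.dim K r ε * (2 * p) + 1) + v ∧
        A.queries ≤ 4096 * (J + 1) ^ 2 * (4 * 3 ^ J) ∧
        A.ops ≤ (P.dim K r ε * (2 * p) + 1) +
          4096 * (J + 1) ^ 2 * (2 * 3 ^ J * (42 * (P.dim K r ε * (2 * p) + 1) + 4 * v + 3) + 3) := by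
  obtain ⟨B, hB, hpt⟩ := P.exists_points hr hK
  have hK0 := hK 0 (Nat.zero_le _)
  refine ⟨2 * (6 * B + 1) + 4 * (96 * K 0 + 1) + 3 * (24 * K 0 + 1), by positivity, fun ε hε => ?_⟩
  set d := P.dim K r ε
  set b := 2 * (6 * B + 1) + 4 * (96 * K 0 + 1) + 3 * (24 * K 0 + 1) with hb
  obtain ⟨p, hp1, hp2⟩ := exists_pow_between (b := 2) one_lt_two (by positivity : 0 ≤ 6 * B * d / ε)
  obtain ⟨v, hv1, hv2⟩ := exists_pow_between (b := 2) one_lt_two (by positivity : 0 ≤ 96 * K 0 / ε)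
  obtain ⟨J, hJ1, hJ2⟩ := exists_pow_between (b := 3) (by norm_num) (by positivity : 0 ≤ 24 * K 0 / ε)
  obtain ⟨point, hpoint⟩ := hpt d (p + 1)
  obtain ⟨A, hA1, hA2, hA3, hA4⟩ := exists_mean_algorithm (d * (2 * (p + 1))) (v + 1 + 1) (J + 1)
    (by omega) hK0 point
  refine ⟨A, fun f hf => ?_, p + 1, v + 1 + 1, J + 1, ?_, ?_, ?_, ?_, hA1, hA2, hA3⟩
  · refine (hA4 (P.restrict d f) fun x => P.abs_le_of_mem_F hf _).trans (A.prob_mono _ ?_)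
    intro y hy
    simp only [Set.mem_ofPred_eq] at hy ⊢
    have h1 := hdim ε hε f hf
    have h2 := hpoint f hf
    have h3 : B * d / 2 ^ (p + 1) ≤ ε / 6 := by
      rw [div_le_iff₀ (by positivity)]
      rw [div_le_iff₀ hε] at hp1
      linarith
    have h4 : 16 * K 0 / 2 ^ (v + 1 + 1) ≤ ε / 6 := by
      rw [div_le_iff₀ (by positivity), pow_succ]
      rw [div_le_iff₀ hε] at hv1
      nlinarith [show (0 : ℝ) < 2 ^ (v + 1) by positivity]
    have h5 : 4 * K 0 / 3 ^ (J + 1) ≤ ε / 6 := by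
      rw [div_le_iff₀ (by positivity)]
      rw [div_le_iff₀ hε] at hJ1
      linarith
    rw [abs_le] at *
    constructor <;> linarith [h1.1, h1.2, h2.1, h2.2, hy.1, hy.2]
  · refine hp2.trans ?_
    have e : 2 * (6 * B * d / ε + 1) = 2 * (6 * B * (d * (1 / ε)) + 1) := by ring
    have h0 : 0 < 1 / ε := by positivity
    have h1 : (d : ℝ) * (1 / ε) ≤ (d + 1) * (1 + 1 / ε) := by
      gcongr <;> linarith
    have h2 : 1 ≤ ((d : ℝ) + 1) * (1 + 1 / ε) :=
      one_le_mul_of_one_le_of_one_le (by linarith [d.cast_nonneg (α := ℝ)]) (by linarith)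
    calc 2 * (6 * B * d / ε + 1) = 2 * (6 * B * (d * (1 / ε)) + 1) := by ring
      _ ≤ 2 * (6 * B * ((d + 1) * (1 + 1 / ε)) + 1 * ((d + 1) * (1 + 1 / ε))) := by
          rw [one_mul]
          gcongr
      _ = 2 * (6 * B + 1) * ((d + 1) * (1 + 1 / ε)) := by ring
      _ ≤ b * ((d + 1) * (1 + 1 / ε)) := by
          gcongr
          rw [hb]
          linarith
      _ = _ := by ring
  · rw [pow_succ]
    have h0 : 0 < 1 / ε := by positivity
    calc (2 : ℝ) ^ (v + 1) * 2 ≤ 2 * (96 * K 0 / ε + 1) * 2 := by gcongr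
      _ = 4 * (96 * K 0 * (1 / ε) + 1) := by ring
      _ ≤ 4 * (96 * K 0 * (1 + 1 / ε) + 1 * (1 + 1 / ε)) := by
          gcongr <;> linarith
      _ = 4 * (96 * K 0 + 1) * (1 + 1 / ε) := by ring
      _ ≤ _ := by
          gcongr
          rw [hb]
          linarith
  · have h0 : 0 < 1 / ε := by positivity
    refine hJ2.trans ?_
    calc 3 * (24 * K 0 / ε + 1) = 3 * (24 * K 0 * (1 / ε) + 1) := by ring
      _ ≤ 3 * (24 * K 0 * (1 + 1 / ε) + 1 * (1 + 1 / ε)) := by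
          gcongr <;> linarith
      _ = 3 * (24 * K 0 + 1) * (1 + 1 / ε) := by ring
      _ ≤ _ := by
          gcongr
          rw [hb]
          linarith
  · rw [hA1]
    nlinarith [Nat.zero_le (d * p)]

/-- The quantum algorithms: the numbers of qubits, queries and operations. -/
theorem exists_quantumAlgs (P : Setting X) {K : ℕ → ℝ} {r : ℕ} (hr : 1 ≤ r)
    (hK : ∀ i ≤ r, 0 < K i)
    (hdim : ∀ ε : ℝ, 0 < ε → ∀ f ∈ P.F K r, |P.I f - P.Id (P.dim K r ε) f| ≤ ε / 2)
    {C₀ : ℝ} {s : ℕ} (hC₀ : 0 < C₀)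
    (hle : ∀ ε : ℝ, 0 < ε → ε ≤ 1 → (P.dim K r ε : ℝ) ≤ C₀ * (1 / ε) ^ s) :
    ∃ A : (ε : ℝ) → QuantumAlg (P.dim K r ε), (∀ ε : ℝ, 0 < ε → P.QuantumSolves K r ε (A ε)) ∧
      (∀ ε : ℝ, 0 < ε → P.dim K r ε ≤ (A ε).qubits) ∧
      ∀ δ : ℝ, 0 < δ → ∃ C : ℝ, 0 < C ∧ ∀ ε : ℝ, 0 < ε → ε ≤ 1 →
        ((A ε).qubits : ℝ) ≤ C * (P.dim K r ε + 1) * (1 / ε) ^ δ ∧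
        ((A ε).queries : ℝ) ≤ C * (1 / ε) ^ (1 + δ) ∧
        ((A ε).ops : ℝ) ≤ C * (P.dim K r ε + 1) * (1 / ε) ^ (1 + δ) := by
  obtain ⟨B, hB, h⟩ := P.exists_quantumSolves hr hK hdim
  have hinh : ∀ ε : ℝ, ∃ A : QuantumAlg (P.dim K r ε), 0 < ε → P.QuantumSolves K r ε A ∧
      ∃ p v J : ℕ, (2 : ℝ) ^ p ≤ B * (P.dim K r ε + 1) * (1 + 1 / ε) ∧ (2 : ℝ) ^ v ≤ B * (1 + 1 / ε) ∧
        (3 : ℝ) ^ J ≤ B * (1 + 1 / ε) ∧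
        P.dim K r ε ≤ A.qubits ∧
        A.qubits = 4096 * (J + 1) ^ 2 + 2 * (P.dim K r ε * (2 * p) + 1) + v ∧
        A.queries ≤ 4096 * (J + 1) ^ 2 * (4 * 3 ^ J) ∧
        A.ops ≤ (P.dim K r ε * (2 * p) + 1) +
          4096 * (J + 1) ^ 2 * (2 * 3 ^ J * (42 * (P.dim K r ε * (2 * p) + 1) + 4 * v + 3) + 3) := by
    intro ε
    by_cases hε : 0 < ε
    · obtain ⟨A, hA⟩ := h ε hε
      exact ⟨A, fun _ => hA⟩
    -- An arbitrary algorithm for ε ≤ 0, where nothing is claimed.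
    · obtain ⟨A, -⟩ := exists_mean_algorithm 0 2 0 le_rfl one_pos
        (fun _ => (0 : Fin (P.dim K r ε) → ℝ))
      exact ⟨A, fun h => absurd h hε⟩
  choose A hA using hinh
  refine ⟨A, fun ε hε => (hA ε hε).1, fun ε hε => ?_, fun δ hδ => ?_⟩
  · obtain ⟨-, p, v, J, -, -, -, h, -⟩ := hA ε hε
    exact h
  -- The number 2^p is at most Z x^(s+1), because d is at most C₀ x^s. The power η of this is a
  -- constant times x^(δ/4).
  set η := δ / (4 * (s + 1)) with hη
  have hη0 : 0 < η := by positivity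
  obtain ⟨C₁, hC₁, hlog⟩ := exists_succ_le_mul_rpow hη0
  set Z := 2 * B * (C₀ + 1) with hZ
  have hZ0 : 0 < Z := by positivity
  set Y := C₁ * Z ^ η with hY
  have hY0 : 0 < Y := by positivity
  refine ⟨1000000 * (Y ^ 2 + Y + Y ^ 4 + 1) * (2 * B + 1), by positivity, fun ε hε hε1 => ?_⟩
  obtain ⟨-, p, v, J, hp, hv, hJ, -, hqb, hqu, hop⟩ := hA ε hε
  set d := P.dim K r ε
  set x := 1 / ε with hx
  have hx1 : 1 ≤ x := by rw [hx, le_div_iff₀ hε]; linarith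
  have hx0 : 0 < x := by linarith
  have hd := hle ε hε hε1
  have key : ∀ n : ℕ, (2 : ℝ) ^ n ≤ Z * x ^ (s + 1) → (n : ℝ) + 1 ≤ Y * x ^ (δ / 4) := by
    intro n hn
    refine (hlog n _ hn).trans (le_of_eq ?_)
    rw [Real.mul_rpow hZ0.le (by positivity), ← Real.rpow_natCast, ← Real.rpow_mul hx0.le, hY,
      mul_assoc]
    congr 3
    rw [hη]
    push_cast
    field_simp
  have hxs : 1 ≤ x ^ s := one_le_pow₀ hx1
  have hp' : (p : ℝ) + 1 ≤ Y * x ^ (δ / 4) := by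
    refine key p (hp.trans ?_)
    have h1 : (d : ℝ) + 1 ≤ (C₀ + 1) * x ^ s := by linarith
    calc B * (d + 1) * (1 + x) ≤ B * ((C₀ + 1) * x ^ s) * (x + x) := by gcongr
      _ = _ := by rw [hZ]; ring
  have hsm : B * (1 + x) ≤ Z * x ^ (s + 1) := by
    calc B * (1 + x) ≤ B * (x + x) := by gcongr
      _ = 2 * B * (0 + 1) * (1 * x) := by ring
      _ ≤ 2 * B * (C₀ + 1) * (x ^ s * x) := by gcongr
      _ = _ := by rw [hZ]; ring
  have hv' : (v : ℝ) + 1 ≤ Y * x ^ (δ / 4) := key v (hv.trans hsm)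
  have hJ' : (J : ℝ) + 1 ≤ Y * x ^ (δ / 4) := by
    refine key J (le_trans ?_ (hJ.trans hsm))
    gcongr
    norm_num
  set t := x ^ (δ / 4) with ht
  have ht1 : 1 ≤ t := Real.one_le_rpow hx1 (by positivity)
  have htδ : t ^ 4 = x ^ δ := by
    rw [ht, ← Real.rpow_natCast, ← Real.rpow_mul hx0.le]
    congr 1
    push_cast
    ring
  have hxδ : x ^ (1 + δ) = x * t ^ 4 := by rw [Real.rpow_add hx0, Real.rpow_one, htδ]
  rw [← htδ, hxδ]
  have hqb' : ((A ε).qubits : ℝ) = 4096 * (J + 1) ^ 2 + 2 * (d * (2 * p) + 1) + v := by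
    rw [hqb]; push_cast; ring
  have hqu' : ((A ε).queries : ℝ) ≤ 4096 * (J + 1) ^ 2 * (4 * 3 ^ J) := by exact_mod_cast hqu
  have hop' : ((A ε).ops : ℝ) ≤ (d * (2 * p) + 1) +
      4096 * (J + 1) ^ 2 * (2 * 3 ^ J * (42 * (d * (2 * p) + 1) + 4 * v + 3) + 3) := by
    exact_mod_cast hop
  have hpos : ∀ n : ℕ, (0 : ℝ) ≤ n := fun n => n.cast_nonneg
  obtain ⟨h1, h2, h3⟩ := resource_bounds hB hY0 hx1 ht1 (hpos d) (hpos p) (hpos v) (hpos J)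
    (by positivity) hp' hv' hJ' hJ
  exact ⟨hqb'.le.trans h1, hqu'.trans h2, hop'.trans h3⟩

end Setting

/-! ### Asymptotics of the counts and costs -/

theorem tendsto_one_div_rpow {δ : ℝ} (hδ : 0 < δ) :
    Tendsto (fun ε : ℝ => (1 / ε) ^ δ) (𝓝[>] 0) atTop := by
  simp only [one_div]
  exact (tendsto_rpow_atTop hδ).comp tendsto_inv_nhdsGT_zero

/-- Constants are absorbed by powers. -/
theorem eventually_mul_rpow_le (C : ℝ) {a b : ℝ} (hab : a < b) :
    ∀ᶠ ε in 𝓝[>] (0 : ℝ), C * (1 / ε) ^ a ≤ (1 / ε) ^ b := by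
  filter_upwards [(tendsto_one_div_rpow (sub_pos.2 hab)).eventually_ge_atTop C,
    self_mem_nhdsWithin] with ε h hε
  have hε' : 0 < 1 / ε := by
    have : 0 < ε := hε
    positivity
  calc C * (1 / ε) ^ a ≤ (1 / ε) ^ (b - a) * (1 / ε) ^ a := by gcongr
    _ = _ := by rw [← Real.rpow_add hε', sub_add_cancel]

/-- M is the integer part of (c/ε)^(1/q). Rounding costs at most a factor 2, and all constants are
absorbed by the gap between e and p/q. -/
theorem eventually_exists_nat {c : ℝ} (hc : 0 < c) {q p : ℕ} (hq : 1 ≤ q) {e : ℝ}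
    (he : e < p / q) : ∀ᶠ ε in 𝓝[>] (0 : ℝ), ∃ M : ℕ, 1 ≤ M ∧ ε * (M : ℝ) ^ q ≤ c ∧
      (1 / ε) ^ e ≤ (M : ℝ) ^ p := by
  have hq0 : (0 : ℝ) < q := by exact_mod_cast hq
  have hq' : 0 < 1 / (q : ℝ) := by positivity
  have hcq : 0 < c ^ (1 / (q : ℝ)) := Real.rpow_pos_of_pos hc _
  filter_upwards [(tendsto_one_div_rpow hq').eventually_ge_atTop (1 / c ^ (1 / (q : ℝ))),
    eventually_mul_rpow_le (1 / (c ^ (1 / (q : ℝ)) / 2) ^ p) he, self_mem_nhdsWithin] with ε h1 h2 hε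
  have hε : 0 < ε := hε
  set x := 1 / ε with hx
  have hx0 : 0 < x := by positivity
  set y := c ^ (1 / (q : ℝ)) * x ^ (1 / (q : ℝ)) with hy
  have hy1 : 1 ≤ y := by
    rw [div_le_iff₀ hcq] at h1
    linarith
  have hfl := Nat.floor_le (by linarith : 0 ≤ y)
  have hM : 1 ≤ ⌊y⌋₊ := (Nat.one_le_floor_iff y).2 hy1
  have hM' : y / 2 ≤ ⌊y⌋₊ := by
    have h3 := Nat.lt_floor_add_one y
    have h4 : (1 : ℝ) ≤ ⌊y⌋₊ := by exact_mod_cast hM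
    linarith
  refine ⟨⌊y⌋₊, hM, ?_, ?_⟩
  · calc ε * (⌊y⌋₊ : ℝ) ^ q ≤ ε * y ^ q := by gcongr
      _ = ε * (c * x) := by
        rw [hy, ← Real.mul_rpow hc.le hx0.le, one_div (q : ℝ), Real.rpow_inv_natCast_pow (by positivity)
          (by omega)]
      _ = c := by
        rw [hx]
        field_simp
  · have h5 : (y / 2) ^ p ≤ (⌊y⌋₊ : ℝ) ^ p := by gcongr
    refine le_trans ?_ h5
    have e1 : (y / 2) ^ p = (c ^ (1 / (q : ℝ)) / 2) ^ p * x ^ ((p : ℝ) / q) := by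
      rw [hy, mul_div_right_comm, mul_pow]
      congr 1
      rw [← Real.rpow_natCast, ← Real.rpow_mul hx0.le]
      congr 1
      ring
    rw [e1]
    rw [one_div, inv_mul_le_iff₀ (by positivity)] at h2
    exact h2

namespace Setting
variable {X : Type*} [NormedAddCommGroup X] [NormedSpace ℝ X] [CompleteSpace X]
    [TopologicalSpace.SeparableSpace X] [MeasurableSpace X] [BorelSpace X]

/-- With M of order ε^(-1/(r+D)) the bound M^(2D)/4 has exponent 2D/(r+D), which exceeds 2 - δ/2
once D > 4r/δ. -/
theorem eventually_le_nRan (P : Setting X) {K : ℕ → ℝ} {r : ℕ} (hr : 1 ≤ r)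
    (hK : ∀ i ≤ r, 0 < K i) {δ : ℝ} (hδ : 0 < δ) :
    ∀ᶠ ε in 𝓝[>] (0 : ℝ), ENNReal.ofReal ((1 / ε) ^ (2 - δ)) ≤ P.nRan K r ε := by
  obtain ⟨D, hD⟩ := exists_nat_gt (4 * r / δ)
  obtain ⟨c, hc, h⟩ := P.exists_le_of_ranSolves hr hK D
  have hr0 : (0 : ℝ) < r := by exact_mod_cast hr
  have hD0 : (0 : ℝ) < D := lt_of_le_of_lt (by positivity) hD
  have he : 2 - δ / 2 < ((2 * D : ℕ) : ℝ) / ((r + D : ℕ) : ℝ) := by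
    push_cast
    rw [lt_div_iff₀ (by positivity)]
    rw [div_lt_iff₀ hδ] at hD
    nlinarith
  filter_upwards [eventually_exists_nat hc (by omega : 1 ≤ r + D) he,
    eventually_mul_rpow_le 4 (by linarith : 2 - δ < 2 - δ / 2)] with ε h1 h2
  obtain ⟨M, hM, hM1, hM2⟩ := h1
  refine le_sInf ?_
  rintro N ⟨A, hA, hN⟩
  refine le_trans (ENNReal.ofReal_le_ofReal ?_) (h M ε hM hM1 _ A hA N hN)
  linarith

theorem eventually_le_qq (P : Setting X) {K : ℕ → ℝ} {r : ℕ} (hr : 1 ≤ r)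
    (hK : ∀ i ≤ r, 0 < K i) {δ : ℝ} (hδ : 0 < δ) :
    ∀ᶠ ε in 𝓝[>] (0 : ℝ), ENNReal.ofReal ((1 / ε) ^ (1 - δ)) ≤ P.qq K r ε := by
  obtain ⟨D, hD⟩ := exists_nat_gt (2 * r / δ)
  obtain ⟨c, hc, h⟩ := P.exists_le_of_quantumSolves hr hK D
  have hr0 : (0 : ℝ) < r := by exact_mod_cast hr
  have hD0 : (0 : ℝ) < D := lt_of_le_of_lt (by positivity) hD
  have he : 1 - δ / 2 < (D : ℝ) / ((r + D : ℕ) : ℝ) := by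
    push_cast
    rw [lt_div_iff₀ (by positivity)]
    rw [div_lt_iff₀ hδ] at hD
    nlinarith
  filter_upwards [eventually_exists_nat hc (by omega : 1 ≤ r + D) he,
    eventually_mul_rpow_le 2 (by linarith : 1 - δ < 1 - δ / 2)] with ε h1 h2
  obtain ⟨M, hM, hM1, hM2⟩ := h1
  refine le_sInf ?_
  rintro N ⟨A, hA, rfl⟩
  have h3 := h M ε hM hM1 _ A hA
  rw [← ENNReal.ofReal_natCast]
  refine ENNReal.ofReal_le_ofReal ?_
  linarith

/-- With M of order ε^(-1/r), the dimension D = r(s+2) makes M^D of order ε^(-(s+2)); one power is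
spent on constants. -/
theorem eventually_le_compWor (P : Setting X) {K : ℕ → ℝ} {r : ℕ} (hr : 1 ≤ r)
    (hK : ∀ i ≤ r, 0 < K i) {c : ℕ → ℝ} (hc0 : ∀ d, 0 ≤ c d) (s : ℕ) :
    ∀ᶠ ε in 𝓝[>] (0 : ℝ),
      ENNReal.ofReal (c (P.dim K r ε) * (1 / ε) ^ (s : ℝ)) ≤ P.compWor K r c ε := by
  obtain ⟨κ, hκ, h⟩ := P.exists_le_values_of_detSolves hr hK (r * (s + 2))
  have hr0 : (0 : ℝ) < r := by exact_mod_cast hr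
  have he : (s : ℝ) + 1 < ((r * (s + 2) : ℕ) : ℝ) / (r : ℝ) := by
    push_cast
    rw [lt_div_iff₀ (by positivity)]
    nlinarith
  filter_upwards [eventually_exists_nat hκ hr he,
    eventually_mul_rpow_le 2 (by linarith : (s : ℝ) < s + 1)] with ε h1 h2
  obtain ⟨M, hM, hM1, hM2⟩ := h1
  refine le_sInf ?_
  rintro N ⟨A, hA, hN⟩
  obtain ⟨f, hf, hv⟩ := h M ε hM hM1 _ A hA
  refine le_trans (ENNReal.ofReal_le_ofReal ?_) (hN f hf)
  have hc := hc0 (P.dim K r ε)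
  have : (1 / ε) ^ (s : ℝ) ≤ A.values (P.restrict _ f) [] := by linarith
  rw [RealProg.cost]
  calc c (P.dim K r ε) * (1 / ε) ^ (s : ℝ) ≤ c (P.dim K r ε) * A.values (P.restrict _ f) [] := by
        gcongr
    _ ≤ _ := le_add_of_nonneg_right (Nat.cast_nonneg _)

theorem ofReal_mul_nRan_le (P : Setting X) {K : ℕ → ℝ} {r : ℕ} {c : ℕ → ℝ} {ε : ℝ}
    (hc : 0 < c (P.dim K r ε)) :
    ENNReal.ofReal (c (P.dim K r ε)) * P.nRan K r ε ≤ P.compRan K r c ε := by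
  refine le_sInf ?_
  rintro N ⟨A, hA, hN⟩
  have h0 : ENNReal.ofReal (c (P.dim K r ε)) ≠ 0 := (ENNReal.ofReal_pos.2 hc).ne'
  rw [mul_comm, ← ENNReal.le_div_iff_mul_le (.inl h0) (.inl ENNReal.ofReal_ne_top)]
  refine sInf_le ⟨A, hA, fun f hf => ?_⟩
  rw [ENNReal.le_div_iff_mul_le (.inl h0) (.inl ENNReal.ofReal_ne_top), mul_comm]
  refine le_trans ?_ (hN f hf)
  rw [RandomProg.expect, RandomProg.expect, ← lintegral_const_mul' _ _ ENNReal.ofReal_ne_top]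
  refine lintegral_mono fun ω => ?_
  rw [← ENNReal.ofReal_mul hc.le]
  exact ENNReal.ofReal_le_ofReal (le_add_of_nonneg_right (Nat.cast_nonneg _))

theorem ofReal_mul_qq_le (P : Setting X) {K : ℕ → ℝ} {r : ℕ} {c : ℕ → ℝ} {ε : ℝ}
    (hc : 0 ≤ c (P.dim K r ε)) :
    ENNReal.ofReal (c (P.dim K r ε)) * P.qq K r ε ≤ P.compQuantum K r c ε := by
  refine le_sInf ?_
  rintro N ⟨A, hA, rfl⟩
  have h : P.qq K r ε ≤ A.queries := sInf_le ⟨A, hA, rfl⟩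
  calc _ ≤ ENNReal.ofReal (c (P.dim K r ε)) * ENNReal.ofReal A.queries := by
        rw [ENNReal.ofReal_natCast]
        gcongr
    _ = ENNReal.ofReal (c (P.dim K r ε) * A.queries) := (ENNReal.ofReal_mul hc).symm
    _ ≤ _ := by
        refine ENNReal.ofReal_le_ofReal ?_
        rw [QuantumAlg.cost]
        have h1 : (0 : ℝ) ≤ A.qubits * A.queries := by positivity
        have h2 : (0 : ℝ) ≤ A.ops := by positivity
        linarith

theorem exists_sampleSize_le (κ : ℝ) : ∃ C : ℝ, 0 < C ∧ ∀ ε : ℝ, 0 < ε → ε ≤ 1 →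
    (sampleSize κ ε : ℝ) ≤ C * (1 / ε) ^ (2 : ℝ) := by
  refine ⟨4 * κ ^ 2 + 2, by positivity, fun ε hε hε1 => ?_⟩
  have h1 : 1 ≤ 1 / ε := by rw [le_div_iff₀ hε]; linarith
  have h2 : (1 : ℝ) ≤ (1 / ε) ^ 2 := one_le_pow₀ h1
  have h3 := (Nat.ceil_lt_add_one (by positivity : 0 ≤ (2 * κ / ε) ^ 2)).le
  rw [sampleSize, Real.rpow_two]
  push_cast
  have e : (2 * κ / ε) ^ 2 = 4 * κ ^ 2 * (1 / ε) ^ 2 := by ring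
  rw [e] at h3
  rw [e]
  linarith

end Setting

theorem eventually_small {ε₀ : ℝ} (h : 0 < ε₀) : ∀ᶠ ε in 𝓝[>] (0 : ℝ), 0 < ε ∧ ε < ε₀ :=
  Ioo_mem_nhdsGT h

namespace Setting
variable {X : Type*} [NormedAddCommGroup X] [NormedSpace ℝ X] [CompleteSpace X]
    [TopologicalSpace.SeparableSpace X] [MeasurableSpace X] [BorelSpace X]

theorem eventually_nRan_le (P : Setting X) {K : ℕ → ℝ} {r : ℕ}
    (hdim : ∀ ε : ℝ, 0 < ε → ∀ f ∈ P.F K r, |P.I f - P.Id (P.dim K r ε) f| ≤ ε / 2)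
    {δ : ℝ} (hδ : 0 < δ) :
    ∀ᶠ ε in 𝓝[>] (0 : ℝ), P.nRan K r ε ≤ ENNReal.ofReal ((1 / ε) ^ (2 + δ)) := by
  obtain ⟨C, hC, hN⟩ := exists_sampleSize_le (K 0)
  filter_upwards [eventually_small one_pos, eventually_mul_rpow_le C (by linarith : 2 < 2 + δ)]
    with ε hε h
  refine (P.nRan_le hε.1 (hdim ε hε.1)).trans ?_
  rw [← ENNReal.ofReal_natCast]
  exact ENNReal.ofReal_le_ofReal ((hN ε hε.1 hε.2.le).trans h)

theorem eventually_compRan_le (P : Setting X) {K : ℕ → ℝ} {r : ℕ}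
    (hdim : ∀ ε : ℝ, 0 < ε → ∀ f ∈ P.F K r, |P.I f - P.Id (P.dim K r ε) f| ≤ ε / 2)
    {c : ℕ → ℝ} {a : ℝ} (ha : 0 < a) (hc : ∀ᶠ ε in 𝓝[>] (0 : ℝ), a ≤ c (P.dim K r ε))
    {δ : ℝ} (hδ : 0 < δ) :
    ∀ᶠ ε in 𝓝[>] (0 : ℝ),
      P.compRan K r c ε ≤ ENNReal.ofReal (c (P.dim K r ε) * (1 / ε) ^ (2 + δ)) := by
  obtain ⟨C, hC, hN⟩ := exists_sampleSize_le (K 0)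
  filter_upwards [eventually_small one_pos,
    eventually_mul_rpow_le (C + (C + 1) / a) (by linarith : 2 < 2 + δ), hc] with ε hε h hcε
  refine (P.compRan_le hε.1 (hdim ε hε.1) c).trans (ENNReal.ofReal_le_ofReal ?_)
  have h1 := hN ε hε.1 hε.2.le
  set x := (1 / ε) ^ (2 : ℝ) with hx
  have hε0 := hε.1
  have hx1 : 1 ≤ x := Real.one_le_rpow (by rw [le_div_iff₀ hε0]; linarith [hε.2]) (by norm_num)
  have hc0 : 0 < c (P.dim K r ε) := ha.trans_le hcε
  have h2 : (C + 1) * x ≤ c (P.dim K r ε) * ((C + 1) / a * x) := by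
    have e : (C + 1) * x = a * ((C + 1) / a * x) := by field_simp
    rw [e]
    gcongr
  calc c (P.dim K r ε) * (sampleSize (K 0) ε) + ((sampleSize (K 0) ε) + 1)
      ≤ c (P.dim K r ε) * (C * x) + (C * x + 1) := by gcongr
    _ ≤ c (P.dim K r ε) * (C * x) + (C + 1) * x := by linarith
    _ ≤ c (P.dim K r ε) * ((C + (C + 1) / a) * x) := by linarith
    _ ≤ _ := by gcongr

/-- For d ≥ 1 the number d + 1 is at most (2/a) c d. The qubits charged in each query, and the
gates, are therefore bounded by c d times powers of 1/ε, and c d factors out of the whole cost. -/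
theorem eventually_cost_le (P : Setting X) {K : ℕ → ℝ} {r : ℕ}
    {A : (ε : ℝ) → QuantumAlg (P.dim K r ε)}
    (hA : ∀ δ : ℝ, 0 < δ → ∃ C : ℝ, 0 < C ∧ ∀ ε : ℝ, 0 < ε → ε ≤ 1 →
        ((A ε).qubits : ℝ) ≤ C * (P.dim K r ε + 1) * (1 / ε) ^ δ ∧
        ((A ε).queries : ℝ) ≤ C * (1 / ε) ^ (1 + δ) ∧
        ((A ε).ops : ℝ) ≤ C * (P.dim K r ε + 1) * (1 / ε) ^ (1 + δ))
    {c : ℕ → ℝ} {a : ℝ} (ha : 0 < a) (hc : ∀ d : ℕ, a * d ≤ c d)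
    (hd : ∀ᶠ ε in 𝓝[>] (0 : ℝ), 1 ≤ P.dim K r ε) {δ : ℝ} (hδ : 0 < δ) :
    ∀ᶠ ε in 𝓝[>] (0 : ℝ), (A ε).cost c ≤ c (P.dim K r ε) * (1 / ε) ^ (1 + δ) := by
  obtain ⟨C, hC, h⟩ := hA (δ / 4) (by positivity)
  filter_upwards [eventually_small one_pos, hd, eventually_mul_rpow_le
    ((1 + 2 * C / a) * C + 2 * C / a) (by linarith : 1 + δ / 4 + δ / 4 < 1 + δ)] with ε hε hd hle
  obtain ⟨h1, h2, h3⟩ := h ε hε.1 hε.2.le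
  have hε0 := hε.1
  have hx1 : 1 ≤ 1 / ε := by rw [le_div_iff₀ hε0]; linarith [hε.2]
  rw [Real.rpow_add (by positivity)] at hle
  have hy1 : 1 ≤ (1 / ε) ^ (δ / 4) := Real.one_le_rpow hx1 (by positivity)
  have hz0 : 0 < (1 / ε) ^ (1 + δ / 4) := by positivity
  have hd' : (1 : ℝ) ≤ P.dim K r ε := by exact_mod_cast hd
  have hcd : (P.dim K r ε : ℝ) + 1 ≤ 2 / a * c (P.dim K r ε) := by
    have := hc (P.dim K r ε)
    rw [div_mul_eq_mul_div, le_div_iff₀ ha]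
    nlinarith
  have hc0 : 0 < c (P.dim K r ε) := lt_of_lt_of_le (by positivity) (hc (P.dim K r ε))
  set κ := c (P.dim K r ε)
  set y := (1 / ε) ^ (δ / 4)
  set z := (1 / ε) ^ (1 + δ / 4)
  rw [QuantumAlg.cost]
  calc (κ + (A ε).qubits) * (A ε).queries + (A ε).ops
      ≤ (κ + C * (2 / a * κ) * y) * (C * z) + C * (2 / a * κ) * z := by
        have h1' := h1.trans (by gcongr : _ ≤ C * (2 / a * κ) * y)
        have h3' := h3.trans (by gcongr : _ ≤ C * (2 / a * κ) * z)
        gcongr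
    _ = κ * z * C + κ * z * (2 * C / a * y * C) + κ * z * (2 * C / a) := by ring
    _ ≤ κ * z * (C * y) + κ * z * (2 * C / a * y * C) + κ * z * (2 * C / a * y) := by
        have : C ≤ C * y := le_mul_of_one_le_right hC.le hy1
        have : 2 * C / a ≤ 2 * C / a * y := le_mul_of_one_le_right (by positivity) hy1
        gcongr
    _ = κ * (((1 + 2 * C / a) * C + 2 * C / a) * (z * y)) := by ring
    _ ≤ _ := by gcongr

theorem exists_cost_le (P : Setting X) {K : ℕ → ℝ} {r : ℕ}
    {A : (ε : ℝ) → QuantumAlg (P.dim K r ε)}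
    (hA : ∀ δ : ℝ, 0 < δ → ∃ C : ℝ, 0 < C ∧ ∀ ε : ℝ, 0 < ε → ε ≤ 1 →
        ((A ε).qubits : ℝ) ≤ C * (P.dim K r ε + 1) * (1 / ε) ^ δ ∧
        ((A ε).queries : ℝ) ≤ C * (1 / ε) ^ (1 + δ) ∧
        ((A ε).ops : ℝ) ≤ C * (P.dim K r ε + 1) * (1 / ε) ^ (1 + δ))
    {c : ℕ → ℝ} (hc' : ∃ (b : ℝ) (s : ℕ), ∀ d : ℕ, c d ≤ b * ((d : ℝ) + 1) ^ s)
    {C₀ : ℝ} {s₀ : ℕ} (hC₀ : 0 < C₀)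
    (hle : ∀ ε : ℝ, 0 < ε → ε ≤ 1 → (P.dim K r ε : ℝ) ≤ C₀ * (1 / ε) ^ s₀) :
    (∃ (C : ℝ) (s : ℕ), ∀ ε : ℝ, 0 < ε → ε < 1 / 2 → (A ε).cost c ≤ C * (1 / ε) ^ s) ∧
    ∃ (C : ℝ) (s : ℕ), ∀ ε : ℝ, 0 < ε → ε < 1 / 2 → ((A ε).qubits : ℝ) ≤ C * (1 / ε) ^ s := by
  obtain ⟨b, s, hb⟩ := hc'
  obtain ⟨C, hC, h⟩ := hA 1 one_pos
  have hdim : ∀ ε : ℝ, 0 < ε → ε ≤ 1 → (P.dim K r ε : ℝ) + 1 ≤ (C₀ + 1) * (1 / ε) ^ s₀ := by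
    intro ε hε hε1
    have : 1 ≤ (1 / ε) ^ s₀ := one_le_pow₀ (by rw [le_div_iff₀ hε]; linarith)
    linarith [hle ε hε hε1]
  have hq : ∀ ε : ℝ, 0 < ε → ε ≤ 1 →
      ((A ε).qubits : ℝ) ≤ C * (C₀ + 1) * (1 / ε) ^ (s₀ + 1) := by
    intro ε hε hε1
    have h1 := (h ε hε hε1).1
    rw [Real.rpow_one] at h1
    calc _ ≤ _ := h1
      _ ≤ C * ((C₀ + 1) * (1 / ε) ^ s₀) * (1 / ε) := by
        have := hdim ε hε hε1
        gcongr
      _ = _ := by ring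
  refine ⟨⟨(|b| * (C₀ + 1) ^ s + C * (C₀ + 1)) * C + C * (C₀ + 1), s₀ * s + s₀ + 3,
    fun ε hε hε1 => ?_⟩, ⟨_, s₀ + 1, fun ε hε hε1 => hq ε hε (by linarith)⟩⟩
  obtain ⟨-, h2, h3⟩ := h ε hε (by linarith)
  have hd := hdim ε hε (by linarith)
  have hq' := hq ε hε (by linarith)
  have hbd := hb (P.dim K r ε)
  set x := 1 / ε with hx
  have hx1 : 1 ≤ x := by rw [hx, le_div_iff₀ hε]; linarith
  have e : x ^ ((1 : ℝ) + 1) = x ^ 2 := by norm_num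
  rw [e] at h2 h3
  have hc1 : c (P.dim K r ε) ≤ |b| * (C₀ + 1) ^ s * x ^ (s₀ * s) := by
    calc _ ≤ _ := hbd
      _ ≤ |b| * ((C₀ + 1) * x ^ s₀) ^ s := by
        gcongr
        exact le_abs_self b
      _ = _ := by rw [mul_pow, ← pow_mul, mul_assoc]
  have p1 : x ^ (s₀ * s) ≤ x ^ (s₀ * s + s₀ + 1) := pow_le_pow_right₀ hx1 (by omega)
  have p2 : x ^ (s₀ + 1) ≤ x ^ (s₀ * s + s₀ + 1) := pow_le_pow_right₀ hx1 (by nlinarith [Nat.zero_le (s₀ * s)])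
  have p3 : x ^ (s₀ + 2) ≤ x ^ (s₀ * s + s₀ + 3) := pow_le_pow_right₀ hx1 (by nlinarith [Nat.zero_le (s₀ * s)])
  rw [QuantumAlg.cost]
  calc (c (P.dim K r ε) + (A ε).qubits) * (A ε).queries + (A ε).ops
      ≤ (|b| * (C₀ + 1) ^ s * x ^ (s₀ * s) + C * (C₀ + 1) * x ^ (s₀ + 1)) * (C * x ^ 2) +
        C * ((C₀ + 1) * x ^ s₀) * x ^ 2 := by
        have h3' := h3.trans (by gcongr : _ ≤ C * ((C₀ + 1) * x ^ s₀) * x ^ 2)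
        gcongr
    _ ≤ (|b| * (C₀ + 1) ^ s * x ^ (s₀ * s + s₀ + 1) + C * (C₀ + 1) * x ^ (s₀ * s + s₀ + 1)) *
          (C * x ^ 2) + C * (C₀ + 1) * x ^ (s₀ * s + s₀ + 3) := by
        have e2 : C * ((C₀ + 1) * x ^ s₀) * x ^ 2 = C * (C₀ + 1) * x ^ (s₀ + 2) := by ring
        rw [e2]
        gcongr
    _ = _ := by ring

theorem one_le_ofReal_rpow {ε e : ℝ} (hε : 0 < ε) (hε1 : ε < 1) (he : 0 ≤ e) :
    1 ≤ ENNReal.ofReal ((1 / ε) ^ e) := by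
  rw [ENNReal.one_le_ofReal]
  exact Real.one_le_rpow (by rw [le_div_iff₀ hε]; linarith) he

theorem eventually_queries_le (P : Setting X) {K : ℕ → ℝ} {r : ℕ} (hr : 1 ≤ r)
    (hK : ∀ i ≤ r, 0 < K i)
    {A : (ε : ℝ) → QuantumAlg (P.dim K r ε)}
    (hA : ∀ δ : ℝ, 0 < δ → ∃ C : ℝ, 0 < C ∧ ∀ ε : ℝ, 0 < ε → ε ≤ 1 →
        ((A ε).queries : ℝ) ≤ C * (1 / ε) ^ (1 + δ)) {δ : ℝ} (hδ : 0 < δ) :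
    ∀ᶠ ε in 𝓝[>] (0 : ℝ), ((A ε).queries : ℝ≥0∞) ≤ P.nRan K r ε ^ (1 / 2 + δ) := by
  obtain ⟨C, hC, h⟩ := hA (δ / 2) (by positivity)
  -- Chosen so that (2 - δ/(1/2 + δ))(1/2 + δ) = 1 + δ.
  have hδ' : 0 < δ / (1 / 2 + δ) := by positivity
  filter_upwards [eventually_small one_pos, eventually_mul_rpow_le C
    (by linarith : 1 + δ / 2 < 1 + δ), P.eventually_le_nRan hr hK hδ'] with ε hε h1 h2
  have hε0 := hε.1
  calc ((A ε).queries : ℝ≥0∞) = ENNReal.ofReal (A ε).queries := (ENNReal.ofReal_natCast _).symm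
    _ ≤ ENNReal.ofReal ((1 / ε) ^ (1 + δ)) :=
        ENNReal.ofReal_le_ofReal ((h ε hε.1 hε.2.le).trans h1)
    _ = ENNReal.ofReal ((1 / ε) ^ (2 - δ / (1 / 2 + δ))) ^ (1 / 2 + δ) := by
        rw [ENNReal.ofReal_rpow_of_pos (by positivity), ← Real.rpow_mul (by positivity)]
        congr 2
        field_simp
        ring
    _ ≤ _ := by gcongr

theorem eventually_nRan_rpow_le (P : Setting X) {K : ℕ → ℝ} {r : ℕ} (hr : 1 ≤ r)
    (hK : ∀ i ≤ r, 0 < K i)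
    (hdim : ∀ ε : ℝ, 0 < ε → ∀ f ∈ P.F K r, |P.I f - P.Id (P.dim K r ε) f| ≤ ε / 2)
    {δ : ℝ} (hδ : 0 < δ) :
    ∀ᶠ ε in 𝓝[>] (0 : ℝ), P.nRan K r ε ^ (1 / 2 - δ) ≤ P.qq K r ε := by
  -- As `nRan` is at least 1, δ may be lowered. A value of at most 1/4 keeps the exponent 1/2 - η
  -- positive, as monotonicity of the power needs, and (2 + η)(1/2 - η) ≤ 1 - η.
  set η := min δ (1 / 4) with hη
  have hη0 : 0 < η := lt_min hδ (by norm_num)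
  have hη1 : η ≤ 1 / 4 := min_le_right _ _
  filter_upwards [eventually_small one_pos, P.eventually_nRan_le hdim hη0,
    P.eventually_le_nRan hr hK one_pos, P.eventually_le_qq hr hK hη0] with ε hε h1 h2 h3
  have hε0 := hε.1
  have hx1 : 1 ≤ 1 / ε := by rw [le_div_iff₀ hε0]; linarith [hε.2]
  have h4 : 1 ≤ P.nRan K r ε := (one_le_ofReal_rpow hε.1 hε.2 (by norm_num)).trans h2
  calc P.nRan K r ε ^ (1 / 2 - δ) ≤ P.nRan K r ε ^ (1 / 2 - η) :=
        ENNReal.rpow_le_rpow_of_exponent_le h4 (by linarith [min_le_left δ (1 / 4)])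
    _ ≤ ENNReal.ofReal ((1 / ε) ^ (2 + η)) ^ (1 / 2 - η) :=
        ENNReal.rpow_le_rpow h1 (by linarith)
    _ = ENNReal.ofReal ((1 / ε) ^ ((2 + η) * (1 / 2 - η))) := by
        rw [ENNReal.ofReal_rpow_of_pos (by positivity), ← Real.rpow_mul (by positivity)]
    _ ≤ ENNReal.ofReal ((1 / ε) ^ (1 - η)) := by
        refine ENNReal.ofReal_le_ofReal (Real.rpow_le_rpow_of_exponent_le hx1 ?_)
        nlinarith
    _ ≤ _ := h3

end Setting

/-! ### Chaining: moments of the maximum of a Gaussian process -/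

theorem abs_le_of_dyadic {f : ℝ → ℝ} (hf0 : f 0 = 0) {B ρ : ℝ} (hB : 0 ≤ B) (hρ : 0 ≤ ρ)
    (h : ∀ m k : ℕ, k < 2 ^ m → |f ((k + 1) / 2 ^ m) - f (k / 2 ^ m)| ≤ B * ρ ^ m) (M : ℕ) :
    ∀ k : ℕ, k ≤ 2 ^ M → |f (k / 2 ^ M)| ≤ B * ∑ m ∈ Finset.range (M + 1), ρ ^ m := by
  induction M with
  | zero =>
    intro k hk
    have h0 := h 0 0 (by norm_num)
    rcases Nat.le_one_iff_eq_zero_or_eq_one.1 hk with rfl | rfl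
    · simpa [hf0] using hB
    · simpa [hf0] using h0
  -- An even grid point belongs to the coarser grid; an odd one is reached from its left neighbour,
  -- which does, by one increment of the new level.
  | succ M ih =>
    intro k hk
    rw [Finset.sum_range_succ, mul_add]
    rcases Nat.even_or_odd' k with ⟨j, rfl | rfl⟩
    · have e : ((2 * j : ℕ) : ℝ) / 2 ^ (M + 1) = j / 2 ^ M := by
        push_cast
        field_simp
        ring
      rw [e]
      have := ih j (by rw [pow_succ] at hk; omega)
      have : 0 ≤ B * ρ ^ (M + 1) := by positivity
      linarith
    · have e : ((2 * j : ℕ) : ℝ) / 2 ^ (M + 1) = j / 2 ^ M := by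
        push_cast
        field_simp
        ring
      have h1 := h (M + 1) (2 * j) (by omega)
      have h2 := ih j (by rw [pow_succ] at hk; omega)
      rw [e] at h1
      have h3 := abs_add_le (f (((2 * j : ℕ) + 1) / 2 ^ (M + 1)) - f (j / 2 ^ M)) (f (j / 2 ^ M))
      rw [sub_add_cancel] at h3
      rw [Nat.cast_add_one]
      linarith

/-- Chaining: the maximum of a continuous function is controlled by its dyadic increments. -/
theorem exists_ofReal_pow_le_tsum {q : ℕ} (hq : 1 ≤ q) : ∃ C : ℝ, 0 < C ∧ ∀ f : ℝ → ℝ,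
    Continuous f → f 0 = 0 → ∀ t ∈ Set.Icc (0 : ℝ) 1,
      ENNReal.ofReal (|f t| ^ q) ≤ ENNReal.ofReal C * ∑' m : ℕ, ∑ k ∈ Finset.range (2 ^ m),
        ENNReal.ofReal (2 ^ m * |f ((k + 1) / 2 ^ m) - f (k / 2 ^ m)| ^ q) := by
  have hq0 : (0 : ℝ) < q := by exact_mod_cast hq
  -- Each single term of the sum is at most S, so an increment of level m is at most (S/2^m)^(1/q) =
  -- S^(1/q) ρ^m, and the geometric series in ρ converges.
  set ρ : ℝ := (1 / 2) ^ (1 / (q : ℝ)) with hρ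
  have hρ0 : 0 < ρ := by positivity
  have hρ1 : ρ < 1 := Real.rpow_lt_one (by norm_num) (by norm_num) (by positivity)
  have hρq : ρ ^ q = 1 / 2 := by
    rw [hρ, one_div (q : ℝ), Real.rpow_inv_natCast_pow (by norm_num) (by omega)]
  have hρ2 : 0 < 1 / (1 - ρ) := by
    have : 0 < 1 - ρ := by linarith
    positivity
  refine ⟨(1 / (1 - ρ)) ^ q, by positivity, fun f hf hf0 t ht => ?_⟩
  set S := ∑' m : ℕ, ∑ k ∈ Finset.range (2 ^ m),
    ENNReal.ofReal (2 ^ m * |f ((k + 1) / 2 ^ m) - f (k / 2 ^ m)| ^ q) with hS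
  rcases eq_or_ne S ⊤ with h | h
  · rw [h, ENNReal.mul_top (ENNReal.ofReal_pos.2 (by positivity)).ne']
    exact le_top
  set B : ℝ := S.toReal ^ (1 / (q : ℝ)) with hB
  have hB0 : 0 ≤ B := by positivity
  have hBq : B ^ q = S.toReal := by
    rw [hB, one_div (q : ℝ), Real.rpow_inv_natCast_pow (by positivity) (by omega)]
  have hinc : ∀ m k : ℕ, k < 2 ^ m → |f ((k + 1) / 2 ^ m) - f (k / 2 ^ m)| ≤ B * ρ ^ m := by
    intro m k hk
    have h1 : ENNReal.ofReal (2 ^ m * |f ((k + 1) / 2 ^ m) - f (k / 2 ^ m)| ^ q) ≤ S :=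
      (Finset.single_le_sum (f := fun k : ℕ =>
        ENNReal.ofReal (2 ^ m * |f ((k + 1) / 2 ^ m) - f (k / 2 ^ m)| ^ q)) (fun _ _ => zero_le)
        (Finset.mem_range.2 hk)).trans (ENNReal.le_tsum m)
    have h2 := (ENNReal.ofReal_le_iff_le_toReal h).1 h1
    refine le_of_pow_le_pow_left₀ (by omega : q ≠ 0) (by positivity) ?_
    rw [mul_pow, hBq, ← pow_mul, mul_comm m, pow_mul, hρq, one_div, inv_pow, ← div_eq_mul_inv,
      le_div_iff₀ (by positivity)]
    linarith
  have hgrid : ∀ M k : ℕ, k ≤ 2 ^ M → |f (k / 2 ^ M)| ≤ B * (1 / (1 - ρ)) := by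
    intro M k hk
    refine (abs_le_of_dyadic hf0 hB0 hρ0.le hinc M k hk).trans ?_
    gcongr
    rw [one_div, ← tsum_geometric_of_lt_one hρ0.le hρ1]
    exact (summable_geometric_of_lt_one hρ0.le hρ1).sum_le_tsum _ fun _ _ => by positivity
  have hlim : Tendsto (fun M : ℕ => (⌊t * 2 ^ M⌋₊ : ℝ) / 2 ^ M) atTop (𝓝 t) :=
    (tendsto_nat_floor_mul_div_atTop ht.1).comp
      (tendsto_pow_atTop_atTop_of_one_lt (r := (2 : ℝ)) one_lt_two)
  have hle : |f t| ≤ B * (1 / (1 - ρ)) := by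
    refine le_of_tendsto ((hf.abs.tendsto t).comp hlim) (Eventually.of_forall fun M => ?_)
    refine hgrid M _ (Nat.floor_le_of_le ?_)
    push_cast
    exact mul_le_of_le_one_left (by positivity) ht.2
  rw [← ENNReal.ofReal_toReal h, ← ENNReal.ofReal_mul (by positivity)]
  refine ENNReal.ofReal_le_ofReal ?_
  calc |f t| ^ q ≤ (B * (1 / (1 - ρ))) ^ q := by gcongr
    _ = _ := by rw [mul_pow, hBq, mul_comm]

/-- The moments of even order of the standard normal distribution. -/
def evenMoment (p : ℕ) : ℝ := ∫ t, t ^ (2 * p) ∂(gaussianReal 0 1)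

theorem evenMoment_nonneg (p : ℕ) : 0 ≤ evenMoment p :=
  integral_nonneg fun t => by
    change 0 ≤ t ^ (2 * p)
    rw [pow_mul]
    positivity

namespace Setting
variable {X : Type*} [NormedAddCommGroup X] [NormedSpace ℝ X] [CompleteSpace X]
    [TopologicalSpace.SeparableSpace X] [MeasurableSpace X] [BorelSpace X]

theorem integral_dual_pow (P : Setting X) (L : X →L[ℝ] ℝ) (p : ℕ) :
    ∫ x, L x ^ (2 * p) ∂P.μ = (∫ x, L x ^ 2 ∂P.μ) ^ p * evenMoment p := by
  have := P.gaussian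
  set V := ∫ x, L x ^ 2 ∂P.μ with hV
  have hV0 : 0 ≤ V := integral_nonneg fun x => by positivity
  have hvar : Var[L; P.μ] = V := by
    rw [variance_of_integral_eq_zero L.continuous.measurable.aemeasurable (P.zero_mean L)]
  have hmap : P.μ.map L = (gaussianReal 0 1).map (Real.sqrt V * ·) := by
    rw [IsGaussian.map_eq_gaussianReal, P.zero_mean, hvar, gaussianReal_map_const_mul]
    congr 1
    · simp
    · ext
      simp [Real.sq_sqrt hV0, hV0]
  have h1 : ∫ x, L x ^ (2 * p) ∂P.μ = ∫ t, t ^ (2 * p) ∂(P.μ.map L) := by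
    rw [integral_map L.continuous.measurable.aemeasurable (by fun_prop)]
  rw [h1, hmap, integral_map (by fun_prop) (by fun_prop), evenMoment, ← integral_const_mul]
  congr 1 with t
  rw [mul_pow, pow_mul, Real.sq_sqrt hV0]

theorem integrable_dual_pow (P : Setting X) (L : X →L[ℝ] ℝ) (n : ℕ) :
    Integrable (fun x => L x ^ n) P.μ :=
  (P.integrable_clm_norm_pow L n).mono' (L.continuous.pow n).aestronglyMeasurable
    (ae_of_all _ fun x => by simp)

/-- The value at `t` of the path `T x`. -/
def pathEval (T : X →L[ℝ] C(unitInterval, ℝ)) (t : ℝ) : X →L[ℝ] ℝ :=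
  (ContinuousMap.evalCLM ℝ (Set.projIcc 0 1 zero_le_one t)).comp T

theorem pathEval_apply (T : X →L[ℝ] C(unitInterval, ℝ)) (t : ℝ) (x : X) :
    pathEval T t x = T x (Set.projIcc 0 1 zero_le_one t) := rfl

theorem pathEval_coe (T : X →L[ℝ] C(unitInterval, ℝ)) (t : unitInterval) (x : X) :
    pathEval T t x = T x t := by
  rw [pathEval_apply, Set.projIcc_val]

theorem continuous_pathEval (T : X →L[ℝ] C(unitInterval, ℝ)) (x : X) :
    Continuous fun t => pathEval T t x :=
  (T x).continuous.comp continuous_projIcc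

/-- The moments of the maximum of a Gaussian process whose increments are bounded by those of the
Wiener process and have variances at most `V`. -/
theorem exists_integral_norm_pow_le (P : Setting X) {p : ℕ} (hp : 3 ≤ p) :
    ∃ C : ℝ, 0 < C ∧ ∀ (T : X →L[ℝ] C(unitInterval, ℝ)) (V : ℝ), 0 ≤ V →
      (∫ x, pathEval T 0 x ^ 2 ∂P.μ = 0) →
      (∀ s t : ℝ, s ∈ Set.Icc (0 : ℝ) 1 → t ∈ Set.Icc (0 : ℝ) 1 →
        ∫ x, (pathEval T t x - pathEval T s x) ^ 2 ∂P.μ ≤ |t - s|) →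
      (∀ s t : ℝ, s ∈ Set.Icc (0 : ℝ) 1 → t ∈ Set.Icc (0 : ℝ) 1 →
        ∫ x, (pathEval T t x - pathEval T s x) ^ 2 ∂P.μ ≤ V) →
      ∫ x, ‖T x‖ ^ (2 * p) ∂P.μ ≤ C * V ^ (p - 3) := by
  obtain ⟨C, hC, h⟩ := exists_ofReal_pow_le_tsum (by omega : 1 ≤ 2 * p)
  have hm := evenMoment_nonneg p
  refine ⟨C * (evenMoment p + 1) * 2, by positivity, fun T V hV h0 h1 h2 => ?_⟩
  have hint := P.integrable_clm_norm_pow T (2 * p)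
  have hz : ∀ᵐ x ∂P.μ, pathEval T 0 x = 0 := by
    have := (integral_eq_zero_iff_of_nonneg (fun x => by positivity)
      (P.integrable_dual_pow (pathEval T 0) 2)).1 h0
    filter_upwards [this] with x hx
    exact pow_eq_zero_iff (two_ne_zero) |>.1 hx
  have hpt : ∀ᵐ x ∂P.μ, ENNReal.ofReal (‖T x‖ ^ (2 * p)) ≤ ENNReal.ofReal C *
      ∑' m : ℕ, ∑ k ∈ Finset.range (2 ^ m), ENNReal.ofReal (2 ^ m *
        |pathEval T ((k + 1) / 2 ^ m) x - pathEval T (k / 2 ^ m) x| ^ (2 * p)) := by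
    filter_upwards [hz] with x hx
    obtain ⟨t, -, ht⟩ := isCompact_univ.exists_isMaxOn (Set.univ_nonempty (α := unitInterval))
      (T x).continuous.norm.continuousOn
    have hn : ‖T x‖ ≤ |pathEval T t x| := by
      rw [pathEval_coe]
      exact ((T x).norm_le (abs_nonneg _)).2 fun s => ht (Set.mem_univ s)
    refine le_trans (ENNReal.ofReal_le_ofReal (by gcongr))
      (h (fun t => pathEval T t x) (continuous_pathEval T x) hx t t.2)
  have hinc : ∀ m k : ℕ, k < 2 ^ m → ∫⁻ x, ENNReal.ofReal (2 ^ m *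
      |pathEval T ((k + 1) / 2 ^ m) x - pathEval T (k / 2 ^ m) x| ^ (2 * p)) ∂P.μ ≤
      ENNReal.ofReal (2 ^ m * ((1 / 8) ^ m * V ^ (p - 3) * evenMoment p)) := by
    intro m k hk
    have hk' : ((k : ℝ) + 1) ≤ 2 ^ m := by exact_mod_cast hk
    have hs : (k : ℝ) / 2 ^ m ∈ Set.Icc (0 : ℝ) 1 :=
      ⟨by positivity, by rw [div_le_one (by positivity)]; linarith⟩
    have ht : ((k : ℝ) + 1) / 2 ^ m ∈ Set.Icc (0 : ℝ) 1 :=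
      ⟨by positivity, by rw [div_le_one (by positivity)]; linarith⟩
    set L := pathEval T (((k : ℝ) + 1) / 2 ^ m) - pathEval T ((k : ℝ) / 2 ^ m) with hL
    have e : ∀ x, |pathEval T ((k + 1) / 2 ^ m) x - pathEval T (k / 2 ^ m) x| ^ (2 * p) =
        L x ^ (2 * p) := by
      intro x
      rw [hL, pow_mul, pow_mul, sq_abs, sub_apply]
    simp only [e]
    rw [← ofReal_integral_eq_lintegral_ofReal ((P.integrable_dual_pow L _).const_mul _)
      (ae_of_all _ fun x => mul_nonneg (by positivity) ((even_two_mul p).pow_nonneg _)), integral_const_mul,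
      P.integral_dual_pow]
    refine ENNReal.ofReal_le_ofReal ?_
    have hv0 : 0 ≤ ∫ x, L x ^ 2 ∂P.μ := integral_nonneg fun x => by positivity
    have hv1 : ∫ x, L x ^ 2 ∂P.μ ≤ (1 / 2) ^ m := by
      refine (h1 _ _ hs ht).trans (le_of_eq ?_)
      rw [← sub_div, add_sub_cancel_left, abs_of_pos (by positivity), one_div_pow]
    have hv2 : ∫ x, L x ^ 2 ∂P.μ ≤ V := h2 _ _ hs ht
    -- Three factors of the variance are spent on convergence: 2^m increments with weight 2^m
    -- against 8^{-m} leave 2^{-m}. The remaining p - 3 factors use the small bound V, so a high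
    -- moment loses little.
    have : (∫ x, L x ^ 2 ∂P.μ) ^ p ≤ (1 / 8) ^ m * V ^ (p - 3) := by
      calc (∫ x, L x ^ 2 ∂P.μ) ^ p = (∫ x, L x ^ 2 ∂P.μ) ^ 3 * (∫ x, L x ^ 2 ∂P.μ) ^ (p - 3) := by
            rw [← pow_add]
            congr 1
            omega
        _ ≤ ((1 / 2) ^ m) ^ 3 * V ^ (p - 3) := by gcongr
        _ = _ := by
            rw [← pow_mul, mul_comm m, pow_mul]
            norm_num
    gcongr
  have hmeas : ∀ m k : ℕ, Measurable fun x => ENNReal.ofReal (2 ^ m *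
      |pathEval T ((k + 1) / 2 ^ m) x - pathEval T (k / 2 ^ m) x| ^ (2 * p)) := fun m k =>
    (ENNReal.continuous_ofReal.comp (by fun_prop)).measurable
  have hW0 : 0 ≤ V ^ (p - 3) := by positivity
  have hsum : ∑' m : ℕ, ENNReal.ofReal ((1 / 2) ^ m * (V ^ (p - 3) * evenMoment p)) =
      ENNReal.ofReal (2 * (V ^ (p - 3) * evenMoment p)) := by
    rw [← ENNReal.ofReal_tsum_of_nonneg (fun m => by positivity)
      (summable_geometric_two.mul_right _), tsum_mul_right, tsum_geometric_two]
  have hfin : ENNReal.ofReal (∫ x, ‖T x‖ ^ (2 * p) ∂P.μ) ≤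
      ENNReal.ofReal C * ENNReal.ofReal (2 * (V ^ (p - 3) * evenMoment p)) := by
    rw [ofReal_integral_eq_lintegral_ofReal hint (ae_of_all _ fun x => by positivity)]
    refine (lintegral_mono_ae hpt).trans ?_
    rw [lintegral_const_mul' _ _ ENNReal.ofReal_ne_top, lintegral_tsum fun m =>
      (Finset.measurable_sum _ fun k _ => hmeas m k).aemeasurable, ← hsum]
    gcongr with m
    rw [lintegral_finsetSum _ fun k _ => hmeas m k]
    refine (Finset.sum_le_sum fun k hk => hinc m k (Finset.mem_range.1 hk)).trans ?_
    rw [Finset.sum_const, Finset.card_range, nsmul_eq_mul, ← ENNReal.ofReal_natCast,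
      ← ENNReal.ofReal_mul (by positivity)]
    refine ENNReal.ofReal_le_ofReal (le_of_eq ?_)
    push_cast
    have e : (1 / 8 : ℝ) ^ m = (1 / 2) ^ m * (1 / 2) ^ m * (1 / 2) ^ m := by
      rw [← mul_pow, ← mul_pow]
      norm_num
    have e2 : (2 : ℝ) ^ m * (1 / 2) ^ m = 1 := by
      rw [← mul_pow]
      norm_num
    rw [e]
    linear_combination (V ^ (p - 3) * evenMoment p * (1 / 2) ^ m) *
      (2 ^ m * (1 / 2) ^ m + 1) * e2
  rw [← ENNReal.ofReal_mul hC.le, ENNReal.ofReal_le_ofReal_iff (by positivity)] at hfin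
  refine hfin.trans ?_
  have : 0 ≤ C * V ^ (p - 3) := by positivity
  nlinarith

/-- The second moment of the maximum of such a process. -/
theorem exists_integral_norm_sq_le (P : Setting X) {p : ℕ} (hp : 3 ≤ p) :
    ∃ C : ℝ, 0 < C ∧ ∀ (T : X →L[ℝ] C(unitInterval, ℝ)) (V : ℝ), 0 < V →
      (∫ x, pathEval T 0 x ^ 2 ∂P.μ = 0) →
      (∀ s t : ℝ, s ∈ Set.Icc (0 : ℝ) 1 → t ∈ Set.Icc (0 : ℝ) 1 →
        ∫ x, (pathEval T t x - pathEval T s x) ^ 2 ∂P.μ ≤ |t - s|) →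
      (∀ s t : ℝ, s ∈ Set.Icc (0 : ℝ) 1 → t ∈ Set.Icc (0 : ℝ) 1 →
        ∫ x, (pathEval T t x - pathEval T s x) ^ 2 ∂P.μ ≤ V) →
      ∫ x, ‖T x‖ ^ 2 ∂P.μ ≤ C * V ^ (1 - 3 / (p : ℝ)) := by
  obtain ⟨C, hC, h⟩ := P.exists_integral_norm_pow_le hp
  refine ⟨1 + C, by positivity, fun T V hV h0 h1 h2 => ?_⟩
  have := P.gaussian
  have hp0 : (0 : ℝ) < p := by
    have : 0 < p := by omega
    exact_mod_cast this
  -- This is the p-th root of V^(p-3). It balances the two terms of y ≤ s + s (y/s)^p, which passes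
  -- from the moment of order 2p to the second moment.
  set s := V ^ (1 - 3 / (p : ℝ)) with hs
  have hs0 : 0 < s := by positivity
  have hsp : s ^ p = V ^ (p - 3) := by
    rw [hs, ← Real.rpow_natCast, ← Real.rpow_mul hV.le, ← Real.rpow_natCast V]
    congr 1
    rw [Nat.cast_sub hp]
    push_cast
    field_simp
  have hi := P.integrable_clm_norm_pow T (2 * p)
  have hpt : ∀ x, ‖T x‖ ^ 2 ≤ s + s / s ^ p * ‖T x‖ ^ (2 * p) := by
    intro x
    rw [pow_mul]
    set y := ‖T x‖ ^ 2 with hy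
    have hy0 : 0 ≤ y := by positivity
    rcases le_total y s with hys | hys
    · have : 0 ≤ s / s ^ p * y ^ p := by positivity
      linarith
    · have e : s / s ^ p * y ^ p = s * (y / s) ^ p := by
        rw [div_pow]
        ring
      have h3 : y / s ≤ (y / s) ^ p := le_self_pow₀ (by rwa [one_le_div hs0]) (by omega)
      have h4 : y = s * (y / s) := by field_simp
      rw [e]
      have : s * (y / s) ≤ s * (y / s) ^ p := by gcongr
      linarith
  refine (integral_mono (P.integrable_clm_norm_pow T 2) ((integrable_const s).add
    (hi.const_mul (s / s ^ p))) hpt).trans ?_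
  rw [integral_add' (integrable_const s) (hi.const_mul _), integral_const_mul]
  simp only [integral_const, probReal_univ, smul_eq_mul, one_mul]
  have h3 := h T V hV.le h0 h1 h2
  rw [← hsp] at h3
  calc s + s / s ^ p * ∫ x, ‖T x‖ ^ (2 * p) ∂P.μ ≤ s + s / s ^ p * (C * s ^ p) := by gcongr
    _ = _ := by
      field_simp

end Setting

/-! ### The eigenvalues and eigenfunctions of the Wiener measure -/

theorem integral_unitInterval (F : ℝ → ℝ) :
    ∫ t : unitInterval, F t = ∫ t in (0 : ℝ)..1, F t := by
  rw [intervalIntegral.integral_of_le zero_le_one, ← integral_Icc_eq_integral_Ioc]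
  exact integral_subtype measurableSet_Icc F

/-- The continuous eigenfunctions of the kernel `min t u` are multiples of sine functions. -/
theorem eigenfunction_min {F : ℝ → ℝ} (hF : Continuous F) {l : ℝ} (hl : 0 < l)
    (h : ∀ t ∈ Set.Icc (0 : ℝ) 1, l * F t = ∫ u in (0 : ℝ)..1, min t u * F u) :
    ∃ A : ℝ, (∀ t ∈ Set.Icc (0 : ℝ) 1, F t = A * Real.sin (t / Real.sqrt l)) ∧
      A * Real.cos (1 / Real.sqrt l) = 0 := by
  set w := 1 / Real.sqrt l with hw
  have hsl : 0 < Real.sqrt l := Real.sqrt_pos.2 hl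
  have hw0 : 0 < w := by positivity
  have hlw : 1 / l = w ^ 2 := by rw [hw, div_pow, Real.sq_sqrt hl.le, one_pow]
  set k : ℝ → ℝ := fun t => ∫ u in t..1, F u with hk
  -- Splitting the integral of min(t, u) F(u) at u = t shows G = F on [0, 1]. Unlike F, the function
  -- G is differentiable by construction: G' = w^2 k and k' = -F.
  set G : ℝ → ℝ := fun t => w ^ 2 * ((∫ u in (0 : ℝ)..t, u * F u) + t * k t) with hG
  have hkd : ∀ t, HasDerivAt k (-F t) t := fun t =>
    intervalIntegral.integral_hasDerivAt_left (hF.intervalIntegrable _ _)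
      (hF.stronglyMeasurableAtFilter _ _) hF.continuousAt
  have huF : Continuous fun u => u * F u := continuous_id.mul hF
  have hGd : ∀ t, HasDerivAt G (w ^ 2 * k t) t := by
    intro t
    have h1 : HasDerivAt (fun t => ∫ u in (0 : ℝ)..t, u * F u) (t * F t) t :=
      intervalIntegral.integral_hasDerivAt_right (huF.intervalIntegrable _ _)
        (huF.stronglyMeasurableAtFilter _ _) huF.continuousAt
    have h2 := (h1.add ((hasDerivAt_id t).mul (hkd t))).const_mul (w ^ 2)
    refine HasDerivAt.congr_deriv (f := G) h2 ?_
    simp only [id]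
    ring
  have hGF : ∀ t ∈ Set.Icc (0 : ℝ) 1, G t = F t := by
    intro t ht
    have hm : Continuous fun u => min t u * F u := (continuous_const.min continuous_id).mul hF
    have e : ∫ u in (0 : ℝ)..1, min t u * F u = (∫ u in (0 : ℝ)..t, u * F u) + t * k t := by
      rw [← intervalIntegral.integral_add_adjacent_intervals (hm.intervalIntegrable 0 t)
        (hm.intervalIntegrable t 1), hk, ← intervalIntegral.integral_const_mul]
      congr 1
      · refine intervalIntegral.integral_congr fun u hu => ?_
        rw [Set.uIcc_of_le ht.1] at hu
        simp only [min_eq_right hu.2]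
      · refine intervalIntegral.integral_congr fun u hu => ?_
        rw [Set.uIcc_of_le ht.2] at hu
        simp only [min_eq_left hu.1]
    simp only [hG]
    rw [← e, ← h t ht, ← hlw]
    field_simp
  set A := w * k 0 with hA
  -- The pair (wk, G) solves the equations of the harmonic oscillator, as does (A cos, A sin) with
  -- the same initial values. The squared distance is constant, hence zero, which replaces a
  -- uniqueness theorem. The condition A cos w = 0 is k(1) = 0.
  set E : ℝ → ℝ := fun t => (w * k t - A * Real.cos (w * t)) ^ 2 + (G t - A * Real.sin (w * t)) ^ 2
    with hE
  have hEd : ∀ t ∈ Set.Ico (0 : ℝ) 1, HasDerivWithinAt E 0 (Set.Ici t) t := by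
    intro t ht
    have hwt : HasDerivAt (fun t => w * t) w t := by
      simpa using (hasDerivAt_id t).const_mul w
    have h1 := (((hkd t).const_mul w).sub ((hwt.cos).const_mul A)).pow 2
    have h2 := ((hGd t).sub ((hwt.sin).const_mul A)).pow 2
    have h3 := h1.add h2
    have e := hGF t ⟨ht.1, ht.2.le⟩
    refine (HasDerivAt.congr_deriv (f := E) h3 ?_).hasDerivWithinAt
    simp only [e, Pi.sub_apply]
    push_cast
    ring
  have hEc : Continuous E := by
    have h1 : Continuous k := continuous_iff_continuousAt.2 fun t => (hkd t).continuousAt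
    have h2 : Continuous G := continuous_iff_continuousAt.2 fun t => (hGd t).continuousAt
    fun_prop
  have hE0 : ∀ t ∈ Set.Icc (0 : ℝ) 1, E t = 0 := by
    intro t ht
    rw [constant_of_has_deriv_right_zero hEc.continuousOn hEd t ht]
    simp [hE, hG, hA]
  have hboth : ∀ t ∈ Set.Icc (0 : ℝ) 1, w * k t = A * Real.cos (w * t) ∧
      G t = A * Real.sin (w * t) := by
    intro t ht
    have h0 := hE0 t ht
    simp only [hE] at h0
    have h1 : (w * k t - A * Real.cos (w * t)) ^ 2 = 0 := by
      nlinarith [sq_nonneg (w * k t - A * Real.cos (w * t)), sq_nonneg (G t - A * Real.sin (w * t))]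
    have h2 : (G t - A * Real.sin (w * t)) ^ 2 = 0 := by rw [h1, zero_add] at h0; exact h0
    exact ⟨sub_eq_zero.1 (pow_eq_zero_iff two_ne_zero |>.1 h1),
      sub_eq_zero.1 (pow_eq_zero_iff two_ne_zero |>.1 h2)⟩
  refine ⟨A, fun t ht => ?_, ?_⟩
  · rw [← hGF t ht, (hboth t ht).2, hw]
    congr 2
    ring
  · have := (hboth 1 (by simp)).1
    rw [mul_one] at this
    rw [← this, hk]
    simp

theorem integral_sin_sq_of_cos_eq_zero {w : ℝ} (hw : 0 < w) (hc : Real.cos w = 0) :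
    ∫ t in (0 : ℝ)..1, Real.sin (w * t) ^ 2 = 1 / 2 := by
  rw [intervalIntegral.integral_comp_mul_left (fun t => Real.sin t ^ 2) hw.ne', integral_sin_sq]
  simp [hc]
  field_simp

/-- The sum of the eigenvalues of the kernel `min t u`. -/
theorem hasSum_one_div_half_odd : HasSum (fun m : ℕ => 1 / (((m : ℝ) + 1 / 2) * Real.pi) ^ 2) (1 / 2) := by
  have hπ := Real.pi_pos
  have hz := hasSum_zeta_two
  have he : HasSum (fun k : ℕ => 1 / (((2 * k : ℕ) : ℝ)) ^ 2) (1 / 4 * (Real.pi ^ 2 / 6)) := by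
    have e : (fun k : ℕ => 1 / (((2 * k : ℕ) : ℝ)) ^ 2) = fun k : ℕ => 1 / 4 * (1 / (k : ℝ) ^ 2) := by
      funext k
      push_cast
      ring
    rw [e]
    exact hz.mul_left (1 / 4)
  have ho : Summable fun k : ℕ => 1 / (((2 * k + 1 : ℕ) : ℝ)) ^ 2 :=
    hz.summable.comp_injective (i := fun k : ℕ => 2 * k + 1) fun a b h => by
      simp only at h
      omega
  -- The even terms of the series for π^2/6 make up a quarter of it, so the odd ones sum to π^2/8.
  have hs := HasSum.unique (HasSum.even_add_odd (f := fun n : ℕ => 1 / (n : ℝ) ^ 2) he ho.hasSum) hz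
  have h2 := ho.hasSum.mul_left (4 / Real.pi ^ 2)
  have e : 4 / Real.pi ^ 2 * ∑' k : ℕ, 1 / (((2 * k + 1 : ℕ) : ℝ)) ^ 2 = 1 / 2 := by
    rw [show ∑' k : ℕ, 1 / (((2 * k + 1 : ℕ) : ℝ)) ^ 2 = Real.pi ^ 2 / 8 by linarith]
    field_simp
    norm_num
  rw [e] at h2
  have e2 : (fun m : ℕ => 1 / (((m : ℝ) + 1 / 2) * Real.pi) ^ 2) =
      fun m : ℕ => 4 / Real.pi ^ 2 * (1 / (((2 * m + 1 : ℕ) : ℝ)) ^ 2) := by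
    funext m
    push_cast
    field_simp
    ring
  rw [e2]
  exact h2

namespace Setting
variable {X : Type*} [NormedAddCommGroup X] [NormedSpace ℝ X] [CompleteSpace X]
    [TopologicalSpace.SeparableSpace X] [MeasurableSpace X] [BorelSpace X]

theorem integral_dual_sub_proj_succ (P : Setting X) (L : X →L[ℝ] ℝ) (d : ℕ) :
    ∫ x, L (x - P.proj d x) ^ 2 ∂P.μ =
      P.lam d * L (P.e d) ^ 2 + ∫ x, L (x - P.proj (d + 1) x) ^ 2 ∂P.μ := by
  set M : X →L[ℝ] ℝ := L.comp (ContinuousLinearMap.id ℝ X - P.proj d) with hM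
  have hMx : ∀ x, L (x - P.proj d x) = M x := fun x => rfl
  have hPe : P.proj d (P.e d) = 0 := by
    rw [proj_apply]
    refine Finset.sum_eq_zero fun i _ => ?_
    rw [coord_e, if_neg i.2.ne, zero_smul]
  have hMe : M (P.e d) = L (P.e d) := by rw [← hMx, hPe, sub_zero]
  have hexp : ∀ x, L (x - P.proj (d + 1) x) ^ 2 =
      M x ^ 2 - 2 * L (P.e d) * (P.coord d x * M x) + L (P.e d) ^ 2 * P.coord d x ^ 2 := by
    intro x
    have : L (x - P.proj (d + 1) x) = M x - P.coord d x * L (P.e d) := by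
      rw [← hMx, proj_apply, proj_apply, Fin.sum_univ_castSucc]
      simp only [map_sub, map_add, map_smul, smul_eq_mul, Fin.val_castSucc, Fin.val_last]
      ring
    rw [this]
    ring
  have i1 : Integrable (fun x => M x ^ 2) P.μ := (P.memLp_dual M).integrable_sq
  have i2 : Integrable (fun x => 2 * L (P.e d) * (P.coord d x * M x)) P.μ :=
    ((P.memLp_coord d).integrable_mul (P.memLp_dual M)).const_mul _
  have i3 : Integrable (fun x => L (P.e d) ^ 2 * P.coord d x ^ 2) P.μ :=
    (P.memLp_coord d).integrable_sq.const_mul _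
  simp only [hexp, hMx]
  rw [integral_add (f := fun x => M x ^ 2 - 2 * L (P.e d) * (P.coord d x * M x)) (i1.sub i2) i3,
    integral_sub i1 i2, integral_const_mul, integral_const_mul, P.integral_coord_mul,
    P.integral_coord_sq, hMe]
  ring

theorem integral_dual_sub_proj_eq (P : Setting X) (L : X →L[ℝ] ℝ) (d n : ℕ) :
    ∫ x, L (x - P.proj d x) ^ 2 ∂P.μ = (∑ i ∈ Finset.range n, P.lam (i + d) * L (P.e (i + d)) ^ 2) +
      ∫ x, L (x - P.proj (n + d) x) ^ 2 ∂P.μ := by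
  induction n with
  | zero => simp
  | succ n ih =>
    rw [ih, Finset.sum_range_succ, P.integral_dual_sub_proj_succ L (n + d),
      show n + 1 + d = n + d + 1 by ring]
    ring

theorem integral_dual_eq_add (P : Setting X) (L : X →L[ℝ] ℝ) (n : ℕ) :
    ∫ x, L x ^ 2 ∂P.μ = (∑ i ∈ Finset.range n, P.lam i * L (P.e i) ^ 2) +
      ∫ x, L (x - P.proj n x) ^ 2 ∂P.μ := by
  have h := P.integral_dual_sub_proj_eq L 0 n
  simpa [proj_apply] using h

theorem integral_dual_sub_proj_le (P : Setting X) (L : X →L[ℝ] ℝ) (n : ℕ) :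
    ∫ x, L (x - P.proj n x) ^ 2 ∂P.μ ≤ ∫ x, L x ^ 2 ∂P.μ := by
  rw [P.integral_dual_eq_add L n]
  have : 0 ≤ ∑ i ∈ Finset.range n, P.lam i * L (P.e i) ^ 2 :=
    Finset.sum_nonneg fun i _ => mul_nonneg (P.lam_pos i).le (sq_nonneg _)
  linarith

theorem integral_integral_swap_unitInterval (P : Setting X) {g : X × unitInterval → ℝ}
    (hg : Continuous g) {C : ℝ} (hC : ∀ x u, |g (x, u)| ≤ C * ‖x‖ ^ 2) :
    ∫ x, (∫ u : unitInterval, g (x, u)) ∂P.μ = ∫ u : unitInterval, (∫ x, g (x, u) ∂P.μ) := by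
  have := P.gaussian
  have := UniformSpace.secondCountable_of_separable X
  refine integral_integral_swap (f := fun x u => g (x, u)) ?_
  refine Integrable.mono' (g := fun q : X × unitInterval => C * ‖q.1‖ ^ 2)
    (((P.integrable_norm_pow 2).const_mul C).comp_fst volume) hg.aestronglyMeasurable
    (ae_of_all _ fun q => hC q.1 q.2)

/-- The Wiener measure on a copy of `C([0,1])`. -/
structure WienerData (P : Setting X) where
  /-- the identification with `C([0,1])` -/
  Φ : X ≃ₗᵢ[ℝ] C(unitInterval, ℝ)
  Im_eq : ∀ x, P.Im x = ContinuousMap.toLp (E := ℝ) 2 (volume : Measure unitInterval) ℝ (Φ x)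
  cov : ∀ t u : unitInterval, ∫ x, Φ x t * Φ x u ∂P.μ = min (t : ℝ) (u : ℝ)

namespace WienerData
variable {P : Setting X}

/-- The path `x`, evaluated at `t`. -/
def ev (W : WienerData P) (t : ℝ) : X →L[ℝ] ℝ :=
  pathEval (W.Φ.toContinuousLinearEquiv : X →L[ℝ] C(unitInterval, ℝ)) t

theorem ev_coe (W : WienerData P) (t : unitInterval) (x : X) : W.ev t x = W.Φ x t := pathEval_coe _ t x

theorem continuous_ev (W : WienerData P) (x : X) : Continuous fun t => W.ev t x := continuous_pathEval _ x

theorem cov_ev (W : WienerData P) {s t : ℝ} (hs : s ∈ Set.Icc (0 : ℝ) 1) (ht : t ∈ Set.Icc (0 : ℝ) 1) :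
    ∫ x, W.ev s x * W.ev t x ∂P.μ = min s t := by
  have h := W.cov ⟨s, hs⟩ ⟨t, ht⟩
  simp only [← W.ev_coe] at h
  exact h

theorem inner_Im (W : WienerData P) (x y : X) : inner ℝ (P.Im x) (P.Im y) = ∫ t in (0 : ℝ)..1, W.ev t x * W.ev t y := by
  rw [← integral_unitInterval (fun t => W.ev t x * W.ev t y), W.Im_eq, W.Im_eq,
    ContinuousMap.inner_toLp]
  simp [W.ev_coe, mul_comm]

theorem integral_inner_mul (W : WienerData P) (y : X) (L : X →L[ℝ] ℝ) :
    ∫ x, inner ℝ (P.Im y) (P.Im x) * L x ∂P.μ =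
      ∫ t in (0 : ℝ)..1, W.ev t y * ∫ x, W.ev t x * L x ∂P.μ := by
  rw [← integral_unitInterval (fun t => W.ev t y * ∫ x, W.ev t x * L x ∂P.μ)]
  have hev : Continuous fun q : X × unitInterval => W.Φ q.1 q.2 := by fun_prop
  have h := P.integral_integral_swap_unitInterval (C := ‖W.Φ y‖ * ‖L‖)
    (g := fun q : X × unitInterval => W.Φ y q.2 * (W.Φ q.1 q.2 * L q.1)) (by fun_prop) fun x u => by
      rw [abs_mul, abs_mul]
      have h1 : |W.Φ y u| ≤ ‖W.Φ y‖ := (W.Φ y).norm_coe_le_norm u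
      have h2 : |W.Φ x u| ≤ ‖x‖ := ((W.Φ x).norm_coe_le_norm u).trans (W.Φ.norm_map x).le
      have h3 : |L x| ≤ ‖L‖ * ‖x‖ := L.le_opNorm x
      calc _ ≤ ‖W.Φ y‖ * (‖x‖ * (‖L‖ * ‖x‖)) := by gcongr
        _ = _ := by ring
  simp only [W.ev_coe, ← integral_const_mul]
  rw [← h]
  congr 1 with x
  rw [W.inner_Im, ← integral_unitInterval (fun t => W.ev t y * W.ev t x), ← integral_mul_const]
  simp only [W.ev_coe, mul_assoc]

theorem integral_norm_Im_sq (W : WienerData P) (B : X →L[ℝ] X) :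
    ∫ x, ‖P.Im (B x)‖ ^ 2 ∂P.μ = ∫ t in (0 : ℝ)..1, ∫ x, W.ev t (B x) ^ 2 ∂P.μ := by
  rw [← integral_unitInterval (fun t => ∫ x, W.ev t (B x) ^ 2 ∂P.μ)]
  have h := P.integral_integral_swap_unitInterval (C := ‖B‖ ^ 2)
    (g := fun q : X × unitInterval => W.Φ (B q.1) q.2 ^ 2) (by fun_prop) fun x u => by
      rw [abs_pow, ← mul_pow]
      have h2 : |W.Φ (B x) u| ≤ ‖B x‖ := ((W.Φ (B x)).norm_coe_le_norm u).trans (W.Φ.norm_map _).le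
      have h3 := h2.trans (B.le_opNorm x)
      gcongr
  simp only [W.ev_coe]
  rw [← h]
  congr 1 with x
  rw [← real_inner_self_eq_norm_sq, W.inner_Im,
    ← integral_unitInterval (fun t => W.ev t (B x) * W.ev t (B x))]
  simp only [W.ev_coe, pow_two]

/-- The covariance of the i-th coordinate and evaluation at t is λ_i e_i(t). Fubini's theorem
expresses the same covariance through the kernel min, so the equation holds at every t and not only
in L₂. -/
theorem eigen_ev (W : WienerData P) (i : ℕ) {t : ℝ} (ht : t ∈ Set.Icc (0 : ℝ) 1) :
    P.lam i * W.ev t (P.e i) = ∫ u in (0 : ℝ)..1, min t u * W.ev u (P.e i) := by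
  have h := W.integral_inner_mul (P.e i) (W.ev t)
  rw [← P.integral_coord_mul]
  refine h.trans (intervalIntegral.integral_congr fun u hu => ?_)
  rw [Set.uIcc_of_le zero_le_one] at hu
  rw [W.cov_ev hu ht, min_comm, mul_comm]

/-- The eigenfunctions are sine functions. -/
theorem exists_ev_e_eq (W : WienerData P) (i : ℕ) : ∃ A : ℝ, A ^ 2 = 2 ∧ Real.cos (1 / Real.sqrt (P.lam i)) = 0 ∧
    ∀ t ∈ Set.Icc (0 : ℝ) 1, W.ev t (P.e i) = A * Real.sin (t / Real.sqrt (P.lam i)) := by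
  obtain ⟨A, hA, hc⟩ := eigenfunction_min (W.continuous_ev (P.e i)) (P.lam_pos i)
    fun t ht => W.eigen_ev i ht
  have hn : ∫ t in (0 : ℝ)..1, W.ev t (P.e i) * W.ev t (P.e i) =
      A ^ 2 * ∫ t in (0 : ℝ)..1, Real.sin (1 / Real.sqrt (P.lam i) * t) ^ 2 := by
    rw [← intervalIntegral.integral_const_mul]
    refine intervalIntegral.integral_congr fun u hu => ?_
    rw [Set.uIcc_of_le zero_le_one] at hu
    rw [hA u hu]
    ring_nf
  rw [← W.inner_Im, real_inner_self_eq_norm_sq, P.norm_Im_e] at hn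
  have hA0 : A ≠ 0 := by
    rintro rfl
    norm_num at hn
  have hcos := (mul_eq_zero.1 hc).resolve_left hA0
  have hs : 0 < Real.sqrt (P.lam i) := Real.sqrt_pos.2 (P.lam_pos i)
  rw [integral_sin_sq_of_cos_eq_zero (by positivity) hcos] at hn
  exact ⟨A, by linarith, hcos, hA⟩

theorem ev_e_sq_le (W : WienerData P) (i : ℕ) {t : ℝ} (ht : t ∈ Set.Icc (0 : ℝ) 1) : W.ev t (P.e i) ^ 2 ≤ 2 := by
  obtain ⟨A, hA, -, h⟩ := W.exists_ev_e_eq i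
  rw [h t ht, mul_pow, hA]
  have := Real.sin_sq_le_one (t / Real.sqrt (P.lam i))
  linarith

/-- Two eigenfunctions with the same eigenvalue are multiples of the same sine function, so they
cannot be orthogonal. -/
theorem lam_injective (W : WienerData P) : Function.Injective P.lam := by
  intro i j hij
  by_contra hne
  obtain ⟨A, hA, hc, h⟩ := W.exists_ev_e_eq i
  obtain ⟨B, hB, -, h'⟩ := W.exists_ev_e_eq j
  have h0 : inner ℝ (P.Im (P.e i)) (P.Im (P.e j)) = 0 := P.orthonormal.2 hne
  have e : ∫ t in (0 : ℝ)..1, W.ev t (P.e i) * W.ev t (P.e j) =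
      A * B * ∫ t in (0 : ℝ)..1, Real.sin (1 / Real.sqrt (P.lam i) * t) ^ 2 := by
    rw [← intervalIntegral.integral_const_mul]
    refine intervalIntegral.integral_congr fun u hu => ?_
    rw [Set.uIcc_of_le zero_le_one] at hu
    rw [h u hu, h' u hu, hij]
    ring_nf
  have hs : 0 < Real.sqrt (P.lam i) := Real.sqrt_pos.2 (P.lam_pos i)
  rw [W.inner_Im, e, integral_sin_sq_of_cos_eq_zero (by positivity) hc] at h0
  have h1 : (A * B) ^ 2 = 4 := by
    rw [mul_pow, hA, hB]
    norm_num
  have h2 : A * B = 0 := by linarith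
  rw [h2] at h1
  norm_num at h1

theorem exists_lam_eq (W : WienerData P) (i : ℕ) : ∃ m : ℕ, P.lam i = 1 / (((m : ℝ) + 1 / 2) * Real.pi) ^ 2 := by
  obtain ⟨A, -, hc, -⟩ := W.exists_ev_e_eq i
  obtain ⟨k, hk⟩ := Real.cos_eq_zero_iff.1 hc
  have hπ := Real.pi_pos
  have hs : 0 < Real.sqrt (P.lam i) := Real.sqrt_pos.2 (P.lam_pos i)
  have hpos : 0 < (2 * (k : ℝ) + 1) * Real.pi / 2 := hk ▸ by positivity
  have hk0 : 0 ≤ k := by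
    by_contra! hneg
    have : (k : ℝ) ≤ -1 := by exact_mod_cast Int.le_sub_one_of_lt hneg
    nlinarith
  lift k to ℕ using hk0
  refine ⟨k, ?_⟩
  have e : (1 / Real.sqrt (P.lam i)) ^ 2 = 1 / P.lam i := by
    rw [div_pow, one_pow, Real.sq_sqrt (P.lam_pos i).le]
  rw [← one_div_one_div (P.lam i), ← e, hk]
  push_cast
  ring

/-- The eigenvalues are strictly decreasing and taken from the list of these numbers, so their
positions m(i) are strictly increasing and m(i) ≥ i. -/
theorem lam_le (W : WienerData P) (i : ℕ) : P.lam i ≤ 1 / (((i : ℝ) + 1 / 2) * Real.pi) ^ 2 := by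
  choose m hm using W.exists_lam_eq
  have hπ := Real.pi_pos
  have hmono : StrictMono m := by
    intro i j hij
    have h1 : P.lam j < P.lam i :=
      lt_of_le_of_ne (P.lam_antitone hij.le) fun h => hij.ne' (W.lam_injective h)
    by_contra! h2
    rw [hm, hm] at h1
    have h3 : (m j : ℝ) ≤ m i := by exact_mod_cast h2
    refine absurd h1 (not_lt.2 ?_)
    gcongr
  rw [hm]
  have : (i : ℝ) ≤ m i := by exact_mod_cast hmono.le_apply
  gcongr

theorem tail_zero (W : WienerData P) : P.tail 0 = 1 / 2 := by
  have h := W.integral_norm_Im_sq (ContinuousLinearMap.id ℝ X - P.proj 0)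
  refine h.trans ?_
  have e : ∫ t in (0 : ℝ)..1, ∫ x, W.ev t ((ContinuousLinearMap.id ℝ X - P.proj 0) x) ^ 2 ∂P.μ =
      ∫ t in (0 : ℝ)..1, t := by
    refine intervalIntegral.integral_congr fun t ht => ?_
    rw [Set.uIcc_of_le zero_le_one] at ht
    have := W.cov_ev ht ht
    simpa [proj_apply, pow_two] using this
  rw [e]
  simp

/-- The trace of the covariance is the integral of t over [0, 1], which is 1/2, and this is already
the sum of the full list. Termwise inequality together with equal sums leaves no gap. -/
theorem lam_eq (W : WienerData P) (i : ℕ) : P.lam i = 1 / (((i : ℝ) + 1 / 2) * Real.pi) ^ 2 := by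
  have h1 : HasSum P.lam (1 / 2) := by
    have h := P.hasSum_lam_tail 0
    have e := W.tail_zero
    rw [tail] at e
    rw [e] at h
    exact h
  have h2 := hasSum_one_div_half_odd.sub h1
  rw [sub_self] at h2
  have h3 := (hasSum_zero_iff_of_nonneg fun i => sub_nonneg.2 (W.lam_le i)).1 h2
  exact (sub_eq_zero.1 (congrFun h3 i)).symm

theorem tail_le (W : WienerData P) (d : ℕ) : P.tail d ≤ 2 / ((d : ℝ) + 1) := by
  have hle : ∀ j : ℕ, P.lam j ≤ 1 / ((j : ℝ) + 1) ^ 2 := by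
    intro j
    refine (W.lam_le j).trans ?_
    have := Real.pi_gt_three
    have hj : (0 : ℝ) ≤ j := j.cast_nonneg
    gcongr
    nlinarith
  have hsum : ∀ n : ℕ, ∑ j ∈ Finset.range n, P.lam (j + d) ≤
      2 / ((d : ℝ) + 1) - 2 / ((n : ℝ) + d + 1) := by
    intro n
    induction n with
    | zero => simp
    | succ n ih =>
      rw [Finset.sum_range_succ]
      have h := hle (n + d)
      push_cast at h ⊢
      set y := (n : ℝ) + d + 1 with hy
      have hy1 : 1 ≤ y := by
        rw [hy]
        linarith [n.cast_nonneg (α := ℝ), d.cast_nonneg (α := ℝ)]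
      have h2 : 1 / y ^ 2 ≤ 2 / y - 2 / (y + 1) := by
        rw [div_sub_div _ _ (by positivity) (by positivity), div_le_div_iff₀ (by positivity)
          (by positivity)]
        nlinarith
      have e : (n : ℝ) + 1 + d + 1 = y + 1 := by rw [hy]; ring
      rw [e]
      linarith
  refine hasSum_le_of_sum_le (P.hasSum_lam_tail d) fun s => ?_
  obtain ⟨n, hn⟩ := s.exists_nat_subset_range
  refine (Finset.sum_le_sum_of_subset_of_nonneg hn fun j _ _ => (P.lam_pos _).le).trans
    ((hsum n).trans ?_)
  have : 0 ≤ 2 / ((n : ℝ) + d + 1) := by positivity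
  linarith

end WienerData
end Setting

/-! ### The dimension for the Wiener measure -/

/-- Second differences of a function with a Lipschitz continuous derivative. -/
theorem abs_second_difference_le {X : Type*} [NormedAddCommGroup X] [NormedSpace ℝ X] {f : X → ℝ}
    (hf : Differentiable ℝ f) {L : ℝ} (hL : 0 ≤ L)
    (h : ∀ x y, ‖fderiv ℝ f x - fderiv ℝ f y‖ ≤ L * ‖x - y‖) (a z : X) :
    |f (a + z) + f (a - z) - 2 * f a| ≤ 2 * L * ‖z‖ ^ 2 := by
  have hd : ∀ s : ℝ, HasDerivAt (fun s : ℝ => f (a + s • z) + f (a - s • z))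
      (fderiv ℝ f (a + s • z) z - fderiv ℝ f (a - s • z) z) s := by
    intro s
    have hs : HasDerivAt (fun s : ℝ => s • z) z s := by
      simpa using (hasDerivAt_id s).smul_const z
    have h1 := (hf (a + s • z)).hasFDerivAt.comp_hasDerivAt s (hs.const_add a)
    have h2 := (hf (a - s • z)).hasFDerivAt.comp_hasDerivAt s (hs.const_sub a)
    refine (h1.add h2).congr_deriv ?_
    rw [map_neg]
    exact (sub_eq_add_neg _ _).symm
  have hb : ∀ s ∈ Set.Ico (0 : ℝ) 1,
      ‖fderiv ℝ f (a + s • z) z - fderiv ℝ f (a - s • z) z‖ ≤ 2 * L * ‖z‖ ^ 2 := by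
    intro s hs
    rw [← sub_apply]
    refine (ContinuousLinearMap.le_opNorm _ _).trans ?_
    have e : a + s • z - (a - s • z) = (2 * s) • z := by
      rw [mul_smul, two_smul]
      abel
    have h1 := h (a + s • z) (a - s • z)
    rw [e, norm_smul, Real.norm_eq_abs, abs_of_nonneg (by linarith [hs.1])] at h1
    calc _ ≤ L * (2 * s * ‖z‖) * ‖z‖ := by gcongr
      _ ≤ L * (2 * 1 * ‖z‖) * ‖z‖ := by
          have := hs.2.le
          gcongr
      _ = _ := by ring
  have := norm_image_sub_le_of_norm_deriv_le_segment_01'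
    (fun s _ => (hd s).hasDerivWithinAt) hb
  simp only [one_smul, zero_smul, add_zero, sub_zero, Real.norm_eq_abs] at this
  rwa [two_mul]

namespace Setting
variable {X : Type*} [NormedAddCommGroup X] [NormedSpace ℝ X] [CompleteSpace X]
    [TopologicalSpace.SeparableSpace X] [MeasurableSpace X] [BorelSpace X]

/-- The point `proj d` x is the midpoint of x and `refl d` x, which have the same distribution. The
truncation error is thus half the mean of a second difference, and first order terms cancel. -/
theorem abs_I_sub_Id_le_of_second_difference (P : Setting X) {K : ℕ → ℝ} {r : ℕ} {f : X → ℝ}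
    (hf : f ∈ P.F K r) (d : ℕ) {L : ℝ}
    (h : ∀ a z, |f (a + z) + f (a - z) - 2 * f a| ≤ 2 * L * ‖z‖ ^ 2) :
    |P.I f - P.Id d f| ≤ L * ∫ x, ‖x - P.proj d x‖ ^ 2 ∂P.μ := by
  have hc := P.continuous_of_mem_F hf
  have i1 := P.integrable_comp_of_mem_F hf (T := fun x => x) continuous_id
  have i2 := P.integrable_comp_of_mem_F hf (T := P.refl d) (P.refl d).continuous
  have i3 := P.integrable_comp_of_mem_F hf (T := P.proj d) (P.proj d).continuous
  have hz := P.integrable_clm_norm_pow (ContinuousLinearMap.id ℝ X - P.proj d) 2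
  have e : P.I f - P.Id d f = ∫ x, (f x + f (P.refl d x) - 2 * f (P.proj d x)) / 2 ∂P.μ := by
    rw [integral_div, integral_sub (f := fun x => f x + f (P.refl d x))
      (g := fun x => 2 * f (P.proj d x)) (i1.add i2) (i3.const_mul 2), integral_add i1 i2,
      integral_const_mul, P.integral_comp_refl d hc, P.Id_eq d f hc, I]
    ring
  rw [e, ← integral_const_mul]
  refine abs_integral_le_integral_abs.trans (integral_mono
    (((i1.add i2).sub (i3.const_mul 2)).div_const 2).abs (hz.const_mul L) fun x => ?_)
  have h1 := h (P.proj d x) (x - P.proj d x)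
  have e2 : P.proj d x - (x - P.proj d x) = P.refl d x := by
    rw [refl_apply, two_smul]
    abel
  rw [add_sub_cancel, e2] at h1
  change _ ≤ L * ‖x - P.proj d x‖ ^ 2
  rw [abs_div, abs_two, div_le_iff₀ two_pos]
  linarith

/-- The derivatives of functions in `F_r`, `r ≥ 2`, are Lipschitz continuous. -/
theorem exists_fderiv_lipschitz (P : Setting X) {K : ℕ → ℝ} {r : ℕ} (hr : 2 ≤ r)
    (hK : ∀ i ≤ r, 0 < K i) : ∃ L : ℝ, 0 < L ∧ ∀ f ∈ P.F K r, Differentiable ℝ f ∧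
      ∀ x y, ‖fderiv ℝ f x - fderiv ℝ f y‖ ≤ L * ‖x - y‖ := by
  have hK2 := hK 2 hr
  refine ⟨K 2 * (‖P.Im‖ + 1), by positivity, fun f hf => ?_⟩
  have hd : Differentiable ℝ f := hf.1.differentiable (by
    have : r - 1 ≠ 0 := by omega
    exact_mod_cast this)
  refine ⟨hd, fun x y => ?_⟩
  have hm := (P.mem_F_iff (by omega)).1 hf
  obtain ⟨m, hm'⟩ : ∃ m, r - 1 = m + 1 := ⟨r - 2, by omega⟩
  rw [hm'] at hm
  have h1 := hm.fderiv
  -- For r = 2 the first derivative is Lipschitz by assumption, through Im; for r ≥ 3 the bound on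
  -- the second derivative is used.
  rcases Nat.eq_zero_or_pos m with rfl | hpos
  · refine (h1.norm_sub_le x y).trans ?_
    have h2 : ‖P.Im (x - y)‖ ≤ (‖P.Im‖ + 1) * ‖x - y‖ :=
      (P.Im.le_opNorm _).trans (by gcongr; linarith)
    calc K 2 * ‖P.Im (x - y)‖ ≤ K 2 * ((‖P.Im‖ + 1) * ‖x - y‖) := by gcongr
      _ = _ := by ring
  · obtain ⟨n, rfl⟩ : ∃ n, m = n + 1 := ⟨m - 1, by omega⟩
    have h2 := h1.fderiv
    have hd2 : Differentiable ℝ (fderiv ℝ f) := h1.1.differentiable (by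
      have : n + 1 ≠ 0 := by omega
      exact_mod_cast this)
    refine (Convex.norm_image_sub_le_of_norm_fderiv_le (𝕜 := ℝ) (fun x _ => hd2 x)
      (fun x _ => h2.norm_le x) convex_univ (Set.mem_univ y) (Set.mem_univ x)).trans ?_
    have h3 : K 2 ≤ K 2 * (‖P.Im‖ + 1) := le_mul_of_one_le_right hK2.le (by simp)
    gcongr

/-- A rate of the truncation error bounds the dimension. -/
theorem dim_le_rpow (P : Setting X) {K : ℕ → ℝ} {r : ℕ} {C α : ℝ} (hC : 0 < C) (hα : 0 < α)
    (h : ∀ d : ℕ, ∀ f ∈ P.F K r, |P.I f - P.Id d f| ≤ C * ((d : ℝ) + 1) ^ (-α)) {ε : ℝ}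
    (hε : 0 < ε) : (P.dim K r ε : ℝ) ≤ (2 * C / ε) ^ (1 / α) := by
  set y := (2 * C / ε) ^ (1 / α) with hy
  have hy0 : 0 < y := by positivity
  refine le_trans (Nat.cast_le.2 (P.dim_le (d := ⌊y⌋₊) fun f hf => (h _ f hf).trans ?_))
    (Nat.floor_le hy0.le)
  have h1 : y ≤ (⌊y⌋₊ : ℝ) + 1 := (Nat.lt_floor_add_one y).le
  have h2 : y ^ α = 2 * C / ε := by
    rw [hy, ← Real.rpow_mul (by positivity), one_div_mul_cancel hα.ne', Real.rpow_one]
  have h3 : 2 * C / ε ≤ ((⌊y⌋₊ : ℝ) + 1) ^ α := by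
    rw [← h2]
    gcongr
  rw [Real.rpow_neg (by positivity), ← div_eq_mul_inv, div_le_iff₀ (by positivity)]
  rw [div_le_iff₀ hε] at h3
  linarith

namespace WienerData
variable {P : Setting X}

theorem integral_ev_sub_sq (W : WienerData P) {s t : ℝ} (hs : s ∈ Set.Icc (0 : ℝ) 1)
    (ht : t ∈ Set.Icc (0 : ℝ) 1) : ∫ x, (W.ev t - W.ev s) x ^ 2 ∂P.μ = |t - s| := by
  have hi : ∀ a b : ℝ, Integrable (fun x => W.ev a x * W.ev b x) P.μ := fun a b =>
    (P.memLp_dual _).integrable_mul (P.memLp_dual _)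
  have e : ∀ x, (W.ev t - W.ev s) x ^ 2 =
      W.ev t x * W.ev t x + W.ev s x * W.ev s x - 2 * (W.ev s x * W.ev t x) := by
    intro x
    rw [sub_apply]
    ring
  simp only [e]
  rw [integral_sub (f := fun x => W.ev t x * W.ev t x + W.ev s x * W.ev s x)
    ((hi t t).add (hi s s)) ((hi s t).const_mul 2), integral_add (hi t t) (hi s s),
    integral_const_mul, W.cov_ev ht ht, W.cov_ev hs hs, W.cov_ev hs ht, min_self, min_self]
  rcases le_total s t with h | h
  · rw [min_eq_left h, abs_of_nonneg (by linarith)]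
    ring
  · rw [min_eq_right h, abs_of_nonpos (by linarith)]
    ring

/-- The variance of the truncation error at time `t`. -/
def var (W : WienerData P) (d : ℕ) (t : ℝ) : ℝ := ∫ x, W.ev t (x - P.proj d x) ^ 2 ∂P.μ

theorem var_nonneg (W : WienerData P) (d : ℕ) (t : ℝ) : 0 ≤ W.var d t :=
  integral_nonneg fun _ => sq_nonneg _

theorem var_le_add (W : WienerData P) (d : ℕ) {s t : ℝ} (hs : s ∈ Set.Icc (0 : ℝ) 1)
    (ht : t ∈ Set.Icc (0 : ℝ) 1) : W.var d t ≤ 2 * W.var d s + 2 * |t - s| := by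
  have hi : ∀ L : X →L[ℝ] ℝ, Integrable (fun x => L (x - P.proj d x) ^ 2) P.μ := fun L =>
    (P.memLp_dual (L.comp (ContinuousLinearMap.id ℝ X - P.proj d))).integrable_sq
  have h1 := (P.integral_dual_sub_proj_le (W.ev t - W.ev s) d).trans (W.integral_ev_sub_sq hs ht).le
  have h2 : W.var d t ≤ ∫ x, (2 * W.ev s (x - P.proj d x) ^ 2 +
      2 * (W.ev t - W.ev s) (x - P.proj d x) ^ 2) ∂P.μ := by
    refine integral_mono (hi _) (((hi _).const_mul 2).add ((hi _).const_mul 2)) fun x => ?_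
    simp only [sub_apply]
    nlinarith [sq_nonneg (W.ev s (x - P.proj d x) - (W.ev t (x - P.proj d x) - W.ev s (x - P.proj d x)))]
  rw [integral_add (f := fun x => 2 * W.ev s (x - P.proj d x) ^ 2) ((hi _).const_mul 2)
    ((hi _).const_mul 2), integral_const_mul, integral_const_mul] at h2
  change _ ≤ 2 * W.var d s + _ at h2
  linarith

theorem continuousOn_var (W : WienerData P) (d : ℕ) :
    ContinuousOn (W.var d) (Set.Icc (0 : ℝ) 1) := by
  have e : Set.EqOn (W.var d) (fun t => t - ∑ i ∈ Finset.range d, P.lam i * W.ev t (P.e i) ^ 2)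
      (Set.Icc (0 : ℝ) 1) := by
    intro t ht
    have h := P.integral_dual_eq_add (W.ev t) d
    have h2 := W.cov_ev ht ht
    simp only [← pow_two, min_self] at h2
    rw [h2] at h
    simp only [var]
    linarith
  refine ContinuousOn.congr (Continuous.continuousOn ?_) e
  have := fun i => W.continuous_ev (P.e i)
  fun_prop

theorem integral_var (W : WienerData P) (d : ℕ) : ∫ t in (0 : ℝ)..1, W.var d t = P.tail d :=
  (W.integral_norm_Im_sq (ContinuousLinearMap.id ℝ X - P.proj d)).symm

/-- The variance at t is compared with the variances in a window of length h inside [0, 1] that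
contains t. Averaging over the window brings in the integral of the variance, which is the tail. -/
theorem var_le_average (W : WienerData P) (d : ℕ) {t h : ℝ} (ht : t ∈ Set.Icc (0 : ℝ) 1)
    (hh : 0 < h) (hh1 : h ≤ 1) : W.var d t ≤ 2 * P.tail d / h + 2 * h := by
  set a := min t (1 - h) with ha
  have ha0 : 0 ≤ a := le_min ht.1 (by linarith)
  have ha1 : a + h ≤ 1 := by linarith [min_le_right t (1 - h)]
  have hat : a ≤ t := min_le_left _ _
  have hta : t ≤ a + h := by
    rcases min_choice t (1 - h) with e | e <;> rw [ha, e] <;> linarith [ht.2]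
  have hint : IntervalIntegrable (W.var d) volume 0 1 := by
    refine ContinuousOn.intervalIntegrable ?_
    rw [Set.uIcc_of_le zero_le_one]
    exact W.continuousOn_var d
  have hsub : Set.uIcc a (a + h) ⊆ Set.uIcc (0 : ℝ) 1 := by
    rw [Set.uIcc_of_le (by linarith), Set.uIcc_of_le zero_le_one]
    exact Set.Icc_subset_Icc ha0 ha1
  have hint2 := hint.mono_set hsub
  have h1 : ∫ _ in a..(a + h), W.var d t ≤ ∫ s in a..(a + h), (2 * W.var d s + 2 * h) := by
    refine intervalIntegral.integral_mono_on (by linarith) intervalIntegrable_const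
      ((hint2.const_mul 2).add intervalIntegrable_const) fun s hs => ?_
    refine (W.var_le_add (s := s) d ⟨by linarith [hs.1], by linarith [hs.2]⟩ ht).trans ?_
    have : |t - s| ≤ h := abs_le.2 ⟨by linarith [hs.2], by linarith [hs.1]⟩
    linarith
  rw [intervalIntegral.integral_add (hint2.const_mul 2) intervalIntegrable_const,
    intervalIntegral.integral_const_mul, intervalIntegral.integral_const,
    intervalIntegral.integral_const, add_sub_cancel_left, smul_eq_mul, smul_eq_mul] at h1
  have h2 : ∫ s in a..(a + h), W.var d s ≤ P.tail d := by
    rw [← W.integral_var d]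
    exact intervalIntegral.integral_mono_interval ha0 (by linarith) ha1
      (ae_of_all _ fun s => W.var_nonneg d s) hint
  have e : 2 * P.tail d / h + 2 * h = (2 * P.tail d + h * (2 * h)) / h := by
    field_simp
  rw [e, le_div_iff₀ hh]
  linarith

/-- The variance at t is a partial sum of λ_i e_i(t)^2 plus the variance of a later remainder, and
e_i(t)^2 ≤ 2. That the later remainder tends to zero at the given t is not clear from L₂
convergence; `var_le_average` with a short window provides it. -/
theorem var_le (W : WienerData P) (d : ℕ) {t : ℝ} (ht : t ∈ Set.Icc (0 : ℝ) 1) :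
    W.var d t ≤ 2 * P.tail d := by
  have h1 : ∀ n : ℕ, W.var d t ≤ 2 * P.tail d + W.var (n + d) t := by
    intro n
    have h2 := P.integral_dual_sub_proj_eq (W.ev t) d n
    have h3 : ∑ i ∈ Finset.range n, P.lam (i + d) * W.ev t (P.e (i + d)) ^ 2 ≤
        ∑ i ∈ Finset.range n, P.lam (i + d) * 2 := Finset.sum_le_sum fun i _ =>
      mul_le_mul_of_nonneg_left (W.ev_e_sq_le _ ht) (P.lam_pos _).le
    have h4 : ∑ i ∈ Finset.range n, P.lam (i + d) ≤ P.tail d :=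
      sum_le_hasSum _ (fun i _ => (P.lam_pos _).le) (P.hasSum_lam_tail d)
    rw [← Finset.sum_mul] at h3
    simp only [var]
    linarith
  refine le_of_forall_pos_le_add fun η hη => ?_
  set h := min 1 (η / 4) with hh
  have hh0 : 0 < h := lt_min one_pos (by linarith)
  obtain ⟨n, hn⟩ := exists_nat_gt (4 / (h * (η / 2)))
  have h2 := h1 n
  have h3 := W.var_le_average (n + d) ht hh0 (min_le_left _ _)
  have h4 : 2 * P.tail (n + d) / h ≤ η / 2 := by
    rw [div_le_iff₀ hh0]
    have h5 := W.tail_le (n + d)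
    rw [div_lt_iff₀ (by positivity)] at hn
    have h6 : 2 / (((n + d : ℕ) : ℝ) + 1) ≤ h * (η / 2) / 2 := by
      rw [div_le_div_iff₀ (by positivity) two_pos]
      push_cast
      have : 0 < h * (η / 2) := by positivity
      nlinarith [d.cast_nonneg (α := ℝ)]
    linarith
  have h5 : h ≤ η / 4 := min_le_right _ _
  linarith

theorem exists_integral_norm_sub_proj_sq_le (W : WienerData P) {p : ℕ} (hp : 3 ≤ p) :
    ∃ C : ℝ, 0 < C ∧ ∀ d : ℕ, ∫ x, ‖x - P.proj d x‖ ^ 2 ∂P.μ ≤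
      C * ((d : ℝ) + 1) ^ (-(1 - 3 / (p : ℝ))) := by
  obtain ⟨C, hC, h⟩ := P.exists_integral_norm_sq_le hp
  refine ⟨C * 16 ^ (1 - 3 / (p : ℝ)), by positivity, fun d => ?_⟩
  set B := ContinuousLinearMap.id ℝ X - P.proj d with hB
  have hev : ∀ t x, pathEval ((W.Φ.toContinuousLinearEquiv : X →L[ℝ] C(unitInterval, ℝ)).comp B) t x =
    W.ev t (x - P.proj d x) := fun t x => rfl
  have h1 := h ((W.Φ.toContinuousLinearEquiv : X →L[ℝ] C(unitInterval, ℝ)).comp B)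
    -- The variance of an increment is at most twice the sum of two variances, each at most twice
    -- the tail, and the tail is at most 2/(d+1).
    (16 / ((d : ℝ) + 1)) (by positivity) ?_ ?_ ?_
  · have e : ∀ x, ‖((W.Φ.toContinuousLinearEquiv : X →L[ℝ] C(unitInterval, ℝ)).comp B) x‖ =
      ‖x - P.proj d x‖ := fun x => W.Φ.norm_map _
    simp only [e] at h1
    refine h1.trans (le_of_eq ?_)
    rw [Real.div_rpow (by norm_num) (by positivity), Real.rpow_neg (by positivity)]
    ring
  · simp only [hev]
    have h0 : (0 : ℝ) ∈ Set.Icc (0 : ℝ) 1 := by simp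
    have h2 := P.integral_dual_sub_proj_le (W.ev 0) d
    have h3 := W.cov_ev h0 h0
    simp only [← pow_two, min_self] at h3
    exact le_antisymm (h2.trans h3.le) (W.var_nonneg d 0)
  · intro s t hs ht
    simp only [hev]
    exact (P.integral_dual_sub_proj_le (W.ev t - W.ev s) d).trans (W.integral_ev_sub_sq hs ht).le
  · intro s t hs ht
    simp only [hev]
    have hi : ∀ L : X →L[ℝ] ℝ, Integrable (fun x => L (x - P.proj d x) ^ 2) P.μ := fun L =>
      (P.memLp_dual (L.comp B)).integrable_sq
    have h2 : ∫ x, (W.ev t (x - P.proj d x) - W.ev s (x - P.proj d x)) ^ 2 ∂P.μ ≤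
        ∫ x, (2 * W.ev t (x - P.proj d x) ^ 2 + 2 * W.ev s (x - P.proj d x) ^ 2) ∂P.μ := by
      refine integral_mono (hi (W.ev t - W.ev s)) (((hi _).const_mul 2).add ((hi _).const_mul 2))
        fun x => ?_
      simp only
      nlinarith [sq_nonneg (W.ev t (x - P.proj d x) + W.ev s (x - P.proj d x))]
    rw [integral_add (f := fun x => 2 * W.ev t (x - P.proj d x) ^ 2) ((hi _).const_mul 2)
      ((hi _).const_mul 2), integral_const_mul, integral_const_mul] at h2
    change _ ≤ 2 * W.var d t + 2 * W.var d s at h2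
    have h3 := W.var_le d ht
    have h4 := W.var_le d hs
    have h5 := W.tail_le d
    have e : 16 / ((d : ℝ) + 1) = 8 * (2 / ((d : ℝ) + 1)) := by ring
    rw [e]
    linarith

end WienerData

theorem exists_le_lam_of_isWiener (P : Setting X) (hW : P.IsWiener) :
    ∃ c : ℝ, 0 < c ∧ ∀ j : ℕ, c / ((j : ℝ) + 1) ^ 2 ≤ P.lam j := by
  obtain ⟨Φ, h1, h2⟩ := hW
  have hπ := Real.pi_pos
  refine ⟨1 / Real.pi ^ 2, by positivity, fun j => ?_⟩
  rw [WienerData.lam_eq ⟨Φ, h1, h2⟩ j, div_div, ← mul_pow, mul_comm]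
  gcongr
  norm_num

/-- For r = 1 the Lipschitz condition through Im gives the mean norm of the remainder in L₂, of
order d^{-1/2}. For r ≥ 2 second differences give the mean squared sup norm, of order d^{-1+3/p}. -/
theorem exists_rate_of_isWiener (P : Setting X) (hW : P.IsWiener) {K : ℕ → ℝ} {r : ℕ}
    (hr : 1 ≤ r) (hK : ∀ i ≤ r, 0 < K i) {p : ℕ} (hp : 3 ≤ p) : ∃ C : ℝ, 0 < C ∧ ∀ d : ℕ,
      ∀ f ∈ P.F K r, |P.I f - P.Id d f| ≤
        C * ((d : ℝ) + 1) ^ (-((1 - 3 / (p : ℝ)) / (1 + gam r))) := by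
  obtain ⟨Φ, hΦ1, hΦ2⟩ := hW
  set W : WienerData P := ⟨Φ, hΦ1, hΦ2⟩
  have := P.gaussian
  rcases hr.eq_or_lt with rfl | hr2
  · have hK1 := hK 1 le_rfl
    refine ⟨2 * K 1, by positivity, fun d f hf => ?_⟩
    set s := Real.sqrt (2 / ((d : ℝ) + 1)) with hs
    have hs0 : 0 < s := Real.sqrt_pos.2 (by positivity)
    have hs2 : s ^ 2 = 2 / ((d : ℝ) + 1) := Real.sq_sqrt (by positivity)
    have hi := P.integrable_tail d
    have h1 : |P.I f - P.Id d f| ≤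
        ∫ x, K 1 * (‖P.Im (x - P.proj d x)‖ ^ 2 / (2 * s) + s / 2) ∂P.μ := by
      refine P.abs_I_sub_Id_le hf d (((hi.div_const _).add (integrable_const _)).const_mul _)
        fun x => ?_
      refine (((P.mem_F_iff le_rfl).1 hf).norm_sub_le x (P.proj d x)).trans ?_
      gcongr
      set y := ‖P.Im (x - P.proj d x)‖
      have e : y ^ 2 / (2 * s) + s / 2 - y = (y - s) ^ 2 / (2 * s) := by
        field_simp
        ring
      have : 0 ≤ (y - s) ^ 2 / (2 * s) := by positivity
      linarith
    rw [integral_const_mul, integral_add (f := fun x => ‖P.Im (x - P.proj d x)‖ ^ 2 / (2 * s))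
      (g := fun _ => s / 2) (hi.div_const _) (integrable_const _), integral_div] at h1
    simp only [integral_const, probReal_univ, smul_eq_mul, one_mul] at h1
    have h2 : P.tail d / (2 * s) ≤ s / 2 := by
      have := W.tail_le d
      rw [← hs2] at this
      rw [div_le_iff₀ (by positivity)]
      linarith
    have h3 : s ≤ 2 * ((d : ℝ) + 1) ^ (-((1 - 3 / (p : ℝ)) / (1 + gam 1))) := by
      have h4 : s ≤ 2 * ((d : ℝ) + 1) ^ (-(1 / 2 : ℝ)) := by
        rw [hs, Real.sqrt_div (by norm_num), Real.rpow_neg (by positivity), ← Real.sqrt_eq_rpow,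
          ← div_eq_mul_inv]
        gcongr
        rw [Real.sqrt_le_left (by norm_num)]
        norm_num
      refine h4.trans ?_
      have hp0 : 0 ≤ 3 / (p : ℝ) := by positivity
      gcongr
      · linarith [d.cast_nonneg (α := ℝ)]
      · linarith
      · rw [gam, if_pos rfl]
        norm_num
    have h5 : K 1 * (P.tail d / (2 * s) + s / 2) ≤ K 1 * (2 * (((d : ℝ) + 1) ^ (-((1 - 3 / (p : ℝ)) / (1 + gam 1))))) := by
      gcongr
      linarith
    refine h1.trans (h5.trans (le_of_eq ?_))
    ring
  · obtain ⟨L, hL, h⟩ := P.exists_fderiv_lipschitz hr2 hK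
    obtain ⟨C, hC, hz⟩ := W.exists_integral_norm_sub_proj_sq_le hp
    refine ⟨L * C, by positivity, fun d f hf => ?_⟩
    obtain ⟨hd, hlip⟩ := h f hf
    refine (P.abs_I_sub_Id_le_of_second_difference hf d
      (abs_second_difference_le hd hL.le hlip)).trans ?_
    rw [gam, if_neg (by omega), add_zero, div_one, mul_assoc]
    gcongr
    exact hz d

theorem exists_dim_le_of_isWiener (P : Setting X) (hW : P.IsWiener) {K : ℕ → ℝ} {r : ℕ}
    (hr : 1 ≤ r) (hK : ∀ i ≤ r, 0 < K i) {δ : ℝ} (hδ : 0 < δ) : ∃ C : ℝ, 0 < C ∧ ∀ ε : ℝ,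
      0 < ε → ε ≤ 1 → (P.dim K r ε : ℝ) ≤ C * (1 / ε) ^ (1 + gam r + δ) := by
  obtain ⟨p, hp⟩ := exists_nat_gt (3 + 6 / δ)
  have hδ6 : 0 < 6 / δ := by positivity
  have hp3 : 3 ≤ p := by
    have : (3 : ℝ) < p := by linarith
    exact_mod_cast this.le
  have hp0 : (0 : ℝ) < p := by linarith
  have hg : 0 ≤ gam r ∧ gam r ≤ 1 := by
    rw [gam]
    split_ifs <;> norm_num
  obtain ⟨C, hC, h⟩ := P.exists_rate_of_isWiener hW hr hK hp3
  set α := (1 - 3 / (p : ℝ)) / (1 + gam r) with hα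
  have h3p : 0 < 1 - 3 / (p : ℝ) := by
    rw [sub_pos, div_lt_one hp0]
    linarith
  have hα0 : 0 < α := div_pos h3p (by linarith)
  have hexp : 1 / α ≤ 1 + gam r + δ := by
    rw [hα, one_div_div, div_le_iff₀ h3p]
    have h1 : (3 / (p : ℝ)) * p = 3 := by field_simp
    have h2 : 3 * δ + 6 < δ * p := by
      have := mul_lt_mul_of_pos_left hp hδ
      have e : δ * (3 + 6 / δ) = 3 * δ + 6 := by field_simp
      linarith
    have h3 : (2 + δ) * (3 / (p : ℝ)) ≤ δ := by
      rw [mul_div_assoc', div_le_iff₀ hp0]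
      linarith
    have h4 : (1 + gam r + δ) * (3 / (p : ℝ)) ≤ (2 + δ) * (3 / (p : ℝ)) := by
      have : 0 ≤ 3 / (p : ℝ) := by positivity
      gcongr
      linarith [hg.2]
    linarith
  refine ⟨(2 * C) ^ (1 / α), by positivity, fun ε hε hε1 => ?_⟩
  refine (P.dim_le_rpow hC hα0 h hε).trans ?_
  have e : 2 * C / ε = 2 * C * (1 / ε) := by ring
  rw [e, Real.mul_rpow (by positivity) (by positivity)]
  have : 1 ≤ 1 / ε := by rw [le_div_iff₀ hε]; linarith
  gcongr

end Setting
end PathIntegration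
end

/-! ### The corollary -/

theorem mainTheorem4 {X : Type*} [NormedAddCommGroup X] [NormedSpace ℝ X] [CompleteSpace X]
    [TopologicalSpace.SeparableSpace X] [MeasurableSpace X] [BorelSpace X]
    (P : PathIntegration.Setting X)
    (k : ℝ) (hk : 1 < k)
    (hlam : ∃ c₁ c₂ : ℝ, 0 < c₁ ∧ 0 < c₂ ∧ ∀ j : ℕ,
      c₁ * ((j : ℝ) + 1) ^ (-k) ≤ P.lam j ∧ P.lam j ≤ c₂ * ((j : ℝ) + 1) ^ (-k))
    (r : ℕ) (hr : 1 ≤ r) (K : ℕ → ℝ) (hK : ∀ i ≤ r, 0 < K i)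
    (c : ℕ → ℝ) (hc : ∃ a : ℝ, 0 < a ∧ ∀ d : ℕ, a * d ≤ c d)
    (hc' : ∃ (b : ℝ) (s : ℕ), ∀ d : ℕ, c d ≤ b * ((d : ℝ) + 1) ^ s) :
    ∃ A : (ε : ℝ) → PathIntegration.QuantumAlg (P.dim K r ε),
      (∀ ε : ℝ, 0 < ε → P.QuantumSolves K r ε (A ε)) ∧
      -- path integration on a quantum computer is tractable
      (∃ (C : ℝ) (s : ℕ), ∀ ε : ℝ, 0 < ε → ε < 1 / 2 → (A ε).cost c ≤ C * (1 / ε) ^ s) ∧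
      -- it is roughly `1 / ε` times faster than on a classical computer using randomization
      (∀ δ : ℝ, 0 < δ → ∀ᶠ ε in 𝓝[>] (0 : ℝ),
        ENNReal.ofReal ((1 / ε) ^ (1 - δ) * (A ε).cost c) ≤ P.compRan K r c ε ∧
        P.compRan K r c ε ≤ ENNReal.ofReal ((1 / ε) ^ (1 + δ)) * P.compQuantum K r c ε) ∧
      -- it is exponentially faster than on a classical computer with a worst case assurance
      (∀ s : ℕ, ∀ᶠ ε in 𝓝[>] (0 : ℝ),
        ENNReal.ofReal ((1 / ε) ^ s * (A ε).cost c) ≤ P.compWor K r c ε) ∧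
      -- the number of quantum queries is roughly the square root of the randomized number of
      -- function values
      (∀ δ : ℝ, 0 < δ → ∀ᶠ ε in 𝓝[>] (0 : ℝ),
        P.nRan K r ε ^ (1 / 2 - δ) ≤ P.qq K r ε ∧
        ((A ε).queries : ℝ≥0∞) ≤ P.nRan K r ε ^ (1 / 2 + δ)) ∧
      -- the number of qubits is polynomial in `1 / ε`
      (∃ (C : ℝ) (s : ℕ), ∀ ε : ℝ, 0 < ε → ε < 1 / 2 → ((A ε).qubits : ℝ) ≤ C * (1 / ε) ^ s) ∧
      -- for the Wiener measure, the degree is `1 + γ(r)`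
      (P.IsWiener → ∀ δ : ℝ, 0 < δ → ∀ᶠ ε in 𝓝[>] (0 : ℝ),
        (1 / ε) ^ (1 + PathIntegration.gam r - δ) ≤ ((A ε).qubits : ℝ) ∧
        ((A ε).qubits : ℝ) ≤ (1 / ε) ^ (1 + PathIntegration.gam r + δ)) := by
  obtain ⟨c₁, c₂, hc₁, hc₂, hl⟩ := hlam
  have hlam' : ∀ j : ℕ, P.lam j ≤ c₂ * ((j : ℝ) + 1) ^ (-k) := fun j => (hl j).2
  have hdim : ∀ ε : ℝ, 0 < ε → ∀ f ∈ P.F K r, |P.I f - P.Id (P.dim K r ε) f| ≤ ε / 2 :=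
    fun ε hε => P.abs_I_sub_Id_dim_le hk hlam' hr hK hε
  obtain ⟨C₀, s₀, hC₀, hle⟩ := P.exists_dim_le hk hlam' hr hK
  obtain ⟨a, ha, hca⟩ := hc
  obtain ⟨A, hsol, hqd, hA⟩ := P.exists_quantumAlgs hr hK hdim hC₀ hle
  obtain ⟨hcost, hqubits⟩ := P.exists_cost_le hA hc' hC₀ hle
  obtain ⟨ε₀, hε₀, hd1⟩ := P.exists_one_le_dim hr hK hdim
  have hd : ∀ᶠ ε in 𝓝[>] (0 : ℝ), 1 ≤ P.dim K r ε :=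
    (PathIntegration.eventually_small hε₀).mono fun ε hε => hd1 ε hε.1 hε.2
  have hc0 : ∀ d, 0 ≤ c d := fun d => le_trans (by positivity) (hca d)
  have hac : ∀ᶠ ε in 𝓝[>] (0 : ℝ), a ≤ c (P.dim K r ε) := hd.mono fun ε h =>
    le_trans (le_mul_of_one_le_right ha.le (by exact_mod_cast h)) (hca _)
  refine ⟨A, hsol, hcost, fun δ hδ => ?_, fun s => ?_, fun δ hδ => ?_, hqubits, fun hW δ hδ => ?_⟩
  -- With d = d(ε), the quantum cost is at most c d ε^{-(1+δ/2)} and the randomized one at least c d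
  -- ε^{-(2-δ/2)}. Conversely, the randomized cost is at most c d ε^{-(2+δ/2)} and the quantum one
  -- at least c d ε^{-(1-δ/2)}. In both comparisons c d cancels.
  · have hδ2 : 0 < δ / 2 := by positivity
    filter_upwards [PathIntegration.eventually_small one_pos, hac,
      P.eventually_cost_le hA ha hca hd hδ2, P.eventually_le_nRan hr hK hδ2,
      P.eventually_compRan_le hdim ha hac hδ2, P.eventually_le_qq hr hK hδ2]
      with ε hε hcε h1 h2 h3 h4
    have hε0 := hε.1
    have hx1 : 1 ≤ 1 / ε := by
      rw [le_div_iff₀ hε0]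
      linarith [hε.2]
    have hcp := ha.trans_le hcε
    constructor
    · refine le_trans ?_ (P.ofReal_mul_nRan_le hcp)
      refine le_trans ?_ (mul_le_mul_right h2 _)
      rw [← ENNReal.ofReal_mul hcp.le]
      refine ENNReal.ofReal_le_ofReal ?_
      calc (1 / ε) ^ (1 - δ) * (A ε).cost c
          ≤ (1 / ε) ^ (1 - δ) * (c (P.dim K r ε) * (1 / ε) ^ (1 + δ / 2)) := by gcongr
        _ = c (P.dim K r ε) * ((1 / ε) ^ (1 - δ) * (1 / ε) ^ (1 + δ / 2)) := by ring
        _ = c (P.dim K r ε) * (1 / ε) ^ (2 - δ / 2) := by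
            rw [← Real.rpow_add (by positivity)]
            ring_nf
    · refine h3.trans (le_trans ?_ (mul_le_mul_right (P.ofReal_mul_qq_le hcp.le) _))
      refine le_trans ?_ (mul_le_mul_right (mul_le_mul_right h4 _) _)
      rw [← ENNReal.ofReal_mul hcp.le, ← ENNReal.ofReal_mul (by positivity)]
      refine ENNReal.ofReal_le_ofReal (le_of_eq ?_)
      rw [mul_left_comm, ← Real.rpow_add (by positivity)]
      ring_nf
  -- The quantum cost is at most c d ε^{-2}, hence the worst case bound with s + 2.
  · filter_upwards [PathIntegration.eventually_small one_pos,
      P.eventually_cost_le hA ha hca hd one_pos, P.eventually_le_compWor hr hK hc0 (s + 2)]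
      with ε hε h1 h2
    have hε0 := hε.1
    refine le_trans (ENNReal.ofReal_le_ofReal ?_) h2
    calc (1 / ε) ^ s * (A ε).cost c
        ≤ (1 / ε) ^ s * (c (P.dim K r ε) * (1 / ε) ^ ((1 : ℝ) + 1)) := by gcongr
      _ = _ := by
          rw [Real.rpow_natCast, show ((1 : ℝ) + 1) = ((2 : ℕ) : ℝ) by norm_num,
            Real.rpow_natCast, pow_add]
          ring
  · filter_upwards [P.eventually_nRan_rpow_le hr hK hdim hδ, P.eventually_queries_le hr hK
      (fun η hη => (hA η hη).imp fun C h => ⟨h.1, fun ε h1 h2 => (h.2 ε h1 h2).2.1⟩) hδ]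
      with ε h1 h2
    exact ⟨h1, h2⟩
  -- The number of qubits is at least d and at most C(d+1)ε^{-δ/4}, so both bounds are those of
  -- d(ε); another δ/4 is lost in the rate for d(ε).
  · obtain ⟨κ, hκ, hκl⟩ := P.exists_le_lam_of_isWiener hW
    obtain ⟨c', hc', hlow⟩ := P.exists_le_dim hκ hκl hr hK hdim
    have hδ4 : 0 < δ / 4 := by positivity
    obtain ⟨C', hC', hup⟩ := P.exists_dim_le_of_isWiener hW hr hK hδ4
    obtain ⟨C, hC, hAq⟩ := hA (δ / 4) hδ4
    filter_upwards [PathIntegration.eventually_small one_pos, hd,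
      PathIntegration.eventually_mul_rpow_le (2 / c')
        (by linarith : 1 + PathIntegration.gam r - δ < 1 + PathIntegration.gam r),
      PathIntegration.eventually_mul_rpow_le (2 * C * C')
        (by linarith : 1 + PathIntegration.gam r + δ / 4 + δ / 4 < 1 + PathIntegration.gam r + δ)]
      with ε hε hd1 h1 h2
    have hε0 := hε.1
    have hd1' : (1 : ℝ) ≤ P.dim K r ε := by exact_mod_cast hd1
    constructor
    · have h3 := hlow ε hε.1
      have h4 : (P.dim K r ε : ℝ) ≤ (A ε).qubits := by exact_mod_cast hqd ε hε.1
      rw [div_mul_eq_mul_div, div_le_iff₀ hc'] at h1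
      linarith
    · calc ((A ε).qubits : ℝ) ≤ C * (P.dim K r ε + 1) * (1 / ε) ^ (δ / 4) :=
            (hAq ε hε.1 hε.2.le).1
        _ ≤ C * (2 * (C' * (1 / ε) ^ (1 + PathIntegration.gam r + δ / 4))) * (1 / ε) ^ (δ / 4) := by
            have := hup ε hε.1 hε.2.le
            have h5 : (P.dim K r ε : ℝ) + 1 ≤
              2 * (C' * (1 / ε) ^ (1 + PathIntegration.gam r + δ / 4)) := by linarith
            gcongr
        _ = 2 * C * C' * (1 / ε) ^ (1 + PathIntegration.gam r + δ / 4 + δ / 4) := by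
            rw [Real.rpow_add (by positivity) (_ + δ / 4)]
            ring
        _ ≤ _ := h2
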